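/- Let $\mathbf k$ be a field of characteristic $0$, let $d\ge 0$, and let $M$ be a differential graded right $\mathcal D_{\mathbb A^d}$-module, i.e. a right module over the Weyl algebra $\mathcal D_{\mathbb A^d}$ with a decomposition $M=\bigoplus_{p\in\mathbb Z}M^p$ into $\mathcal D_{\mathbb A^d}$-submodules and a $\mathcal D_{\mathbb A^d}$-linear differential $\delta$ of degree $1$, $\delta^2=0$ (an ordinary right $\mathcal D_{\mathbb A^d}$-module is the case $M=M^0$, $\delta=0$). **Jouanolou algebras.** For a finite set $I$ and a graph $G$ on $I$ let $\mathbf J_G$ be the graded-commutative $\mathbf k$-algebra generated by $z_i^s$, $x_{jl}^s$ (degree $0$) and $\mathbf dx_{jl}^s$ (degree $1$), for $1\le s\le d$, $i\in I$ and adjacent $j,l$, with relations $x^s_{lj}=-x^s_{jl}$, $\mathbf dx^s_{lj}=-\mathbf dx^s_{jl}$, $\sum_s x_{jl}^s(z_j^s-z_l^s)=1$, $\sum_s \mathbf dx_{jl}^s(z_j^s-z_l^s)=0$. It carries the differential $\mathbf d$ with $\mathbf d z=0$, $\mathbf d(x^s_{jl})=\mathbf dx^s_{jl}$, and the left $\mathcal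 D_{(\mathbb A^d)^I}$-module structure in which $\partial_{z_i^t}$ acts by derivations commuting with $\mathbf d$, $\partial_{z_i^t}z_j^s=\delta_{ij}\delta_{st}$, $\partial_{z_j^t}x_{jl}^s=-x_{jl}^tx_{jl}^s$, and $\partial_{z_i^t}x^s_{jl}=0$ for $i\ne j,l$. For the complete graph write $\mathbf J^I$. For a right $\mathcal D_{(\mathbb A^d)^I}$-module $N$ put $\mathbf J_G(N)=N\otimes_{\mathcal O_{(\mathbb A^d)^I}}\mathbf J_G$, with the right $\mathcal D$-action $(n\otimes a)z=n\otimes za$, $(n\otimes a)\partial=n\partial\otimes a-n\otimes\partial a$. **Pushforwards.** For a map of finite sets $\pi:I\to K$ and a right $\mathcal D_{(\mathbb A^d)^K}$-module $N$ put $\pi_*N=N\otimes_{\mathbf k[\lambda_K]}\mathbf k[\lambda_I]$, where $\lambda_c^s$ acts on $N$ as $\partial_{z_c^s}$ and on $\mathbf k[\lambda_I]$ as $\sum_{\pi(i)=c}\lambda_i^s$; it is a right $\mathcal D_{(\mathbb A^d)^I}$-module by $(n\otimes F)z_i^t=n z_{\pi(i)}^t\otimes F+n\otimes\partial F/\partial\lambda_i^t$,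 $(n\otimes F)\partial_{z_i^t}=n\otimes F\lambda_i^t$. For $K=\{\star\}$, write $\Delta_*M=\pi_*M$. **Operations.** Let $P(0)=0$ and, for $n\ge1$, $$P(n)=\mathrm{Hom}_{\mathcal D_{(\mathbb A^d)^n}}\bigl(\mathbf J^n(M^{\boxtimes n}),\Delta_*M\bigr),$$ the Hom complex: it is the direct sum over $p\in\mathbb Z$ of the spaces of $\mathcal D$-linear maps of degree $p$, with differential $f\mapsto d\circ f-(-1)^pf\circ d$, where $d(m\otimes a)=\delta m\otimes a+(-1)^{|m|}m\otimes\mathbf da$ on the source (with the usual Koszul signs for $\delta$ on $M^{\boxtimes n}$) and $d(m\otimes F)=\delta m\otimes F$ on the target. The group $S_n$ acts by $(\sigma\mu)(x)=\sigma(\mu(\sigma^{-1}x))$, where $\sigma(m_1\boxtimes\cdots\boxtimes m_n\otimes\alpha(z_i,x_{ij},\mathbf dx_{ij}))=\pm\, m_{\sigma^{-1}(1)}\boxtimes\cdots\boxtimes m_{\sigma^{-1}(n)}\otimes\alpha(z_{\sigma(i)},x_{\sigma(i)\sigma(j)},\mathbf dx_{\sigma(i)\sigma(j)})$ with the Koszul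 sign of the permutation of the $m_i$, and $\sigma(m\otimes f(\lambda_1,\dots,\lambda_n))=m\otimes f(\lambda_{\sigma(1)},\dots,\lambda_{\sigma(n)})$. **Partial composition.** Let $\mu\in P(m+1)$, $\nu\in P(n)$ homogeneous of degree $q$, and let $i$ be an input of $\mu$. Let $I'$ be the block of $n$ consecutive elements of $I=\{1,\dots,m+n\}$ that replaces $i$, let $I''=I\setminus I'$, identified with the inputs of $\mu$ other than $i$ (so that the inputs of $\mu$ are $\{\bullet\}\sqcup I''$ with $\bullet=i$), let $\pi:I\to\{\bullet\}\sqcup I''$ collapse $I'$ to $\bullet$, and let $\mathbf J^{(I'),I''}=\mathbf J_G$ be the partial Jouanolou algebra, for the graph $G$ of all pairs not contained in $I'$. Let $c^{(I')}:\mathbf J^{(I'),I''}\to\mathbf J^{\{\bullet\}\sqcup I''}$ be the algebra map $z_a\mapsto z_{\pi(a)}$, $x_{ab}\mapsto x_{\pi(a)\pi(b)}$, $\mathbf dx_{ab}\mapsto\mathbf dx_{\pi(a)\pi(b)}$. There is a unique $\mathcal D_{(\mathbb A^d)^I}$-linear map $$w:\mathbf J^{(I'),I''}(\pi_*(M^{\boxtimes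 \{\bullet\}\sqcup I''}))\to\pi_*\mathbf J^{\{\bullet\}\sqcup I''}(M^{\boxtimes\{\bullet\}\sqcup I''}),\qquad (n\otimes1)\otimes b\mapsto(n\otimes c^{(I')}(b))\otimes1 .$$ For $m'\in M^{\boxtimes I'}$, homogeneous $m''_j\in M$ ($j\in I''$), $a\in\mathbf J^{I'}$ homogeneous of degree $r$ and $b\in\mathbf J^{(I'),I''}$, the composition is to satisfy $$(\mu\circ_i\nu)\bigl((m'\boxtimes m'')\otimes ab\bigr)=(-1)^{q\sum_{j<i}|m''_j|+r\sum_{j>i}|m''_j|}\;\mu\bigl(w\bigl((\nu(m'\otimes a)\boxtimes m'')\otimes b\bigr)\bigr),$$ where the factors of $m'\boxtimes m''$ are placed in the order of $I$, $\Delta_*M\boxtimes M^{\boxtimes I''}$ is identified with $\pi_*(M^{\boxtimes\{\bullet\}\sqcup I''})$, $\mu$ is applied as $n\otimes F\mapsto\mu(n)\otimes F$, and the result is taken in $\pi_*\Delta_*M=\Delta_*M$. **Theorem.** These formulas determine well-defined maps, and with them the $P(n)$, $n\ge0$, form a dg operad: the $P(n)$ are complexes of $\mathbf k[S_n]$-modules,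 the partial compositions are bilinear of degree $0$, satisfy the graded Leibniz rule, are associative (for sequential and, with sign $(-1)^{|\mu||\nu|}$, for parallel compositions) and equivariant, and the element of $P(1)$ given by $m\otimes1\mapsto m\otimes1$ is a unit. Equivalently, there is exactly one dg operad structure on $\{P(n)\}_{n\ge0}$ whose grading, differential, symmetric group actions, unit and partial compositions are given by the formulas above. -/

import Mathlib

set_option linter.unusedSectionVars false

open scoped TensorProduct DirectSum

noncomputable section

namespace HigherChiral

/-! ## The Weyl algebra and right modules over it -/

/-- Generators `z a`, `∂ a` of the ring of differential operators on the affine space with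
coordinates indexed by `κ`. -/
inductive WeylGen (κ : Type*) : Type _
  | z : κ → WeylGen κ
  | pd : κ → WeylGen κ

/-- The usual relations: the `z a` commute, the `∂ a` commute, and `[∂ a, z b] = δ_{ab}`. -/
inductive WeylRel (k : Type*) [Field k] (κ : Type*) :
    FreeAlgebra k (WeylGen κ) → FreeAlgebra k (WeylGen κ) → Prop
  | z_comm (a b : κ) : WeylRel k κ
      (FreeAlgebra.ι k (.z a) * FreeAlgebra.ι k (.z b))
      (FreeAlgebra.ι k (.z b) * FreeAlgebra.ι k (.z a))
  | pd_comm (a b : κ) : WeylRel k κ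
      (FreeAlgebra.ι k (.pd a) * FreeAlgebra.ι k (.pd b))
      (FreeAlgebra.ι k (.pd b) * FreeAlgebra.ι k (.pd a))
  | pd_z_same (a : κ) : WeylRel k κ
      (FreeAlgebra.ι k (.pd a) * FreeAlgebra.ι k (.z a))
      (FreeAlgebra.ι k (.z a) * FreeAlgebra.ι k (.pd a) + 1)
  | pd_z_ne (a b : κ) (h : a ≠ b) : WeylRel k κ
      (FreeAlgebra.ι k (.pd a) * FreeAlgebra.ι k (.z b))
      (FreeAlgebra.ι k (.z b) * FreeAlgebra.ι k (.pd a))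

/-- The Weyl algebra: global differential operators on the affine space `𝔸^κ`. -/
def Weyl (k : Type*) [Field k] (κ : Type*) : Type _ := RingQuot (WeylRel k κ)

instance (k : Type*) [Field k] (κ : Type*) : Ring (Weyl k κ) :=
  inferInstanceAs (Ring (RingQuot (WeylRel k κ)))

instance (k : Type*) [Field k] (κ : Type*) : Algebra k (Weyl k κ) :=
  inferInstanceAs (Algebra k (RingQuot (WeylRel k κ)))

/-- The quotient map from the free algebra on the coordinates and vector fields. -/
def weylMk (k : Type*) [Field k] (κ : Type*) : FreeAlgebra k (WeylGen κ) →ₐ[k] Weyl k κ :=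
  RingQuot.mkAlgHom k (WeylRel k κ)

theorem weylMk_rel {k : Type*} [Field k] {κ : Type*} {a b : FreeAlgebra k (WeylGen κ)}
    (h : WeylRel k κ a b) : weylMk k κ a = weylMk k κ b := RingQuot.mkAlgHom_rel k h

section Weyl

variable {k : Type*} [Field k] {κ : Type*}

/-- The coordinate function `z a`. -/
def wz (k : Type*) [Field k] {κ : Type*} (a : κ) : Weyl k κ :=
  weylMk k κ (FreeAlgebra.ι k (.z a))

/-- The coordinate vector field `∂ a`. -/
def wpd (k : Type*) [Field k] {κ : Type*} (a : κ) : Weyl k κ :=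
  weylMk k κ (FreeAlgebra.ι k (.pd a))

theorem wz_comm (a b : κ) : wz k a * wz k b = wz k b * wz k a := by
  simpa only [wz, map_mul] using weylMk_rel (WeylRel.z_comm (k := k) a b)

theorem wpd_comm (a b : κ) : wpd k a * wpd k b = wpd k b * wpd k a := by
  simpa only [wpd, map_mul] using weylMk_rel (WeylRel.pd_comm (k := k) a b)

theorem wpd_wz_same (a : κ) : wpd k a * wz k a = wz k a * wpd k a + 1 := by
  simpa only [wz, wpd, map_mul, map_add, map_one] using
    weylMk_rel (WeylRel.pd_z_same (k := k) a)

theorem wpd_wz_ne {a b : κ} (h : a ≠ b) : wpd k a * wz k b = wz k b * wpd k a := by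
  simpa only [wz, wpd, map_mul] using weylMk_rel (WeylRel.pd_z_ne (k := k) a b h)

/-- Right multiplication `n ↦ n · P` on a right module over the Weyl algebra (right modules are
modules over the opposite ring). -/
def ract {N : Type*} [AddCommGroup N] [Module k N] [Module (Weyl k κ)ᵐᵒᵖ N]
    [IsScalarTower k (Weyl k κ)ᵐᵒᵖ N] (P : Weyl k κ) : Module.End k N :=
  Algebra.lsmul k k N (MulOpposite.op P)

section ract

variable {N : Type*} [AddCommGroup N] [Module k N] [Module (Weyl k κ)ᵐᵒᵖ N]
    [IsScalarTower k (Weyl k κ)ᵐᵒᵖ N]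

theorem ract_apply (P : Weyl k κ) (n : N) : ract P n = MulOpposite.op P • n := rfl

theorem ract_mul (P Q : Weyl k κ) :
    (ract (P * Q) : Module.End k N) = ract Q * ract P := by
  ext n; simp [ract]

theorem ract_add (P Q : Weyl k κ) :
    (ract (P + Q) : Module.End k N) = ract P + ract Q := by
  ext n; simp [ract]

theorem ract_one : (ract (1 : Weyl k κ) : Module.End k N) = 1 := by
  ext n; simp [ract]

end ract

/-- The data of a right module over the Weyl algebra in terms of generators: operators
`Z a = (· z a)` and `D a = (· ∂ a)` satisfying the opposite of the Weyl relations. -/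
structure RightOps (k : Type*) [Field k] (κ : Type*) (V : Type*) [AddCommGroup V] [Module k V] where
  Z : κ → Module.End k V
  D : κ → Module.End k V
  ZZ : ∀ a b, Z a * Z b = Z b * Z a
  DD : ∀ a b, D a * D b = D b * D a
  ZD_same : ∀ a, Z a * D a = D a * Z a + 1
  ZD_ne : ∀ a b, a ≠ b → Z b * D a = D a * Z b

namespace RightOps

variable {V : Type*} [AddCommGroup V] [Module k V]

/-- The map on the Weyl algebra with prescribed values on generators. -/
def weylLift (R : RightOps k κ V) : Weyl k κ →ₐ[k] (Module.End k V)ᵐᵒᵖ :=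
  RingQuot.liftAlgHom k
    ⟨FreeAlgebra.lift k (fun g => match g with
      | .z a => MulOpposite.op (R.Z a)
      | .pd a => MulOpposite.op (R.D a)), by
      rintro _ _ (⟨a, b⟩ | ⟨a, b⟩ | ⟨a⟩ | ⟨a, b, h⟩)
      · simp only [map_mul, FreeAlgebra.lift_ι_apply, ← MulOpposite.op_mul]
        rw [R.ZZ b a]
      · simp only [map_mul, FreeAlgebra.lift_ι_apply, ← MulOpposite.op_mul]
        rw [R.DD b a]
      · simp only [map_mul, map_add, map_one, FreeAlgebra.lift_ι_apply, ← MulOpposite.op_mul,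
          ← MulOpposite.op_one, ← MulOpposite.op_add]
        rw [R.ZD_same a]
      · simp only [map_mul, FreeAlgebra.lift_ι_apply, ← MulOpposite.op_mul]
        rw [R.ZD_ne a b h]⟩

theorem weylLift_mk (R : RightOps k κ V) (g : WeylGen κ) :
    R.weylLift (weylMk k κ (FreeAlgebra.ι k g)) = (match g with
      | .z a => MulOpposite.op (R.Z a)
      | .pd a => MulOpposite.op (R.D a)) := by
  unfold weylLift weylMk
  refine (RingQuot.liftAlgHom_mkAlgHom_apply (S := k) _ _ _).trans ?_
  rw [FreeAlgebra.lift_ι_apply]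

/-- The right action of the Weyl algebra generated by the given operators. -/
def toAlgHom (R : RightOps k κ V) : (Weyl k κ)ᵐᵒᵖ →ₐ[k] Module.End k V :=
  AlgHom.opComm R.weylLift

theorem toAlgHom_z (R : RightOps k κ V) (a : κ) :
    R.toAlgHom (MulOpposite.op (wz k a)) = R.Z a := by
  simp [toAlgHom, wz, weylLift_mk]

theorem toAlgHom_pd (R : RightOps k κ V) (a : κ) :
    R.toAlgHom (MulOpposite.op (wpd k a)) = R.D a := by
  simp [toAlgHom, wpd, weylLift_mk]

/-- The resulting right module structure. -/
abbrev toModule (R : RightOps k κ V) : Module (Weyl k κ)ᵐᵒᵖ V :=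
  Module.compHom V (R.toAlgHom : (Weyl k κ)ᵐᵒᵖ →+* Module.End k V)

theorem isScalarTower (R : RightOps k κ V) :
    letI := R.toModule; IsScalarTower k (Weyl k κ)ᵐᵒᵖ V := by
  let _ := R.toModule
  refine ⟨fun c P v => ?_⟩
  change R.toAlgHom (c • P) v = c • R.toAlgHom P v
  simp

end RightOps

end Weyl

/-! ## Balanced tensor products -/

section Balanced

variable {k : Type*} [Field k] {κ V W : Type*} [AddCommGroup V] [Module k V] [AddCommGroup W]
  [Module k W]

/-- For commuting operators `a c` on `V` and `b c` on `W` (`c ∈ κ`), the quotient of `V ⊗ W` by this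
submodule is the tensor product `V ⊗_{k[κ]} W` over the polynomial ring acting through them. -/
def balance (a : κ → Module.End k V) (b : κ → Module.End k W) : Submodule k (V ⊗[k] W) :=
  Submodule.span k {t | ∃ c v w, t = a c v ⊗ₜ[k] w - v ⊗ₜ[k] b c w}

variable {a : κ → Module.End k V} {b : κ → Module.End k W}

theorem balance_mk (c : κ) (v : V) (w : W) :
    (balance a b).mkQ (a c v ⊗ₜ[k] w) = (balance a b).mkQ (v ⊗ₜ[k] b c w) := by
  rw [← sub_eq_zero, ← map_sub, Submodule.mkQ_apply, Submodule.Quotient.mk_eq_zero]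
  exact Submodule.subset_span ⟨c, v, w, rfl⟩

/-- A linear map out of `V ⊗_{k[κ]} W` from a balanced linear map out of `V ⊗ W`. -/
def balanceLift {X : Type*} [AddCommGroup X] [Module k X] (f : V ⊗[k] W →ₗ[k] X)
    (hf : ∀ c v w, f (a c v ⊗ₜ[k] w) = f (v ⊗ₜ[k] b c w)) :
    (V ⊗[k] W ⧸ balance a b) →ₗ[k] X :=
  (balance a b).liftQ f <| by
    refine Submodule.span_le.2 ?_
    rintro _ ⟨c, v, w, rfl⟩
    simp [hf]

theorem balance_ext {X : Type*} [AddCommGroup X] [Module k X]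
    {f g : (V ⊗[k] W ⧸ balance a b) →ₗ[k] X}
    (h : ∀ v w, f ((balance a b).mkQ (v ⊗ₜ[k] w)) = g ((balance a b).mkQ (v ⊗ₜ[k] w))) :
    f = g := by
  apply Submodule.linearMap_qext
  apply TensorProduct.ext'
  exact h

end Balanced

/-! ## The relative de Rham algebra of the Jouanolou torsor -/

section Jou

variable (k : Type*) [Field k] (d : ℕ) {I : Type*} (G : SimpleGraph I)

/-- Generators `z_i^s`, `x_{jl}^s`, `𝐝x_{jl}^s`; the pairs `(j, l)` run over the ordered pairs of
adjacent vertices of `G`. -/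
inductive JGen : Type _
  | z : I → Fin d → JGen
  | x : G.Dart → Fin d → JGen
  | dx : G.Dart → Fin d → JGen

/-- Relations of the Jouanolou model attached to a graph `G` on the index set `I`: graded
commutativity, `x_{lj} = - x_{jl}`, `∑ₛ x_{jl}^s (z_j^s - z_l^s) = 1` and
`∑ₛ 𝐝x_{jl}^s (z_j^s - z_l^s) = 0`. -/
inductive JRel : FreeAlgebra k (JGen d G) → FreeAlgebra k (JGen d G) → Prop
  | z_comm (i : I) (s : Fin d) (g : JGen d G) : JRel
      (FreeAlgebra.ι k (.z i s) * FreeAlgebra.ι k g) (FreeAlgebra.ι k g * FreeAlgebra.ι k (.z i s))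
  | x_comm (e : G.Dart) (s : Fin d) (e' : G.Dart) (s' : Fin d) : JRel
      (FreeAlgebra.ι k (.x e s) * FreeAlgebra.ι k (.x e' s'))
      (FreeAlgebra.ι k (.x e' s') * FreeAlgebra.ι k (.x e s))
  | x_dx_comm (e : G.Dart) (s : Fin d) (e' : G.Dart) (s' : Fin d) : JRel
      (FreeAlgebra.ι k (.x e s) * FreeAlgebra.ι k (.dx e' s'))
      (FreeAlgebra.ι k (.dx e' s') * FreeAlgebra.ι k (.x e s))
  | dx_comm (e : G.Dart) (s : Fin d) (e' : G.Dart) (s' : Fin d) : JRel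
      (FreeAlgebra.ι k (.dx e s) * FreeAlgebra.ι k (.dx e' s'))
      (-(FreeAlgebra.ι k (.dx e' s') * FreeAlgebra.ι k (.dx e s)))
  | x_symm (e : G.Dart) (s : Fin d) : JRel
      (FreeAlgebra.ι k (.x e.symm s)) (-FreeAlgebra.ι k (.x e s))
  | dx_symm (e : G.Dart) (s : Fin d) : JRel
      (FreeAlgebra.ι k (.dx e.symm s)) (-FreeAlgebra.ι k (.dx e s))
  | x_z (e : G.Dart) : JRel
      (∑ s, FreeAlgebra.ι k (.x e s) *
        (FreeAlgebra.ι k (.z e.fst s) - FreeAlgebra.ι k (.z e.snd s))) 1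
  | dx_z (e : G.Dart) : JRel
      (∑ s, FreeAlgebra.ι k (.dx e s) *
        (FreeAlgebra.ι k (.z e.fst s) - FreeAlgebra.ι k (.z e.snd s))) 0

/-- The Jouanolou algebra of a graph `G` on `I`. For the complete graph this is the Jouanolou model
`𝐉^I`; for the graph of pairs not contained in one block it is the partial Jouanolou model. -/
def Jou : Type _ := RingQuot (JRel k d G)

instance : Ring (Jou k d G) := inferInstanceAs (Ring (RingQuot (JRel k d G)))

instance : Algebra k (Jou k d G) := inferInstanceAs (Algebra k (RingQuot (JRel k d G)))

/-- The quotient map from the free algebra on the generators. -/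
def jmk : FreeAlgebra k (JGen d G) →ₐ[k] Jou k d G := RingQuot.mkAlgHom k (JRel k d G)

variable {d G}

theorem jmk_rel {a b : FreeAlgebra k (JGen d G)} (h : JRel k d G a b) :
    jmk k d G a = jmk k d G b := RingQuot.mkAlgHom_rel k h

/-- The class of a generator. -/
def jgen (g : JGen d G) : Jou k d G := jmk k d G (FreeAlgebra.ι k g)

variable {k}

theorem jz_comm (i : I) (s : Fin d) (g : JGen d G) :
    jgen k (.z i s) * jgen k g = jgen k g * jgen k (.z i s) := by
  simpa only [jgen, map_mul] using jmk_rel k (JRel.z_comm (k := k) i s g)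

theorem jx_comm (e e' : G.Dart) (s s' : Fin d) :
    jgen k (.x e s) * jgen k (.x e' s') = jgen k (.x e' s') * jgen k (.x e s) := by
  simpa only [jgen, map_mul] using jmk_rel k (JRel.x_comm (k := k) e s e' s')

theorem jx_dx_comm (e e' : G.Dart) (s s' : Fin d) :
    jgen k (.x e s) * jgen k (.dx e' s') = jgen k (.dx e' s') * jgen k (.x e s) := by
  simpa only [jgen, map_mul] using jmk_rel k (JRel.x_dx_comm (k := k) e s e' s')

theorem jdx_comm (e e' : G.Dart) (s s' : Fin d) :
    jgen k (.dx e s) * jgen k (.dx e' s') = -(jgen k (.dx e' s') * jgen k (.dx e s)) := by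
  simpa only [jgen, map_mul, map_neg] using jmk_rel k (JRel.dx_comm (k := k) e s e' s')

theorem jx_symm (e : G.Dart) (s : Fin d) :
    jgen k (.x e.symm s) = -jgen k (.x e s) := by
  simpa only [jgen, map_neg] using jmk_rel k (JRel.x_symm (k := k) e s)

theorem jdx_symm (e : G.Dart) (s : Fin d) :
    jgen k (.dx e.symm s) = -jgen k (.dx e s) := by
  simpa only [jgen, map_neg] using jmk_rel k (JRel.dx_symm (k := k) e s)

theorem jx_z (e : G.Dart) :
    ∑ s : Fin d, jgen k (.x e s) * (jgen k (.z e.fst s) - jgen k (.z e.snd s)) = 1 := by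
  simpa only [jgen, map_mul, map_sum, map_sub, map_one] using
    jmk_rel k (JRel.x_z (k := k) (d := d) e)

theorem jdx_z (e : G.Dart) :
    ∑ s : Fin d, jgen k (.dx e s) * (jgen k (.z e.fst s) - jgen k (.z e.snd s)) = 0 := by
  simpa only [jgen, map_mul, map_sum, map_sub, map_zero] using
    jmk_rel k (JRel.dx_z (k := k) (d := d) e)

/-- Universal property of the Jouanolou algebra. -/
def jlift {A : Type*} [Ring A] [Algebra k A] (f : JGen d G → A)
    (z_comm : ∀ i s g, f (.z i s) * f g = f g * f (.z i s))
    (x_comm : ∀ e s e' s', f (.x e s) * f (.x e' s') = f (.x e' s') * f (.x e s))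
    (x_dx_comm : ∀ e s e' s', f (.x e s) * f (.dx e' s') = f (.dx e' s') * f (.x e s))
    (dx_comm : ∀ e s e' s', f (.dx e s) * f (.dx e' s') = -(f (.dx e' s') * f (.dx e s)))
    (x_symm : ∀ e s, f (.x e.symm s) = -f (.x e s))
    (dx_symm : ∀ e s, f (.dx e.symm s) = -f (.dx e s))
    (x_z : ∀ e, ∑ s, f (.x e s) * (f (.z e.fst s) - f (.z e.snd s)) = 1)
    (dx_z : ∀ e, ∑ s, f (.dx e s) * (f (.z e.fst s) - f (.z e.snd s)) = 0) :
    Jou k d G →ₐ[k] A :=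
  RingQuot.liftAlgHom k ⟨FreeAlgebra.lift k f, by
    rintro _ _ (⟨i, s, g⟩ | ⟨e, s, e', s'⟩ | ⟨e, s, e', s'⟩ | ⟨e, s, e', s'⟩ | ⟨e, s⟩ | ⟨e, s⟩ |
      ⟨e⟩ | ⟨e⟩)
    · simpa using z_comm i s g
    · simpa using x_comm e s e' s'
    · simpa using x_dx_comm e s e' s'
    · simpa using dx_comm e s e' s'
    · simpa using x_symm e s
    · simpa using dx_symm e s
    · simpa using x_z e
    · simpa using dx_z e⟩

section lift

variable {A : Type*} [Ring A] [Algebra k A] (f : JGen d G → A)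

theorem jlift_gen (h1 h2 h3 h4 h5 h6 h7 h8) (g : JGen d G) :
    jlift (k := k) f h1 h2 h3 h4 h5 h6 h7 h8 (jgen k g) = f g := by
  unfold jlift jgen jmk
  refine (RingQuot.liftAlgHom_mkAlgHom_apply (S := k) _ _ _).trans ?_
  rw [FreeAlgebra.lift_ι_apply]

end lift

theorem jou_algHom_ext {A : Type*} [Ring A] [Algebra k A] {f g : Jou k d G →ₐ[k] A}
    (h : ∀ x, f (jgen k x) = g (jgen k x)) : f = g := by
  apply RingQuot.ringQuot_ext'
  ext x
  exact h x

theorem jou_induction {p : Jou k d G → Prop} (hs : ∀ c : k, p (algebraMap k _ c))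
    (hg : ∀ g, p (jgen k g)) (hm : ∀ a b, p a → p b → p (a * b))
    (ha : ∀ a b, p a → p b → p (a + b)) (a : Jou k d G) : p a := by
  obtain ⟨b, rfl⟩ : ∃ b, jmk k d G b = a := RingQuot.mkAlgHom_surjective k (JRel k d G) a
  induction b using FreeAlgebra.induction with
  | grade0 c => simpa using hs c
  | grade1 x => exact hg x
  | mul x y hx hy => simpa using hm _ _ hx hy
  | add x y hx hy => simpa using ha _ _ hx hy

/-- The coordinates `z` are central. -/
theorem jz_central (i : I) (s : Fin d) (a : Jou k d G) :
    jgen k (.z i s) * a = a * jgen k (.z i s) := by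
  induction a using jou_induction with
  | hs c => exact (Algebra.commutes c _).symm
  | hg g => exact jz_comm i s g
  | hm a b ha hb => rw [← mul_assoc, ha, mul_assoc, hb, mul_assoc]
  | ha a b ha hb => rw [mul_add, add_mul, ha, hb]

/-- The elements of `𝐉` of cohomological degree `r`: spanned by the monomials in the generators
containing exactly `r` factors `𝐝x`. -/
def jdeg (r : ℕ) : Submodule k (Jou k d G) :=
  Submodule.span k {a | ∃ l : List (JGen d G),
    l.countP (fun g => match g with | .dx _ _ => true | _ => false) = r ∧
      a = (l.map (jgen k)).prod}

/-- Values on generators of the map of Jouanolou algebras induced by a map of graphs. -/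
def jmapGen {I' : Type*} {G' : SimpleGraph I'} (φ : G →g G') (g : JGen d G) : Jou k d G' :=
  match g with
  | .z i s => jgen k (.z (φ i) s)
  | .x e s => jgen k (.x (φ.mapDart e) s)
  | .dx e s => jgen k (.dx (φ.mapDart e) s)

/-- The map of Jouanolou algebras induced by a map of graphs:
`z_i ↦ z_{φ i}`, `x_{jl} ↦ x_{φ j φ l}`, `𝐝x_{jl} ↦ 𝐝x_{φ j φ l}`. -/
def jmap {I' : Type*} {G' : SimpleGraph I'} (φ : G →g G') : Jou k d G →ₐ[k] Jou k d G' :=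
  jlift (jmapGen φ)
    (fun _ _ _ => jz_central _ _ _) (fun _ _ _ _ => jx_comm _ _ _ _)
    (fun _ _ _ _ => jx_dx_comm _ _ _ _) (fun _ _ _ _ => jdx_comm _ _ _ _)
    (fun e s => jx_symm (φ.mapDart e) s) (fun e s => jdx_symm (φ.mapDart e) s)
    (fun e => jx_z (φ.mapDart e)) (fun e => jdx_z (φ.mapDart e))

theorem jmap_gen {I' : Type*} {G' : SimpleGraph I'} (φ : G →g G') (g : JGen d G) :
    jmap (k := k) φ (jgen k g) = jmapGen φ g := jlift_gen _ _ _ _ _ _ _ _ _ g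

/-- The matrix `[[a, 0], [b, c]]`. -/
def low {A : Type*} [Ring A] (a b c : A) : Matrix (Fin 2) (Fin 2) A := !![a, 0; b, c]

section low

variable {A : Type*} [Ring A]

theorem low_mul (a b c a' b' c' : A) :
    low a b c * low a' b' c' = low (a * a') (b * a' + c * b') (c * c') := by
  simp [low]

theorem low_neg (a b c : A) : -low a b c = low (-a) (-b) (-c) := by simp [low]

theorem low_sub (a b c a' b' c' : A) :
    low a b c - low a' b' c' = low (a - a') (b - b') (c - c') := by
  ext i j; fin_cases i <;> fin_cases j <;> simp [low]

theorem low_one : low (1 : A) 0 1 = 1 := by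
  ext i j; fin_cases i <;> fin_cases j <;> simp [low]

theorem low_zero : low (0 : A) 0 0 = 0 := by
  ext i j; fin_cases i <;> fin_cases j <;> rfl

theorem low_sum {ι : Type*} (s : Finset ι) (a b c : ι → A) :
    ∑ i ∈ s, low (a i) (b i) (c i) = low (∑ i ∈ s, a i) (∑ i ∈ s, b i) (∑ i ∈ s, c i) := by
  ext i j
  rw [Matrix.sum_apply]
  fin_cases i <;> fin_cases j <;> simp [low]

end low

/-- Values on generators of the algebra map `a ↦ [[a, 0], [𝐝a, (-1)^|a| a]]` encoding the
relative de Rham differential `𝐝`: `𝐝 z = 0`, `𝐝 (x) = 𝐝x`, `𝐝 (𝐝x) = 0`. -/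
def jdGen (g : JGen d G) : Matrix (Fin 2) (Fin 2) (Jou k d G) :=
  match g with
  | .z i s => low (jgen k (.z i s)) 0 (jgen k (.z i s))
  | .x e s => low (jgen k (.x e s)) (jgen k (.dx e s)) (jgen k (.x e s))
  | .dx e s => low (jgen k (.dx e s)) 0 (-jgen k (.dx e s))

/-- The algebra map `a ↦ [[a, 0], [𝐝a, (-1)^|a| a]]`; multiplicativity of its lower left entry is the
graded Leibniz rule. -/
def jdMat : Jou k d G →ₐ[k] Matrix (Fin 2) (Fin 2) (Jou k d G) :=
  jlift jdGen
    (by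
      rintro i s (_ | _ | _) <;> simp only [jdGen, low_mul] <;> congr 1 <;>
        simp [jz_central i s])
    (by
      intro e s e' s'
      simp only [jdGen, low_mul, jx_comm e e' s s', jx_dx_comm, add_comm])
    (by
      intro e s e' s'
      simp only [jdGen, low_mul, jx_dx_comm, jdx_comm e e' s s', mul_neg, neg_mul, mul_zero,
        zero_mul, add_zero, zero_add])
    (by
      intro e s e' s'
      simp only [jdGen, low_mul, low_neg, jdx_comm e e' s s', mul_neg, neg_mul, mul_zero,
        zero_mul, add_zero, neg_neg, neg_zero])
    (by intro e s; simp only [jdGen, jx_symm, jdx_symm, low_neg])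
    (by intro e s; simp only [jdGen, jdx_symm, low_neg, neg_zero])
    (by
      intro e
      simp only [jdGen, low_mul, low_sub, low_sum, sub_zero, mul_zero, add_zero, jx_z, jdx_z,
        low_one])
    (by
      intro e
      simp only [jdGen, low_mul, low_sub, low_sum, sub_zero, mul_zero, zero_mul, add_zero, jdx_z,
        neg_mul, Finset.sum_const_zero]
      rw [← low_zero]
      congr 1
      rw [Finset.sum_neg_distrib, jdx_z, neg_zero])

/-- The relative de Rham differential `𝐝` of the Jouanolou algebra. -/
def jd : Jou k d G →ₗ[k] Jou k d G where
  toFun a := jdMat a 1 0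
  map_add' a b := by simp
  map_smul' c a := by simp

theorem jd_z (i : I) (s : Fin d) : jd (jgen k (.z i s) : Jou k d G) = 0 := by
  simp [jd, jdMat, jlift_gen, jdGen, low]

theorem jd_x (e : G.Dart) (s : Fin d) : jd (jgen k (.x e s)) = jgen k (.dx e s) := by
  simp [jd, jdMat, jlift_gen, jdGen, low]

theorem jd_dx (e : G.Dart) (s : Fin d) : jd (jgen k (.dx e s)) = 0 := by
  simp [jd, jdMat, jlift_gen, jdGen, low]

theorem jdMat_low (a : Jou k d G) : ∃ b c, jdMat a = low a b c := by
  induction a using jou_induction with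
  | hs c =>
    refine ⟨0, algebraMap k _ c, ?_⟩
    rw [AlgHom.commutes, Algebra.algebraMap_eq_smul_one, ← low_one,
      Algebra.algebraMap_eq_smul_one]
    simp [low]
  | hg g => cases g <;> exact ⟨_, _, jlift_gen _ _ _ _ _ _ _ _ _ _⟩
  | hm a b ha hb =>
    obtain ⟨x, y, h⟩ := ha
    obtain ⟨x', y', h'⟩ := hb
    exact ⟨_, _, by rw [map_mul, h, h', low_mul]⟩
  | ha a b ha hb =>
    obtain ⟨x, y, h⟩ := ha
    obtain ⟨x', y', h'⟩ := hb
    refine ⟨x + x', y + y', ?_⟩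
    rw [map_add, h, h']; simp [low]

/-- `𝐝` is linear over the coordinates `z`. -/
theorem jd_z_mul (i : I) (s : Fin d) (a : Jou k d G) :
    jd (jgen k (.z i s) * a) = jgen k (.z i s) * jd a := by
  obtain ⟨b, c, h⟩ := jdMat_low a
  have hz : jdMat (jgen k (.z i s) : Jou k d G) =
      low (jgen k (.z i s)) 0 (jgen k (.z i s)) := jlift_gen _ _ _ _ _ _ _ _ _ _
  simp only [jd, LinearMap.coe_mk, AddHom.coe_mk, map_mul, h, hz, low_mul]
  simp [low]

variable [DecidableEq I]

/-- The coefficient of `-x^t x^s` in `∂_{z_i^t} x_e^s`: `1` if `i` is the first vertex of `e`, `-1` if it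
is the second one. -/
def jsign (i : I) (e : G.Dart) : Jou k d G :=
  (if e.fst = i then 1 else 0) - (if e.snd = i then 1 else 0)

theorem jsign_comm (i : I) (e : G.Dart) (a : Jou k d G) :
    jsign i e * a = a * jsign i e := by
  unfold jsign; split_ifs <;> simp

theorem jsign_symm (i : I) (e : G.Dart) :
    (jsign i e.symm : Jou k d G) = -jsign i e := by
  simp [jsign]

/-- Values on generators of the algebra map `a ↦ [[a, 0], [∂a, a]]` encoding the derivation
`∂ = ∂_{z_i^t}`: `∂ z_j^s = δ_{ij} δ_{st}`, `∂_{z_j^t} x_{jl}^s = - x_{jl}^t x_{jl}^s`,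
`∂_{z_l^t} x_{jl}^s = x_{jl}^t x_{jl}^s`, and `∂ 𝐝 = 𝐝 ∂`. -/
def jpdGen (i : I) (t : Fin d) (g : JGen d G) : Matrix (Fin 2) (Fin 2) (Jou k d G) :=
  match g with
  | .z j s => low (jgen k (.z j s)) (if j = i ∧ s = t then 1 else 0) (jgen k (.z j s))
  | .x e s => low (jgen k (.x e s)) (-(jsign i e * (jgen k (.x e t) * jgen k (.x e s))))
      (jgen k (.x e s))
  | .dx e s => low (jgen k (.dx e s))
      (-(jsign i e * (jgen k (.dx e t) * jgen k (.x e s) + jgen k (.x e t) * jgen k (.dx e s))))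
      (jgen k (.dx e s))

theorem sum_ite_jsign (i : I) (t : Fin d) (e : G.Dart) (f : Fin d → Jou k d G) :
    ∑ s, f s * ((if e.fst = i ∧ s = t then 1 else 0) - (if e.snd = i ∧ s = t then 1 else 0)) =
      f t * jsign i e := by
  rw [Finset.sum_eq_single t]
  · simp [jsign]
  · intro s _ hs; simp [hs]
  · simp

theorem jxx_commute (e e' : G.Dart) (s t s' : Fin d) (i : I) :
    Commute (jgen k (.x e' s')) (jsign i e * (jgen k (.x e t) * jgen k (.x e s))) :=
  Commute.mul_right (jsign_comm i e _).symm (Commute.mul_right (jx_comm _ _ _ _) (jx_comm _ _ _ _))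

theorem jdxx_commute (e e' : G.Dart) (s t s' : Fin d) (i : I) :
    Commute (jgen k (.dx e' s')) (jsign i e * (jgen k (.x e t) * jgen k (.x e s))) :=
  Commute.mul_right (jsign_comm i e _).symm
    (Commute.mul_right (jx_dx_comm _ _ _ _).symm (jx_dx_comm _ _ _ _).symm)

theorem jxdx_commute (e e' : G.Dart) (s t s' : Fin d) (i : I) :
    Commute (jgen k (.x e' s')) (jsign i e *
      (jgen k (.dx e t) * jgen k (.x e s) + jgen k (.x e t) * jgen k (.dx e s))) :=
  Commute.mul_right (jsign_comm i e _).symm (Commute.add_right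
    (Commute.mul_right (jx_dx_comm _ _ _ _) (jx_comm _ _ _ _))
    (Commute.mul_right (jx_comm _ _ _ _) (jx_dx_comm _ _ _ _)))

theorem jdxdx_anticommute (e e' : G.Dart) (s t s' : Fin d) (i : I) :
    (jsign i e * (jgen k (.dx e t) * jgen k (.x e s) + jgen k (.x e t) * jgen k (.dx e s))) *
      jgen k (.dx e' s') = -(jgen k (.dx e' s') * (jsign i e *
      (jgen k (.dx e t) * jgen k (.x e s) + jgen k (.x e t) * jgen k (.dx e s)))) := by
  rw [← mul_assoc (jgen k (.dx e' s')), ← jsign_comm, mul_assoc, mul_assoc, ← mul_neg]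
  congr 1
  rw [add_mul, mul_add, neg_add, mul_assoc, jx_dx_comm, ← mul_assoc, jdx_comm, neg_mul, mul_assoc,
    mul_assoc, jdx_comm, mul_neg, ← mul_assoc (jgen k (.x e t)), jx_dx_comm, mul_assoc]

/-- The algebra map `a ↦ [[a, 0], [∂a, a]]`. -/
def jpdMat (i : I) (t : Fin d) : Jou k d G →ₐ[k] Matrix (Fin 2) (Fin 2) (Jou k d G) :=
  jlift (jpdGen i t)
    (by
      rintro j s (_ | _ | _) <;> simp only [jpdGen, low_mul] <;> congr 1 <;>
        simp [jz_central j s, add_comm])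
    (by
      intro e s e' s'
      simp only [jpdGen, low_mul]
      congr 1
      · exact jx_comm _ _ _ _
      · rw [neg_mul, mul_neg, neg_mul, mul_neg, (jxx_commute e e' s t s' i).eq,
          (jxx_commute e' e s' t s i).eq, add_comm]
      · exact jx_comm _ _ _ _)
    (by
      intro e s e' s'
      simp only [jpdGen, low_mul]
      congr 1
      · exact jx_dx_comm _ _ _ _
      · rw [neg_mul, mul_neg, neg_mul, mul_neg, (jdxx_commute e e' s t s' i).eq,
          (jxdx_commute e' e s' t s i).eq, add_comm]
      · exact jx_dx_comm _ _ _ _)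
    (by
      intro e s e' s'
      simp only [jpdGen, low_mul, low_neg]
      congr 1
      · exact jdx_comm _ _ _ _
      · rw [neg_mul, mul_neg, neg_mul, mul_neg, jdxdx_anticommute, jdxdx_anticommute]
        abel
      · exact jdx_comm _ _ _ _)
    (by intro e s; simp [jpdGen, jx_symm, jsign_symm, low_neg])
    (by intro e s; simp [jpdGen, jx_symm, jdx_symm, jsign_symm, low_neg])
    (by
      intro e
      simp only [jpdGen, low_mul, low_sub, low_sum, jx_z, Finset.sum_add_distrib, sum_ite_jsign]
      rw [← low_one]
      congr 1
      simp only [neg_mul, mul_assoc]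
      rw [Finset.sum_neg_distrib, ← Finset.mul_sum, ← Finset.mul_sum, jx_z, mul_one, jsign_comm,
        neg_add_cancel])
    (by
      intro e
      simp only [jpdGen, low_mul, low_sub, low_sum, jdx_z, Finset.sum_add_distrib, sum_ite_jsign]
      rw [← low_zero]
      congr 1
      simp only [neg_mul, mul_assoc, add_mul]
      rw [Finset.sum_neg_distrib, ← Finset.mul_sum, Finset.sum_add_distrib, ← Finset.mul_sum,
        ← Finset.mul_sum, jx_z, jdx_z, mul_one, mul_zero, add_zero, jsign_comm, neg_add_cancel])

theorem jpdMat_gen (i : I) (t : Fin d) (g : JGen d G) :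
    jpdMat (k := k) i t (jgen k g) = jpdGen i t g := jlift_gen _ _ _ _ _ _ _ _ _ _

/-- The derivation `∂_{z_i^t}` of the Jouanolou algebra. -/
def jpd (i : I) (t : Fin d) : Jou k d G →ₗ[k] Jou k d G where
  toFun a := jpdMat i t a 1 0
  map_add' a b := by simp
  map_smul' c a := by simp

theorem jpdMat_eq (i : I) (t : Fin d) (a : Jou k d G) : jpdMat i t a = low a (jpd i t a) a := by
  have key : ∀ a : Jou k d G, ∃ b, jpdMat i t a = low a b a := by
    intro a
    induction a using jou_induction with
    | hs c =>
      refine ⟨0, ?_⟩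
      rw [AlgHom.commutes, Algebra.algebraMap_eq_smul_one, ← low_one,
        Algebra.algebraMap_eq_smul_one]
      simp [low]
    | hg g => cases g <;> exact ⟨_, jpdMat_gen _ _ _⟩
    | hm a b ha hb =>
      obtain ⟨x, h⟩ := ha
      obtain ⟨x', h'⟩ := hb
      exact ⟨_, by rw [map_mul, h, h', low_mul]⟩
    | ha a b ha hb =>
      obtain ⟨x, h⟩ := ha
      obtain ⟨x', h'⟩ := hb
      refine ⟨x + x', ?_⟩
      rw [map_add, h, h']; simp [low]
  obtain ⟨b, h⟩ := key a
  have : jpd i t a = b := by simp [jpd, h, low]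
  rw [this, h]

/-- The Leibniz rule. -/
theorem jpd_mul (i : I) (t : Fin d) (a b : Jou k d G) :
    jpd i t (a * b) = jpd i t a * b + a * jpd i t b := by
  have h : jpd i t (a * b) = jpdMat i t (a * b) 1 0 := rfl
  rw [h, map_mul, jpdMat_eq, jpdMat_eq, low_mul]
  simp [low]

theorem jpd_gen (i : I) (t : Fin d) (g : JGen d G) :
    jpd i t (jgen k g) = jpdGen i t g 1 0 := by
  have h : jpd i t (jgen k g) = jpdMat i t (jgen k g) 1 0 := rfl
  rw [h, jpdMat_gen]

theorem jpd_algebraMap (i : I) (t : Fin d) (c : k) :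
    jpd i t (algebraMap k (Jou k d G) c) = 0 := by
  have h : jpd i t (algebraMap k (Jou k d G) c) = jpdMat i t (algebraMap k _ c) 1 0 := rfl
  rw [h, AlgHom.commutes, Algebra.algebraMap_eq_smul_one, ← low_one]
  simp [low]

theorem jpd_z (i : I) (t : Fin d) (j : I) (s : Fin d) :
    jpd i t (jgen k (.z j s) : Jou k d G) = if j = i ∧ s = t then 1 else 0 := by
  rw [jpd_gen]; simp [jpdGen, low]

theorem jpd_x (i : I) (t : Fin d) (e : G.Dart) (s : Fin d) :
    jpd i t (jgen k (.x e s)) = -(jsign i e * (jgen k (.x e t) * jgen k (.x e s))) := by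
  rw [jpd_gen]; simp [jpdGen, low]

theorem jpd_dx (i : I) (t : Fin d) (e : G.Dart) (s : Fin d) :
    jpd i t (jgen k (.dx e s)) =
      -(jsign i e * (jgen k (.dx e t) * jgen k (.x e s) + jgen k (.x e t) * jgen k (.dx e s))) := by
  rw [jpd_gen]; simp [jpdGen, low]

theorem jpd_jsign (i : I) (t : Fin d) (j : I) (e : G.Dart) :
    jpd i t (jsign j e : Jou k d G) = 0 := by
  have h : (jsign j e : Jou k d G) = algebraMap k _
      ((if e.fst = j then 1 else 0) - (if e.snd = j then 1 else 0)) := by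
    simp only [jsign, map_sub]; split_ifs <;> simp
  rw [h, jpd_algebraMap]

/-- The `∂`'s commute. -/
theorem jpd_comm (i : I) (t : Fin d) (j : I) (u : Fin d) (a : Jou k d G) :
    jpd i t (jpd j u a) = jpd j u (jpd i t a) := by
  have cx : ∀ (e : G.Dart) (s s' : Fin d), jgen k (.x e s) * jgen k (.x e s') =
    jgen k (.x e s') * jgen k (.x e s) := fun e s s' => jx_comm e e s s'
  have clx : ∀ (e : G.Dart) (s s' : Fin d) (a : Jou k d G), jgen k (.x e s) *
    (jgen k (.x e s') * a) = jgen k (.x e s') * (jgen k (.x e s) * a) := fun e s s' a => by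
      rw [← mul_assoc, cx, mul_assoc]
  have cd : ∀ (e : G.Dart) (s s' : Fin d), jgen k (.dx e s') * jgen k (.x e s) =
    jgen k (.x e s) * jgen k (.dx e s') := fun e s s' => (jx_dx_comm e e s s').symm
  have cs : ∀ (i : I) (e : G.Dart) (g : JGen d G), jgen k g * jsign i e = jsign i e * jgen k g :=
    fun i e g => (jsign_comm i e _).symm
  have cls : ∀ (i : I) (e : G.Dart) (g : JGen d G) (a : Jou k d G), jgen k g * (jsign i e * a) =
    jsign i e * (jgen k g * a) := fun i e g a => by rw [← mul_assoc, cs, mul_assoc]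
  have css : ∀ (i j : I) (e : G.Dart), (jsign i e * jsign j e : Jou k d G) =
    jsign j e * jsign i e := fun i j e => jsign_comm i e _
  have clss : ∀ (i j : I) (e : G.Dart) (a : Jou k d G), jsign i e * (jsign j e * a) =
    jsign j e * (jsign i e * a) := fun i j e a => by rw [← mul_assoc, css, mul_assoc]
  induction a using jou_induction with
  | hs c => simp [jpd_algebraMap]
  | hg g =>
    cases g with
    | z l s =>
      simp only [jpd_z]
      have h1 : ∀ (i : I) (t : Fin d), jpd i t (1 : Jou k d G) = 0 := fun i t => by
        simpa using jpd_algebraMap (k := k) (G := G) i t 1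
      split_ifs <;> simp [h1]
    | x e s =>
      simp only [jpd_x, jpd_mul, jpd_jsign, map_neg, mul_neg, neg_mul, zero_mul, zero_add, mul_add,
        neg_add, neg_neg, mul_assoc, cx, clx, cls, clss]
    | dx e s =>
      simp only [jpd_x, jpd_dx, jpd_mul, jpd_jsign, map_neg, map_add, mul_neg, neg_mul, zero_mul,
        zero_add, mul_add, neg_add, neg_neg, mul_assoc, cx, clx, cls, clss, cd]
      abel
  | hm a b ha hb =>
    simp only [jpd_mul, map_add, ha, hb]
    abel
  | ha a b ha hb => simp only [map_add, ha, hb]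

end Jou

/-! ## Right modules over the Weyl algebra built from others -/

section Constructions

variable {k : Type*} [Field k]

section JModel

variable {d : ℕ} {I : Type*} (G : SimpleGraph I)
  (N : Type*) [AddCommGroup N] [Module k N] [Module (Weyl k (I × Fin d))ᵐᵒᵖ N]
  [IsScalarTower k (Weyl k (I × Fin d))ᵐᵒᵖ N]

/-- The Jouanolou model `𝐉_G(N) = N ⊗_𝒪 𝐉_G` of a right `𝒟`-module `N` on `(𝔸^d)^I`. -/
def JModel (k : Type*) [Field k] (d : ℕ) {I : Type*} (G : SimpleGraph I)
    (N : Type*) [AddCommGroup N] [Module k N] [Module (Weyl k (I × Fin d))ᵐᵒᵖ N]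
    [IsScalarTower k (Weyl k (I × Fin d))ᵐᵒᵖ N] : Type _ :=
  (N ⊗[k] Jou k d G) ⧸ balance (fun c : I × Fin d => (ract (wz k c) : Module.End k N))
    (fun c : I × Fin d => LinearMap.mulLeft k (jgen k (.z c.1 c.2) : Jou k d G))

instance : AddCommGroup (JModel k d G N) := Submodule.Quotient.addCommGroup _

instance : Module k (JModel k d G N) := Submodule.Quotient.module _

variable {N}

/-- The class of `n ⊗ a`. -/
def jmMk : N →ₗ[k] Jou k d G →ₗ[k] JModel k d G N :=
  (TensorProduct.mk k N (Jou k d G)).compr₂ (Submodule.mkQ _)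

variable {G}

theorem jmMk_z (c : I × Fin d) (n : N) (a : Jou k d G) :
    jmMk G (ract (wz k c) n) a = jmMk G n (jgen k (.z c.1 c.2) * a) :=
  balance_mk c n a

/-- A linear map out of `𝐉_G(N)`. -/
def jmLift {X : Type*} [AddCommGroup X] [Module k X] (f : N →ₗ[k] Jou k d G →ₗ[k] X)
    (hf : ∀ (c : I × Fin d) (n : N) (a : Jou k d G), f (ract (wz k c) n) a = f n (jgen k (.z c.1 c.2) * a)) :
    JModel k d G N →ₗ[k] X :=
  balanceLift (TensorProduct.lift f) fun c n a => by simpa using hf c n a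

theorem jmLift_mk {X : Type*} [AddCommGroup X] [Module k X] (f : N →ₗ[k] Jou k d G →ₗ[k] X)
    (hf : ∀ (c : I × Fin d) (n : N) (a : Jou k d G), f (ract (wz k c) n) a = f n (jgen k (.z c.1 c.2) * a)) (n : N) (a : Jou k d G) :
    jmLift f hf (jmMk G n a) = f n a := by
  refine (Submodule.liftQ_apply _ _ _).trans ?_
  simp

theorem jm_ext {X : Type*} [AddCommGroup X] [Module k X] {f g : JModel k d G N →ₗ[k] X}
    (h : ∀ n a, f (jmMk G n a) = g (jmMk G n a)) : f = g :=
  balance_ext h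

/-- Right multiplication by `z` on `𝐉_G(N)`: `(n ⊗ a) · z = n ⊗ z a`. -/
def jmZ (c : I × Fin d) : Module.End k (JModel k d G N) :=
  jmLift ((jmMk G).compl₂ (LinearMap.mulLeft k (jgen k (.z c.1 c.2)))) fun c' n a => by
    simp only [LinearMap.compl₂_apply, LinearMap.mulLeft_apply, jmMk_z, ← mul_assoc,
      jz_comm c.1 c.2]

theorem jmZ_mk (c : I × Fin d) (n : N) (a : Jou k d G) :
    jmZ c (jmMk G n a) = jmMk G n (jgen k (.z c.1 c.2) * a) := jmLift_mk _ _ _ _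

variable [DecidableEq I]

/-- Right multiplication by `∂` on `𝐉_G(N)`: `(n ⊗ a) · ∂ = (n · ∂) ⊗ a - n ⊗ ∂ a`. -/
def jmD (c : I × Fin d) : Module.End k (JModel k d G N) :=
  jmLift ((jmMk G).comp (ract (wpd k c)) - (jmMk G).compl₂ (jpd c.1 c.2)) fun c' n a => by
    simp only [LinearMap.sub_apply, LinearMap.comp_apply, LinearMap.compl₂_apply, jpd_mul, jpd_z,
      map_add, jmMk_z]
    rw [← jmMk_z c' (ract (wpd k c) n), ← Module.End.mul_apply, ← Module.End.mul_apply, ← ract_mul,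
      ← ract_mul]
    by_cases h : c = c'
    · subst h
      simp only [wpd_wz_same, ract_add, ract_one, and_self, if_true, one_mul,
        LinearMap.add_apply, map_add, Module.End.one_apply]
      abel
    · have h' : ¬ (c'.1 = c.1 ∧ c'.2 = c.2) := fun e => h (Prod.ext e.1 e.2).symm
      rw [wpd_wz_ne h, if_neg h', zero_mul, map_zero, zero_add]

theorem jmD_mk (c : I × Fin d) (n : N) (a : Jou k d G) :
    jmD c (jmMk G n a) = jmMk G (ract (wpd k c) n) a - jmMk G n (jpd c.1 c.2 a) :=
  jmLift_mk _ _ _ _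

variable (G N) in
/-- The right `𝒟`-module structure of `𝐉_G(N)`. -/
def jmOps : RightOps k (I × Fin d) (JModel k d G N) where
  Z := jmZ
  D := jmD
  ZZ c c' := jm_ext fun n a => by
    simp only [Module.End.mul_apply, jmZ_mk, ← mul_assoc, jz_comm c.1 c.2]
  DD c c' := jm_ext fun n a => by
    simp only [Module.End.mul_apply, jmD_mk, map_sub, jpd_comm c.1 c.2 c'.1 c'.2]
    rw [← Module.End.mul_apply, ← ract_mul, ← Module.End.mul_apply (ract (wpd k c')), ← ract_mul,
      wpd_comm]
    abel
  ZD_same c := jm_ext fun n a => by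
    simp only [Module.End.mul_apply, LinearMap.add_apply, jmD_mk, jmZ_mk, map_sub,
      Module.End.one_apply, jpd_mul, jpd_z, and_self, if_true, one_mul, map_add]
    abel
  ZD_ne c c' h := jm_ext fun n a => by
    have h' : ¬ (c'.1 = c.1 ∧ c'.2 = c.2) := fun e => h (Prod.ext e.1 e.2).symm
    simp only [Module.End.mul_apply, jmD_mk, jmZ_mk, map_sub, jpd_mul, jpd_z,
      if_neg h', zero_mul, zero_add]

instance : Module (Weyl k (I × Fin d))ᵐᵒᵖ (JModel k d G N) := (jmOps G N).toModule

instance : IsScalarTower k (Weyl k (I × Fin d))ᵐᵒᵖ (JModel k d G N) := (jmOps G N).isScalarTower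

end JModel

section Push

variable {ι κ : Type*} [Fintype ι] [DecidableEq κ]

/-- The pushforward `N ⊗_{k[λ_κ]} k[λ_ι]` of a right `𝒟`-module `N` on `𝔸^κ` along the linear embedding
`𝔸^κ → 𝔸^ι`, `z ↦ z ∘ p`, for `p : ι → κ`: the variable `λ_c` acts on `N` as right multiplication by
`∂_c` and on `k[λ_ι]` as multiplication by the sum of the `λ_i` with `p i = c`. -/
def Push {k : Type*} [Field k] {ι κ : Type*} [Fintype ι] [DecidableEq κ] (p : ι → κ)
    (N : Type*) [AddCommGroup N] [Module k N] [Module (Weyl k κ)ᵐᵒᵖ N]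
    [IsScalarTower k (Weyl k κ)ᵐᵒᵖ N] : Type _ :=
  (N ⊗[k] MvPolynomial ι k) ⧸ balance (fun c : κ => (ract (wpd k c) : Module.End k N))
    (fun c : κ => LinearMap.mulLeft k
      (∑ i, if p i = c then MvPolynomial.X i else 0 : MvPolynomial ι k))

theorem pderiv_pderiv_comm (i j : ι) (F : MvPolynomial ι k) :
    MvPolynomial.pderiv i (MvPolynomial.pderiv j F) =
      MvPolynomial.pderiv j (MvPolynomial.pderiv i F) := by
  classical
  have h : ⁅(MvPolynomial.pderiv i : Derivation k (MvPolynomial ι k) (MvPolynomial ι k)),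
      (MvPolynomial.pderiv j : Derivation k (MvPolynomial ι k) (MvPolynomial ι k))⁆ = 0 := by
    refine MvPolynomial.derivation_ext fun l => ?_
    simp only [Derivation.commutator_apply, MvPolynomial.pderiv_X, Derivation.zero_apply]
    simp only [Pi.single_apply]
    split_ifs <;> simp
  have := DFunLike.congr_fun h F
  simpa [Derivation.commutator_apply, sub_eq_zero] using this

variable (p : ι → κ) (N : Type*) [AddCommGroup N] [Module k N] [Module (Weyl k κ)ᵐᵒᵖ N]
    [IsScalarTower k (Weyl k κ)ᵐᵒᵖ N]

instance : AddCommGroup (Push (k := k) p N) := Submodule.Quotient.addCommGroup _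

instance : Module k (Push (k := k) p N) := Submodule.Quotient.module _

variable {N}

/-- The class of `n ⊗ F`. -/
def puMk : N →ₗ[k] MvPolynomial ι k →ₗ[k] Push (k := k) p N :=
  (TensorProduct.mk k N (MvPolynomial ι k)).compr₂ (Submodule.mkQ _)

variable {p}

theorem puMk_pd (c : κ) (n : N) (F : MvPolynomial ι k) :
    puMk p (ract (wpd k c) n) F =
      puMk p n ((∑ i, if p i = c then MvPolynomial.X i else 0) * F) :=
  balance_mk c n F

/-- A linear map out of the pushforward. -/
def puLift {X : Type*} [AddCommGroup X] [Module k X] (f : N →ₗ[k] MvPolynomial ι k →ₗ[k] X)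
    (hf : ∀ c n F, f (ract (wpd k c) n) F =
      f n ((∑ i, if p i = c then MvPolynomial.X i else 0) * F)) :
    Push (k := k) p N →ₗ[k] X :=
  balanceLift (TensorProduct.lift f) fun c n F => by
    simpa only [TensorProduct.lift.tmul, LinearMap.mulLeft_apply] using hf c n F

theorem puLift_mk {X : Type*} [AddCommGroup X] [Module k X]
    (f : N →ₗ[k] MvPolynomial ι k →ₗ[k] X)
    (hf : ∀ c n F, f (ract (wpd k c) n) F =
      f n ((∑ i, if p i = c then MvPolynomial.X i else 0) * F)) (n : N) (F : MvPolynomial ι k) :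
    puLift f hf (puMk p n F) = f n F := by
  refine (Submodule.liftQ_apply _ _ _).trans ?_
  simp

theorem pu_ext {X : Type*} [AddCommGroup X] [Module k X] {f g : Push (k := k) p N →ₗ[k] X}
    (h : ∀ n F, f (puMk p n F) = g (puMk p n F)) : f = g :=
  balance_ext h

theorem pderiv_sum_ite (i : ι) (c : κ) : MvPolynomial.pderiv i
    (∑ j, if p j = c then MvPolynomial.X j else 0 : MvPolynomial ι k) =
      if p i = c then 1 else 0 := by
  classical
  rw [map_sum, Finset.sum_eq_single i]
  · split_ifs <;> simp
  · intro j _ hj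
    split_ifs
    · rw [MvPolynomial.pderiv_X_of_ne hj]
    · simp
  · simp

/-- Right multiplication by `z_i` on the pushforward:
`(n ⊗ F) · z_i = (n · z_{p i}) ⊗ F + n ⊗ ∂F/∂λ_i`. -/
def puZ (i : ι) : Module.End k (Push (k := k) p N) :=
  puLift ((puMk p).comp (ract (wz k (p i))) +
      (puMk p).compl₂ (MvPolynomial.pderiv i).toLinearMap) fun c n F => by
    simp only [LinearMap.add_apply, LinearMap.comp_apply, LinearMap.compl₂_apply,
      Derivation.coeFn_coe, Derivation.leibniz, pderiv_sum_ite, smul_eq_mul, map_add]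
    rw [puMk_pd c n, ← puMk_pd c (ract (wz k (p i)) n), ← Module.End.mul_apply, ← ract_mul,
      ← Module.End.mul_apply, ← ract_mul]
    by_cases h : p i = c
    · subst h
      simp only [wpd_wz_same, ract_add, ract_one, if_true, mul_one, LinearMap.add_apply,
        Module.End.one_apply, map_add]
      abel
    · simp [h, wpd_wz_ne (k := k) (Ne.symm h)]

/-- Right multiplication by `∂_i` on the pushforward: `(n ⊗ F) · ∂_i = n ⊗ F λ_i`. -/
def puD (i : ι) : Module.End k (Push (k := k) p N) :=
  puLift ((puMk p).compl₂ (LinearMap.mulLeft k (MvPolynomial.X i))) fun c n F => by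
    simp only [LinearMap.compl₂_apply, LinearMap.mulLeft_apply, puMk_pd, mul_left_comm]

theorem puZ_mk (i : ι) (n : N) (F : MvPolynomial ι k) : puZ i (puMk p n F) =
    puMk p (ract (wz k (p i)) n) F + puMk p n (MvPolynomial.pderiv i F) := puLift_mk _ _ _ _

theorem puD_mk (i : ι) (n : N) (F : MvPolynomial ι k) :
    puD i (puMk p n F) = puMk p n (MvPolynomial.X i * F) := puLift_mk _ _ _ _

variable (p N) in
/-- The right `𝒟`-module structure of the pushforward. -/
def puOps : RightOps k ι (Push (k := k) p N) where
  Z := puZ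
  D := puD
  ZZ i j := pu_ext fun n F => by
    simp only [Module.End.mul_apply, puZ_mk, map_add]
    rw [← Module.End.mul_apply, ← ract_mul, ← Module.End.mul_apply (ract (wz k (p j))), ← ract_mul,
      wz_comm, pderiv_pderiv_comm]
    abel
  DD i j := pu_ext fun n F => by
    simp only [Module.End.mul_apply, puD_mk, mul_left_comm]
  ZD_same i := pu_ext fun n F => by
    simp only [Module.End.mul_apply, LinearMap.add_apply, puZ_mk, puD_mk, map_add,
      Module.End.one_apply, Derivation.leibniz, MvPolynomial.pderiv_X_self, smul_eq_mul, mul_one]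
    abel
  ZD_ne i j h := pu_ext fun n F => by
    simp only [Module.End.mul_apply, puZ_mk, puD_mk, map_add,
      Derivation.leibniz, MvPolynomial.pderiv_X_of_ne h, smul_eq_mul, mul_zero, add_zero]

instance : Module (Weyl k ι)ᵐᵒᵖ (Push (k := k) p N) := (puOps p N).toModule

instance : IsScalarTower k (Weyl k ι)ᵐᵒᵖ (Push (k := k) p N) := (puOps p N).isScalarTower

end Push

end Constructions

/-! ## Exterior products -/

section Box

variable {k : Type*} [Field k] {I : Type*}

/-- The external product `M^{⊠ I}`. -/
def Box (k : Type*) [Field k] (I : Type*) (M : Type*) [AddCommGroup M] [Module k M] : Type _ :=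
  ⨂[k] _ : I, M

variable {M : Type*} [AddCommGroup M] [Module k M]

instance : AddCommGroup (Box k I M) := inferInstanceAs (AddCommGroup (⨂[k] _ : I, M))

instance : Module k (Box k I M) := inferInstanceAs (Module k (⨂[k] _ : I, M))

/-- The pure tensor `⊠ᵢ m i`. -/
def box (k : Type*) [Field k] {I : Type*} {M : Type*} [AddCommGroup M] [Module k M] :
    MultilinearMap k (fun _ : I => M) (Box k I M) := PiTensorProduct.tprod k

theorem box_ext {X : Type*} [AddCommGroup X] [Module k X] {f g : Box k I M →ₗ[k] X}
    (h : ∀ m, f (box k m) = g (box k m)) : f = g :=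
  PiTensorProduct.ext (MultilinearMap.ext h)

/-- The tensor product `⊠ᵢ f i` of operators. -/
def boxMap (f : I → Module.End k M) : Module.End k (Box k I M) := PiTensorProduct.map f

theorem boxMap_box (f : I → Module.End k M) (m : I → M) :
    boxMap f (box k m) = box k fun i => f i (m i) := PiTensorProduct.map_tprod _ _

variable [DecidableEq I]

/-- The operator acting by `f` on the factor with index `i` and by the identity on the others. -/
def slot (i : I) (f : Module.End k M) : Module.End k (Box k I M) :=
  boxMap (Function.update (fun _ => 1) i f)

theorem slot_box (i : I) (f : Module.End k M) (m : I → M) :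
    slot i f (box k m) = box k (Function.update m i (f (m i))) := by
  rw [slot, boxMap_box]
  congr 1
  ext j
  by_cases h : j = i
  · subst h; simp
  · simp [h]

theorem slot_comm {i j : I} (h : i ≠ j) (f g : Module.End k M) :
    slot i f * slot j g = slot j g * slot i f := by
  refine box_ext fun m => ?_
  simp [slot_box, h, h.symm, Function.update_comm h]

theorem slot_mul (i : I) (f g : Module.End k M) : slot i f * slot i g = slot i (f * g) :=
  box_ext fun m => by simp [slot_box]

theorem slot_add_one (i : I) (f : Module.End k M) : slot i (f + 1) = slot i f + 1 :=
  box_ext fun m => by simp [slot_box]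

variable {d : ℕ} [Module (Weyl k (Fin d))ᵐᵒᵖ M] [IsScalarTower k (Weyl k (Fin d))ᵐᵒᵖ M]

variable (k d I M) in
/-- The right `𝒟`-module structure of `M^{⊠ I}` on `(𝔸^d)^I`: `z_i^s` and `∂_i^s` act on the factor with
index `i`. -/
def boxOps : RightOps k (I × Fin d) (Box k I M) where
  Z c := slot c.1 (ract (wz k c.2))
  D c := slot c.1 (ract (wpd k c.2))
  ZZ := by
    rintro ⟨i, s⟩ ⟨j, t⟩
    by_cases h : i = j
    · subst h; simp only [slot_mul, ← ract_mul, wz_comm]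
    · exact slot_comm h _ _
  DD := by
    rintro ⟨i, s⟩ ⟨j, t⟩
    by_cases h : i = j
    · subst h; simp only [slot_mul, ← ract_mul, wpd_comm]
    · exact slot_comm h _ _
  ZD_same := by
    rintro ⟨i, s⟩
    simp only [slot_mul, ← ract_mul, wpd_wz_same, ract_add, ract_one, slot_add_one]
  ZD_ne := by
    rintro ⟨i, s⟩ ⟨j, t⟩ h
    by_cases h' : i = j
    · subst h'
      have h2 : s ≠ t := fun e => h (by rw [e])
      simp only [slot_mul, ← ract_mul, wpd_wz_ne h2]
    · exact slot_comm (Ne.symm h') _ _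

instance : Module (Weyl k (I × Fin d))ᵐᵒᵖ (Box k I M) := (boxOps k I M d).toModule

instance : IsScalarTower k (Weyl k (I × Fin d))ᵐᵒᵖ (Box k I M) := (boxOps k I M d).isScalarTower

theorem ract_box_z (c : I × Fin d) :
    (ract (wz k c) : Module.End k (Box k I M)) = slot c.1 (ract (wz k c.2)) :=
  (boxOps k I M d).toAlgHom_z c

theorem ract_box_pd (c : I × Fin d) :
    (ract (wpd k c) : Module.End k (Box k I M)) = slot c.1 (ract (wpd k c.2)) :=
  (boxOps k I M d).toAlgHom_pd c

end Box

/-! ## Differential graded right modules -/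

/-- A differential graded structure on a right `𝒟_{𝔸^d}`-module `M`: a decomposition
`M = ⨁ₚ M^p` into `𝒟`-submodules and a `𝒟`-linear differential of degree `1`. -/
structure DGStructure (k : Type*) [Field k] (d : ℕ) (M : Type*) [AddCommGroup M] [Module k M]
    [Module (Weyl k (Fin d))ᵐᵒᵖ M] where
  deg : ℤ → Submodule k M
  internal : DirectSum.IsInternal deg
  smul_mem : ∀ (p : ℤ) (P : (Weyl k (Fin d))ᵐᵒᵖ) (m : M), m ∈ deg p → P • m ∈ deg p
  diff : M →ₗ[k] M
  diff_mem : ∀ (p : ℤ) (m : M), m ∈ deg p → diff m ∈ deg (p + 1)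
  diff_diff : ∀ m : M, diff (diff m) = 0
  diff_smul : ∀ (P : (Weyl k (Fin d))ᵐᵒᵖ) (m : M), diff (P • m) = P • diff m

namespace DGStructure

variable {k : Type*} [Field k] {d : ℕ} {M : Type*} [AddCommGroup M] [Module k M]
    [Module (Weyl k (Fin d))ᵐᵒᵖ M] [IsScalarTower k (Weyl k (Fin d))ᵐᵒᵖ M]

variable (k d M) in
/-- An ordinary right `𝒟`-module, regarded as a differential graded one concentrated in degree `0`
with zero differential. -/
def concentrated : DGStructure k d M where
  deg p := if p = 0 then ⊤ else ⊥
  internal := by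
    rw [DirectSum.isInternal_submodule_iff_iSupIndep_and_iSup_eq_top]
    constructor
    · intro p
      by_cases h : p = 0
      · subst h
        rw [disjoint_iff, eq_bot_iff]
        refine inf_le_right.trans (iSup₂_le fun j hj => ?_)
        simp [hj]
      · simp [h]
    · exact eq_top_iff.2 (le_iSup_of_le 0 (by simp))
  smul_mem p P m h := by
    by_cases hp : p = 0
    · simp [hp]
    · have : m = 0 := by simpa [hp] using h
      simp [this]
  diff := 0
  diff_mem _ _ _ := by simp
  diff_diff _ := rfl
  diff_smul _ _ := by simp

variable (𝓜 : DGStructure k d M)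

/-- The operator acting on `M^p` as multiplication by the scalar `c p`. -/
def degScale (c : ℤ → k) : Module.End k M :=
  DirectSum.toModule k ℤ M (fun p => c p • (𝓜.deg p).subtype) ∘ₗ
    (LinearEquiv.ofBijective (DirectSum.coeLinearMap 𝓜.deg) 𝓜.internal).symm.toLinearMap

theorem degScale_of_mem (c : ℤ → k) {p : ℤ} {m : M} (h : m ∈ 𝓜.deg p) :
    𝓜.degScale c m = c p • m := by
  have e : (LinearEquiv.ofBijective (DirectSum.coeLinearMap 𝓜.deg) 𝓜.internal).symm m =
      DirectSum.lof k ℤ (fun p => 𝓜.deg p) p ⟨m, h⟩ := by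
    rw [LinearEquiv.symm_apply_eq]
    exact (DirectSum.coeLinearMap_lof 𝓜.deg p ⟨m, h⟩).symm
  simp [degScale, e]

theorem hom_ext {X : Type*} [AddCommGroup X] [Module k X] {f g : M →ₗ[k] X}
    (h : ∀ p, ∀ m ∈ 𝓜.deg p, f m = g m) : f = g := by
  ext m
  have hm : m ∈ ⨆ p, 𝓜.deg p := by rw [𝓜.internal.submodule_iSup_eq_top]; trivial
  induction hm using Submodule.iSup_induction' with
  | mem p x hx => exact h p x hx
  | zero => simp
  | add x y _ _ hx hy => rw [map_add, map_add, hx, hy]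

theorem degScale_ract (c : ℤ → k) (P : Weyl k (Fin d)) :
    𝓜.degScale c * ract P = ract P * 𝓜.degScale c :=
  𝓜.hom_ext fun p m hm => by
    rw [Module.End.mul_apply, Module.End.mul_apply, 𝓜.degScale_of_mem c hm, map_smul]
    exact 𝓜.degScale_of_mem c (𝓜.smul_mem p _ m hm)

/-- The sign operator `m ↦ (-1)^|m| m`. -/
def parity : Module.End k M := 𝓜.degScale fun p => ((p.negOnePow : ℤ) : k)

/-- The projection to the part of parity `ε`. -/
def parityProj (ε : ZMod 2) : Module.End k M :=
  𝓜.degScale fun p => if (p : ZMod 2) = ε then 1 else 0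

theorem diff_ract (P : Weyl k (Fin d)) : 𝓜.diff * ract P = ract P * 𝓜.diff :=
  LinearMap.ext fun m => 𝓜.diff_smul _ m

end DGStructure

section Operations

variable {k : Type*} [Field k] {d : ℕ} {M : Type*} [AddCommGroup M] [Module k M]
    [Module (Weyl k (Fin d))ᵐᵒᵖ M] [IsScalarTower k (Weyl k (Fin d))ᵐᵒᵖ M]

theorem boxMap_slot {I : Type*} [DecidableEq I] (f : I → Module.End k M) (i : I)
    (g : Module.End k M) (h : f i * g = g * f i) :
    boxMap f * slot i g = slot i g * boxMap f := by
  refine box_ext fun m => ?_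
  simp only [Module.End.mul_apply, slot_box, boxMap_box]
  congr 1
  ext j
  by_cases hj : j = i
  · subst hj
    simpa using LinearMap.congr_fun h (m j)
  · simp [hj]

variable (𝓜 : DGStructure k d M)

/-- The Jouanolou model `𝐉^n(M^{⊠ n})`. -/
abbrev JouBox (k : Type*) [Field k] (d : ℕ) (M : Type*) [AddCommGroup M] [Module k M]
    [Module (Weyl k (Fin d))ᵐᵒᵖ M] [IsScalarTower k (Weyl k (Fin d))ᵐᵒᵖ M] (n : ℕ) : Type _ :=
  JModel k d (⊤ : SimpleGraph (Fin n)) (Box k (Fin n) M)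

/-- The pushforward `Δ_* M = M ⊗_{k[λ_⋆]} k[λ_1, …, λ_n]` along the diagonal `𝔸^d → (𝔸^d)^n`. -/
abbrev Diag (k : Type*) [Field k] (d : ℕ) (M : Type*) [AddCommGroup M] [Module k M]
    [Module (Weyl k (Fin d))ᵐᵒᵖ M] [IsScalarTower k (Weyl k (Fin d))ᵐᵒᵖ M] (n : ℕ) : Type _ :=
  Push (k := k) (fun c : Fin n × Fin d => c.2) M

/-- The differential of `M^{⊠ n}`:
`δ (m_1 ⊠ ⋯ ⊠ m_n) = ∑ᵢ (-1)^{|m_1| + ⋯ + |m_{i-1}|} m_1 ⊠ ⋯ ⊠ δ m_i ⊠ ⋯ ⊠ m_n`. -/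
def boxDiff (n : ℕ) : Module.End k (Box k (Fin n) M) :=
  ∑ i, boxMap fun j => if j < i then 𝓜.parity else if j = i then 𝓜.diff else 1

theorem boxDiff_z (n : ℕ) (c : Fin n × Fin d) :
    boxDiff 𝓜 n * ract (wz k c) = ract (wz k c) * boxDiff 𝓜 n := by
  rw [boxDiff, Finset.sum_mul, Finset.mul_sum]
  refine Finset.sum_congr rfl fun i _ => ?_
  rw [ract_box_z]
  refine boxMap_slot _ _ _ ?_
  split_ifs
  · exact 𝓜.degScale_ract _ _
  · exact 𝓜.diff_ract _
  · simp

theorem boxParity_z (n : ℕ) (c : Fin n × Fin d) :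
    boxMap (fun _ => 𝓜.parity) * (ract (wz k c) : Module.End k (Box k (Fin n) M)) =
      ract (wz k c) * boxMap (fun _ => 𝓜.parity) := by
  rw [ract_box_z]
  exact boxMap_slot _ _ _ (𝓜.degScale_ract _ _)

/-- The differential of `𝐉^n(M^{⊠ n})`: `d (m ⊗ a) = δ m ⊗ a + (-1)^|m| m ⊗ 𝐝 a`. -/
def jouBoxDiff (n : ℕ) : Module.End k (JouBox k d M n) :=
  jmLift ((jmMk _).comp (boxDiff 𝓜 n) +
    ((jmMk _).comp (boxMap fun _ => 𝓜.parity)).compl₂ jd) fun c m a => by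
    have h1 := LinearMap.congr_fun (boxDiff_z 𝓜 n c) m
    have h2 := LinearMap.congr_fun (boxParity_z 𝓜 n c) m
    rw [Module.End.mul_apply, Module.End.mul_apply] at h1 h2
    simp only [LinearMap.add_apply, LinearMap.comp_apply, LinearMap.compl₂_apply, h1, h2, jmMk_z,
      jd_z_mul]

/-- The differential of `Δ_* M`: `m ⊗ F ↦ δ m ⊗ F`. -/
def diagDiff (n : ℕ) : Module.End k (Diag k d M n) :=
  puLift ((puMk _).comp 𝓜.diff) fun c m F => by
    have h := LinearMap.congr_fun (𝓜.diff_ract (wpd k c)) m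
    rw [Module.End.mul_apply, Module.End.mul_apply] at h
    simp only [LinearMap.comp_apply, h, puMk_pd]

/-- The elements of `𝐉^n(M^{⊠ n})` of degree `p`. -/
def jouBoxDeg (n : ℕ) (p : ℤ) : Submodule k (JouBox k d M n) :=
  Submodule.span k {x | ∃ (e : Fin n → ℤ) (m : Fin n → M) (r : ℕ) (a : Jou k d ⊤),
    (∀ i, m i ∈ 𝓜.deg (e i)) ∧ a ∈ jdeg r ∧ ∑ i, e i + r = p ∧ x = jmMk ⊤ (box k m) a}

/-- The elements of `Δ_* M` of degree `p`. -/
def diagDeg (n : ℕ) (p : ℤ) : Submodule k (Diag k d M n) :=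
  Submodule.span k {x | ∃ (m : M) (F : MvPolynomial (Fin n × Fin d) k),
    m ∈ 𝓜.deg p ∧ x = puMk _ m F}

/-- The Koszul sign of moving homogeneous elements of parities `ε 1, …, ε n` to the positions
`σ 1, …, σ n`. -/
def koszulSign {n : ℕ} (ε : Fin n → ZMod 2) (σ : Equiv.Perm (Fin n)) : ℤ :=
  ∏ i, ∏ j, if i < j ∧ σ j < σ i ∧ ε i = 1 ∧ ε j = 1 then -1 else 1

/-- The permutation of tensor factors without signs: the factor with index `i` gets the index
`σ i`. -/
def boxReindex {I : Type*} (σ : Equiv.Perm I) : Module.End k (Box k I M) :=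
  (PiTensorProduct.reindex k (fun _ : I => M) σ).toLinearMap

theorem boxReindex_box {I : Type*} (σ : Equiv.Perm I) (m : I → M) :
    boxReindex σ (box k m) = box k fun i => m (σ.symm i) := PiTensorProduct.reindex_tprod _ _

/-- The action of a permutation on `M^{⊠ n}`:
`m_1 ⊠ ⋯ ⊠ m_n ↦ (-1)^χ m_{σ⁻¹ 1} ⊠ ⋯ ⊠ m_{σ⁻¹ n}` with the Koszul sign `(-1)^χ`; the sum
decomposes each factor into its even and its odd part. -/
def boxPerm {n : ℕ} (σ : Equiv.Perm (Fin n)) : Module.End k (Box k (Fin n) M) :=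
  ∑ ε : Fin n → ZMod 2, koszulSign ε σ • (boxReindex σ * boxMap fun i => 𝓜.parityProj (ε i))

theorem boxPerm_box {n : ℕ} (σ : Equiv.Perm (Fin n)) (e : Fin n → ℤ) (m : Fin n → M)
    (h : ∀ i, m i ∈ 𝓜.deg (e i)) :
    boxPerm 𝓜 σ (box k m) =
      koszulSign (fun i => (e i : ZMod 2)) σ • box k fun i => m (σ.symm i) := by
  have key : ∀ ε : Fin n → ZMod 2, boxMap (fun i => 𝓜.parityProj (ε i)) (box k m) =
      if ε = fun i => (e i : ZMod 2) then box k m else 0 := by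
    intro ε
    rw [boxMap_box]
    split_ifs with hε
    · congr 1; ext i
      rw [DGStructure.parityProj, 𝓜.degScale_of_mem _ (h i), hε, if_pos rfl, one_smul]
    · obtain ⟨i, hi⟩ := Function.ne_iff.1 hε
      refine (box k).map_coord_zero i ?_
      rw [DGStructure.parityProj, 𝓜.degScale_of_mem _ (h i), if_neg (Ne.symm hi), zero_smul]
  rw [boxPerm, LinearMap.sum_apply, Finset.sum_eq_single fun i => (e i : ZMod 2)]
  · rw [LinearMap.smul_apply, Module.End.mul_apply, key, if_pos rfl, boxReindex_box]
  · intro ε _ hε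
    rw [LinearMap.smul_apply, Module.End.mul_apply, key, if_neg hε, map_zero, smul_zero]
  · simp

theorem boxPerm_z {n : ℕ} (σ : Equiv.Perm (Fin n)) (c : Fin n × Fin d) :
    boxPerm 𝓜 σ * ract (wz k c) = ract (wz k (σ c.1, c.2)) * boxPerm 𝓜 σ := by
  rw [boxPerm, Finset.sum_mul, Finset.mul_sum]
  refine Finset.sum_congr rfl fun ε _ => ?_
  rw [smul_mul_assoc, mul_smul_comm]
  congr 1
  refine box_ext fun m => ?_
  have h := LinearMap.congr_fun (𝓜.degScale_ract
    (fun p => if (p : ZMod 2) = ε c.1 then 1 else 0) (wz k c.2)) (m c.1)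
  simp only [Module.End.mul_apply] at h
  simp only [Module.End.mul_apply, ract_box_z, boxMap_box, slot_box, boxReindex_box]
  congr 1
  ext j
  by_cases hj : j = σ c.1
  · subst hj; simpa [DGStructure.parityProj] using h
  · have : σ.symm j ≠ c.1 := fun e => hj (by rw [← e, Equiv.apply_symm_apply])
    simp [hj, this]

/-- An injective map of index sets, as a map of complete graphs. -/
def topHom {A B : Type*} (f : A → B) (hf : Function.Injective f) :
    (⊤ : SimpleGraph A) →g (⊤ : SimpleGraph B) where
  toFun := f
  map_rel' h := by
    rw [SimpleGraph.top_adj] at h ⊢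
    exact fun e => h (hf e)

/-- The action of a permutation on `𝐉^n(M^{⊠ n})`:
`m ⊗ α(z_i, x_{ij}, 𝐝x_{ij}) ↦ σ m ⊗ α(z_{σ i}, x_{σ i σ j}, 𝐝x_{σ i σ j})`. -/
def jouBoxPerm {n : ℕ} (σ : Equiv.Perm (Fin n)) : Module.End k (JouBox k d M n) :=
  jmLift (((jmMk _).comp (boxPerm 𝓜 σ)).compl₂ (jmap (topHom σ σ.injective)).toLinearMap)
    fun c m a => by
    have h := LinearMap.congr_fun (boxPerm_z 𝓜 σ c) m
    rw [Module.End.mul_apply, Module.End.mul_apply] at h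
    simp only [LinearMap.comp_apply, LinearMap.compl₂_apply, h, jmMk_z, AlgHom.toLinearMap_apply,
      map_mul, jmap_gen]
    rfl

/-- The action of a permutation on `Δ_* M`: `m ⊗ f(λ_1, …, λ_n) ↦ m ⊗ f(λ_{σ 1}, …, λ_{σ n})`. -/
def diagPerm {n : ℕ} (σ : Equiv.Perm (Fin n)) : Module.End k (Diag k d M n) :=
  puLift ((puMk _).compl₂
    (MvPolynomial.rename fun c : Fin n × Fin d => (σ c.1, c.2)).toLinearMap) fun c m F => by
    simp only [LinearMap.compl₂_apply, AlgHom.toLinearMap_apply, map_mul, puMk_pd]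
    congr 2
    rw [map_sum, ← Equiv.sum_comp (σ.prodCongr (Equiv.refl (Fin d)))]
    refine Finset.sum_congr rfl fun x _ => ?_
    simp only [Equiv.prodCongr_apply, Prod.map, Equiv.refl_apply]
    split_ifs <;> simp

end Operations

/-! ## The complexes of chiral operations -/

section ChiralOp

variable {k : Type*} [Field k] {d : ℕ} {M : Type*} [AddCommGroup M] [Module k M]
    [Module (Weyl k (Fin d))ᵐᵒᵖ M] [IsScalarTower k (Weyl k (Fin d))ᵐᵒᵖ M]
    (𝓜 : DGStructure k d M)

/-- The `𝒟`-linear maps `𝐉^n(M^{⊠ n}) → Δ_* M` of degree `p`. -/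
def HomDeg (n : ℕ) (p : ℤ) : Submodule k (JouBox k d M n →ₗ[k] Diag k d M n) where
  carrier := {f | (∀ (P : (Weyl k (Fin n × Fin d))ᵐᵒᵖ) (x : JouBox k d M n), f (P • x) = P • f x) ∧
    ∀ (q : ℤ) (x : JouBox k d M n), x ∈ jouBoxDeg 𝓜 n q → f x ∈ diagDeg 𝓜 n (q + p)}
  add_mem' := by
    rintro f g ⟨hf, hf'⟩ ⟨hg, hg'⟩
    refine ⟨fun P x => ?_, fun q x hx => ?_⟩
    · simp only [LinearMap.add_apply, hf, hg, smul_add]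
    · exact Submodule.add_mem _ (hf' q x hx) (hg' q x hx)
  zero_mem' := ⟨fun P x => by simp, fun q x _ => Submodule.zero_mem _⟩
  smul_mem' := by
    rintro c f ⟨hf, hf'⟩
    refine ⟨fun P x => ?_, fun q x hx => ?_⟩
    · simp only [LinearMap.smul_apply, hf]
      exact ((Algebra.lsmul k k (Diag k d M n) P).map_smul c (f x)).symm
    · exact Submodule.smul_mem _ _ (hf' q x hx)

/-- The space of chiral operations with `n` inputs: it is `0` for `n = 0`, and the total space
`⨁ₚ Hom^p` of the complex `Hom_𝒟(𝐉^n(M^{⊠ n}), Δ_* M)` for `n ≥ 1`. -/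
def ChiralOp (n : ℕ) : Submodule k (JouBox k d M n →ₗ[k] Diag k d M n) :=
  if n = 0 then ⊥ else ⨆ p, HomDeg 𝓜 n p

theorem chiralOp_map_smul {𝓜 : DGStructure k d M} {n : ℕ} (f : ChiralOp 𝓜 n)
    (P : (Weyl k (Fin n × Fin d))ᵐᵒᵖ) (x : JouBox k d M n) :
    (f : JouBox k d M n →ₗ[k] Diag k d M n) (P • x) = P • (f : JouBox k d M n →ₗ[k] Diag k d M n) x := by
  have hf : (f : JouBox k d M n →ₗ[k] Diag k d M n) ∈ ⨆ p, HomDeg 𝓜 n p := by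
    have h := f.2
    unfold ChiralOp at h
    split_ifs at h
    · rw [(Submodule.mem_bot k).1 h]; exact Submodule.zero_mem _
    · exact h
  generalize (f : JouBox k d M n →ₗ[k] Diag k d M n) = g at hf
  induction hf using Submodule.iSup_induction' with
  | mem p g hg => exact hg.1 P x
  | zero => simp
  | add g h _ _ hg hh => rw [LinearMap.add_apply, LinearMap.add_apply, hg, hh, smul_add]

end ChiralOp

/-! ## Operads -/

/-- The identification `P a ≃ P b` for `a = b`. -/
def recast {P : ℕ → Type*} {a b : ℕ} (h : a = b) (x : P a) : P b := h ▸ x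

/-- The inputs of a partial composition `μ ∘_i ν`: the `m` inputs of `μ` other than the one with index
`i`, and the `n` inputs of `ν`, which are inserted at the position `i`. -/
def insEquiv {m : ℕ} (i : Fin (m + 1)) (n : ℕ) :
    Fin (m + n) ≃ {j : Fin (m + 1) // j ≠ i} ⊕ Fin n where
  toFun a :=
    if h : (a : ℕ) < i then .inl ⟨⟨a, by omega⟩, fun e => by rw [← e] at h; simp at h⟩
    else if h' : (a : ℕ) < i + n then .inr ⟨a - i, by omega⟩
    else .inl ⟨⟨a + 1 - n, by omega⟩, fun e => by
      have := congrArg Fin.val e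
      simp only at this
      omega⟩
  invFun := Sum.elim
    (fun j => if h : j.1 < i then ⟨j.1, by omega⟩ else ⟨j.1 + n - 1, by
      have := j.2; have : (j.1 : ℕ) ≠ i := fun e => j.2 (Fin.ext e); omega⟩)
    (fun b => ⟨i + b, by omega⟩)
  left_inv a := by
    dsimp only
    split_ifs with h h'
    · simp only [Sum.elim_inl, Fin.lt_def]
      rw [dif_pos h]
    · simp only [Sum.elim_inr]; ext; simp only; omega
    · simp only [Sum.elim_inl, Fin.lt_def]
      rw [dif_neg (by omega)]
      ext; simp only; omega
  right_inv x := by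
    rcases x with ⟨j, hj⟩ | b
    · have hj' : (j : ℕ) ≠ i := fun e => hj (Fin.ext e)
      simp only [Sum.elim_inl, Fin.lt_def]
      by_cases h : (j : ℕ) < i
      · simp [h]
      · simp only [h, dif_neg, not_false_eq_true]
        rw [dif_neg (by omega), dif_neg (by omega)]
        congr 2
        ext; simp only; omega
    · simp

/-- The permutation `σ ∘_i τ` of the inputs of a partial composition: it permutes the blocks by `σ` and
the inputs inside the block that was inserted at the position `i` by `τ`. -/
def blockPerm {m n : ℕ} (i : Fin (m + 1)) (σ : Equiv.Perm (Fin (m + 1))) (τ : Equiv.Perm (Fin n)) :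
    Equiv.Perm (Fin (m + n)) :=
  (insEquiv i n).trans ((Equiv.sumCongr (σ.subtypeEquiv fun j => by
    rw [not_iff_not]; exact σ.injective.eq_iff.symm) τ).trans (insEquiv (σ i) n).symm)

/-- A (symmetric, unital) differential graded operad over `k` with underlying modules `P n`, presented by
partial compositions `μ ∘_i ν`; inputs are numbered from `0`, symmetric groups act from the left and the
usual sign rules are used. -/
structure DGOperad (k : Type*) [Field k] (P : ℕ → Type*) [∀ n, AddCommGroup (P n)]
    [∀ n, Module k (P n)] where
  /-- The grading. -/
  deg : ∀ n, ℤ → Submodule k (P n)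
  internal : ∀ n, DirectSum.IsInternal (deg n)
  /-- The differential. -/
  d : ∀ n, P n →ₗ[k] P n
  d_mem : ∀ (n : ℕ) (p : ℤ) (μ : P n), μ ∈ deg n p → d n μ ∈ deg n (p + 1)
  d_d : ∀ (n : ℕ) (μ : P n), d n (d n μ) = 0
  /-- The action of the symmetric groups. -/
  act : ∀ n, Representation k (Equiv.Perm (Fin n)) (P n)
  act_mem : ∀ (n : ℕ) (σ : Equiv.Perm (Fin n)) (p : ℤ) (μ : P n),
    μ ∈ deg n p → act n σ μ ∈ deg n p
  act_d : ∀ (n : ℕ) (σ : Equiv.Perm (Fin n)) (μ : P n), d n (act n σ μ) = act n σ (d n μ)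
  /-- The unit. -/
  one : P 1
  one_mem : one ∈ deg 1 0
  d_one : d 1 one = 0
  /-- The partial compositions. -/
  comp : ∀ {m n : ℕ}, Fin (m + 1) → P (m + 1) →ₗ[k] P n →ₗ[k] P (m + n)
  comp_mem : ∀ {m n : ℕ} (i : Fin (m + 1)) (p q : ℤ) (μ : P (m + 1)) (ν : P n),
    μ ∈ deg (m + 1) p → ν ∈ deg n q → comp i μ ν ∈ deg (m + n) (p + q)
  d_comp : ∀ {m n : ℕ} (i : Fin (m + 1)) (p : ℤ) (μ : P (m + 1)) (ν : P n), μ ∈ deg (m + 1) p →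
    d (m + n) (comp i μ ν) = comp i (d (m + 1) μ) ν + p.negOnePow • comp i μ (d n ν)
  comp_one : ∀ {m : ℕ} (i : Fin (m + 1)) (μ : P (m + 1)), comp i μ one = μ
  one_comp : ∀ {n : ℕ} (μ : P n), comp (m := 0) 0 one μ = recast (Nat.zero_add n).symm μ
  assoc_seq : ∀ {l m n : ℕ} (i : Fin (l + 1)) (j : Fin (m + 1)) (κ : P (l + 1)) (μ : P (m + 1))
    (ν : P n),
    comp (m := l + m) ⟨i + j, by omega⟩ (comp i κ μ) ν =
      recast (Nat.add_assoc l m n).symm (comp i κ (comp j μ ν))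
  assoc_par : ∀ {l m n : ℕ} (i j : Fin (l + 2)) (_ : i < j) (κ : P (l + 2)) (p q : ℤ) (μ : P m)
    (ν : P n), μ ∈ deg m p → ν ∈ deg n q →
    comp (m := l + m) ⟨j + m - 1, by omega⟩ (recast (Nat.add_right_comm l 1 m) (comp i κ μ)) ν =
      (p * q).negOnePow • recast (Nat.add_right_comm l n m)
        (comp (m := l + n) ⟨i, by omega⟩ (recast (Nat.add_right_comm l 1 n) (comp j κ ν)) μ)
  act_comp : ∀ {m n : ℕ} (i : Fin (m + 1)) (σ : Equiv.Perm (Fin (m + 1)))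
    (τ : Equiv.Perm (Fin n)) (μ : P (m + 1)) (ν : P n),
    comp (σ i) (act (m + 1) σ μ) (act n τ ν) = act (m + n) (blockPerm i σ τ) (comp i μ ν)

/-! ## Composition of chiral operations -/

section Collapse

variable {I K B : Type*} {i : K}

/-- For a partition of an index set `I` into a subset `B` and its complement `K ∖ {i}`, the map `I → K`
which collapses `B` to the point `i`. -/
def collapse (e : I ≃ {j : K // j ≠ i} ⊕ B) (a : I) : K := Sum.elim (fun j => j.1) (fun _ => i) (e a)

/-- The family on `I` which restricts to `m''` on `K ∖ {i}` and to `m'` on `B`. -/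
def glue {M : Type*} (e : I ≃ {j : K // j ≠ i} ⊕ B) (m'' : K → M) (m' : B → M) (a : I) : M :=
  Sum.elim (fun j => m'' j.1) m' (e a)

/-- The inclusion of `B` into `I`. -/
def incl (e : I ≃ {j : K // j ≠ i} ⊕ B) (b : B) : I := e.symm (.inr b)

theorem incl_injective (e : I ≃ {j : K // j ≠ i} ⊕ B) : Function.Injective (incl e) :=
  e.symm.injective.comp Sum.inr_injective

theorem collapse_eq_iff (e : I ≃ {j : K // j ≠ i} ⊕ B) (a : I) :
    collapse e a = i ↔ ∃ b, incl e b = a := by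
  unfold collapse incl
  obtain ⟨x, rfl⟩ := e.symm.surjective a
  rw [Equiv.apply_symm_apply]
  rcases x with ⟨j, hj⟩ | b
  · simp [hj]
  · simp

/-- The map on coordinates of points of `𝔸^d` induced by a map of index sets. -/
def liftIdx {d : ℕ} (π : I → K) (c : I × Fin d) : K × Fin d := (π c.1, c.2)

end Collapse

section Push

variable {k : Type*} [Field k] {ι κ θ : Type*} [Fintype ι] [DecidableEq κ] [DecidableEq θ]

theorem ract_push_pd {p : ι → κ} {N : Type*} [AddCommGroup N] [Module k N]
    [Module (Weyl k κ)ᵐᵒᵖ N] [IsScalarTower k (Weyl k κ)ᵐᵒᵖ N] (c : ι) :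
    (ract (wpd k c) : Module.End k (Push (k := k) p N)) = puD c :=
  (puOps p N).toAlgHom_pd c

/-- Pushforward of a `𝒟`-linear map: `n ⊗ F ↦ f n ⊗ F`. -/
def pushMap (p : ι → κ) {N N' : Type*} [AddCommGroup N] [Module k N] [Module (Weyl k κ)ᵐᵒᵖ N]
    [IsScalarTower k (Weyl k κ)ᵐᵒᵖ N] [AddCommGroup N'] [Module k N'] [Module (Weyl k κ)ᵐᵒᵖ N']
    [IsScalarTower k (Weyl k κ)ᵐᵒᵖ N'] (f : N →ₗ[k] N')
    (hf : ∀ (P : (Weyl k κ)ᵐᵒᵖ) (n : N), f (P • n) = P • f n) :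
    Push (k := k) p N →ₗ[k] Push (k := k) p N' :=
  puLift ((puMk p).comp f) fun c n F => by
    simp only [LinearMap.comp_apply]
    rw [← puMk_pd, ract_apply, ract_apply, hf]

/-- The substitution `λ_c ↦ ∑_{p i = c} λ_i`. -/
def substSum (k : Type*) [Field k] {ι κ : Type*} [Fintype ι] [DecidableEq κ] (p : ι → κ) :
    MvPolynomial κ k →ₐ[k] MvPolynomial ι k :=
  MvPolynomial.aeval fun c => ∑ i, if p i = c then MvPolynomial.X i else 0

variable [Fintype κ]

theorem substSum_sum (p : ι → κ) (q : κ → θ) (r : ι → θ) (h : ∀ i, q (p i) = r i) (t : θ) :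
    substSum k p (∑ c, if q c = t then MvPolynomial.X c else 0) =
      ∑ i, if r i = t then MvPolynomial.X i else 0 := by
  rw [map_sum]
  have : ∀ c, substSum k p (if q c = t then MvPolynomial.X c else 0) =
      ∑ i, if p i = c then (if r i = t then MvPolynomial.X i else 0 : MvPolynomial ι k) else 0 := by
    intro c
    split_ifs with hc
    · rw [substSum, MvPolynomial.aeval_X]
      refine Finset.sum_congr rfl fun i _ => ?_
      by_cases hi : p i = c
      · rw [if_pos hi, if_pos hi, ← h, hi, if_pos hc]
      · rw [if_neg hi, if_neg hi]
    · rw [map_zero]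
      refine (Finset.sum_eq_zero fun i _ => ?_).symm
      by_cases hi : p i = c
      · rw [if_pos hi, ← h, hi, if_neg hc]
      · rw [if_neg hi]
  rw [Finset.sum_congr rfl fun c _ => this c, Finset.sum_comm]
  simp

variable (p : ι → κ) (q : κ → θ) (r : ι → θ) (h : ∀ i, q (p i) = r i)
    (N : Type*) [AddCommGroup N] [Module k N] [Module (Weyl k θ)ᵐᵒᵖ N]
    [IsScalarTower k (Weyl k θ)ᵐᵒᵖ N]

/-- The bilinear map underlying `pushCollapse`. -/
def pushCollapseAux :
    Push (k := k) q N →ₗ[k] MvPolynomial ι k →ₗ[k] Push (k := k) r N :=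
  puLift (((LinearMap.llcomp k (MvPolynomial ι k) (MvPolynomial ι k) (Push (k := k) r N)).comp
      (puMk r)).compl₂ ((LinearMap.mul k (MvPolynomial ι k)).comp (substSum k p).toLinearMap))
    fun c n F => LinearMap.ext fun G => by
      simp only [LinearMap.compl₂_apply, LinearMap.comp_apply, LinearMap.llcomp_apply,
        LinearMap.mul_apply', AlgHom.toLinearMap_apply, map_mul, puMk_pd,
        substSum_sum p q r h, mul_assoc]

theorem pushCollapseAux_mk (n : N) (F : MvPolynomial κ k) (G : MvPolynomial ι k) :
    pushCollapseAux p q r h N (puMk q n F) G = puMk r n (substSum k p F * G) := by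
  rw [pushCollapseAux, puLift_mk]
  rfl

/-- Transitivity of pushforward, `(N ⊗_{k[λ_θ]} k[λ_κ]) ⊗_{k[λ_κ]} k[λ_ι] = N ⊗_{k[λ_θ]} k[λ_ι]`:
`(n ⊗ F) ⊗ G ↦ n ⊗ F G` where `λ_c = ∑_{p i = c} λ_i` in `F`. -/
def pushCollapse : Push (k := k) p (Push (k := k) q N) →ₗ[k] Push (k := k) r N :=
  puLift (pushCollapseAux p q r h N) fun c y G => by
    rw [ract_push_pd]
    refine LinearMap.congr_fun (pu_ext (f := (LinearMap.applyₗ G).comp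
      ((pushCollapseAux p q r h N).comp (puD c))) (g := (LinearMap.applyₗ
      ((∑ i, if p i = c then MvPolynomial.X i else 0) * G)).comp
        (pushCollapseAux p q r h N)) fun n F => ?_) y
    simp only [LinearMap.comp_apply, puD_mk, LinearMap.applyₗ_apply_apply, pushCollapseAux_mk,
      map_mul]
    congr 1
    rw [substSum, MvPolynomial.aeval_X]
    ring

end Push

section Insert

variable {k : Type*} [Field k] {d : ℕ} {M : Type*} [AddCommGroup M] [Module k M]
    [Module (Weyl k (Fin d))ᵐᵒᵖ M] [IsScalarTower k (Weyl k (Fin d))ᵐᵒᵖ M]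
  {I K B : Type*} [Fintype I] [Fintype B] [DecidableEq K] {i : K}

/-- The map `Δ_* M → Δ_* M ⊠ M^{⊠ K ∖ {i}}`, where `Δ` is the diagonal of `(𝔸^d)^B`, given by exterior
multiplication with the `m''_j`, `j ≠ i`. Its target is identified with the pushforward of `M^{⊠ K}` along
the partial diagonal `(𝔸^d)^K → (𝔸^d)^I`, so the map is
`x ⊗ F(λ_b) ↦ (x ⊠ m'') ⊗ F(λ_b)` with `x` at the index `i`. -/
def insertPush (e : I ≃ {j : K // j ≠ i} ⊕ B) (m'' : K → M) :
    Push (k := k) (fun c : B × Fin d => c.2) M →ₗ[k]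
      Push (k := k) (liftIdx (d := d) (collapse e)) (Box k K M) :=
  puLift (((puMk _).comp ((box k).toLinearMap m'' i)).compl₂
    (MvPolynomial.rename (liftIdx (incl e))).toLinearMap) fun c x F => by
    simp only [LinearMap.compl₂_apply, LinearMap.comp_apply, AlgHom.toLinearMap_apply, map_mul,
      MultilinearMap.toLinearMap_apply]
    have h1 : box k (Function.update m'' i (ract (wpd k c) x)) =
        ract (wpd k (i, c)) (box k (Function.update m'' i x)) := by
      rw [ract_box_pd, slot_box]; simp
    rw [h1, puMk_pd]
    congr 2
    classical
    rw [map_sum]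
    have h2 : ∀ b : B × Fin d, MvPolynomial.rename (liftIdx (incl e))
        (if b.2 = c then MvPolynomial.X b else 0 : MvPolynomial (B × Fin d) k) =
        if b.2 = c then MvPolynomial.X (liftIdx (incl e) b) else 0 := by
      intro b; split_ifs <;> simp
    have hinj : Function.Injective (liftIdx (d := d) (incl e)) := fun a b hab =>
      Prod.ext (incl_injective e (Prod.ext_iff.1 hab).1) (Prod.ext_iff.1 hab).2
    rw [Finset.sum_congr rfl fun b _ => h2 b, ← Finset.sum_filter, ← Finset.sum_filter]
    refine (Finset.sum_bij (fun b _ => liftIdx (incl e) b) ?_ ?_ ?_ ?_).symm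
    · intro b hb
      simp only [Finset.mem_filter, Finset.mem_univ, true_and] at hb ⊢
      exact Prod.ext ((collapse_eq_iff e _).2 ⟨_, rfl⟩) hb
    · intro a _ b _ hab
      exact hinj hab
    · intro a ha
      simp only [Finset.mem_filter, Finset.mem_univ, true_and] at ha
      obtain ⟨b, hb⟩ := (collapse_eq_iff e a.1).1 (Prod.ext_iff.1 ha).1
      exact ⟨(b, a.2), by simpa using (show a.2 = c from (Prod.ext_iff.1 ha).2), Prod.ext hb rfl⟩
    · intro b _
      rfl

end Insert

section Partial

variable {k : Type*} [Field k] {d : ℕ} {I K : Type*} (π : I → K)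

/-- The graph on `I` whose edges are the pairs of indices in different fibres of `π`. If `π` collapses a
subset `B` to a point, its Jouanolou algebra is the partial Jouanolou model, with variables `x_{jl}` for
the pairs not contained in `B`. -/
abbrev partialGraph : SimpleGraph I := (⊤ : SimpleGraph K).comap π

/-- The map `z_a ↦ z_{π a}`, `x_{ab} ↦ x_{π a π b}`, `𝐝x_{ab} ↦ 𝐝x_{π a π b}`, which models the restriction
to the partial diagonal. -/
def restrictDiag : Jou k d (partialGraph π) →ₐ[k] Jou k d (⊤ : SimpleGraph K) :=
  jmap (SimpleGraph.Hom.comap π ⊤)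

/-- The inclusion of the partial Jouanolou algebra into the Jouanolou algebra. -/
def partialIncl : Jou k d (partialGraph π) →ₐ[k] Jou k d (⊤ : SimpleGraph I) :=
  jmap { toFun := id
         map_rel' := fun h => by
          rw [SimpleGraph.top_adj]
          exact fun e => (SimpleGraph.ne_of_adj _ h) e }

variable [Fintype I] [DecidableEq I] [DecidableEq K] {N : Type*} [AddCommGroup N] [Module k N]
  [Module (Weyl k (K × Fin d))ᵐᵒᵖ N] [IsScalarTower k (Weyl k (K × Fin d))ᵐᵒᵖ N]

/-- `w` is the `𝒟`-linear map from the partial Jouanolou model of the pushforward of `N` along the partial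
diagonal of `π` to the pushforward of the Jouanolou model of `N` which extends
`n ⊗ b ↦ n ⊗ c(b)`, where `c` is the restriction to the partial diagonal. -/
structure IsDiagRestriction
    (w : JModel k d (partialGraph π) (Push (k := k) (liftIdx (d := d) π) N) →ₗ[k]
      Push (k := k) (liftIdx (d := d) π) (JModel k d (⊤ : SimpleGraph K) N)) : Prop where
  map_smul : ∀ (P : (Weyl k (I × Fin d))ᵐᵒᵖ)
    (y : JModel k d (partialGraph π) (Push (k := k) (liftIdx (d := d) π) N)), w (P • y) = P • w y
  map_mk : ∀ (n : N) (b : Jou k d (partialGraph π)),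
    w (jmMk _ (puMk _ n 1) b) = puMk _ (jmMk _ n (restrictDiag π b)) 1

end Partial

section Main

variable {k : Type*} [Field k] {d : ℕ} {M : Type*} [AddCommGroup M] [Module k M]
    [Module (Weyl k (Fin d))ᵐᵒᵖ M] [IsScalarTower k (Weyl k (Fin d))ᵐᵒᵖ M]
    (𝓜 : DGStructure k d M)

/-- The inclusion of the Jouanolou algebra of the inserted inputs. -/
def blockIncl {m n : ℕ} (i : Fin (m + 1)) :
    Jou k d (⊤ : SimpleGraph (Fin n)) →ₐ[k] Jou k d (⊤ : SimpleGraph (Fin (m + n))) :=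
  jmap (topHom (incl (insEquiv i n)) (incl_injective _))

/-- The chiral operation `μ` applied under a pushforward:
`𝐉(M^{⊠ K}) ⊗_{k[λ_K]} k[λ_I] → (M ⊗_{k[λ_⋆]} k[λ_K]) ⊗_{k[λ_K]} k[λ_I] = M ⊗_{k[λ_⋆]} k[λ_I]`. -/
def outerMap {m n : ℕ} (i : Fin (m + 1)) (μ : ChiralOp 𝓜 (m + 1)) :
    Push (k := k) (liftIdx (d := d) (collapse (insEquiv i n))) (JouBox k d M (m + 1)) →ₗ[k]
      Diag k d M (m + n) :=
  (pushCollapse (liftIdx (collapse (insEquiv i n))) (fun c : Fin (m + 1) × Fin d => c.2)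
    (fun c : Fin (m + n) × Fin d => c.2) (fun _ => rfl) M).comp
  (pushMap _ (μ : JouBox k d M (m + 1) →ₗ[k] Diag k d M (m + 1)) (chiralOp_map_smul μ))

/-- The structure maps of the operad `O` on the spaces of chiral operations are the prescribed ones. -/
structure IsChiral (O : DGOperad k fun n => ↥(ChiralOp 𝓜 n)) : Prop where
  /-- The grading is the one by the degree of maps. -/
  mem_deg : ∀ (n : ℕ) (p : ℤ) (f : ChiralOp 𝓜 n),
    f ∈ O.deg n p ↔ (f : JouBox k d M n →ₗ[k] Diag k d M n) ∈ HomDeg 𝓜 n p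
  /-- The differential is the one of the Hom complex. -/
  d_eq : ∀ (n : ℕ) (p : ℤ) (f : ChiralOp 𝓜 n),
    (f : JouBox k d M n →ₗ[k] Diag k d M n) ∈ HomDeg 𝓜 n p →
    (O.d n f : JouBox k d M n →ₗ[k] Diag k d M n) =
      (diagDiff 𝓜 n).comp (f : JouBox k d M n →ₗ[k] Diag k d M n) -
        p.negOnePow • (f : JouBox k d M n →ₗ[k] Diag k d M n).comp (jouBoxDiff 𝓜 n)
  /-- The symmetric groups act by `(σ μ)(x) = σ (μ (σ⁻¹ x))`. -/
  act_eq : ∀ (n : ℕ) (σ : Equiv.Perm (Fin n)) (f : ChiralOp 𝓜 n) (x : JouBox k d M n),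
    (O.act n σ f : JouBox k d M n →ₗ[k] Diag k d M n) x =
      diagPerm σ ((f : JouBox k d M n →ₗ[k] Diag k d M n) (jouBoxPerm 𝓜 σ⁻¹ x))
  /-- The unit is the identity of `M`. -/
  one_eq : ∀ m : Fin 1 → M,
    (O.one : JouBox k d M 1 →ₗ[k] Diag k d M 1) (jmMk _ (box k m) 1) = puMk _ (m 0) 1
  /-- The partial composition `μ ∘_i ν`: the operation `ν` is applied to its inputs `m'` and the
  variables `a` of the Jouanolou model which only involve them, the result in the partial Jouanolou model
  is restricted to the partial diagonal, and `μ` is applied. The sign is the one for moving `ν` past the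
  inputs on its left, and `a` past the inputs on its right. -/
  comp_eq : ∀ (m n : ℕ) (i : Fin (m + 1)),
    ∃ w, IsDiagRestriction (k := k) (d := d) (collapse (insEquiv i n))
        (N := Box k (Fin (m + 1)) M) w ∧
      ∀ (μ : ChiralOp 𝓜 (m + 1)) (q : ℤ) (ν : ChiralOp 𝓜 n),
        (ν : JouBox k d M n →ₗ[k] Diag k d M n) ∈ HomDeg 𝓜 n q →
      ∀ (e : Fin (m + 1) → ℤ) (m'' : Fin (m + 1) → M), (∀ j, j ≠ i → m'' j ∈ 𝓜.deg (e j)) →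
      ∀ (m' : Fin n → M) (r : ℕ) (a : Jou k d (⊤ : SimpleGraph (Fin n))), a ∈ jdeg r →
      ∀ b : Jou k d (partialGraph (collapse (insEquiv i n))),
        (O.comp i μ ν : JouBox k d M (m + n) →ₗ[k] Diag k d M (m + n))
          (jmMk _ (box k (glue (insEquiv i n) m'' m')) (blockIncl i a * partialIncl _ b)) =
        (q * ∑ j with j < i, e j + r * ∑ j with i < j, e j).negOnePow •
          outerMap 𝓜 i μ (w (jmMk _ (insertPush (insEquiv i n) m''
            ((ν : JouBox k d M n →ₗ[k] Diag k d M n) (jmMk _ (box k m') a))) b))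

end Main

end HigherChiral

end

/-!
Uniqueness. The Jouanolou algebra `𝐉^I` is spanned by the products `a b` with `a ∈ 𝐉^{I'}` and
`b ∈ 𝐉^{(I'),I''}` (`jdeg_le_span`, `jouBox_glue_ext`), a `𝒟`-linear map out of
`𝐉^{(I'),I''}(π_* N)` is determined on the elements `(n ⊗ 1) ⊗ b`, because vector fields generate
the pushforward (`IsDiagRestriction.eq_diagW`), and an operation in `P(1)` is determined by its
values on `m ⊗ 1` (`IsDLin.ext_fin_one`). Hence the formulas leave no choice (`IsChiral.eq`).

Existence. Two points need an argument before the composition is defined at all.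

* The map `w` is obtained from the commuting operators by which the `∂_{z_c}`, `c ∈ I`, act on
  `π_* 𝐉(N)` together with the Leibniz rule on `𝐉^{(I'),I''}` (`leibnizOp`, `diagW`). It
  respects the tensor product over `𝐤[λ_K]` because `c^{(I')}` intertwines the sum of the
  `∂_{z_i}` over a fibre of `π` with the derivation at the collapsed point.
* The multiplication `𝐉^{I'} ⊗ 𝐉^{(I'),I''} → 𝐉^I`, balanced over the coordinates of the block, is
  an isomorphism: its inverse is constructed by letting the generators of `𝐉^I` act on the balanced
  tensor product (`facAct`, `factor_mul`). So the formula for `μ ∘_i ν` on products `a b` defines a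
  map (`coreComp`). The signs depend on the degrees of `ν` and `a` only through their parities, and
  are implemented by decomposing `ν` and `a` into even and odd parts (`compOn`, `compOn_mk`).

Write `outerOn π μ` for `w` followed by `μ`, with values in `Δ_* M` on `I`. The axioms follow from
one principle. By `𝒟`-linearity and the Leibniz rule, both sides of an identity between expressions
`outerOn π μ ((m'' ⊠ y) ⊗ b)` with `y ∈ Δ_* M` change in the same way when `y` is replaced by a
derivative of `y` (`insertPush_pd`, `outerOn_pd`); since `Δ_* M` is generated by the elements
`x ⊗ 1` under derivatives (`tgtDeg_induction`), the identity may be checked for `y = x ⊗ 1`, where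
`outerOn π μ` is `μ` after restriction to the partial diagonal. In this way,

* the differential of `μ` satisfies the expected formula on inserted elements (`outerOn_opDiff`),
  which gives the Leibniz rule (`chiralDiff_comp`);
* restriction to partial diagonals is transitive (`outerOn_substMap`), which gives sequential
  associativity (`outerOn_compOn`, `compOn_compOn`);
* both sides of parallel associativity are the value of `κ` on the simultaneous insertion of two
  elements of `Δ_* M`, and this is symmetric in the two elements (`insertTwo_comm`, `compOn_comm`);
* permutations of the inputs commute with insertion (`outerOn_opPerm`), and the Koszul sign of a
  block permutation factors (`koszulExp_glue`), which gives equivariance (`compOn_opPerm`).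

The unit is the identity of `M` under the identification of `𝐉^1` with the polynomial functions on
`𝔸^d` (`unitAct`, `chiralOne_comp`, `chiralComp_one`).
-/

set_option linter.unusedSectionVars false

noncomputable section

namespace HigherChiral

/-! ### Linear maps over the Weyl algebra -/

section DLinear

variable {k : Type*} [Field k] {κ : Type*}
  {V : Type*} [AddCommGroup V] [Module k V] [Module (Weyl k κ)ᵐᵒᵖ V]
  [IsScalarTower k (Weyl k κ)ᵐᵒᵖ V]
  {W : Type*} [AddCommGroup W] [Module k W] [Module (Weyl k κ)ᵐᵒᵖ W]
  [IsScalarTower k (Weyl k κ)ᵐᵒᵖ W]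

/-- Linearity over the Weyl algebra may be tested on the generators `z` and `∂`. -/
theorem map_smul_of_map_ract (f : V →ₗ[k] W)
    (hz : ∀ (c : κ) v, f (ract (wz k c) v) = ract (wz k c) (f v))
    (hd : ∀ (c : κ) v, f (ract (wpd k c) v) = ract (wpd k c) (f v))
    (P : (Weyl k κ)ᵐᵒᵖ) (v : V) : f (P • v) = P • f v := by
  obtain ⟨Q, rfl⟩ := MulOpposite.op_surjective P
  obtain ⟨F, rfl⟩ : ∃ b, weylMk k κ b = Q := RingQuot.mkAlgHom_surjective k (WeylRel k κ) Q
  rw [← ract_apply, ← ract_apply]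
  induction F using FreeAlgebra.induction generalizing v with
  | grade0 c =>
    rw [AlgHom.commutes, Algebra.algebraMap_eq_smul_one]
    simp [ract]
  | grade1 g => cases g with
    | z c => exact hz c v
    | pd c => exact hd c v
  | mul x y hx hy => rw [map_mul, ract_mul, ract_mul, Module.End.mul_apply, Module.End.mul_apply,
      hy, hx]
  | add x y hx hy => rw [map_add, ract_add, ract_add, LinearMap.add_apply, LinearMap.add_apply,
      map_add, hy, hx]

end DLinear

/-! ### Polynomials in commuting operators -/

section CommEval

variable {k : Type*} [Field k] {ι : Type*} {A : Type*} [Ring A] [Algebra k A]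

open scoped IsMulCommutative in
/-- Evaluation of polynomials at a commuting family of elements of a possibly noncommutative
algebra. -/
def commEval (Θ : ι → A) (h : ∀ i j, Θ i * Θ j = Θ j * Θ i) : MvPolynomial ι k →ₐ[k] A :=
  haveI := Algebra.isMulCommutative_adjoin k (s := Set.range Θ)
    (by rintro _ ⟨i, rfl⟩ _ ⟨j, rfl⟩; exact h i j)
  (Algebra.adjoin k (Set.range Θ)).val.comp
    (MvPolynomial.aeval (R := k) (S₁ := Algebra.adjoin k (Set.range Θ))
      fun i => ⟨Θ i, Algebra.subset_adjoin ⟨i, rfl⟩⟩)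

theorem commEval_X (Θ : ι → A) (h : ∀ i j, Θ i * Θ j = Θ j * Θ i) (i : ι) :
    commEval (k := k) Θ h (MvPolynomial.X i) = Θ i := by
  simp [commEval]

/-- Induction on polynomials along multiplication by variables from the left. -/
theorem mvPoly_induction {p : MvPolynomial ι k → Prop} (h1 : p 1)
    (hs : ∀ (c : k) F, p F → p (c • F)) (ha : ∀ F G, p F → p G → p (F + G))
    (hX : ∀ i F, p F → p (MvPolynomial.X i * F)) (F : MvPolynomial ι k) : p F := by
  induction F using MvPolynomial.induction_on with
  | C c => simpa [MvPolynomial.smul_eq_C_mul] using hs c 1 h1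
  | add F G hF hG => exact ha F G hF hG
  | mul_X F i hF => rw [mul_comm]; exact hX i F hF

end CommEval

/-! ### The Jouanolou algebra as a differential graded algebra -/

section Jou

variable {k : Type*} [Field k] {d : ℕ} {I : Type*} {G : SimpleGraph I}

/-- The sign automorphism `a ↦ (-1)^|a| a` of the Jouanolou algebra. -/
def jpar : Jou k d G →ₐ[k] Jou k d G :=
  jlift (fun g => match g with
      | .z i s => jgen k (.z i s)
      | .x e s => jgen k (.x e s)
      | .dx e s => -jgen k (.dx e s))
    (by rintro i s (_ | _ | _) <;> simp [jz_central i s])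
    (fun _ _ _ _ => jx_comm _ _ _ _)
    (fun e s e' s' => by simp [jx_dx_comm])
    (fun e s e' s' => by simpa using jdx_comm e e' s s')
    (fun e s => jx_symm e s) (fun e s => by simp [jdx_symm])
    (fun e => jx_z e) (fun e => by simp [jdx_z])

theorem jpar_z (i : I) (s : Fin d) : jpar (jgen k (.z i s) : Jou k d G) = jgen k (.z i s) :=
  jlift_gen _ _ _ _ _ _ _ _ _ _

theorem jpar_x (e : G.Dart) (s : Fin d) : jpar (jgen k (.x e s)) = jgen k (.x e s) :=
  jlift_gen _ _ _ _ _ _ _ _ _ _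

theorem jpar_dx (e : G.Dart) (s : Fin d) : jpar (jgen k (.dx e s)) = -jgen k (.dx e s) :=
  jlift_gen _ _ _ _ _ _ _ _ _ _

theorem jdMat_eq (a : Jou k d G) : jdMat a = low a (jd a) (jpar a) := by
  have key : ∃ b, jdMat a = low a b (jpar a) := by
    induction a using jou_induction with
    | hs c =>
      refine ⟨0, ?_⟩
      rw [AlgHom.commutes, AlgHom.commutes, Algebra.algebraMap_eq_smul_one, ← low_one,
        Algebra.algebraMap_eq_smul_one]
      simp [low]
    | hg g =>
      cases g
      · exact ⟨_, by rw [jpar_z]; exact jlift_gen _ _ _ _ _ _ _ _ _ _⟩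
      · exact ⟨_, by rw [jpar_x]; exact jlift_gen _ _ _ _ _ _ _ _ _ _⟩
      · exact ⟨_, by rw [jpar_dx]; exact jlift_gen _ _ _ _ _ _ _ _ _ _⟩
    | hm a b ha hb =>
      obtain ⟨x, h⟩ := ha
      obtain ⟨x', h'⟩ := hb
      exact ⟨_, by rw [map_mul, h, h', low_mul, map_mul]⟩
    | ha a b ha hb =>
      obtain ⟨x, h⟩ := ha
      obtain ⟨x', h'⟩ := hb
      exact ⟨x + x', by rw [map_add, h, h', map_add]; simp [low]⟩
  obtain ⟨b, h⟩ := key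
  have : jd a = b := by simp [jd, h, low]
  rw [this, h]

/-- The graded Leibniz rule for `𝐝`. -/
theorem jd_mul (a b : Jou k d G) : jd (a * b) = jd a * b + jpar a * jd b := by
  have h : jd (a * b) = jdMat (a * b) 1 0 := rfl
  rw [h, map_mul, jdMat_eq, jdMat_eq, low_mul]
  simp [low]

theorem jd_algebraMap (c : k) : jd (algebraMap k (Jou k d G) c) = 0 := by
  have h : jd (algebraMap k (Jou k d G) c) = jdMat (algebraMap k _ c) 1 0 := rfl
  rw [h, AlgHom.commutes, Algebra.algebraMap_eq_smul_one, ← low_one]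
  simp [low]

theorem jd_one : jd (1 : Jou k d G) = 0 := by
  simpa using jd_algebraMap (k := k) (d := d) (G := G) 1

theorem jd_jpar (a : Jou k d G) : jd (jpar a) = -jpar (jd a) := by
  induction a using jou_induction with
  | hs c => rw [AlgHom.commutes, jd_algebraMap]; simp
  | hg g => cases g <;> simp [jpar_z, jpar_x, jpar_dx, jd_x, jd_z, jd_dx]
  | hm a b ha hb => simp only [map_mul, jd_mul, ha, hb, map_add, neg_mul, mul_neg]; abel
  | ha a b ha hb => simp only [map_add, ha, hb]; abel

theorem jd_jd (a : Jou k d G) : jd (jd a) = 0 := by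
  induction a using jou_induction with
  | hs c => rw [jd_algebraMap]; simp
  | hg g => cases g <;> simp [jd_x, jd_z, jd_dx]
  | hm a b ha hb =>
    simp only [jd_mul, map_add, ha, hb, jd_jpar, neg_mul, mul_zero, zero_mul]
    abel
  | ha a b ha hb => simp only [map_add, ha, hb, add_zero]

section Derivations

variable [DecidableEq I]

theorem jpd_one (i : I) (t : Fin d) : jpd i t (1 : Jou k d G) = 0 := by
  simpa using jpd_algebraMap (k := k) (G := G) i t 1

theorem jpar_jsign (i : I) (e : G.Dart) : jpar (jsign i e : Jou k d G) = jsign i e := by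
  unfold jsign; split_ifs <;> simp

theorem jd_jsign (i : I) (e : G.Dart) : jd (jsign i e : Jou k d G) = 0 := by
  unfold jsign; split_ifs <;> simp [jd_one]

theorem jpd_jpar (i : I) (t : Fin d) (a : Jou k d G) : jpd i t (jpar a) = jpar (jpd i t a) := by
  induction a using jou_induction with
  | hs c => rw [AlgHom.commutes, jpd_algebraMap, map_zero]
  | hg g =>
    cases g with
    | z j s => rw [jpar_z, jpd_z]; split_ifs <;> simp
    | x e s => simp [jpar_x, jpd_x, jpar_jsign]
    | dx e s => simp [jpar_x, jpar_dx, jpd_dx, jpar_jsign]; noncomm_ring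
  | hm a b ha hb => simp only [map_mul, jpd_mul, ha, hb, map_add]
  | ha a b ha hb => simp only [map_add, ha, hb]

theorem jpd_jd (i : I) (t : Fin d) (a : Jou k d G) : jpd i t (jd a) = jd (jpd i t a) := by
  induction a using jou_induction with
  | hs c => rw [jd_algebraMap, jpd_algebraMap, map_zero, map_zero]
  | hg g =>
    cases g with
    | z j s => rw [jd_z, jpd_z]; split_ifs <;> simp [jd_one]
    | x e s => simp [jd_x, jpd_x, jpd_dx, jd_jsign, jpar_jsign, jd_mul, jpar_x]
    | dx e s => simp [jd_x, jd_dx, jpd_dx, jd_jsign, jpar_jsign, jd_mul, jpar_x, jpar_dx]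
  | hm a b ha hb => simp only [jd_mul, jpd_mul, ha, hb, map_add, jpd_jpar]; abel
  | ha a b ha hb => simp only [map_add, ha, hb]

end Derivations

/-! ### Functoriality of the Jouanolou algebra in the graph -/

section Map

variable {I' I'' : Type*} {G' : SimpleGraph I'} {G'' : SimpleGraph I''}

theorem jmap_z (φ : G →g G') (i : I) (s : Fin d) :
    jmap φ (jgen k (.z i s)) = jgen k (.z (φ i) s) := jmap_gen _ _

theorem jmap_x (φ : G →g G') (e : G.Dart) (s : Fin d) :
    jmap φ (jgen k (.x e s)) = jgen k (.x (φ.mapDart e) s) := jmap_gen _ _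

theorem jmap_dx (φ : G →g G') (e : G.Dart) (s : Fin d) :
    jmap φ (jgen k (.dx e s)) = jgen k (.dx (φ.mapDart e) s) := jmap_gen _ _

theorem jmap_jmap (φ : G →g G') (ψ : G' →g G'') (χ : G →g G'') (h : ∀ i, ψ (φ i) = χ i)
    (a : Jou k d G) : jmap ψ (jmap φ a) = jmap χ a := by
  obtain rfl : χ = ψ.comp φ := RelHom.ext fun i => (h i).symm
  have : (jmap ψ).comp (jmap φ) = jmap (k := k) (d := d) (ψ.comp φ) :=
    jou_algHom_ext fun g => by
      cases g
      · simp only [AlgHom.comp_apply, jmap_z]; rfl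
      · simp only [AlgHom.comp_apply, jmap_x]; rfl
      · simp only [AlgHom.comp_apply, jmap_dx]; rfl
  exact DFunLike.congr_fun this a

theorem jmap_id (φ : G →g G) (h : ∀ i, φ i = i) (a : Jou k d G) : jmap φ a = a := by
  obtain rfl : φ = RelHom.id _ := RelHom.ext h
  have : jmap (k := k) (d := d) (RelHom.id _ : G →g G) = AlgHom.id k _ :=
    jou_algHom_ext fun g => by
      cases g
      · simp only [jmap_z]; rfl
      · simp only [jmap_x]; rfl
      · simp only [jmap_dx]; rfl
  exact DFunLike.congr_fun this a

theorem jmap_jpar (φ : G →g G') (a : Jou k d G) : jmap φ (jpar a) = jpar (jmap φ a) := by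
  have : (jmap φ).comp jpar = jpar.comp (jmap (k := k) (d := d) φ) :=
    jou_algHom_ext fun g => by
      cases g
      · simp only [AlgHom.comp_apply, jmap_z, jpar_z]
      · simp only [AlgHom.comp_apply, jmap_x, jpar_x]
      · simp only [AlgHom.comp_apply, jmap_dx, jpar_dx, map_neg]
  exact DFunLike.congr_fun this a

theorem jmap_jd (φ : G →g G') (a : Jou k d G) : jmap φ (jd a) = jd (jmap φ a) := by
  induction a using jou_induction with
  | hs c => rw [AlgHom.commutes, jd_algebraMap, jd_algebraMap, map_zero]
  | hg g => cases g <;> simp [jd_x, jd_z, jd_dx, jmap_x, jmap_z, jmap_dx]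
  | hm a b ha hb => simp only [jd_mul, map_mul, ha, hb, map_add, jmap_jpar]
  | ha a b ha hb => simp only [map_add, ha, hb]

variable [DecidableEq I] [DecidableEq I'] [Fintype I]

theorem sum_jsign (φ : G →g G') (i' : I') (e : G.Dart) :
    (jsign i' (φ.mapDart e) : Jou k d G') =
      ∑ i, if φ i = i' then jmap φ (jsign i e) else 0 := by
  simp only [jsign, map_sub, apply_ite (jmap φ), map_one, map_zero]
  have : ∀ v : I, (if φ v = i' then (1 : Jou k d G') else 0) =
      ∑ i, if φ i = i' then (if v = i then 1 else 0) else 0 := by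
    intro v
    rw [Finset.sum_eq_single v] <;> simp +contextual [eq_comm]
  have h2 : ∀ i, (if φ i = i' then ((if e.fst = i then 1 else 0) - (if e.snd = i then 1 else 0))
      else 0 : Jou k d G') = (if φ i = i' then (if e.fst = i then 1 else 0) else 0) -
        (if φ i = i' then (if e.snd = i then 1 else 0) else 0) := by
    intro i; split_ifs <;> simp
  simp only [h2]
  rw [Finset.sum_sub_distrib, ← this, ← this]
  rfl

/-- The chain rule: a vector field on the target of a map of Jouanolou algebras acts as the sum of
the vector fields at the points lying over it. -/
theorem jpd_jmap' (φ : G →g G') (i' : I') (t : Fin d) (a : Jou k d G) :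
    jpd i' t (jmap φ a) = ∑ i, if φ i = i' then jmap φ (jpd i t a) else 0 := by
  induction a using jou_induction with
  | hs c => simp [jpd_algebraMap]
  | hg g =>
    cases g with
    | z j s =>
      rw [jmap_z, jpd_z, Finset.sum_eq_single j]
      · rw [jpd_z]; by_cases h : φ j = i' <;> by_cases h' : s = t <;> simp [h, h']
      · intro i _ hi; simp [jpd_z, Ne.symm hi]
      · simp
    | x e s =>
      rw [jmap_x, jpd_x, sum_jsign, Finset.sum_mul, ← Finset.sum_neg_distrib]
      refine Finset.sum_congr rfl fun i _ => ?_
      split_ifs <;> simp [jpd_x, jmap_x]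
    | dx e s =>
      rw [jmap_dx, jpd_dx, sum_jsign, Finset.sum_mul, ← Finset.sum_neg_distrib]
      refine Finset.sum_congr rfl fun i _ => ?_
      split_ifs <;> simp [jpd_dx, jmap_x, jmap_dx]
  | hm a b ha hb =>
    rw [map_mul, jpd_mul, ha, hb, Finset.sum_mul, Finset.mul_sum, ← Finset.sum_add_distrib]
    refine Finset.sum_congr rfl fun i _ => ?_
    split_ifs <;> simp [jpd_mul]
  | ha a b ha hb =>
    rw [map_add, map_add, ha, hb, ← Finset.sum_add_distrib]
    refine Finset.sum_congr rfl fun i _ => ?_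
    split_ifs <;> simp

theorem sum_liftIdx {X : Type*} [AddCommMonoid X] (π : I → I') (c' : I' × Fin d)
    (f : I × Fin d → X) : (∑ c, if liftIdx π c = c' then f c else 0) =
      ∑ i, if π i = c'.1 then f (i, c'.2) else 0 := by
  rw [Fintype.sum_prod_type]
  refine Finset.sum_congr rfl fun i _ => ?_
  rw [Finset.sum_eq_single c'.2]
  · by_cases h : π i = c'.1 <;> simp [liftIdx, h, Prod.ext_iff]
  · intro s _ hs; simp [liftIdx, Prod.ext_iff, hs]
  · simp

theorem jpd_jmap (φ : G →g G') (c' : I' × Fin d) (a : Jou k d G) :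
    jpd c'.1 c'.2 (jmap φ a) =
      ∑ c : I × Fin d, if liftIdx φ c = c' then jmap φ (jpd c.1 c.2 a) else 0 := by
  rw [jpd_jmap', sum_liftIdx φ c' fun c => jmap φ (jpd c.1 c.2 a)]

/-- Vector fields in directions which are not in the image of the graph act by zero. -/
theorem jpd_jmap_of_notMem (φ : G →g G') (c' : I' × Fin d) (h : ∀ i, φ i ≠ c'.1)
    (a : Jou k d G) : jpd c'.1 c'.2 (jmap φ a) = 0 := by
  rw [jpd_jmap']
  exact Finset.sum_eq_zero fun i _ => if_neg (h i)

theorem jpd_jmap_of_injective (φ : G →g G') (h : Function.Injective φ) (i : I) (t : Fin d)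
    (a : Jou k d G) : jpd (φ i) t (jmap φ a) = jmap φ (jpd i t a) := by
  rw [jpd_jmap', Finset.sum_eq_single i]
  · simp
  · intro j _ hj; rw [if_neg fun e => hj (h e)]
  · simp

end Map

/-! ### The grading of the Jouanolou algebra -/

section Degree

theorem jx_central (e : G.Dart) (s : Fin d) (a : Jou k d G) :
    jgen k (.x e s) * a = a * jgen k (.x e s) := by
  induction a using jou_induction with
  | hs c => exact (Algebra.commutes c _).symm
  | hg g => cases g with
    | z i t => exact (jz_comm i t _).symm
    | x e' t => exact jx_comm _ _ _ _
    | dx e' t => exact jx_dx_comm _ _ _ _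
  | hm a b ha hb => rw [← mul_assoc, ha, mul_assoc, hb, mul_assoc]
  | ha a b ha hb => rw [mul_add, add_mul, ha, hb]

theorem jdx_mul (e : G.Dart) (s : Fin d) (a : Jou k d G) :
    jgen k (.dx e s) * a = jpar a * jgen k (.dx e s) := by
  induction a using jou_induction with
  | hs c => rw [AlgHom.commutes]; exact (Algebra.commutes c _).symm
  | hg g => cases g with
    | z i t => rw [jpar_z]; exact (jz_comm i t _).symm
    | x e' t => rw [jpar_x]; exact (jx_dx_comm _ _ _ _).symm
    | dx e' t => rw [jpar_dx, neg_mul]; exact jdx_comm _ _ _ _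
  | hm a b ha hb => rw [← mul_assoc, ha, mul_assoc, hb, map_mul, mul_assoc]
  | ha a b ha hb => rw [mul_add, map_add, add_mul, ha, hb]

theorem one_mem_jdeg : (1 : Jou k d G) ∈ jdeg 0 :=
  Submodule.subset_span ⟨[], by simp, by simp⟩

/-- The homogeneous parts form the smallest family of subspaces which contains `1` and is stable
under left multiplication by generators. -/
theorem jdeg_le {S : ℕ → Submodule k (Jou k d G)} (h1 : 1 ∈ S 0)
    (hz : ∀ i s r, ∀ a ∈ S r, jgen k (.z i s) * a ∈ S r)
    (hx : ∀ e s r, ∀ a ∈ S r, jgen k (.x e s) * a ∈ S r)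
    (hdx : ∀ e s r, ∀ a ∈ S r, jgen k (.dx e s) * a ∈ S (r + 1)) (r : ℕ) :
    jdeg r ≤ S r := by
  refine Submodule.span_le.2 ?_
  rintro _ ⟨l, rfl, rfl⟩
  induction l with
  | nil => simpa using h1
  | cons g l ih =>
    cases g with
    | z i s => simpa using hz i s _ _ ih
    | x e s => simpa using hx e s _ _ ih
    | dx e s => simpa using hdx e s _ _ ih

theorem gen_mul_mem_jdeg (g : JGen d G) {r : ℕ} {a : Jou k d G} (ha : a ∈ jdeg r) :
    jgen k g * a ∈ jdeg (k := k) (r + if g matches .dx _ _ then 1 else 0) := by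
  have : jdeg r ≤ (jdeg (k := k) (d := d) (G := G)
      (r + if g matches .dx _ _ then 1 else 0)).comap (LinearMap.mulLeft k (jgen k g)) := by
    refine Submodule.span_le.2 ?_
    rintro _ ⟨l, rfl, rfl⟩
    refine Submodule.subset_span ⟨g :: l, ?_, by simp⟩
    cases g <;> simp
  exact this ha

theorem z_mul_mem_jdeg (i : I) (s : Fin d) {r : ℕ} {a : Jou k d G} (ha : a ∈ jdeg r) :
    jgen k (.z i s) * a ∈ jdeg r := by simpa using gen_mul_mem_jdeg (.z i s) ha

theorem x_mul_mem_jdeg (e : G.Dart) (s : Fin d) {r : ℕ} {a : Jou k d G} (ha : a ∈ jdeg r) :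
    jgen k (.x e s) * a ∈ jdeg r := by simpa using gen_mul_mem_jdeg (.x e s) ha

theorem dx_mul_mem_jdeg (e : G.Dart) (s : Fin d) {r : ℕ} {a : Jou k d G} (ha : a ∈ jdeg r) :
    jgen k (.dx e s) * a ∈ jdeg (r + 1) := by simpa using gen_mul_mem_jdeg (.dx e s) ha

theorem mul_mem_jdeg {r r' : ℕ} {a b : Jou k d G} (ha : a ∈ jdeg r) (hb : b ∈ jdeg r') :
    a * b ∈ jdeg (r + r') := by
  have := jdeg_le (S := fun r => (jdeg (r + r')).comap (LinearMap.mulRight k b))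
    (by simpa using hb) (fun i s r a h => by simpa [mul_assoc] using z_mul_mem_jdeg i s h)
    (fun i s r a h => by simpa [mul_assoc] using x_mul_mem_jdeg i s h)
    (fun i s r a h => by
      simpa [mul_assoc, add_right_comm r 1 r'] using dx_mul_mem_jdeg i s h) r ha
  simpa using this

theorem iSup_jdeg : ⨆ r, jdeg (k := k) (d := d) (G := G) r = ⊤ := by
  have key : ∀ a b : Jou k d G, b ∈ ⨆ r, jdeg (k := k) (d := d) (G := G) r →
      a * b ∈ ⨆ r, jdeg (k := k) (d := d) (G := G) r := by
    intro a
    induction a using jou_induction with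
    | hs c =>
      intro b hb
      rw [← Algebra.smul_def]
      exact Submodule.smul_mem _ _ hb
    | hg g =>
      intro b hb
      have : ⨆ r, jdeg (k := k) (d := d) (G := G) r ≤
          (⨆ r, jdeg (k := k) (d := d) (G := G) r).comap (LinearMap.mulLeft k (jgen k g)) :=
        iSup_le fun r a ha => Submodule.mem_iSup_of_mem _ (gen_mul_mem_jdeg g ha)
      exact this hb
    | hm a a' ha ha' => intro b hb; rw [mul_assoc]; exact ha _ (ha' _ hb)
    | ha a a' ha ha' => intro b hb; rw [add_mul]; exact Submodule.add_mem _ (ha _ hb) (ha' _ hb)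
  refine eq_top_iff.2 fun a _ => ?_
  simpa using key a 1 (Submodule.mem_iSup_of_mem 0 one_mem_jdeg)

theorem jpar_of_mem {r : ℕ} {a : Jou k d G} (ha : a ∈ jdeg r) :
    jpar a = (r : ℤ).negOnePow • a := by
  have := jdeg_le (k := k) (d := d) (G := G) (S := fun r => LinearMap.eqLocus jpar.toLinearMap
    (((r : ℤ).negOnePow : ℤ) • LinearMap.id)) (by simp [LinearMap.mem_eqLocus])
    (fun i s r a h => by
      simp only [LinearMap.mem_eqLocus, AlgHom.toLinearMap_apply, LinearMap.smul_apply,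
        LinearMap.id_apply, map_mul, jpar_z] at h ⊢
      rw [h, mul_smul_comm])
    (fun i s r a h => by
      simp only [LinearMap.mem_eqLocus, AlgHom.toLinearMap_apply, LinearMap.smul_apply,
        LinearMap.id_apply, map_mul, jpar_x] at h ⊢
      rw [h, mul_smul_comm])
    (fun i s r a h => by
      simp only [LinearMap.mem_eqLocus, AlgHom.toLinearMap_apply, LinearMap.smul_apply,
        LinearMap.id_apply, map_mul, jpar_dx] at h ⊢
      rw [h, mul_smul_comm, Nat.cast_add, Nat.cast_one, Int.negOnePow_succ, neg_mul, smul_neg,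
        Units.val_neg, neg_smul]) r ha
  exact this

theorem jd_mem_jdeg {r : ℕ} {a : Jou k d G} (ha : a ∈ jdeg r) : jd a ∈ jdeg (r + 1) := by
  refine (jdeg_le (k := k) (d := d) (G := G) (S := fun r => jdeg r ⊓ (jdeg (r + 1)).comap jd)
    ⟨one_mem_jdeg, by simp [jd_one]⟩ ?_ ?_ ?_ r ha).2
  · rintro i s r a ⟨h, h'⟩
    refine ⟨z_mul_mem_jdeg i s h, ?_⟩
    simpa [jd_mul, jd_z, jpar_z] using z_mul_mem_jdeg i s h'
  · rintro i s r a ⟨h, h'⟩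
    refine ⟨x_mul_mem_jdeg i s h, ?_⟩
    simpa [jd_mul, jd_x, jpar_x] using add_mem (dx_mul_mem_jdeg i s h) (x_mul_mem_jdeg i s h')
  · rintro i s r a ⟨h, h'⟩
    refine ⟨dx_mul_mem_jdeg i s h, ?_⟩
    simpa [jd_mul, jd_dx, jpar_dx] using dx_mul_mem_jdeg i s h'

theorem jpd_mem_jdeg [DecidableEq I] (i : I) (t : Fin d) {r : ℕ} {a : Jou k d G}
    (ha : a ∈ jdeg r) : jpd i t a ∈ jdeg r := by
  have hs : ∀ (e : G.Dart) {r : ℕ} {a : Jou k d G}, a ∈ jdeg r → jsign i e * a ∈ jdeg r := by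
    intro e r a h
    unfold jsign
    split_ifs <;> simp [h]
  refine (jdeg_le (k := k) (d := d) (G := G) (S := fun r => jdeg r ⊓ (jdeg r).comap (jpd i t))
    ⟨one_mem_jdeg, by simp [jpd_one]⟩ ?_ ?_ ?_ r ha).2
  · rintro j s r a ⟨h, h'⟩
    refine ⟨z_mul_mem_jdeg j s h, ?_⟩
    have := add_mem (show (if j = i ∧ s = t then 1 else 0) * a ∈ jdeg r by
      split_ifs
      · rw [one_mul]; exact h
      · simp) (z_mul_mem_jdeg j s h')
    simpa [jpd_mul, jpd_z] using this
  · rintro e s r a ⟨h, h'⟩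
    refine ⟨x_mul_mem_jdeg e s h, ?_⟩
    have := add_mem (neg_mem (hs e (x_mul_mem_jdeg e t (x_mul_mem_jdeg e s h))))
      (x_mul_mem_jdeg e s h')
    simpa [jpd_mul, jpd_x, mul_assoc] using this
  · rintro e s r a ⟨h, h'⟩
    refine ⟨dx_mul_mem_jdeg e s h, ?_⟩
    have := add_mem (neg_mem (hs e (add_mem (dx_mul_mem_jdeg e t (x_mul_mem_jdeg e s h))
      (x_mul_mem_jdeg e t (dx_mul_mem_jdeg e s h))))) (dx_mul_mem_jdeg e s h')
    simpa [jpd_mul, jpd_dx, mul_assoc, add_mul] using this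

theorem jmap_mem_jdeg {I' : Type*} {G' : SimpleGraph I'} (φ : G →g G') {r : ℕ}
    {a : Jou k d G} (ha : a ∈ jdeg r) : jmap φ a ∈ jdeg r := by
  refine jdeg_le (k := k) (d := d) (G := G) (S := fun r => (jdeg r).comap (jmap φ).toLinearMap)
    (by simpa using one_mem_jdeg) ?_ ?_ ?_ r ha
  · intro i s r a h
    simpa [jmap_z] using z_mul_mem_jdeg _ s h
  · intro i s r a h
    simpa [jmap_x] using x_mul_mem_jdeg _ s h
  · intro i s r a h
    simpa [jmap_dx] using dx_mul_mem_jdeg _ s h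

variable {I₁ I₂ : Type*} {G₁ : SimpleGraph I₁} {G₂ : SimpleGraph I₂}

/-- If every edge of `G` comes from `G₁` or from `G₂` and every vertex comes from `G₂`, then the
Jouanolou algebra of `G` is spanned by products of homogeneous elements of those of `G₁` and
`G₂`. -/
theorem jdeg_le_span (φ₁ : G₁ →g G) (φ₂ : G₂ →g G) (hv : Function.Surjective φ₂)
    (he : ∀ e : G.Dart, (∃ e₁, φ₁.mapDart e₁ = e) ∨ ∃ e₂, φ₂.mapDart e₂ = e) (r : ℕ) :
    jdeg (k := k) (d := d) (G := G) r ≤ Submodule.span k {c | ∃ (r₁ r₂ : ℕ) (a : Jou k d G₁)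
      (b : Jou k d G₂), a ∈ jdeg r₁ ∧ b ∈ jdeg r₂ ∧ r₁ + r₂ = r ∧
      c = jmap φ₁ a * jmap φ₂ b} := by
  set S : ℕ → Submodule k (Jou k d G) := fun r => Submodule.span k {c | ∃ (r₁ r₂ : ℕ)
    (a : Jou k d G₁) (b : Jou k d G₂), a ∈ jdeg r₁ ∧ b ∈ jdeg r₂ ∧ r₁ + r₂ = r ∧
    c = jmap φ₁ a * jmap φ₂ b} with hS
  have step : ∀ (g : Jou k d G) (r r' : ℕ), (∀ r₁ r₂, r₁ + r₂ = r → ∀ a ∈ jdeg r₁, ∀ b ∈ jdeg r₂,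
      g * (jmap φ₁ a * jmap φ₂ b) ∈ S r') → ∀ c ∈ S r, g * c ∈ S r' := by
    intro g r r' h c hc
    have : S r ≤ (S r').comap (LinearMap.mulLeft k g) := by
      refine Submodule.span_le.2 ?_
      rintro _ ⟨r₁, r₂, a, b, ha, hb, hr, rfl⟩
      exact h _ _ hr a ha b hb
    exact this hc
  have mem : ∀ r₁ r₂ r, r₁ + r₂ = r → ∀ a ∈ jdeg r₁, ∀ b ∈ jdeg r₂,
      jmap φ₁ a * jmap φ₂ b ∈ S r := fun r₁ r₂ r h a ha b hb =>
    Submodule.subset_span ⟨r₁, r₂, a, b, ha, hb, h, rfl⟩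
  refine jdeg_le (S := S) ?_ ?_ ?_ ?_ r
  · simpa using mem 0 0 0 rfl 1 one_mem_jdeg 1 one_mem_jdeg
  · intro i s r
    refine step _ r r fun r₁ r₂ hr a ha b hb => ?_
    obtain ⟨i, rfl⟩ := hv i
    rw [← mul_assoc, jz_central, mul_assoc, ← jmap_z, ← map_mul]
    exact mem _ _ _ hr a ha _ (z_mul_mem_jdeg i s hb)
  · intro e s r
    refine step _ r r fun r₁ r₂ hr a ha b hb => ?_
    obtain ⟨e, rfl⟩ | ⟨e, rfl⟩ := he e
    · rw [← mul_assoc, ← jmap_x, ← map_mul]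
      exact mem _ _ _ hr _ (x_mul_mem_jdeg e s ha) b hb
    · rw [← mul_assoc, jx_central, mul_assoc, ← jmap_x, ← map_mul]
      exact mem _ _ _ hr a ha _ (x_mul_mem_jdeg e s hb)
  · intro e s r
    refine step _ r (r + 1) fun r₁ r₂ hr a ha b hb => ?_
    obtain ⟨e, rfl⟩ | ⟨e, rfl⟩ := he e
    · rw [← mul_assoc, ← jmap_dx, ← map_mul]
      exact mem _ _ _ (by omega) _ (dx_mul_mem_jdeg e s ha) b hb
    · rw [← mul_assoc, jdx_mul, mul_assoc, ← jmap_dx, ← map_mul, jpar_of_mem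
        (jmap_mem_jdeg φ₁ ha), smul_mul_assoc, Units.smul_def]
      exact zsmul_mem (mem _ _ _ (by omega) a ha _ (dx_mul_mem_jdeg e s hb)) _

theorem jou_hom_ext {X : Type*} [AddCommGroup X] [Module k X] {f g : Jou k d G →ₗ[k] X}
    (h : ∀ r, ∀ a ∈ jdeg r, f a = g a) : f = g := by
  have : (⊤ : Submodule k (Jou k d G)) ≤ LinearMap.eqLocus f g := by
    rw [← iSup_jdeg]
    exact iSup_le fun r a ha => h r a ha
  exact LinearMap.ext fun a => this trivial

/-- Linear maps on the Jouanolou algebra of `G` agree if they agree on the products of homogeneous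
elements which come from `G₁` and from `G₂`. -/
theorem jou_hom_ext_mul {X : Type*} [AddCommGroup X] [Module k X] {f g : Jou k d G →ₗ[k] X}
    (φ₁ : G₁ →g G) (φ₂ : G₂ →g G) (hv : Function.Surjective φ₂)
    (he : ∀ e : G.Dart, (∃ e₁, φ₁.mapDart e₁ = e) ∨ ∃ e₂, φ₂.mapDart e₂ = e)
    (h : ∀ r₁ r₂, ∀ a ∈ jdeg r₁, ∀ b ∈ jdeg r₂, f (jmap φ₁ a * jmap φ₂ b) =
      g (jmap φ₁ a * jmap φ₂ b)) : f = g := by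
  refine jou_hom_ext fun r a ha => ?_
  have : jdeg r ≤ LinearMap.eqLocus f g := by
    refine (jdeg_le_span φ₁ φ₂ hv he r).trans (Submodule.span_le.2 ?_)
    rintro _ ⟨r₁, r₂, a, b, ha, hb, -, rfl⟩
    exact h _ _ a ha b hb
  exact this ha

end Degree

end Jou

/-! ### Pushforwards -/

section Push

variable {k : Type*} [Field k] {ι κ θ : Type*} [Fintype ι] [DecidableEq κ]
  {N : Type*} [AddCommGroup N] [Module k N] [Module (Weyl k κ)ᵐᵒᵖ N]
  [IsScalarTower k (Weyl k κ)ᵐᵒᵖ N]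

theorem ract_push_z {p : ι → κ} (c : ι) :
    (ract (wz k c) : Module.End k (Push (k := k) p N)) = puZ c :=
  (puOps p N).toAlgHom_z c

theorem ract_push_pd_mk {p : ι → κ} (c : ι) (n : N) (F : MvPolynomial ι k) :
    ract (wpd k c) (puMk p n F) = puMk p n (MvPolynomial.X c * F) := by
  rw [ract_push_pd, puD_mk]

theorem ract_push_z_mk {p : ι → κ} (c : ι) (n : N) (F : MvPolynomial ι k) :
    ract (wz k c) (puMk p n F) = puMk p (ract (wz k (p c)) n) F +
      puMk p n (MvPolynomial.pderiv c F) := by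
  rw [ract_push_z, puZ_mk]

/-- A property of elements of a pushforward which is linear and stable under vector fields holds
for `n ⊗ F` as soon as it holds for `n ⊗ 1`. -/
theorem puMk_induction {p : ι → κ} {P : Push (k := k) p N → Prop} (n : N) (h1 : P (puMk p n 1))
    (hs : ∀ (c : k) y, P y → P (c • y)) (ha : ∀ y y', P y → P y' → P (y + y'))
    (hd : ∀ (c : ι) y, P y → P (ract (wpd k c) y)) (F : MvPolynomial ι k) : P (puMk p n F) := by
  induction F using mvPoly_induction with
  | h1 => exact h1
  | hs c F hF => rw [map_smul]; exact hs c _ hF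
  | ha F G hF hG => rw [map_add]; exact ha _ _ hF hG
  | hX i F hF => rw [← ract_push_pd_mk]; exact hd i _ hF

@[elab_as_elim]
theorem push_induction {p : ι → κ} {P : Push (k := k) p N → Prop}
    (hm : ∀ n F, P (puMk p n F)) (ha : ∀ y y', P y → P y' → P (y + y'))
    (y : Push (k := k) p N) : P y := by
  obtain ⟨t, rfl⟩ := Submodule.mkQ_surjective _ y
  induction t using TensorProduct.induction_on with
  | zero =>
    have h := hm 0 0
    rw [map_zero] at h
    rwa [map_zero]
  | tmul n F => exact hm n F
  | add x y hx hy => rw [map_add]; exact ha _ _ hx hy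

theorem ract_pushMap_mk (p : ι → κ) {N' : Type*} [AddCommGroup N'] [Module k N']
    [Module (Weyl k κ)ᵐᵒᵖ N'] [IsScalarTower k (Weyl k κ)ᵐᵒᵖ N'] (f : N →ₗ[k] N')
    (hf : ∀ (P : (Weyl k κ)ᵐᵒᵖ) (n : N), f (P • n) = P • f n) (n : N) (F : MvPolynomial ι k) :
    pushMap p f hf (puMk p n F) = puMk p (f n) F := puLift_mk _ _ _ _

theorem pushMap_smul (p : ι → κ) {N' : Type*} [AddCommGroup N'] [Module k N']
    [Module (Weyl k κ)ᵐᵒᵖ N'] [IsScalarTower k (Weyl k κ)ᵐᵒᵖ N'] (f : N →ₗ[k] N')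
    (hf : ∀ (P : (Weyl k κ)ᵐᵒᵖ) (n : N), f (P • n) = P • f n) (P : (Weyl k ι)ᵐᵒᵖ)
    (y : Push (k := k) p N) : pushMap p f hf (P • y) = P • pushMap p f hf y := by
  refine map_smul_of_map_ract _ (fun c y => ?_) (fun c y => ?_) P y
  · refine LinearMap.congr_fun (f := (pushMap p f hf) ∘ₗ ract (wz k c))
      (g := ract (wz k c) ∘ₗ (pushMap p f hf)) (pu_ext fun n F => ?_) y
    simp only [LinearMap.comp_apply, ract_push_z_mk, map_add, ract_pushMap_mk]
    rw [ract_apply, ract_apply, hf]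
  · refine LinearMap.congr_fun (f := (pushMap p f hf) ∘ₗ ract (wpd k c))
      (g := ract (wpd k c) ∘ₗ (pushMap p f hf)) (pu_ext fun n F => ?_) y
    simp only [LinearMap.comp_apply, ract_push_pd_mk, ract_pushMap_mk]

end Push

section Subst

variable {k : Type*} [Field k] {ι κ θ : Type*} [Fintype ι] [Fintype κ] [DecidableEq κ]
  [DecidableEq θ]

theorem substSum_X (p : ι → κ) (c : κ) : substSum k p (MvPolynomial.X c) =
    ∑ i, if p i = c then MvPolynomial.X i else 0 := by
  rw [substSum, MvPolynomial.aeval_X]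

theorem pderiv_substSum (p : ι → κ) (i : ι) (F : MvPolynomial κ k) :
    MvPolynomial.pderiv i (substSum k p F) = substSum k p (MvPolynomial.pderiv (p i) F) := by
  classical
  induction F using MvPolynomial.induction_on with
  | C c => simp [substSum]
  | add F G hF hG => simp only [map_add, hF, hG]
  | mul_X F c hF =>
    simp only [map_mul, Derivation.leibniz, hF, smul_eq_mul, map_add]
    congr 2
    rw [substSum_X, pderiv_sum_ite, MvPolynomial.pderiv_X]
    by_cases h : p i = c
    · subst h; simp
    · rw [if_neg h, Pi.single_eq_of_ne (fun e => h e.symm), map_zero]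

variable (p : ι → κ) (q : κ → θ) (r : ι → θ) (h : ∀ i, q (p i) = r i)
    (N : Type*) [AddCommGroup N] [Module k N] [Module (Weyl k θ)ᵐᵒᵖ N]
    [IsScalarTower k (Weyl k θ)ᵐᵒᵖ N]

/-- The map `n ⊗ F ↦ n ⊗ F(∑_{p i = c} λ_i)` from the pushforward along `q` to the one along
`q ∘ p`: the restriction of the identification of iterated pushforwards to the elements
`y ⊗ 1`. -/
def substMap : Push (k := k) q N →ₗ[k] Push (k := k) r N :=
  (pushCollapse p q r h N).comp ((puMk p).flip 1)

theorem pushCollapse_mk (n : N) (F : MvPolynomial κ k) (G : MvPolynomial ι k) :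
    pushCollapse p q r h N (puMk p (puMk q n F) G) = puMk r n (substSum k p F * G) :=
  (puLift_mk _ _ _ _).trans (pushCollapseAux_mk p q r h N n F G)

theorem substMap_mk (n : N) (F : MvPolynomial κ k) :
    substMap p q r h N (puMk q n F) = puMk r n (substSum k p F) := by
  rw [substMap, LinearMap.comp_apply, LinearMap.flip_apply, pushCollapse_mk, mul_one]

theorem pushCollapse_mk_one (y : Push (k := k) q N) :
    pushCollapse p q r h N (puMk p y 1) = substMap p q r h N y := rfl

theorem substMap_pd (c : κ) (y : Push (k := k) q N) :
    substMap p q r h N (ract (wpd k c) y) =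
      ∑ i, if p i = c then ract (wpd k i) (substMap p q r h N y) else 0 := by
  induction y using push_induction with
  | hm n F =>
    rw [ract_push_pd_mk, substMap_mk, substMap_mk, map_mul]
    rw [substSum_X, Finset.sum_mul, map_sum]
    refine Finset.sum_congr rfl fun i _ => ?_
    split_ifs
    · rw [ract_push_pd_mk]
    · simp
  | ha y y' hy hy' =>
    simp only [map_add, hy, hy', ← Finset.sum_add_distrib]
    refine Finset.sum_congr rfl fun i _ => ?_
    split_ifs <;> simp

theorem pushCollapse_smul (P : (Weyl k ι)ᵐᵒᵖ) (y : Push (k := k) p (Push (k := k) q N)) :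
    pushCollapse p q r h N (P • y) = P • pushCollapse p q r h N y := by
  refine map_smul_of_map_ract _ (fun c y => ?_) (fun c y => ?_) P y
  · induction y using push_induction with
    | ha y y' hy hy' => simp only [map_add, hy, hy']
    | hm y G =>
    induction y using push_induction with
    | ha y y' hy hy' => simp only [map_add, LinearMap.add_apply, hy, hy']
    | hm n F =>
    rw [ract_push_z_mk, ract_push_z_mk]
    simp only [map_add, LinearMap.add_apply, pushCollapse_mk]
    rw [ract_push_z_mk, Derivation.leibniz, pderiv_substSum, smul_eq_mul, smul_eq_mul, map_add,
      mul_comm G, ← h c]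
    abel
  · induction y using push_induction with
    | ha y y' hy hy' => simp only [map_add, hy, hy']
    | hm y G =>
    induction y using push_induction with
    | ha y y' hy hy' => simp only [map_add, LinearMap.add_apply, hy, hy']
    | hm n F =>
    rw [ract_push_pd_mk, pushCollapse_mk, pushCollapse_mk, ract_push_pd_mk, mul_left_comm]

theorem substMap_substMap {ι' : Type*} [Fintype ι'] [DecidableEq ι] (p' : ι' → ι) (p'' : ι' → κ)
    (hp : ∀ i, p (p' i) = p'' i) (r' : ι' → θ) (h' : ∀ i, r (p' i) = r' i)
    (h'' : ∀ i, q (p'' i) = r' i) (y : Push (k := k) q N) :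
    substMap p' r r' h' N (substMap p q r h N y) = substMap p'' q r' h'' N y := by
  induction y using push_induction with
  | ha y y' hy hy' => simp only [map_add, hy, hy']
  | hm n F =>
  rw [substMap_mk, substMap_mk, substMap_mk]
  congr 1
  have : (substSum k p').comp (substSum k p) = substSum k p'' := by
    refine MvPolynomial.algHom_ext fun c => ?_
    rw [AlgHom.comp_apply, substSum_X, substSum_sum p' p p'' hp, substSum_X]
  exact DFunLike.congr_fun this F

theorem substMap_id (q : κ → θ) (p : κ → κ) (hp : ∀ c, p c = c) (h) (y : Push (k := k) q N) :
    substMap p q q h N y = y := by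
  induction y using push_induction with
  | ha y y' hy hy' => simp only [map_add, hy, hy']
  | hm n F =>
  rw [substMap_mk]
  congr 1
  have : substSum k p = AlgHom.id k _ := by
    refine MvPolynomial.algHom_ext fun c => ?_
    rw [substSum_X]
    simp [hp]
  exact DFunLike.congr_fun this F

end Subst

/-! ### Restriction to a partial diagonal -/

section JModel

variable {k : Type*} [Field k] {d : ℕ} {I : Type*} [DecidableEq I] {G : SimpleGraph I}
  {N : Type*} [AddCommGroup N] [Module k N] [Module (Weyl k (I × Fin d))ᵐᵒᵖ N]
  [IsScalarTower k (Weyl k (I × Fin d))ᵐᵒᵖ N]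

theorem ract_jm_z (c : I × Fin d) (n : N) (a : Jou k d G) :
    ract (wz k c) (jmMk G n a) = jmMk G n (jgen k (.z c.1 c.2) * a) :=
  (LinearMap.congr_fun ((jmOps G N).toAlgHom_z c) _).trans (jmZ_mk c n a)

theorem ract_jm_pd (c : I × Fin d) (n : N) (a : Jou k d G) :
    ract (wpd k c) (jmMk G n a) = jmMk G (ract (wpd k c) n) a - jmMk G n (jpd c.1 c.2 a) :=
  (LinearMap.congr_fun ((jmOps G N).toAlgHom_pd c) _).trans (jmD_mk c n a)

theorem ract_jm_z' (c : I × Fin d) (n : N) (a : Jou k d G) :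
    ract (wz k c) (jmMk G n a) = jmMk G (ract (wz k c) n) a := by
  rw [ract_jm_z, jmMk_z]

theorem jmMk_pd (c : I × Fin d) (n : N) (a : Jou k d G) :
    jmMk G (ract (wpd k c) n) a = ract (wpd k c) (jmMk G n a) + jmMk G n (jpd c.1 c.2 a) := by
  rw [ract_jm_pd, sub_add_cancel]

end JModel

section DiagW

variable {k : Type*} [Field k] {d : ℕ} {I K : Type*} (π : I → K)
  [Fintype I] [DecidableEq I] [DecidableEq K] (N : Type*) [AddCommGroup N] [Module k N]
  [Module (Weyl k (K × Fin d))ᵐᵒᵖ N] [IsScalarTower k (Weyl k (K × Fin d))ᵐᵒᵖ N]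

/-- The operator `g ↦ (b ↦ g(b) ∂ + g(∂ b))` on linear maps from the partial Jouanolou algebra to
a right `𝒟`-module: the effect of replacing `y` by `y ∂` in `b ↦ w (y ⊗ b)` for a `𝒟`-linear
map `w`. -/
def leibnizOp {G : SimpleGraph I} (Y : Type*) [AddCommGroup Y] [Module k Y]
    [Module (Weyl k (I × Fin d))ᵐᵒᵖ Y] [IsScalarTower k (Weyl k (I × Fin d))ᵐᵒᵖ Y]
    (c : I × Fin d) : Module.End k (Jou k d G →ₗ[k] Y) :=
  LinearMap.compRight k (ract (wpd k c)) + LinearMap.lcomp k Y (jpd c.1 c.2)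

theorem leibnizOp_apply {G : SimpleGraph I} (Y : Type*) [AddCommGroup Y] [Module k Y]
    [Module (Weyl k (I × Fin d))ᵐᵒᵖ Y] [IsScalarTower k (Weyl k (I × Fin d))ᵐᵒᵖ Y]
    (c : I × Fin d) (g : Jou k d G →ₗ[k] Y) (b : Jou k d G) :
    leibnizOp (k := k) Y c g b = ract (wpd k c) (g b) + g (jpd c.1 c.2 b) := rfl

theorem leibnizOp_comm {G : SimpleGraph I} (Y : Type*) [AddCommGroup Y] [Module k Y]
    [Module (Weyl k (I × Fin d))ᵐᵒᵖ Y] [IsScalarTower k (Weyl k (I × Fin d))ᵐᵒᵖ Y]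
    (c c' : I × Fin d) : leibnizOp (k := k) (G := G) Y c * leibnizOp Y c' =
      leibnizOp Y c' * leibnizOp Y c := by
  refine LinearMap.ext fun g => LinearMap.ext fun b => ?_
  simp only [Module.End.mul_apply, leibnizOp_apply, map_add]
  rw [← Module.End.mul_apply, ← Module.End.mul_apply (ract (wpd k c')), ← ract_mul, ← ract_mul,
    wpd_comm, jpd_comm]
  abel

/-- `n ↦ (b ↦ (n ⊗ c(b)) ⊗ 1)`, where `c` is the restriction to the partial diagonal. -/
def diagWOne : N →ₗ[k] Jou k d (partialGraph π) →ₗ[k]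
    Push (k := k) (liftIdx (d := d) π) (JModel k d (⊤ : SimpleGraph K) N) :=
  ((jmMk (⊤ : SimpleGraph K)).compl₂ (restrictDiag π).toLinearMap).compr₂ ((puMk _).flip 1)

variable {N}

theorem diagWOne_apply (n : N) (b : Jou k d (partialGraph π)) :
    diagWOne (k := k) π N n b = puMk _ (jmMk _ n (restrictDiag π b)) 1 := rfl

theorem jpd_restrictDiag (c : K × Fin d) (b : Jou k d (partialGraph π)) :
    jpd c.1 c.2 (restrictDiag π b) = ∑ i : I × Fin d,
      if liftIdx π i = c then restrictDiag π (jpd i.1 i.2 b) else 0 :=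
  jpd_jmap _ c b

theorem diagWOne_pd (c : K × Fin d) (n : N) :
    diagWOne (k := k) π N (ract (wpd k c) n) =
      ∑ i, if liftIdx π i = c then leibnizOp _ i (diagWOne π N n) else 0 := by
  refine LinearMap.ext fun b => ?_
  have h1 : ∀ i, (if liftIdx π i = c then leibnizOp _ i (diagWOne π N n) else 0) b =
      puMk (k := k) (liftIdx π) (jmMk _ n (restrictDiag π b))
          ((if liftIdx π i = c then MvPolynomial.X i else 0) * 1) +
        puMk _ (jmMk _ n (if liftIdx π i = c then restrictDiag π (jpd i.1 i.2 b) else 0)) 1 := by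
    intro i
    split_ifs
    · rw [leibnizOp_apply, diagWOne_apply, diagWOne_apply, ract_push_pd_mk]
    · simp
  rw [LinearMap.sum_apply, Finset.sum_congr rfl fun i _ => h1 i, Finset.sum_add_distrib,
    ← map_sum, ← Finset.sum_mul, ← puMk_pd, ract_jm_pd, jpd_restrictDiag, diagWOne_apply]
  simp only [map_sub, LinearMap.sub_apply, map_sum, LinearMap.sum_apply]
  abel

/-- The linear map `y ↦ (b ↦ w (y ⊗ b))`, where `w` is the extension of the restriction to the
partial diagonal to the pushforward: `n ⊗ F ↦ F(θ) (b ↦ (n ⊗ c(b)) ⊗ 1)`, where `λ_i` acts by the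
Leibniz operator `θ_i`. -/
def diagWAux : Push (k := k) (liftIdx (d := d) π) N →ₗ[k] Jou k d (partialGraph π) →ₗ[k]
    Push (k := k) (liftIdx (d := d) π) (JModel k d (⊤ : SimpleGraph K) N) :=
  puLift ((commEval (leibnizOp _) (leibnizOp_comm _)).toLinearMap.flip.comp (diagWOne π N))
    fun c n F => by
    simp only [LinearMap.comp_apply, LinearMap.flip_apply, AlgHom.toLinearMap_apply]
    rw [mul_comm, map_mul, Module.End.mul_apply, map_sum, LinearMap.sum_apply, diagWOne_pd]
    congr 1
    refine Finset.sum_congr rfl fun i _ => ?_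
    split_ifs
    · rw [commEval_X]
    · rw [map_zero, LinearMap.zero_apply]

theorem diagWAux_one (n : N) : diagWAux (k := k) (d := d) π (puMk _ n 1) = diagWOne π N n := by
  refine (puLift_mk _ _ _ _).trans ?_
  simp

theorem diagWAux_pd (c : I × Fin d) (y : Push (k := k) (liftIdx (d := d) π) N) :
    diagWAux (k := k) π (ract (wpd k c) y) = leibnizOp _ c (diagWAux π y) := by
  induction y using push_induction with
  | ha y y' hy hy' => simp only [map_add, hy, hy']
  | hm n F =>
  rw [ract_push_pd_mk]
  refine (puLift_mk _ _ _ _).trans ?_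
  rw [show diagWAux π (puMk _ n F) = _ from puLift_mk _ _ _ _]
  simp only [LinearMap.comp_apply, LinearMap.flip_apply, AlgHom.toLinearMap_apply]
  rw [map_mul, Module.End.mul_apply, commEval_X]

theorem ract_pd_z {κ V : Type*} [DecidableEq κ] [AddCommGroup V] [Module k V]
    [Module (Weyl k κ)ᵐᵒᵖ V] [IsScalarTower k (Weyl k κ)ᵐᵒᵖ V] (c c' : κ) (v : V) :
    ract (wz k c) (ract (wpd k c') v) =
      ract (wpd k c') (ract (wz k c) v) + if c' = c then v else 0 := by
  rw [← Module.End.mul_apply, ← ract_mul, ← Module.End.mul_apply, ← ract_mul]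
  split_ifs with h
  · subst h; rw [wpd_wz_same, ract_add, ract_one]; rfl
  · rw [wpd_wz_ne h, add_zero]

theorem diagWAux_z (c : I × Fin d) (y : Push (k := k) (liftIdx (d := d) π) N)
    (b : Jou k d (partialGraph π)) :
    diagWAux π (ract (wz k c) y) b = diagWAux π y (jgen k (.z c.1 c.2) * b) := by
  induction y using push_induction with
  | ha y y' hy hy' => simp only [map_add, LinearMap.add_apply, hy, hy']
  | hm n F =>
  refine puMk_induction (P := fun y => ∀ b, diagWAux π (ract (wz k c) y) b =
    diagWAux π y (jgen k (.z c.1 c.2) * b)) n (fun b => ?_) (fun a y hy b => by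
    simp only [map_smul, LinearMap.smul_apply, hy]) (fun y y' hy hy' b => by
    simp only [map_add, LinearMap.add_apply, hy, hy']) (fun c' y hy b => ?_) F b
  · rw [ract_push_z_mk, Derivation.map_one_eq_zero, map_zero, add_zero, diagWAux_one,
      diagWAux_one, diagWOne_apply, diagWOne_apply, jmMk_z, map_mul (restrictDiag π),
          restrictDiag, jmap_z]
    rfl
  · rw [ract_pd_z, map_add, diagWAux_pd, diagWAux_pd, LinearMap.add_apply, leibnizOp_apply,
      leibnizOp_apply, hy, hy, jpd_mul, jpd_z, map_add, add_assoc]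
    by_cases h : c' = c
    · subst h; simp [add_comm]
    · have h' : ¬ (c.1 = c'.1 ∧ c.2 = c'.2) := fun e => h (Prod.ext e.1 e.2).symm
      simp [h, h']

/-- The `𝒟`-linear extension of the restriction to the partial diagonal. -/
def diagW : JModel k d (partialGraph π) (Push (k := k) (liftIdx (d := d) π) N) →ₗ[k]
    Push (k := k) (liftIdx (d := d) π) (JModel k d (⊤ : SimpleGraph K) N) :=
  jmLift (diagWAux π) (diagWAux_z π)

theorem diagW_mk (y : Push (k := k) (liftIdx (d := d) π) N) (b : Jou k d (partialGraph π)) :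
    diagW π (jmMk _ y b) = diagWAux π y b := jmLift_mk _ _ _ _

theorem diagWAux_z' (c : I × Fin d) (y : Push (k := k) (liftIdx (d := d) π) N)
    (b : Jou k d (partialGraph π)) :
    diagWAux π y (jgen k (.z c.1 c.2) * b) = ract (wz k c) (diagWAux π y b) := by
  induction y using push_induction with
  | ha y y' hy hy' => simp only [map_add, LinearMap.add_apply, hy, hy']
  | hm n F =>
  refine puMk_induction (P := fun y => ∀ b, diagWAux π y (jgen k (.z c.1 c.2) * b) =
    ract (wz k c) (diagWAux π y b)) n (fun b => ?_) (fun a y hy b => by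
    simp only [map_smul, LinearMap.smul_apply, hy]) (fun y y' hy hy' b => by
    simp only [map_add, LinearMap.add_apply, hy, hy']) (fun c' y hy b => ?_) F b
  · rw [diagWAux_one, diagWOne_apply, diagWOne_apply, ract_push_z_mk,
      Derivation.map_one_eq_zero, map_zero, add_zero, ract_jm_z, map_mul (restrictDiag π),
      restrictDiag, jmap_z]
    rfl
  · rw [diagWAux_pd, leibnizOp_apply, leibnizOp_apply, hy, map_add, ract_pd_z, jpd_mul, jpd_z,
      map_add, hy, ← add_assoc]
    by_cases h : c' = c
    · subst h; simp
    · have h' : ¬ (c.1 = c'.1 ∧ c.2 = c'.2) := fun e => h (Prod.ext e.1 e.2).symm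
      simp [h, h']

theorem isDiagRestriction_diagW : IsDiagRestriction (k := k) (d := d) π (N := N) (diagW π) where
  map_smul P y := by
    refine map_smul_of_map_ract _ (fun c y => ?_) (fun c y => ?_) P y
    · refine LinearMap.congr_fun (f := (diagW π) ∘ₗ ract (wz k c))
        (g := ract (wz k c) ∘ₗ (diagW π)) (jm_ext fun y b => ?_) y
      simp only [LinearMap.comp_apply]
      rw [ract_jm_z, diagW_mk, diagW_mk, diagWAux_z']
    · refine LinearMap.congr_fun (f := (diagW π) ∘ₗ ract (wpd k c))
        (g := ract (wpd k c) ∘ₗ (diagW π)) (jm_ext fun y b => ?_) y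
      simp only [LinearMap.comp_apply]
      rw [ract_jm_pd, map_sub, diagW_mk, diagW_mk, diagW_mk, diagWAux_pd, leibnizOp_apply,
        add_sub_cancel_right]
  map_mk n b := by rw [diagW_mk, diagWAux_one, diagWOne_apply]

/-- Linear maps on the Jouanolou model of a pushforward which commute with the vector fields are
determined by their values on the elements `(n ⊗ 1) ⊗ b`. -/
theorem jmPush_ext {κ : Type*} [DecidableEq κ] {p : I × Fin d → κ} {N : Type*} [AddCommGroup N]
    [Module k N] [Module (Weyl k κ)ᵐᵒᵖ N] [IsScalarTower k (Weyl k κ)ᵐᵒᵖ N] {G : SimpleGraph I}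
    {X : Type*} [AddCommGroup X] [Module k X]
    {f g : JModel k d G (Push (k := k) p N) →ₗ[k] X} (T : I × Fin d → X →ₗ[k] X)
    (hf : ∀ (c : I × Fin d) y, f (ract (wpd k c) y) = T c (f y))
    (hg : ∀ (c : I × Fin d) y, g (ract (wpd k c) y) = T c (g y))
    (h : ∀ n b, f (jmMk G (puMk p n 1) b) = g (jmMk G (puMk p n 1) b)) : f = g := by
  refine jm_ext fun y b => ?_
  induction y using push_induction with
  | ha y y' hy hy' => simp only [map_add, LinearMap.add_apply, hy, hy']
  | hm n F =>
  refine puMk_induction (P := fun y => ∀ b, f (jmMk G y b) = g (jmMk G y b)) n (h n)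
    (fun a y hy b => by simp only [map_smul, LinearMap.smul_apply, hy])
    (fun y y' hy hy' b => by simp only [map_add, LinearMap.add_apply, hy, hy'])
    (fun c y hy b => ?_) F b
  rw [jmMk_pd, map_add, map_add, hf, hg, hy, hy]

theorem IsDiagRestriction.eq_diagW
    {w : JModel k d (partialGraph π) (Push (k := k) (liftIdx (d := d) π) N) →ₗ[k]
      Push (k := k) (liftIdx (d := d) π) (JModel k d (⊤ : SimpleGraph K) N)}
    (hw : IsDiagRestriction (k := k) (d := d) π (N := N) w) : w = diagW π :=
  jmPush_ext (fun c => ract (wpd k c)) (fun c y => hw.map_smul _ y)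
    (fun c y => (isDiagRestriction_diagW π).map_smul _ y) fun n b => by
      rw [hw.map_mk, (isDiagRestriction_diagW π).map_mk]

end DiagW

/-! ### Applying an operation under a pushforward -/

section Outer

variable {k : Type*} [Field k] {d : ℕ} {M : Type*} [AddCommGroup M] [Module k M]
    [Module (Weyl k (Fin d))ᵐᵒᵖ M] [IsScalarTower k (Weyl k (Fin d))ᵐᵒᵖ M]
  {I K L : Type*} [Fintype I] [DecidableEq I] [Fintype K] [DecidableEq K] [DecidableEq L]

/-- The pushforward of `M` along the diagonal of `(𝔸^d)^I`. -/
abbrev DiagOn (k : Type*) [Field k] (d : ℕ) (M : Type*) [AddCommGroup M] [Module k M]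
    [Module (Weyl k (Fin d))ᵐᵒᵖ M] [IsScalarTower k (Weyl k (Fin d))ᵐᵒᵖ M] (I : Type*)
    [Fintype I] : Type _ :=
  Push (k := k) (fun c : I × Fin d => c.2) M

theorem snd_liftIdx (π : I → K) (c : I × Fin d) : (liftIdx π c).2 = c.2 := rfl

/-- The map `x ⊗ F ↦ x ⊗ F(∑_{π i = c} λ_i)` between pushforwards along diagonals. -/
def diagSubst (π : I → K) : DiagOn k d M K →ₗ[k] DiagOn k d M I :=
  substMap (liftIdx π) (fun c : K × Fin d => c.2) (fun c : I × Fin d => c.2) (snd_liftIdx π) M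

theorem diagSubst_mk_one (π : I → K) (x : M) :
    diagSubst (k := k) (d := d) π (puMk _ x 1) = puMk _ x 1 := by
  rw [diagSubst, substMap_mk, map_one]

variable {N : Type*} [AddCommGroup N] [Module k N]
  [Module (Weyl k (K × Fin d))ᵐᵒᵖ N] [IsScalarTower k (Weyl k (K × Fin d))ᵐᵒᵖ N]

/-- The composition `𝐉(π_* N) → π_* 𝐉(N) → π_* Δ_* M = Δ_* M` of the restriction to a partial
diagonal with the pushforward of a `𝒟`-linear map `μ`. -/
def outerOn (π : I → K) (μ : JModel k d (⊤ : SimpleGraph K) N →ₗ[k] DiagOn k d M K)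
    (hμ : ∀ (P : (Weyl k (K × Fin d))ᵐᵒᵖ) x, μ (P • x) = P • μ x) :
    JModel k d (partialGraph π) (Push (k := k) (liftIdx (d := d) π) N) →ₗ[k] DiagOn k d M I :=
  (pushCollapse (liftIdx π) (fun c : K × Fin d => c.2) (fun c : I × Fin d => c.2)
    (snd_liftIdx π) M) ∘ₗ (pushMap _ μ hμ) ∘ₗ (diagW π)

section

variable (π : I → K) {μ : JModel k d (⊤ : SimpleGraph K) N →ₗ[k] DiagOn k d M K}
    (hμ : ∀ (P : (Weyl k (K × Fin d))ᵐᵒᵖ) x, μ (P • x) = P • μ x)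

theorem outerOn_smul (P : (Weyl k (I × Fin d))ᵐᵒᵖ) (y) :
    outerOn π μ hμ (P • y) = P • outerOn π μ hμ y := by
  simp only [outerOn, LinearMap.comp_apply]
  rw [(isDiagRestriction_diagW π).map_smul, pushMap_smul, pushCollapse_smul]

theorem outerOn_ract (P : Weyl k (I × Fin d)) (y) :
    outerOn π μ hμ (ract P y) = ract P (outerOn π μ hμ y) := outerOn_smul π hμ _ y

theorem outerOn_one (n : N) (b : Jou k d (partialGraph π)) :
    outerOn π μ hμ (jmMk _ (puMk _ n 1) b) = diagSubst π (μ (jmMk _ n (restrictDiag π b))) := by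
  simp only [outerOn, LinearMap.comp_apply]
  rw [(isDiagRestriction_diagW π).map_mk, ract_pushMap_mk, pushCollapse_mk_one]
  rfl

/-- Vector fields can be moved out of the pushforward by the Leibniz rule. -/
theorem outerOn_pd (c : I × Fin d) (y : Push (k := k) (liftIdx (d := d) π) N)
    (b : Jou k d (partialGraph π)) :
    outerOn π μ hμ (jmMk _ (ract (wpd k c) y) b) =
      ract (wpd k c) (outerOn π μ hμ (jmMk _ y b)) +
        outerOn π μ hμ (jmMk _ y (jpd c.1 c.2 b)) := by
  rw [jmMk_pd, map_add, outerOn_ract]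

theorem outerOn_eq {g : JModel k d (partialGraph π) (Push (k := k) (liftIdx (d := d) π) N) →ₗ[k]
      DiagOn k d M I}
    (hg : ∀ (c : I × Fin d) y, g (ract (wpd k c) y) = ract (wpd k c) (g y))
    (h : ∀ n b, g (jmMk _ (puMk _ n 1) b) = diagSubst π (μ (jmMk _ n (restrictDiag π b)))) :
    outerOn π μ hμ = g :=
  jmPush_ext (fun c => ract (wpd k c)) (fun _ _ => outerOn_ract π hμ _ _) hg fun n b => by
    rw [outerOn_one, h]

end

/-- The map of partial graphs induced by a map of index sets. -/
def partialHom {I' K' : Type*} {π : I → K} {π' : I' → K'} (f : I → I')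
    (h : ∀ a b, π' (f a) = π' (f b) → π a = π b) : partialGraph π →g partialGraph π' where
  toFun := f
  map_rel' {a b} hab := by
    simp only [SimpleGraph.comap_adj, SimpleGraph.top_adj] at hab ⊢
    exact fun e => hab (h _ _ e)

theorem diagSubst_pd (π : I → K) (c : K × Fin d) (y : DiagOn k d M K) :
    diagSubst π (ract (wpd k c) y) =
      ∑ i : I × Fin d, if liftIdx π i = c then ract (wpd k i) (diagSubst π y) else 0 :=
  substMap_pd _ _ _ _ _ _ _

/-- Transitivity of the restriction to partial diagonals: for `I → K → L`, an operation on `L`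
applied under the pushforward to `I` may be applied under the pushforward to `K` first. -/
theorem outerOn_substMap {L : Type*} [Fintype L] [DecidableEq L] {N : Type*} [AddCommGroup N]
    [Module k N] [Module (Weyl k (L × Fin d))ᵐᵒᵖ N] [IsScalarTower k (Weyl k (L × Fin d))ᵐᵒᵖ N]
    (π : I → K) (ρ : K → L) (τ : I → L) (h : ∀ i, ρ (π i) = τ i)
    {μ : JModel k d (⊤ : SimpleGraph L) N →ₗ[k] DiagOn k d M L}
    (hμ : ∀ (P : (Weyl k (L × Fin d))ᵐᵒᵖ) x, μ (P • x) = P • μ x)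
    (h' : ∀ i, liftIdx (d := d) ρ (liftIdx π i) = liftIdx τ i)
    (hg : ∀ a b, ρ (π a) = ρ (π b) → τ a = τ b)
    (y : Push (k := k) (liftIdx (d := d) ρ) N) (c : Jou k d (partialGraph τ)) :
    outerOn τ μ hμ (jmMk _ (substMap (liftIdx π) (liftIdx ρ) (liftIdx τ) h' N y) c) =
      diagSubst π (outerOn ρ μ hμ (jmMk _ y (jmap (partialHom (π' := ρ) π hg) c))) := by
  induction y using push_induction with
  | ha y y' hy hy' => simp only [map_add, LinearMap.add_apply, hy, hy']
  | hm n F =>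
  refine puMk_induction (P := fun y => ∀ c, outerOn τ μ hμ (jmMk _ (substMap (liftIdx π)
    (liftIdx ρ) (liftIdx τ) h' N y) c) = diagSubst π (outerOn ρ μ hμ (jmMk _ y
    (jmap (partialHom (π' := ρ) π hg) c)))) n (fun c => ?_) (fun a y hy c => by
    simp only [map_smul, LinearMap.smul_apply, hy]) (fun y y' hy hy' c => by
    simp only [map_add, LinearMap.add_apply, hy, hy']) (fun j y hy c => ?_) F c
  · rw [substMap_mk, map_one, outerOn_one, outerOn_one]
    rw [restrictDiag, restrictDiag, jmap_jmap _ _ (SimpleGraph.Hom.comap τ ⊤) h]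
    rw [diagSubst, diagSubst, diagSubst,
      substMap_substMap (liftIdx ρ) _ _ (snd_liftIdx ρ) M (liftIdx π) (liftIdx τ) h' _
        (snd_liftIdx π) (snd_liftIdx τ)]
  · rw [substMap_pd, outerOn_pd, map_add, diagSubst_pd, jpd_jmap]
    simp only [map_sum, LinearMap.sum_apply]
    rw [← Finset.sum_add_distrib]
    refine Finset.sum_congr rfl fun i _ => ?_
    by_cases hi : liftIdx π i = j
    · have hi' : liftIdx (⇑(partialHom (π := τ) (π' := ρ) π hg)) i = j := hi
      rw [if_pos hi, if_pos hi, if_pos hi', outerOn_pd, hy, hy]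
    · have hi' : ¬ liftIdx (⇑(partialHom (π := τ) (π' := ρ) π hg)) i = j := hi
      rw [if_neg hi, if_neg hi, if_neg hi']
      simp

end Outer

/-! ### Blocks of indices -/

section Index

variable {I K B : Type*} {i : K} (e : I ≃ {j : K // j ≠ i} ⊕ B)

theorem collapse_incl (b : B) : collapse e (incl e b) = i := (collapse_eq_iff e _).2 ⟨b, rfl⟩

/-- The index of `I` which is identified with the index `j ≠ i` of `K`. -/
def outerIdx (j : {j : K // j ≠ i}) : I := e.symm (.inl j)

theorem collapse_outerIdx (j : {j : K // j ≠ i}) : collapse e (outerIdx e j) = j := by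
  simp [collapse, outerIdx]

theorem eq_outerIdx {a : I} {j : {j : K // j ≠ i}} (h : collapse e a = j) :
    a = outerIdx e j := by
  obtain ⟨x, rfl⟩ := e.symm.surjective a
  rcases x with j' | b
  · have := collapse_outerIdx e j'
    rw [outerIdx, h] at this
    rw [Subtype.ext this]; rfl
  · have := collapse_incl e b
    rw [incl, h] at this
    exact absurd this j.2

theorem idx_cases (a : I) : (∃ j, outerIdx e j = a) ∨ ∃ b, incl e b = a := by
  obtain ⟨x, rfl⟩ := e.symm.surjective a
  rcases x with j | b
  · exact Or.inl ⟨j, rfl⟩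
  · exact Or.inr ⟨b, rfl⟩

theorem outerIdx_ne_incl (j : {j : K // j ≠ i}) (b : B) : outerIdx e j ≠ incl e b :=
  fun h => Sum.inl_ne_inr (e.symm.injective h)

theorem outerIdx_injective : Function.Injective (outerIdx e) :=
  e.symm.injective.comp Sum.inl_injective

theorem glue_outerIdx {X : Type*} (m'' : K → X) (m' : B → X) (j : {j : K // j ≠ i}) :
    glue e m'' m' (outerIdx e j) = m'' j := by simp [glue, outerIdx]

theorem glue_incl {X : Type*} (m'' : K → X) (m' : B → X) (b : B) :
    glue e m'' m' (incl e b) = m' b := by simp [glue, incl]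

end Index

/-! ### Insertion of an operation into an exterior product -/

section Insert

variable {k : Type*} [Field k] {d : ℕ} {M : Type*} [AddCommGroup M] [Module k M]
    [Module (Weyl k (Fin d))ᵐᵒᵖ M] [IsScalarTower k (Weyl k (Fin d))ᵐᵒᵖ M]
  {I K B : Type*} [Fintype I] [Fintype B] [DecidableEq K] {i : K}
  (e : I ≃ {j : K // j ≠ i} ⊕ B)

theorem insertPush_mk (m'' : K → M) (x : M) (F : MvPolynomial (B × Fin d) k) :
    insertPush e m'' (puMk _ x F) = puMk _ (box k (Function.update m'' i x))
      (MvPolynomial.rename (liftIdx (incl e)) F) := puLift_mk _ _ _ _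

theorem insertPush_congr {m m' : K → M} (h : ∀ j, j ≠ i → m j = m' j) :
    insertPush (k := k) (d := d) e m = insertPush e m' :=
  pu_ext fun x F => by
    rw [insertPush_mk, insertPush_mk]
    congr 3
    ext j
    by_cases hj : j = i
    · subst hj; simp
    · simp [hj, h j hj]

variable [DecidableEq I]

theorem insertPush_pd (m'' : K → M) (c : B × Fin d) (y : DiagOn k d M B) :
    insertPush e m'' (ract (wpd k c) y) =
      ract (wpd k (liftIdx (incl e) c)) (insertPush e m'' y) := by
  induction y using push_induction with
  | ha y y' hy hy' => simp only [map_add, hy, hy']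
  | hm x F => rw [ract_push_pd_mk, insertPush_mk, insertPush_mk, ract_push_pd_mk, map_mul,
      MvPolynomial.rename_X]

theorem liftIdx_incl_injective : Function.Injective (liftIdx (d := d) (incl e)) := fun _ _ hab =>
  Prod.ext (incl_injective e (Prod.ext_iff.1 hab).1) (Prod.ext_iff.1 hab).2

theorem insertPush_z (m'' : K → M) (c : B × Fin d) (y : DiagOn k d M B) :
    insertPush e m'' (ract (wz k c) y) =
      ract (wz k (liftIdx (incl e) c)) (insertPush e m'' y) := by
  induction y using push_induction with
  | ha y y' hy hy' => simp only [map_add, hy, hy']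
  | hm x F =>
    rw [ract_push_z_mk, map_add, insertPush_mk, insertPush_mk, insertPush_mk, ract_push_z_mk,
      MvPolynomial.pderiv_rename (liftIdx_incl_injective e), ract_box_z, slot_box]
    simp [liftIdx, collapse_incl]

theorem pderiv_rename_incl {a : I × Fin d} (ha : ∀ b, incl e b ≠ a.1)
    (F : MvPolynomial (B × Fin d) k) :
    MvPolynomial.pderiv a (MvPolynomial.rename (liftIdx (incl e)) F) = 0 := by
  induction F using MvPolynomial.induction_on with
  | C c => simp
  | add F G hF hG => simp [hF, hG]
  | mul_X F c hF =>
    rw [map_mul, Derivation.leibniz, hF, MvPolynomial.rename_X, MvPolynomial.pderiv_X_of_ne,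
      smul_zero, smul_zero, add_zero]
    exact fun h => ha c.1 (congrArg Prod.fst h)

/-- Multiplication of an outer input by a coordinate. -/
theorem insertPush_update_z (m'' : K → M) (j : {j : K // j ≠ i}) (s : Fin d)
    (y : DiagOn k d M B) :
    insertPush e (Function.update m'' j (ract (wz k s) (m'' j))) y =
      ract (wz k (outerIdx e j, s)) (insertPush e m'' y) := by
  induction y using push_induction with
  | ha y y' hy hy' => simp only [map_add, hy, hy']
  | hm x F =>
    rw [insertPush_mk, insertPush_mk, ract_push_z_mk, pderiv_rename_incl, map_zero, add_zero,
      ract_box_z, slot_box]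
    · simp only [liftIdx, collapse_outerIdx]
      rw [Function.update_comm j.2, Function.update_of_ne j.2]
    · exact fun b h => outerIdx_ne_incl e j b h.symm

/-- Multiplication of an outer input by a vector field. -/
theorem insertPush_update_pd (m'' : K → M) (j : {j : K // j ≠ i}) (s : Fin d)
    (y : DiagOn k d M B) :
    insertPush e (Function.update m'' j (ract (wpd k s) (m'' j))) y =
      ract (wpd k (outerIdx e j, s)) (insertPush e m'' y) := by
  induction y using push_induction with
  | ha y y' hy hy' => simp only [map_add, hy, hy']
  | hm x F =>
    rw [insertPush_mk, insertPush_mk, ract_push_pd_mk]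
    have h : box k (Function.update (Function.update m'' (j : K) (ract (wpd k s) (m'' j))) i x) =
        ract (wpd k ((j : K), s)) (box k (Function.update m'' i x)) := by
      rw [ract_box_pd, slot_box, Function.update_comm j.2, Function.update_of_ne j.2]
    rw [h, puMk_pd, Finset.sum_eq_single (outerIdx e j, s)]
    · have h0 : liftIdx (d := d) (collapse e) (outerIdx e j, s) = ((j : K), s) :=
        Prod.ext (collapse_outerIdx e j) rfl
      rw [if_pos h0]
    · rintro ⟨a, t⟩ - h'
      refine if_neg fun h'' => h' ?_
      have h1 := eq_outerIdx e (Prod.ext_iff.1 h'').1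
      have h2 : t = s := (Prod.ext_iff.1 h'').2
      simp only at h1
      rw [h1, h2]
    · simp

theorem insertPush_update_add (m'' : K → M) {j : K} (hj : j ≠ i) (x y : M) :
    insertPush (k := k) (d := d) e (Function.update m'' j (x + y)) =
      insertPush e (Function.update m'' j x) + insertPush e (Function.update m'' j y) :=
  pu_ext fun n F => by
    simp only [LinearMap.add_apply, insertPush_mk, Function.update_comm hj,
      MultilinearMap.map_update_add, map_add]

theorem insertPush_update_smul (m'' : K → M) {j : K} (hj : j ≠ i) (c : k) (x : M) :
    insertPush (k := k) (d := d) e (Function.update m'' j (c • x)) =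
      c • insertPush e (Function.update m'' j x) :=
  pu_ext fun n F => by
    simp only [LinearMap.smul_apply, insertPush_mk, Function.update_comm hj,
      MultilinearMap.map_update_smul, map_smul]

end Insert

/-! ### Factorization of the Jouanolou algebra along a block of indices -/

section Factor

variable {k : Type*} [Field k] {d : ℕ} {I K B : Type*} {i : K}
  (e : I ≃ {j : K // j ≠ i} ⊕ B)

/-- The inclusion of the complete graph on the block `B` into the complete graph on `I`. -/
abbrev blockHom : (⊤ : SimpleGraph B) →g (⊤ : SimpleGraph I) := topHom (incl e) (incl_injective e)

theorem exists_block {a : (⊤ : SimpleGraph I).Dart} (h : collapse e a.fst = collapse e a.snd) :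
    ∃ a' : (⊤ : SimpleGraph B).Dart, (blockHom e).mapDart a' = a := by
  obtain ⟨⟨v, w⟩, hvw⟩ := a
  have hvw' : v ≠ w := hvw
  obtain ⟨j, rfl⟩ | ⟨b, rfl⟩ := idx_cases e v
  · have h' : collapse e w = j := by rw [← collapse_outerIdx e j]; exact h.symm
    exact absurd (eq_outerIdx e h').symm hvw'
  · obtain ⟨j, rfl⟩ | ⟨b', rfl⟩ := idx_cases e w
    · have h' : (j : K) = i :=
        (collapse_outerIdx e j).symm.trans (h.symm.trans (collapse_incl e b))
      exact absurd h' j.2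
    · exact ⟨⟨(b, b'), fun h => hvw' (congrArg (incl e) h)⟩, rfl⟩

/-- The inclusion of the partial graph into the complete graph. -/
def partialGraphHom (π : I → K) : partialGraph π →g (⊤ : SimpleGraph I) where
  toFun := id
  map_rel' h := by
    rw [SimpleGraph.top_adj]
    exact fun e => (SimpleGraph.ne_of_adj _ h) e

theorem dart_cases (a : (⊤ : SimpleGraph I).Dart) :
    (∃ a' : (⊤ : SimpleGraph B).Dart, (blockHom e).mapDart a' = a) ∨
      ∃ a' : (partialGraph (collapse e)).Dart, (partialGraphHom (collapse e)).mapDart a' = a := by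
  by_cases h : collapse e a.fst = collapse e a.snd
  · exact Or.inl (exists_block e h)
  · exact Or.inr ⟨⟨a.toProd, h⟩, rfl⟩

theorem blockHom_mapDart_injective : Function.Injective (blockHom e).mapDart := by
  intro a b h
  have h1 := congrArg SimpleGraph.Dart.toProd h
  exact SimpleGraph.Dart.ext _ _ (Prod.ext (incl_injective e (Prod.ext_iff.1 h1).1)
    (incl_injective e (Prod.ext_iff.1 h1).2))

/-- An ordered pair of distinct indices lies in the block `B` or is an edge of the partial graph. -/
def dartClass (a : (⊤ : SimpleGraph I).Dart) :
    (⊤ : SimpleGraph B).Dart ⊕ (partialGraph (collapse e)).Dart :=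
  open Classical in
  if h : collapse e a.fst = collapse e a.snd then .inl (exists_block e h).choose
  else .inr ⟨a.toProd, by rw [SimpleGraph.comap_adj, SimpleGraph.top_adj]; exact h⟩

theorem dartClass_block (a : (⊤ : SimpleGraph B).Dart) :
    dartClass e ((blockHom e).mapDart a) = .inl a := by
  have h : collapse e ((blockHom e).mapDart a).fst = collapse e ((blockHom e).mapDart a).snd :=
    (collapse_incl e a.fst).trans (collapse_incl e a.snd).symm
  rw [dartClass, dif_pos h]
  exact congrArg _ (blockHom_mapDart_injective e (exists_block e h).choose_spec)

theorem dartClass_partial (a : (partialGraph (collapse e)).Dart) :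
    dartClass e ((partialGraphHom (collapse e)).mapDart a) = .inr a := by
  rw [dartClass, dif_neg (show ¬ collapse e ((partialGraphHom (collapse e)).mapDart a).fst =
    collapse e ((partialGraphHom (collapse e)).mapDart a).snd from a.adj)]
  rfl

variable (k d)

/-- The tensor product of the Jouanolou algebra of the block `B` and the partial Jouanolou algebra
over the coordinates of the block. It is isomorphic to the Jouanolou algebra of `I`. -/
def Fac : Type _ := (Jou k d (⊤ : SimpleGraph B) ⊗[k] Jou k d (partialGraph (collapse e))) ⧸
  balance (fun c : B × Fin d => LinearMap.mulLeft k (jgen k (.z c.1 c.2) : Jou k d ⊤))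
    (fun c : B × Fin d => LinearMap.mulLeft k
      (jgen k (.z (incl e c.1) c.2) : Jou k d (partialGraph (collapse e))))

instance : AddCommGroup (Fac k d e) := Submodule.Quotient.addCommGroup _

instance : Module k (Fac k d e) := Submodule.Quotient.module _

/-- The class of `a ⊗ b`. -/
def facMk : Jou k d (⊤ : SimpleGraph B) →ₗ[k] Jou k d (partialGraph (collapse e)) →ₗ[k]
    Fac k d e :=
  (TensorProduct.mk k _ _).compr₂ (Submodule.mkQ _)

variable {k d}

theorem facMk_z (b : B) (s : Fin d) (a : Jou k d (⊤ : SimpleGraph B)) (a') :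
    facMk k d e (jgen k (.z b s) * a) a' = facMk k d e a (jgen k (.z (incl e b) s) * a') :=
  balance_mk (b, s) a a'

theorem fac_ext {X : Type*} [AddCommGroup X] [Module k X] {f g : Fac k d e →ₗ[k] X}
    (h : ∀ a b, f (facMk k d e a b) = g (facMk k d e a b)) : f = g := balance_ext h

/-- A linear map out of the balanced tensor product. -/
def facLift {X : Type*} [AddCommGroup X] [Module k X]
    (f : Jou k d (⊤ : SimpleGraph B) →ₗ[k] Jou k d (partialGraph (collapse e)) →ₗ[k] X)
    (hf : ∀ b s a a', f (jgen k (.z b s) * a) a' = f a (jgen k (.z (incl e b) s) * a')) :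
    Fac k d e →ₗ[k] X :=
  balanceLift (TensorProduct.lift f) fun c a a' => by simpa using hf c.1 c.2 a a'

theorem facLift_mk {X : Type*} [AddCommGroup X] [Module k X]
    (f : Jou k d (⊤ : SimpleGraph B) →ₗ[k] Jou k d (partialGraph (collapse e)) →ₗ[k] X)
    (hf : ∀ b s a a', f (jgen k (.z b s) * a) a' = f a (jgen k (.z (incl e b) s) * a')) (a a') :
    facLift e f hf (facMk k d e a a') = f a a' := by
  refine (Submodule.liftQ_apply _ _ _).trans ?_
  simp

/-- Left multiplication by a generator of the Jouanolou algebra of the block. -/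
def facLeft (g : JGen d (⊤ : SimpleGraph B)) : Module.End k (Fac k d e) :=
  facLift e ((facMk k d e).comp (LinearMap.mulLeft k (jgen k g))) fun b s a a' => by
    simp only [LinearMap.comp_apply, LinearMap.mulLeft_apply, ← facMk_z]
    rw [← mul_assoc, ← mul_assoc, jz_central]

theorem facLeft_mk (g : JGen d (⊤ : SimpleGraph B)) (a : Jou k d ⊤) (a') :
    facLeft e g (facMk k d e a a') = facMk k d e (jgen k g * a) a' := facLift_mk _ _ _ _ _

/-- Left multiplication by a generator of degree `0` of the partial Jouanolou algebra. -/
def facRight (g : JGen d (partialGraph (collapse e))) : Module.End k (Fac k d e) :=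
  facLift e ((facMk k d e).compl₂ (LinearMap.mulLeft k (jgen k g))) fun b s a a' => by
    simp only [LinearMap.compl₂_apply, LinearMap.mulLeft_apply, facMk_z]
    rw [← mul_assoc, ← mul_assoc, jz_central]

theorem facRight_mk (g : JGen d (partialGraph (collapse e))) (a : Jou k d ⊤) (a') :
    facRight e g (facMk k d e a a') = facMk k d e a (jgen k g * a') := facLift_mk _ _ _ _ _

/-- Left multiplication by a generator of degree `1` of the partial Jouanolou algebra, with the
sign for moving it past the first factor. -/
def facOdd (g : JGen d (partialGraph (collapse e))) : Module.End k (Fac k d e) :=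
  facLift e (((facMk k d e).compl₂ (LinearMap.mulLeft k (jgen k g))).comp
    (jpar (k := k) (d := d)).toLinearMap) fun b s a a' => by
    simp only [LinearMap.comp_apply, LinearMap.compl₂_apply, LinearMap.mulLeft_apply,
      AlgHom.toLinearMap_apply, map_mul, jpar_z, facMk_z]
    rw [← mul_assoc, ← mul_assoc, jz_central]

theorem facOdd_mk (g : JGen d (partialGraph (collapse e))) (a : Jou k d ⊤) (a') :
    facOdd e g (facMk k d e a a') = facMk k d e (jpar a) (jgen k g * a') := facLift_mk _ _ _ _ _

/-- The action of the generators of the Jouanolou algebra of `I` on the balanced tensor product by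
left multiplication. -/
def facGen (g : JGen d (⊤ : SimpleGraph I)) : Module.End k (Fac k d e) :=
  match g with
  | .z a s => facRight e (.z a s)
  | .x a s => match dartClass e a with
    | .inl a' => facLeft e (.x a' s)
    | .inr a' => facRight e (.x a' s)
  | .dx a s => match dartClass e a with
    | .inl a' => facLeft e (.dx a' s)
    | .inr a' => facOdd e (.dx a' s)

theorem facRight_incl (b : B) (s : Fin d) :
    facRight (k := k) e (.z (incl e b) s) = facLeft e (.z b s) :=
  fac_ext e fun a a' => by rw [facRight_mk, facLeft_mk, facMk_z]

theorem facGen_x_block (a : (⊤ : SimpleGraph B).Dart) (s : Fin d) :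
    facGen (k := k) e (.x ((blockHom e).mapDart a) s) = facLeft e (.x a s) := by
  simp only [facGen, dartClass_block]

theorem facGen_dx_block (a : (⊤ : SimpleGraph B).Dart) (s : Fin d) :
    facGen (k := k) e (.dx ((blockHom e).mapDart a) s) = facLeft e (.dx a s) := by
  simp only [facGen, dartClass_block]

theorem facGen_x_partial (a : (partialGraph (collapse e)).Dart) (s : Fin d) :
    facGen (k := k) e (.x ((partialGraphHom _).mapDart a) s) = facRight e (.x a s) := by
  simp only [facGen, dartClass_partial]

theorem facGen_dx_partial (a : (partialGraph (collapse e)).Dart) (s : Fin d) :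
    facGen (k := k) e (.dx ((partialGraphHom _).mapDart a) s) = facOdd e (.dx a s) := by
  simp only [facGen, dartClass_partial]

theorem facGen_z_comm (a : I) (s : Fin d) (g : JGen d (⊤ : SimpleGraph I)) :
    facGen (k := k) e (.z a s) * facGen e g = facGen e g * facGen e (.z a s) := by
  refine fac_ext e fun b b' => ?_
  rw [Module.End.mul_apply, Module.End.mul_apply]
  cases g with
  | z a' s' =>
    simp only [facGen, facRight_mk]
    rw [← mul_assoc, ← mul_assoc, jz_central]
  | x a' s' =>
    obtain ⟨a', rfl⟩ | ⟨a', rfl⟩ := dart_cases e a'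
    · rw [facGen_x_block]; simp only [facGen, facRight_mk, facLeft_mk]
    · rw [facGen_x_partial]
      simp only [facGen, facRight_mk]
      rw [← mul_assoc, ← mul_assoc, jz_central]
  | dx a' s' =>
    obtain ⟨a', rfl⟩ | ⟨a', rfl⟩ := dart_cases e a'
    · rw [facGen_dx_block]; simp only [facGen, facRight_mk, facLeft_mk]
    · rw [facGen_dx_partial]
      simp only [facGen, facRight_mk, facOdd_mk]
      rw [← mul_assoc, ← mul_assoc, jz_central]

/-- The action of the Jouanolou algebra of `I` on the balanced tensor product by left
multiplication. -/
def facAct : Jou k d (⊤ : SimpleGraph I) →ₐ[k] Module.End k (Fac k d e) :=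
  jlift (facGen e) (facGen_z_comm e)
    (by
      intro a s a' s'
      refine fac_ext e fun b b' => ?_
      rw [Module.End.mul_apply, Module.End.mul_apply]
      obtain ⟨a, rfl⟩ | ⟨a, rfl⟩ := dart_cases e a <;>
        obtain ⟨a', rfl⟩ | ⟨a', rfl⟩ := dart_cases e a' <;>
        simp only [facGen_x_block, facGen_x_partial, facLeft_mk, facRight_mk] <;>
        rw [← mul_assoc, ← mul_assoc, jx_comm])
    (by
      intro a s a' s'
      refine fac_ext e fun b b' => ?_
      rw [Module.End.mul_apply, Module.End.mul_apply]
      obtain ⟨a, rfl⟩ | ⟨a, rfl⟩ := dart_cases e a <;>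
        obtain ⟨a', rfl⟩ | ⟨a', rfl⟩ := dart_cases e a' <;>
        simp only [facGen_x_block, facGen_x_partial, facGen_dx_block, facGen_dx_partial,
          facLeft_mk, facRight_mk, facOdd_mk, map_mul, jpar_x] <;>
        rw [← mul_assoc, ← mul_assoc, jx_dx_comm])
    (by
      intro a s a' s'
      refine fac_ext e fun b b' => ?_
      rw [LinearMap.neg_apply, Module.End.mul_apply, Module.End.mul_apply]
      obtain ⟨a, rfl⟩ | ⟨a, rfl⟩ := dart_cases e a <;>
        obtain ⟨a', rfl⟩ | ⟨a', rfl⟩ := dart_cases e a' <;>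
        simp only [facGen_dx_block, facGen_dx_partial,
          facLeft_mk, facOdd_mk, map_mul, jpar_dx, neg_mul, map_neg, LinearMap.neg_apply,
          neg_neg] <;>
        (rw [← mul_assoc, ← mul_assoc, jdx_comm, neg_mul, map_neg]; try rfl))
    (by
      intro a s
      refine fac_ext e fun b b' => ?_
      rw [LinearMap.neg_apply]
      obtain ⟨a, rfl⟩ | ⟨a, rfl⟩ := dart_cases e a
      · rw [show ((blockHom e).mapDart a).symm = (blockHom e).mapDart a.symm from rfl,
          facGen_x_block, facGen_x_block, facLeft_mk, facLeft_mk, jx_symm, neg_mul, map_neg]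
        rfl
      · rw [show ((partialGraphHom (collapse e)).mapDart a).symm =
            (partialGraphHom (collapse e)).mapDart a.symm from rfl,
          facGen_x_partial, facGen_x_partial, facRight_mk, facRight_mk, jx_symm, neg_mul, map_neg])
    (by
      intro a s
      refine fac_ext e fun b b' => ?_
      rw [LinearMap.neg_apply]
      obtain ⟨a, rfl⟩ | ⟨a, rfl⟩ := dart_cases e a
      · rw [show ((blockHom e).mapDart a).symm = (blockHom e).mapDart a.symm from rfl,
          facGen_dx_block, facGen_dx_block, facLeft_mk, facLeft_mk, jdx_symm, neg_mul, map_neg]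
        rfl
      · rw [show ((partialGraphHom (collapse e)).mapDart a).symm =
            (partialGraphHom (collapse e)).mapDart a.symm from rfl,
          facGen_dx_partial, facGen_dx_partial, facOdd_mk, facOdd_mk, jdx_symm, neg_mul, map_neg])
    (by
      intro a
      refine fac_ext e fun b b' => ?_
      obtain ⟨a, rfl⟩ | ⟨a, rfl⟩ := dart_cases e a
      · have h : ∀ s : Fin d, facGen (k := k) e (.x ((blockHom e).mapDart a) s) *
            (facGen e (.z ((blockHom e).mapDart a).fst s) -
              facGen e (.z ((blockHom e).mapDart a).snd s)) =
            facLeft e (.x a s) * (facLeft e (.z a.fst s) - facLeft e (.z a.snd s)) := fun s => by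
          rw [facGen_x_block, ← facRight_incl, ← facRight_incl]; rfl
        simp only [h, LinearMap.sum_apply, Module.End.mul_apply, LinearMap.sub_apply, facLeft_mk,
          map_sub, Module.End.one_apply]
        simp only [← LinearMap.sub_apply, ← map_sub, ← LinearMap.sum_apply, ← map_sum, ← mul_sub,
          ← sub_mul, ← mul_assoc, ← Finset.sum_mul]
        rw [jx_z, one_mul]
      · have h : ∀ s : Fin d, facGen (k := k) e (.x ((partialGraphHom _).mapDart a) s) *
            (facGen e (.z ((partialGraphHom _).mapDart a).fst s) -
              facGen e (.z ((partialGraphHom _).mapDart a).snd s)) =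
            facRight e (.x a s) * (facRight e (.z a.fst s) - facRight e (.z a.snd s)) := fun s => by
          rw [facGen_x_partial]; rfl
        simp only [h, LinearMap.sum_apply, Module.End.mul_apply, LinearMap.sub_apply, facRight_mk,
          map_sub, Module.End.one_apply]
        simp only [← map_sub, ← map_sum, ← mul_sub, ← sub_mul, ← mul_assoc, ← Finset.sum_mul]
        rw [jx_z, one_mul])
    (by
      intro a
      refine fac_ext e fun b b' => ?_
      obtain ⟨a, rfl⟩ | ⟨a, rfl⟩ := dart_cases e a
      · have h : ∀ s : Fin d, facGen (k := k) e (.dx ((blockHom e).mapDart a) s) *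
            (facGen e (.z ((blockHom e).mapDart a).fst s) -
              facGen e (.z ((blockHom e).mapDart a).snd s)) =
            facLeft e (.dx a s) * (facLeft e (.z a.fst s) - facLeft e (.z a.snd s)) := fun s => by
          rw [facGen_dx_block, ← facRight_incl, ← facRight_incl]; rfl
        simp only [h, LinearMap.sum_apply, Module.End.mul_apply, LinearMap.sub_apply, facLeft_mk,
          map_sub, LinearMap.zero_apply]
        simp only [← LinearMap.sub_apply, ← map_sub, ← LinearMap.sum_apply, ← map_sum, ← mul_sub,
          ← sub_mul, ← mul_assoc, ← Finset.sum_mul]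
        rw [jdx_z, zero_mul, map_zero, LinearMap.zero_apply]
      · have h : ∀ s : Fin d, facGen (k := k) e (.dx ((partialGraphHom _).mapDart a) s) *
            (facGen e (.z ((partialGraphHom _).mapDart a).fst s) -
              facGen e (.z ((partialGraphHom _).mapDart a).snd s)) =
            facOdd e (.dx a s) * (facRight e (.z a.fst s) - facRight e (.z a.snd s)) := fun s => by
          rw [facGen_dx_partial]; rfl
        simp only [h, LinearMap.sum_apply, Module.End.mul_apply, LinearMap.sub_apply, facRight_mk,
          facOdd_mk, map_sub, LinearMap.zero_apply]
        simp only [← map_sub, ← map_sum, ← mul_sub, ← sub_mul, ← mul_assoc, ← Finset.sum_mul]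
        rw [jdx_z, zero_mul, map_zero])

theorem facAct_gen (g : JGen d (⊤ : SimpleGraph I)) :
    facAct (k := k) e (jgen k g) = facGen e g := jlift_gen _ _ _ _ _ _ _ _ _ _

theorem facAct_block (a b : Jou k d (⊤ : SimpleGraph B)) (b') :
    facAct e (jmap (blockHom e) a) (facMk k d e b b') = facMk k d e (a * b) b' := by
  induction a using jou_induction generalizing b with
  | hs c =>
    rw [AlgHom.commutes, AlgHom.commutes, Module.algebraMap_end_apply, ← Algebra.smul_def,
      map_smul]; rfl
  | hg g =>
    cases g with
    | z a s =>
      rw [jmap_z, facAct_gen]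
      exact (LinearMap.congr_fun (facRight_incl e a s) _).trans (facLeft_mk _ _ _ _)
    | x a s => rw [jmap_x, facAct_gen, facGen_x_block, facLeft_mk]
    | dx a s => rw [jmap_dx, facAct_gen, facGen_dx_block, facLeft_mk]
  | hm x y hx hy => rw [map_mul, map_mul, Module.End.mul_apply, hy, hx, mul_assoc]
  | ha x y hx hy => rw [map_add, map_add, LinearMap.add_apply, hy, hx, add_mul, map_add]; rfl

theorem facAct_partial (a b' : Jou k d (partialGraph (collapse e))) :
    facAct e (jmap (partialGraphHom _) a) (facMk k d e 1 b') = facMk k d e 1 (a * b') := by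
  induction a using jou_induction generalizing b' with
  | hs c =>
    rw [AlgHom.commutes, AlgHom.commutes, Module.algebraMap_end_apply, ← Algebra.smul_def,
      map_smul]
  | hg g =>
    cases g with
    | z a s => rw [jmap_z, facAct_gen]; exact facRight_mk _ _ _ _
    | x a s => rw [jmap_x, facAct_gen, facGen_x_partial, facRight_mk]
    | dx a s => rw [jmap_dx, facAct_gen, facGen_dx_partial, facOdd_mk, map_one]
  | hm x y hx hy => rw [map_mul, map_mul, Module.End.mul_apply, hy, hx, mul_assoc]
  | ha x y hx hy => rw [map_add, map_add, LinearMap.add_apply, hy, hx, add_mul, map_add]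

/-- The inverse `ab ↦ a ⊗ b` of the multiplication map. -/
def factor : Jou k d (⊤ : SimpleGraph I) →ₗ[k] Fac k d e :=
  (facAct e).toLinearMap.flip (facMk k d e 1 1)

/-- The multiplication map is inverted by `factor`. This makes formulas in terms of products `a b`
well defined. -/
theorem factor_mul (a : Jou k d (⊤ : SimpleGraph B)) (b : Jou k d (partialGraph (collapse e))) :
    factor e (jmap (blockHom e) a * jmap (partialGraphHom _) b) = facMk k d e a b := by
  change facAct e _ _ = _
  rw [map_mul, Module.End.mul_apply, facAct_partial, mul_one, facAct_block, mul_one]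

theorem factor_z_mul (a : I) (s : Fin d) (b : Jou k d (⊤ : SimpleGraph I)) :
    factor e (jgen k (.z a s) * b) = facRight e (.z a s) (factor e b) := by
  change facAct e _ _ = _
  rw [map_mul, Module.End.mul_apply, facAct_gen]
  rfl

/-- Linear maps on `𝐉^I` agree if they agree on the products `a b` adapted to a block of indices. -/
theorem jou_ext_block {X : Type*} [AddCommGroup X] [Module k X]
    {f g : Jou k d (⊤ : SimpleGraph I) →ₗ[k] X}
    (h : ∀ r₁ r₂, ∀ a ∈ jdeg r₁, ∀ b ∈ jdeg r₂,
      f (jmap (blockHom e) a * jmap (partialGraphHom (collapse e)) b) =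
      g (jmap (blockHom e) a * jmap (partialGraphHom (collapse e)) b)) : f = g :=
  jou_hom_ext_mul _ _ (fun i => ⟨i, rfl⟩) (dart_cases e) h

end Factor

/-! ### The composition of two operations up to signs -/

section Core

variable {k : Type*} [Field k] {d : ℕ} {M : Type*} [AddCommGroup M] [Module k M]
    [Module (Weyl k (Fin d))ᵐᵒᵖ M] [IsScalarTower k (Weyl k (Fin d))ᵐᵒᵖ M]
  {I K B : Type*} [Fintype I] [DecidableEq I] [Fintype K] [DecidableEq K] [Fintype B]
  [DecidableEq B] {i : K} (e : I ≃ {j : K // j ≠ i} ⊕ B)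

/-- The restriction of a family on `I` to the indices of `K` other than `i`. -/
def outerFam (m : I → M) (j : K) : M := if h : j = i then 0 else m (outerIdx e ⟨j, h⟩)

theorem outerFam_update_outer (m : I → M) (j : {j : K // j ≠ i}) (x : M) :
    outerFam e (Function.update m (outerIdx e j) x) = Function.update (outerFam e m) j x := by
  ext j'
  by_cases h : j' = i
  · have h' : j' ≠ j := fun h'' => j.2 (h''.symm.trans h)
    rw [Function.update_of_ne h']
    simp [outerFam, h]
  · by_cases h' : j' = j
    · subst h'; simp [outerFam, h]
    · have : outerIdx e ⟨j', h⟩ ≠ outerIdx e j := fun h'' =>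
        h' (congrArg Subtype.val (outerIdx_injective e h''))
      simp [outerFam, h, h', this]

theorem outerFam_update_incl (m : I → M) (b : B) (x : M) :
    outerFam e (Function.update m (incl e b) x) = outerFam e m := by
  ext j'
  by_cases h : j' = i
  · simp [outerFam, h]
  · simp [outerFam, h, Function.update_of_ne (outerIdx_ne_incl e ⟨j', h⟩ b)]

theorem comp_incl_update_outer (m : I → M) (j : {j : K // j ≠ i}) (x : M) :
    (fun b => Function.update m (outerIdx e j) x (incl e b)) = fun b => m (incl e b) := by
  ext b
  rw [Function.update_of_ne (outerIdx_ne_incl e j b).symm]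

theorem comp_incl_update_incl (m : I → M) (b : B) (x : M) :
    (fun b' => Function.update m (incl e b) x (incl e b')) =
      Function.update (fun b => m (incl e b)) b x := by
  ext b'
  by_cases h : b' = b
  · subst h; simp
  · rw [Function.update_of_ne h, Function.update_of_ne fun h' => h (incl_injective e h')]

/-- The space of linear maps `𝐉_G(N) → Δ_* M` for the complete graph on `B`. -/
abbrev OpOn (k : Type*) [Field k] (d : ℕ) (M : Type*) [AddCommGroup M] [Module k M]
    [Module (Weyl k (Fin d))ᵐᵒᵖ M] [IsScalarTower k (Weyl k (Fin d))ᵐᵒᵖ M] (B : Type*)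
    [Fintype B] [DecidableEq B] : Type _ :=
  JModel k d (⊤ : SimpleGraph B) (Box k B M) →ₗ[k] DiagOn k d M B

/-- Linearity over the differential operators. -/
abbrev IsDLin (ν : OpOn k d M B) : Prop :=
  ∀ (P : (Weyl k (B × Fin d))ᵐᵒᵖ) x, ν (P • x) = P • ν x

theorem IsDLin.ract {ν : OpOn k d M B} (hν : IsDLin ν) (P : Weyl k (B × Fin d)) (x) :
    ν (HigherChiral.ract P x) = HigherChiral.ract P (ν x) := hν _ x

theorem isDLin_of_ract {ν : OpOn k d M B}
    (hz : ∀ (c : B × Fin d) x, ν (ract (wz k c) x) = ract (wz k c) (ν x))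
    (hd : ∀ (c : B × Fin d) x, ν (ract (wpd k c) x) = ract (wpd k c) (ν x)) : IsDLin ν :=
  map_smul_of_map_ract ν hz hd

/-- `𝒟`-linearity may be tested on the elements `m ⊗ a`. -/
theorem isDLin_of_mk {ν : OpOn k d M B}
    (hz : ∀ (c : B × Fin d) n a, ν (ract (wz k c) (jmMk _ n a)) = ract (wz k c) (ν (jmMk _ n a)))
    (hd : ∀ (c : B × Fin d) n a, ν (ract (wpd k c) (jmMk _ n a)) =
      ract (wpd k c) (ν (jmMk _ n a))) : IsDLin ν :=
  isDLin_of_ract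
    (fun c x => LinearMap.congr_fun (f := ν ∘ₗ ract (wz k c)) (g := ract (wz k c) ∘ₗ ν)
      (jm_ext fun n a => hz c n a) x)
    (fun c x => LinearMap.congr_fun (f := ν ∘ₗ ract (wpd k c)) (g := ract (wpd k c) ∘ₗ ν)
      (jm_ext fun n a => hd c n a) x)

/-- The multilinear map underlying `insertOp`. -/
def insertMulti (τ : K → Module.End k M) (ν : OpOn k d M B) : MultilinearMap k (fun _ : I => M)
    (Jou k d (⊤ : SimpleGraph B) →ₗ[k]
      Push (k := k) (liftIdx (d := d) (collapse e)) (Box k K M)) :=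
  MultilinearMap.mk' (fun m => insertPush e (fun j => τ j (outerFam e m j)) ∘ₗ ν ∘ₗ
      jmMk _ (box k fun b => m (incl e b)))
    (fun m a x y => by
      obtain ⟨j, rfl⟩ | ⟨b, rfl⟩ := idx_cases e a
      · simp only [outerFam_update_outer, comp_incl_update_outer]
        have h : ∀ x, (fun j' => τ j' (Function.update (outerFam e m) j x j')) =
            Function.update (fun j' => τ j' (outerFam e m j')) j (τ j x) := fun x => by
          ext j'
          by_cases h : j' = j
          · subst h; simp
          · simp [h]
        rw [h, h, h, map_add, insertPush_update_add _ _ j.2]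
        rfl
      · simp only [outerFam_update_incl, comp_incl_update_incl, MultilinearMap.map_update_add,
          map_add, LinearMap.comp_add])
    (fun m a c x => by
      obtain ⟨j, rfl⟩ | ⟨b, rfl⟩ := idx_cases e a
      · simp only [outerFam_update_outer, comp_incl_update_outer]
        have h : ∀ x, (fun j' => τ j' (Function.update (outerFam e m) j x j')) =
            Function.update (fun j' => τ j' (outerFam e m j')) j (τ j x) := fun x => by
          ext j'
          by_cases h : j' = j
          · subst h; simp
          · simp [h]
        rw [h, h, map_smul, insertPush_update_smul _ _ j.2]
        rfl
      · simp only [outerFam_update_incl, comp_incl_update_incl, MultilinearMap.map_update_smul,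
          map_smul, LinearMap.comp_smul])

/-- The application of `ν` to the inputs in the block `B`:
`m'' ⊠ m' ↦ (a ↦ τ m'' ⊠ ν (m' ⊗ a))`. The operators `τ j` on the inputs outside the block serve to
encode signs. -/
def insertOp (τ : K → Module.End k M) (ν : OpOn k d M B) : Box k I M →ₗ[k]
    Jou k d (⊤ : SimpleGraph B) →ₗ[k]
      Push (k := k) (liftIdx (d := d) (collapse e)) (Box k K M) :=
  PiTensorProduct.lift (insertMulti e τ ν)

theorem insertOp_box (τ : K → Module.End k M) (ν : OpOn k d M B) (m : I → M)
    (a : Jou k d (⊤ : SimpleGraph B)) : insertOp e τ ν (box k m) a =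
      insertPush e (fun j => τ j (outerFam e m j)) (ν (jmMk _ (box k fun b => m (incl e b)) a)) :=
  LinearMap.congr_fun (PiTensorProduct.lift.tprod (φ := insertMulti e τ ν) m) a

theorem insertOp_glue (τ : K → Module.End k M) (ν : OpOn k d M B) (m'' : K → M) (m' : B → M)
    (a : Jou k d (⊤ : SimpleGraph B)) : insertOp e τ ν (box k (glue e m'' m')) a =
      insertPush e (fun j => τ j (m'' j)) (ν (jmMk _ (box k m') a)) := by
  rw [insertOp_box]
  simp only [glue_incl]
  refine LinearMap.congr_fun (insertPush_congr e fun j hj => ?_) _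
  rw [outerFam, dif_neg hj, glue_outerIdx]

section

variable {τ : K → Module.End k M} (hτ : ∀ j (P : Weyl k (Fin d)),
    τ j * ract P = ract P * τ j) {ν : OpOn k d M B}
  (hν : IsDLin ν)

include hν in
theorem insertOp_z_mul (n : Box k I M) (b : B) (s : Fin d) (a : Jou k d (⊤ : SimpleGraph B)) :
    insertOp e τ ν n (jgen k (.z b s) * a) =
      ract (wz k (incl e b, s)) (insertOp e τ ν n a) := by
  refine LinearMap.congr_fun (f := (insertOp e τ ν).flip (jgen k (.z b s) * a))
    (g := ract (wz k (incl e b, s)) ∘ₗ (insertOp e τ ν).flip a) (box_ext fun m => ?_) n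
  simp only [LinearMap.comp_apply, LinearMap.flip_apply, insertOp_box]
  rw [← ract_jm_z (b, s), hν.ract, insertPush_z]
  rfl

include hτ hν in
theorem insertOp_z (n : Box k I M) (c : I × Fin d) (a : Jou k d (⊤ : SimpleGraph B)) :
    insertOp e τ ν (ract (wz k c) n) a = ract (wz k c) (insertOp e τ ν n a) := by
  refine LinearMap.congr_fun (f := (insertOp e τ ν).flip a ∘ₗ ract (wz k c))
    (g := ract (wz k c) ∘ₗ (insertOp e τ ν).flip a) (box_ext fun m => ?_) n
  obtain ⟨v, s⟩ := c
  simp only [LinearMap.comp_apply, LinearMap.flip_apply, ract_box_z, slot_box, insertOp_box]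
  obtain ⟨j, rfl⟩ | ⟨b, rfl⟩ := idx_cases e v
  · simp only [outerFam_update_outer, comp_incl_update_outer]
    rw [← insertPush_update_z]
    congr 2
    ext j'
    by_cases h : j' = j
    · subst h
      have := LinearMap.congr_fun (hτ j (wz k s)) (m (outerIdx e j))
      simp only [Module.End.mul_apply] at this
      simp [outerFam, j.2, this]
    · simp [h]
  · simp only [outerFam_update_incl, comp_incl_update_incl]
    have : box k (Function.update (fun b => m (incl e b)) b (ract (wz k s) (m (incl e b)))) =
        ract (wz k (b, s)) (box k fun b => m (incl e b)) := by rw [ract_box_z, slot_box]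
    rw [this, jmMk_z, ← ract_jm_z (b, s), hν.ract, insertPush_z]
    rfl

include hτ in
theorem insertOp_pd_outer (n : Box k I M) (j : {j : K // j ≠ i}) (s : Fin d)
    (a : Jou k d (⊤ : SimpleGraph B)) :
    insertOp e τ ν (ract (wpd k (outerIdx e j, s)) n) a =
      ract (wpd k (outerIdx e j, s)) (insertOp e τ ν n a) := by
  refine LinearMap.congr_fun
    (f := (insertOp e τ ν).flip a ∘ₗ ract (wpd k (outerIdx e j, s)))
    (g := ract (wpd k (outerIdx e j, s)) ∘ₗ (insertOp e τ ν).flip a) (box_ext fun m => ?_) n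
  simp only [LinearMap.comp_apply, LinearMap.flip_apply, ract_box_pd, slot_box, insertOp_box,
    outerFam_update_outer, comp_incl_update_outer]
  rw [← insertPush_update_pd]
  congr 2
  ext j'
  by_cases h : j' = j
  · subst h
    have := LinearMap.congr_fun (hτ j (wpd k s)) (m (outerIdx e j))
    simp only [Module.End.mul_apply] at this
    simp [outerFam, j.2, this]
  · simp [h]

include hν in
theorem insertOp_pd_incl (n : Box k I M) (b : B) (s : Fin d)
    (a : Jou k d (⊤ : SimpleGraph B)) :
    insertOp e τ ν (ract (wpd k (incl e b, s)) n) a =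
      ract (wpd k (incl e b, s)) (insertOp e τ ν n a) + insertOp e τ ν n (jpd b s a) := by
  refine LinearMap.congr_fun
    (f := (insertOp e τ ν).flip a ∘ₗ ract (wpd k (incl e b, s)))
    (g := ract (wpd k (incl e b, s)) ∘ₗ (insertOp e τ ν).flip a +
      (insertOp e τ ν).flip (jpd b s a)) (box_ext fun m => ?_) n
  simp only [LinearMap.comp_apply, LinearMap.flip_apply, LinearMap.add_apply, ract_box_pd,
    slot_box, insertOp_box, outerFam_update_incl, comp_incl_update_incl]
  have : box k (Function.update (fun b => m (incl e b)) b (ract (wpd k s) (m (incl e b)))) =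
      ract (wpd k (b, s)) (box k fun b => m (incl e b)) := by rw [ract_box_pd, slot_box]
  rw [this, jmMk_pd, map_add, map_add, hν.ract, insertPush_pd]
  rfl

end

/-- The bilinear map underlying `coreComp`. -/
def coreFac {τ : K → Module.End k M} {μ : OpOn k d M K} (hμ : IsDLin μ) {ν : OpOn k d M B}
    (hν : IsDLin ν) : Fac k d e →ₗ[k] Box k I M →ₗ[k] DiagOn k d M I :=
  facLift e (LinearMap.mk₂ k (fun a b => outerOn (collapse e) μ hμ ∘ₗ (jmMk _).flip b ∘ₗ
      (insertOp e τ ν).flip a)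
    (fun a a' b => LinearMap.ext fun n => by simp) (fun c a b => LinearMap.ext fun n => by simp)
    (fun a b b' => LinearMap.ext fun n => by simp) (fun c a b => LinearMap.ext fun n => by simp))
    fun b s a a' => LinearMap.ext fun n => by
      simp only [LinearMap.mk₂_apply, LinearMap.comp_apply, LinearMap.flip_apply]
      rw [insertOp_z_mul e hν, jmMk_z]

variable (τ : K → Module.End k M) (hτ : ∀ j (P : Weyl k (Fin d)), τ j * ract P = ract P * τ j)
  {μ : OpOn k d M K} (hμ : IsDLin μ) {ν : OpOn k d M B} (hν : IsDLin ν)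

/-- The composition of two `𝒟`-linear operations,
`(m'' ⊠ m') ⊗ a b ↦ μ (w ((τ m'' ⊠ ν (m' ⊗ a)) ⊗ b))`. -/
def coreComp : OpOn k d M I :=
  jmLift ((coreFac (τ := τ) e hμ hν ∘ₗ factor e).flip) fun c n α => by
    simp only [LinearMap.flip_apply, LinearMap.comp_apply, factor_z_mul]
    refine LinearMap.congr_fun (f := (coreFac e hμ hν).flip (ract (wz k c) n))
      (g := (coreFac e hμ hν).flip n ∘ₗ facRight e (.z c.1 c.2)) (fac_ext e fun a b => ?_) _
    simp only [LinearMap.flip_apply, LinearMap.comp_apply, facRight_mk]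
    rw [coreFac, facLift_mk, facLift_mk]
    simp only [LinearMap.mk₂_apply, LinearMap.comp_apply, LinearMap.flip_apply]
    rw [insertOp_z e hτ hν, jmMk_z]

theorem coreComp_mk (n : Box k I M) (a : Jou k d (⊤ : SimpleGraph B))
    (b : Jou k d (partialGraph (collapse e))) :
    coreComp e τ hτ hμ hν (jmMk _ n (jmap (blockHom e) a * jmap (partialGraphHom _) b)) =
      outerOn (collapse e) μ hμ (jmMk _ (insertOp e τ ν n a) b) := by
  rw [coreComp, jmLift_mk, LinearMap.flip_apply, LinearMap.comp_apply, factor_mul, coreFac,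
    facLift_mk]
  rfl

theorem coreComp_isDLin : IsDLin (coreComp e τ hτ hμ hν) := by
  refine isDLin_of_mk (fun c n α => ?_) (fun c n α => ?_)
  · refine LinearMap.congr_fun (f := coreComp e τ hτ hμ hν ∘ₗ ract (wz k c) ∘ₗ jmMk _ n)
      (g := ract (wz k c) ∘ₗ coreComp e τ hτ hμ hν ∘ₗ jmMk _ n) (jou_ext_block e
        fun _ _ a _ b _ => ?_) α
    simp only [LinearMap.comp_apply]
    rw [ract_jm_z', coreComp_mk, coreComp_mk, insertOp_z e hτ hν, ← outerOn_ract, ract_jm_z']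
  · refine LinearMap.congr_fun (f := coreComp e τ hτ hμ hν ∘ₗ ract (wpd k c) ∘ₗ jmMk _ n)
      (g := ract (wpd k c) ∘ₗ coreComp e τ hτ hμ hν ∘ₗ jmMk _ n) (jou_ext_block e
        fun _ _ a _ b _ => ?_) α
    simp only [LinearMap.comp_apply]
    rw [ract_jm_pd, map_sub, jpd_mul, map_add, map_add, coreComp_mk, coreComp_mk]
    obtain ⟨v, s⟩ := c
    have h2 : jpd v s (jmap (partialGraphHom (collapse e)) b) =
        jmap (partialGraphHom (collapse e)) (jpd v s b) :=
      jpd_jmap_of_injective (partialGraphHom (collapse e)) (fun _ _ h => h) v s b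
    simp only [h2, coreComp_mk]
    obtain ⟨j, rfl⟩ | ⟨b', rfl⟩ := idx_cases e v
    · have h1 : jpd (outerIdx e j) s (jmap (blockHom e) a) = 0 :=
        jpd_jmap_of_notMem _ (outerIdx e j, s) (fun b h => outerIdx_ne_incl e j b h.symm) a
      rw [h1, zero_mul, map_zero, map_zero, insertOp_pd_outer e hτ, outerOn_pd, zero_add,
        add_sub_cancel_right]
    · have h1 : jpd (incl e b') s (jmap (blockHom e) a) = jmap (blockHom e) (jpd b' s a) :=
        jpd_jmap_of_injective (blockHom e) (incl_injective e) b' s a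
      rw [h1, coreComp_mk, insertOp_pd_incl e hν, map_add, LinearMap.add_apply, map_add,
        outerOn_pd]
      abel

end Core

/-! ### Homogeneous elements -/

section Homogeneous

variable {k : Type*} [Field k] {d : ℕ} {M : Type*} [AddCommGroup M] [Module k M]
    [Module (Weyl k (Fin d))ᵐᵒᵖ M] [IsScalarTower k (Weyl k (Fin d))ᵐᵒᵖ M]
    (𝓜 : DGStructure k d M) {B : Type*} [Fintype B] [DecidableEq B]

/-- Linear maps on an exterior product agree if they agree on products of homogeneous elements. -/
theorem box_hom_ext {X : Type*} [AddCommGroup X] [Module k X] {f g : Box k B M →ₗ[k] X}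
    (h : ∀ (ε : B → ℤ) (m : B → M), (∀ j, m j ∈ 𝓜.deg (ε j)) → f (box k m) = g (box k m)) :
    f = g := by
  have key : ∀ (s : Finset B) (m : B → M), (∀ j, j ∉ s → ∃ p, m j ∈ 𝓜.deg p) →
      f (box k m) = g (box k m) := by
    intro s
    induction s using Finset.induction_on with
    | empty =>
      intro m hm
      choose ε hε using fun j => hm j (Finset.notMem_empty j)
      exact h ε m hε
    | insert a s ha ih =>
      intro m hm
      have hx : ∀ x ∈ ⨆ p, 𝓜.deg p, f (box k (Function.update m a x)) =
          g (box k (Function.update m a x)) := by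
        intro x hx
        induction hx using Submodule.iSup_induction' with
        | mem p x hx =>
          refine ih _ fun j hj => ?_
          by_cases hja : j = a
          · subst hja; exact ⟨p, by simpa using hx⟩
          · rw [Function.update_of_ne hja]
            exact hm j (by simp [hja, hj])
        | zero => simp [MultilinearMap.map_update_zero]
        | add x y _ _ hx hy => rw [MultilinearMap.map_update_add, map_add, map_add, hx, hy]
      have := hx (m a) (by rw [𝓜.internal.submodule_iSup_eq_top]; trivial)
      simpa using this
  exact box_ext fun m => key Finset.univ m fun j hj => absurd (Finset.mem_univ j) hj

theorem jouBox_hom_ext {G : SimpleGraph B} {X : Type*} [AddCommGroup X] [Module k X]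
    {f g : JModel k d G (Box k B M) →ₗ[k] X}
    (h : ∀ (ε : B → ℤ) (m : B → M) (r : ℕ) (a : Jou k d G), (∀ j, m j ∈ 𝓜.deg (ε j)) →
      a ∈ jdeg r → f (jmMk G (box k m) a) = g (jmMk G (box k m) a)) : f = g := by
  refine jm_ext fun n a => ?_
  refine LinearMap.congr_fun (f := f ∘ₗ (jmMk G).flip a) (g := g ∘ₗ (jmMk G).flip a)
    (box_hom_ext 𝓜 fun ε m hm => ?_) n
  exact LinearMap.congr_fun (f := f ∘ₗ jmMk G (box k m)) (g := g ∘ₗ jmMk G (box k m))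
    (jou_hom_ext fun r a ha => h ε m r a hm ha) a

/-- Linear maps on `𝐉(M^{⊠ I})` agree if they agree on the elements `(m'' ⊠ m') ⊗ a b` with
homogeneous factors which are adapted to a block of inputs. -/
theorem jouBox_glue_ext {I K : Type*} [Fintype I] [DecidableEq I] {i : K}
    (e : I ≃ {j : K // j ≠ i} ⊕ B) {X : Type*} [AddCommGroup X] [Module k X]
    {f g : JModel k d (⊤ : SimpleGraph I) (Box k I M) →ₗ[k] X}
    (h : ∀ (ε : K → ℤ) (ε' : B → ℤ) (m'' : K → M) (m' : B → M) (r r' : ℕ)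
      (a : Jou k d (⊤ : SimpleGraph B)) (b : Jou k d (partialGraph (collapse e))),
      (∀ j, m'' j ∈ 𝓜.deg (ε j)) → (∀ j, m' j ∈ 𝓜.deg (ε' j)) → a ∈ jdeg r → b ∈ jdeg r' →
      f (jmMk _ (box k (glue e m'' m')) (jmap (blockHom e) a * jmap (partialGraphHom _) b)) =
      g (jmMk _ (box k (glue e m'' m')) (jmap (blockHom e) a * jmap (partialGraphHom _) b))) :
    f = g := by
  classical
  refine jm_ext fun n α => ?_
  refine LinearMap.congr_fun (f := f ∘ₗ (jmMk ⊤).flip α) (g := g ∘ₗ (jmMk ⊤).flip α)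
    (box_hom_ext 𝓜 fun ε m hm => ?_) n
  refine LinearMap.congr_fun (f := f ∘ₗ jmMk ⊤ (box k m)) (g := g ∘ₗ jmMk ⊤ (box k m))
    (jou_ext_block e fun r r' a ha b hb => ?_) α
  have hm' : m = glue e (fun j => if h : j = i then 0 else m (outerIdx e ⟨j, h⟩))
      (fun b => m (incl e b)) := by
    ext a
    obtain ⟨j, rfl⟩ | ⟨b, rfl⟩ := idx_cases e a
    · rw [glue_outerIdx, dif_neg j.2]
    · rw [glue_incl]
  simp only [LinearMap.comp_apply]
  rw [hm']
  refine h (fun j => if h : j = i then 0 else ε (outerIdx e ⟨j, h⟩)) (fun b => ε (incl e b)) _ _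
    r r' a b (fun j => ?_) (fun b => hm _) ha hb
  by_cases hj : j = i
  · simp [hj]
  · simp only [hj, dite_false]; exact hm _

end Homogeneous

/-! ### Signs -/

section Signs

variable {k : Type*} [Field k] {d : ℕ} {M : Type*} [AddCommGroup M] [Module k M]
    [Module (Weyl k (Fin d))ᵐᵒᵖ M] [IsScalarTower k (Weyl k (Fin d))ᵐᵒᵖ M]
    (𝓜 : DGStructure k d M) {B : Type*} [Fintype B] [DecidableEq B]

theorem negOnePow_smul_eq {X : Type*} [AddCommGroup X] [Module k X] (p : ℤ) (x : X) :
    ((p.negOnePow : ℤ) : k) • x = p.negOnePow • x := by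
  rw [Int.cast_smul_eq_zsmul, Units.smul_def]

theorem negOnePow_congr {p q : ℤ} (h : Even (p - q)) : p.negOnePow = q.negOnePow :=
  (Int.negOnePow_eq_iff p q).2 h

theorem map_negOnePow_smul {X Y : Type*} [AddCommGroup X] [Module k X] [AddCommGroup Y]
    [Module k Y] (f : X →ₗ[k] Y) (p : ℤ) (x : X) : f (p.negOnePow • x) = p.negOnePow • f x := by
  rw [Units.smul_def, Units.smul_def, map_zsmul]

theorem negOnePow_smul_apply {X Y : Type*} [AddCommGroup X] [Module k X] [AddCommGroup Y]
    [Module k Y] (f : X →ₗ[k] Y) (p : ℤ) (x : X) : (p.negOnePow • f) x = p.negOnePow • f x := by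
  rw [Units.smul_def, Units.smul_def, LinearMap.smul_apply]

theorem negOnePow_smul_smul {X : Type*} [AddCommGroup X] (p q : ℤ) (x : X) :
    p.negOnePow • q.negOnePow • x = (p + q).negOnePow • x := by
  rw [smul_smul, Int.negOnePow_add]

/-- The operator acting on `M^p` as the sign `(-1)^{s p}`. -/
def signOp (s : ℤ) : Module.End k M := 𝓜.degScale fun p => (((s * p).negOnePow : ℤ) : k)

theorem signOp_of_mem (s : ℤ) {p : ℤ} {m : M} (h : m ∈ 𝓜.deg p) :
    signOp 𝓜 s m = (s * p).negOnePow • m := by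
  rw [signOp, 𝓜.degScale_of_mem _ h, negOnePow_smul_eq]

theorem parity_of_mem {p : ℤ} {m : M} (h : m ∈ 𝓜.deg p) : 𝓜.parity m = p.negOnePow • m := by
  rw [DGStructure.parity, 𝓜.degScale_of_mem _ h, negOnePow_smul_eq]

theorem box_signs (p : B → ℤ) (m : B → M) :
    box k (fun j => (p j).negOnePow • m j) = (∑ j, p j).negOnePow • box k m := by
  have h1 : ∀ j, (p j).negOnePow • m j = (((p j).negOnePow : ℤ) : k) • m j :=
    fun j => (negOnePow_smul_eq _ _).symm
  simp only [h1]
  rw [MultilinearMap.map_smul_univ, ← negOnePow_smul_eq (k := k)]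
  congr 1
  have : ∀ s : Finset B, ∏ j ∈ s, (((p j).negOnePow : ℤ) : k) =
      (((∑ j ∈ s, p j).negOnePow : ℤ) : k) := by
    intro s
    induction s using Finset.induction_on with
    | empty => simp
    | insert a s ha ih => rw [Finset.prod_insert ha, Finset.sum_insert ha, ih, Int.negOnePow_add]
                          push_cast; rfl
  exact this _

theorem boxMap_parity {ε : B → ℤ} {m : B → M} (h : ∀ j, m j ∈ 𝓜.deg (ε j)) :
    boxMap (fun _ => 𝓜.parity) (box k m) = (∑ j, ε j).negOnePow • box k m := by
  rw [boxMap_box, ← box_signs]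
  congr 1
  ext j
  exact parity_of_mem 𝓜 (h j)

theorem insertPush_sign {I K : Type*} [Fintype I] [Fintype K] [DecidableEq K] {i : K}
    (e : I ≃ {j : K // j ≠ i} ⊕ B) (p : K → ℤ) (m'' : K → M) :
    insertPush (k := k) (d := d) e (fun j => (p j).negOnePow • m'' j) =
      (∑ j, if j = i then 0 else p j).negOnePow • insertPush e m'' :=
  pu_ext fun x F => by
    rw [Units.smul_def, LinearMap.smul_apply, ← Units.smul_def, insertPush_mk, insertPush_mk]
    have : Function.update (fun j => (p j).negOnePow • m'' j) i x =
        fun j => (if j = i then 0 else p j).negOnePow • Function.update m'' i x j := by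
      ext j
      by_cases h : j = i
      · subst h; simp
      · simp [h]
    rw [this, box_signs, map_negOnePow_smul, Units.smul_def, Units.smul_def, LinearMap.smul_apply]

/-! ### Parity of operations -/

theorem boxMap_ract_z (τ : B → Module.End k M)
    (hτ : ∀ j (P : Weyl k (Fin d)), τ j * ract P = ract P * τ j) (c : B × Fin d) (n : Box k B M) :
    boxMap τ (ract (wz k c) n) = ract (wz k c) (boxMap τ n) := by
  rw [ract_box_z]
  exact LinearMap.congr_fun (boxMap_slot τ c.1 _ (hτ _ _)) n

theorem boxMap_ract_pd (τ : B → Module.End k M)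
    (hτ : ∀ j (P : Weyl k (Fin d)), τ j * ract P = ract P * τ j) (c : B × Fin d) (n : Box k B M) :
    boxMap τ (ract (wpd k c) n) = ract (wpd k c) (boxMap τ n) := by
  rw [ract_box_pd]
  exact LinearMap.congr_fun (boxMap_slot τ c.1 _ (hτ _ _)) n

/-- The operator `m ⊗ a ↦ τ m ⊗ (-1)^|a| a` on `𝐉_G(M^{⊠ B})`. -/
def jmTwist {G : SimpleGraph B} (τ : B → Module.End k M)
    (hτ : ∀ j (P : Weyl k (Fin d)), τ j * ract P = ract P * τ j) :
    Module.End k (JModel k d G (Box k B M)) :=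
  jmLift (((jmMk G).comp (boxMap τ)).compl₂ jpar.toLinearMap) fun c n a => by
    simp only [LinearMap.comp_apply, LinearMap.compl₂_apply, AlgHom.toLinearMap_apply, map_mul,
      jpar_z, boxMap_ract_z τ hτ, jmMk_z]

theorem jmTwist_mk {G : SimpleGraph B} (τ : B → Module.End k M)
    (hτ : ∀ j (P : Weyl k (Fin d)), τ j * ract P = ract P * τ j) (n : Box k B M)
    (a : Jou k d G) : jmTwist τ hτ (jmMk G n a) = jmMk G (boxMap τ n) (jpar a) :=
  jmLift_mk _ _ _ _

theorem jmTwist_smul {G : SimpleGraph B} (τ : B → Module.End k M)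
    (hτ : ∀ j (P : Weyl k (Fin d)), τ j * ract P = ract P * τ j) (P : (Weyl k (B × Fin d))ᵐᵒᵖ)
    (x : JModel k d G (Box k B M)) : jmTwist τ hτ (P • x) = P • jmTwist τ hτ x := by
  refine map_smul_of_map_ract _ (fun c x => ?_) (fun c x => ?_) P x
  · refine LinearMap.congr_fun (f := jmTwist τ hτ ∘ₗ ract (wz k c))
      (g := ract (wz k c) ∘ₗ jmTwist τ hτ) (jm_ext fun n a => ?_) x
    simp only [LinearMap.comp_apply]
    rw [ract_jm_z, jmTwist_mk, jmTwist_mk, ract_jm_z, map_mul (jpar (k := k) (d := d)), jpar_z]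
  · refine LinearMap.congr_fun (f := jmTwist τ hτ ∘ₗ ract (wpd k c))
      (g := ract (wpd k c) ∘ₗ jmTwist τ hτ) (jm_ext fun n a => ?_) x
    simp only [LinearMap.comp_apply]
    rw [ract_jm_pd, map_sub, jmTwist_mk, jmTwist_mk, jmTwist_mk, ract_jm_pd,
      boxMap_ract_pd τ hτ, jpd_jpar]

/-- The operator `m ⊗ F ↦ f m ⊗ F` on the pushforward along the diagonal. -/
def diagEnd (f : Module.End k M) (hf : ∀ P : Weyl k (Fin d), f * ract P = ract P * f) :
    Module.End k (DiagOn k d M B) :=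
  puLift ((puMk _).comp f) fun c m F => by
    have h := LinearMap.congr_fun (hf (wpd k c)) m
    rw [Module.End.mul_apply, Module.End.mul_apply] at h
    simp only [LinearMap.comp_apply, h, puMk_pd]

theorem diagEnd_mk (f : Module.End k M) (hf : ∀ P : Weyl k (Fin d), f * ract P = ract P * f)
    (m : M) (F : MvPolynomial (B × Fin d) k) :
    diagEnd f hf (puMk (fun c : B × Fin d => c.2) m F) = puMk _ (f m) F := puLift_mk _ _ _ _

theorem diagEnd_ract_pd (f : Module.End k M)
    (hf : ∀ P : Weyl k (Fin d), f * ract P = ract P * f) (c : B × Fin d) (y : DiagOn k d M B) :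
    diagEnd f hf (ract (wpd k c) y) = ract (wpd k c) (diagEnd f hf y) := by
  induction y using push_induction with
  | ha y y' hy hy' => simp only [map_add, hy, hy']
  | hm m F => rw [ract_push_pd_mk, diagEnd_mk, diagEnd_mk, ract_push_pd_mk]

theorem diagEnd_smul (f : Module.End k M)
    (hf : ∀ P : Weyl k (Fin d), f * ract P = ract P * f) (P : (Weyl k (B × Fin d))ᵐᵒᵖ)
    (y : DiagOn k d M B) : diagEnd f hf (P • y) = P • diagEnd f hf y := by
  refine map_smul_of_map_ract _ (fun c y => ?_) (diagEnd_ract_pd f hf) P y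
  induction y using push_induction with
  | ha y y' hy hy' => simp only [map_add, hy, hy']
  | hm m F =>
    have h := LinearMap.congr_fun (hf (wz k c.2)) m
    rw [Module.End.mul_apply, Module.End.mul_apply] at h
    rw [ract_push_z_mk, map_add, diagEnd_mk, diagEnd_mk, diagEnd_mk, ract_push_z_mk, h]

theorem parity_ract (P : Weyl k (Fin d)) : 𝓜.parity * ract P = ract P * 𝓜.parity :=
  𝓜.degScale_ract _ P

/-- The sign operator `x ↦ (-1)^|x| x` on `𝐉(M^{⊠ B})`. -/
def srcPar : Module.End k (JModel k d (⊤ : SimpleGraph B) (Box k B M)) :=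
  jmTwist (fun _ => 𝓜.parity) fun _ => parity_ract 𝓜

/-- The sign operator `y ↦ (-1)^|y| y` on `Δ_* M`. -/
def tgtPar : Module.End k (DiagOn k d M B) :=
  diagEnd 𝓜.parity (parity_ract 𝓜)

/-- The operator `m ⊗ a ↦ m ⊗ (-1)^|a| a` on `𝐉(M^{⊠ B})`. -/
def varPar : Module.End k (JModel k d (⊤ : SimpleGraph B) (Box k B M)) :=
  jmTwist (fun _ => 1) fun _ _ => by rw [one_mul, mul_one]

theorem varPar_mk (n : Box k B M) (a : Jou k d (⊤ : SimpleGraph B)) :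
    varPar (jmMk _ n a) = jmMk _ n (jpar a) := by
  rw [varPar, jmTwist_mk]
  congr 1
  refine LinearMap.congr_fun (g := LinearMap.id) (box_ext fun m => ?_) n ▸ rfl
  rw [boxMap_box]; rfl

/-- The sign `f ↦ (-1)^|f| f` on the space of operations. -/
def opPar : Module.End k (OpOn k d M B) :=
  LinearMap.compRight k (tgtPar 𝓜) ∘ₗ LinearMap.lcomp k _ (srcPar 𝓜)

theorem opPar_apply (f : OpOn k d M B) (x) : opPar 𝓜 f x = tgtPar 𝓜 (f (srcPar 𝓜 x)) := rfl

theorem opPar_isDLin {f : OpOn k d M B} (hf : IsDLin f) : IsDLin (opPar 𝓜 f) := fun P x => by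
  rw [opPar_apply, opPar_apply, srcPar, jmTwist_smul, hf, tgtPar, diagEnd_smul]

theorem IsDLin.add {f g : OpOn k d M B} (hf : IsDLin f) (hg : IsDLin g) : IsDLin (f + g) :=
  fun P x => by rw [LinearMap.add_apply, LinearMap.add_apply, hf, hg, smul_add]

theorem IsDLin.smul (c : k) {f : OpOn k d M B} (hf : IsDLin f) : IsDLin (c • f) :=
  fun P x => by
    rw [LinearMap.smul_apply, LinearMap.smul_apply, hf]
    exact ((Algebra.lsmul k k _ P).map_smul c (f x)).symm

theorem IsDLin.zsmul (c : ℤ) {f : OpOn k d M B} (hf : IsDLin f) : IsDLin (c • f) := by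
  rw [← Int.cast_smul_eq_zsmul k]; exact hf.smul _

/-- The summand of an operation `ν` which has the parity of `s` and acts by `ν` on those `m ⊗ a` for
which `a` has the parity of `t`, and by zero on the others. -/
def parityPart (s t : ℤ) : Module.End k (OpOn k d M B) :=
  (4⁻¹ : k) • ((LinearMap.id + (t.negOnePow : ℤ) • LinearMap.lcomp k _ varPar) ∘ₗ
    (LinearMap.id + (s.negOnePow : ℤ) • opPar 𝓜))

theorem parityPart_isDLin (s t : ℤ) {f : OpOn k d M B} (hf : IsDLin f) :
    IsDLin (parityPart 𝓜 s t f) := by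
  have h1 := hf.add ((opPar_isDLin 𝓜 hf).zsmul s.negOnePow)
  have h2 : IsDLin (LinearMap.lcomp k _ varPar (f + (s.negOnePow : ℤ) • opPar 𝓜 f)) :=
    fun P x => by rw [LinearMap.lcomp_apply, LinearMap.lcomp_apply, varPar, jmTwist_smul, h1]
  exact (h1.add (h2.zsmul t.negOnePow)).smul _

/-! ### Homogeneous operations -/

/-- The elements of `𝐉(M^{⊠ B})` of degree `p`. -/
def srcDeg (B : Type*) [Fintype B] [DecidableEq B] (p : ℤ) :
    Submodule k (JModel k d (⊤ : SimpleGraph B) (Box k B M)) :=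
  Submodule.span k {x | ∃ (e : B → ℤ) (m : B → M) (r : ℕ) (a : Jou k d ⊤),
    (∀ i, m i ∈ 𝓜.deg (e i)) ∧ a ∈ jdeg r ∧ ∑ i, e i + r = p ∧ x = jmMk ⊤ (box k m) a}

/-- The elements of `Δ_* M` of degree `p`. -/
def tgtDeg (B : Type*) [Fintype B] (p : ℤ) : Submodule k (DiagOn k d M B) :=
  Submodule.span k {x | ∃ (m : M) (F : MvPolynomial (B × Fin d) k),
    m ∈ 𝓜.deg p ∧ x = puMk _ m F}

/-- The operation `f` is homogeneous of degree `p`. -/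
def IsHom (p : ℤ) (f : OpOn k d M B) : Prop :=
  IsDLin f ∧ ∀ (q : ℤ) x, x ∈ srcDeg 𝓜 B q → f x ∈ tgtDeg 𝓜 B (q + p)

variable {𝓜} in
theorem IsHom.mk_mem {p : ℤ} {f : OpOn k d M B} (hf : IsHom 𝓜 p f) {ε : B → ℤ} {m : B → M}
    (hm : ∀ j, m j ∈ 𝓜.deg (ε j)) {r : ℕ} {a : Jou k d (⊤ : SimpleGraph B)} (ha : a ∈ jdeg r) :
    f (jmMk _ (box k m) a) ∈ tgtDeg 𝓜 B (∑ j, ε j + r + p) :=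
  hf.2 _ _ (Submodule.subset_span ⟨ε, m, r, a, hm, ha, rfl, rfl⟩)

theorem isHom_of_mk {p : ℤ} {f : OpOn k d M B} (hf : IsDLin f)
    (h : ∀ (ε : B → ℤ) (m : B → M) (r : ℕ) (a : Jou k d (⊤ : SimpleGraph B)),
      (∀ j, m j ∈ 𝓜.deg (ε j)) → a ∈ jdeg r →
        f (jmMk _ (box k m) a) ∈ tgtDeg 𝓜 B (∑ j, ε j + r + p)) : IsHom 𝓜 p f := by
  refine ⟨hf, fun q x hx => ?_⟩
  induction hx using Submodule.span_induction with
  | mem x hx =>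
    obtain ⟨ε, m, r, a, hm, ha, rfl, rfl⟩ := hx
    exact h ε m r a hm ha
  | zero => rw [map_zero]; exact Submodule.zero_mem _
  | add x y _ _ hx hy => rw [map_add]; exact Submodule.add_mem _ hx hy
  | smul c x _ hx => rw [map_smul]; exact Submodule.smul_mem _ _ hx

theorem tgtPar_of_mem {p : ℤ} {y : DiagOn k d M B} (hy : y ∈ tgtDeg 𝓜 B p) :
    tgtPar 𝓜 y = p.negOnePow • y := by
  induction hy using Submodule.span_induction with
  | mem y hy =>
    obtain ⟨m, F, hm, rfl⟩ := hy
    rw [tgtPar, diagEnd_mk, parity_of_mem 𝓜 hm, Units.smul_def, Units.smul_def, map_zsmul,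
      LinearMap.smul_apply]
  | zero => simp
  | add x y _ _ hx hy => rw [map_add, hx, hy, smul_add]
  | smul c x _ hx => rw [map_smul, hx, smul_comm]

theorem srcPar_mk {ε : B → ℤ} {m : B → M} (hm : ∀ j, m j ∈ 𝓜.deg (ε j)) {r : ℕ}
    {a : Jou k d (⊤ : SimpleGraph B)} (ha : a ∈ jdeg r) :
    srcPar 𝓜 (jmMk _ (box k m) a) = (∑ j, ε j + r).negOnePow • jmMk _ (box k m) a := by
  rw [srcPar, jmTwist_mk, boxMap_parity 𝓜 hm, jpar_of_mem ha, map_negOnePow_smul,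
    map_negOnePow_smul (jmMk (k := k) (d := d) ⊤), negOnePow_smul_apply, negOnePow_smul_smul,
    add_comm (r : ℤ)]

variable {𝓜} in
theorem IsHom.opPar {p : ℤ} {f : OpOn k d M B} (hf : IsHom 𝓜 p f) :
    opPar 𝓜 f = p.negOnePow • f := by
  refine jouBox_hom_ext 𝓜 fun ε m r a hm ha => ?_
  rw [opPar_apply, srcPar_mk 𝓜 hm ha, map_negOnePow_smul, map_negOnePow_smul,
    tgtPar_of_mem 𝓜 (hf.mk_mem hm ha), negOnePow_smul_smul]
  rw [Units.smul_def p.negOnePow, LinearMap.smul_apply, ← Units.smul_def]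
  congr 1
  exact negOnePow_congr ⟨∑ j, ε j + r, by ring⟩

theorem parityPart_mk [CharZero k] (s t : ℤ) {q : ℤ} {ν : OpOn k d M B} (hν : IsHom 𝓜 q ν)
    (n : Box k B M)
    {r : ℕ} {a : Jou k d (⊤ : SimpleGraph B)} (ha : a ∈ jdeg r) :
    parityPart 𝓜 s t ν (jmMk _ n a) = if Even (s + q) ∧ Even (t + r) then ν (jmMk _ n a)
        else 0 := by
  have h1 : parityPart 𝓜 s t ν (jmMk _ n a) = (4⁻¹ : k) • (((1 + ((t + r).negOnePow : ℤ)) *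
      (1 + ((s + q).negOnePow : ℤ)) : ℤ) • ν (jmMk _ n a)) := by
    have h2 : ν + (s.negOnePow : ℤ) • opPar 𝓜 ν = (1 + ((s + q).negOnePow : ℤ)) • ν := by
      rw [hν.opPar, ← Units.smul_def, negOnePow_smul_smul, add_smul, one_smul, Units.smul_def]
    have h3 : parityPart 𝓜 s t ν = (4⁻¹ : k) • ((1 + ((s + q).negOnePow : ℤ)) • ν +
        (t.negOnePow : ℤ) • ((1 + ((s + q).negOnePow : ℤ)) • ν) ∘ₗ varPar) := by
      rw [← h2]; rfl
    rw [h3]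
    simp only [LinearMap.smul_apply, LinearMap.add_apply, LinearMap.comp_apply]
    rw [varPar_mk, jpar_of_mem ha, map_negOnePow_smul, map_negOnePow_smul, ← Units.smul_def,
      smul_comm (1 + _ : ℤ), negOnePow_smul_smul, Units.smul_def, mul_smul,
      add_smul 1 (((t + r).negOnePow : ℤˣ) : ℤ), one_smul]
  have h4 : (4 : k) ≠ 0 := by norm_num
  rw [h1]
  by_cases hs : Even (s + q)
  · by_cases ht : Even (t + r)
    · rw [if_pos ⟨hs, ht⟩, Int.negOnePow_even _ hs, Int.negOnePow_even _ ht,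
        ← Int.cast_smul_eq_zsmul k, smul_smul]
      norm_num
    · rw [if_neg fun h => ht h.2, Int.negOnePow_odd _ (Int.not_even_iff_odd.1 ht)]
      simp
  · rw [if_neg fun h => hs h.1, Int.negOnePow_odd _ (Int.not_even_iff_odd.1 hs)]
    simp

end Signs

/-! ### The composition of two operations -/

section Comp

variable {k : Type*} [Field k] {d : ℕ} {M : Type*} [AddCommGroup M] [Module k M]
    [Module (Weyl k (Fin d))ᵐᵒᵖ M] [IsScalarTower k (Weyl k (Fin d))ᵐᵒᵖ M]
    (𝓜 : DGStructure k d M)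
  {I K B : Type*} [Fintype I] [DecidableEq I] [Fintype K] [DecidableEq K] [Fintype B]
  [DecidableEq B]

variable {𝓜} in
/-- To prove a property of the elements of `Δ_* M` of degree `p`, it suffices to consider the
elements `x ⊗ 1` and to show that the property is inherited by sums, multiples and derivatives. -/
theorem tgtDeg_induction {p : ℤ} {P : DiagOn k d M B → Prop}
    (h1 : ∀ x ∈ 𝓜.deg p, P (puMk _ x 1)) (hs : ∀ (c : k) y, P y → P (c • y))
    (ha : ∀ y y', P y → P y' → P (y + y'))
    (hd : ∀ (c : B × Fin d) y, P y → P (ract (wpd k c) y)) {y : DiagOn k d M B}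
    (hy : y ∈ tgtDeg 𝓜 B p) : P y := by
  induction hy using Submodule.span_induction with
  | mem y hy =>
    obtain ⟨x, F, hx, rfl⟩ := hy
    exact puMk_induction (P := P) x (h1 x hx) hs ha hd F
  | zero => simpa using hs 0 _ (h1 0 (Submodule.zero_mem _))
  | add x y _ _ hx hy => exact ha _ _ hx hy
  | smul c x _ hx => exact hs c _ hx

theorem ract_pd_mem_tgtDeg {p : ℤ} {y : DiagOn k d M B} (hy : y ∈ tgtDeg 𝓜 B p)
    (c : B × Fin d) : ract (wpd k c) y ∈ tgtDeg 𝓜 B p := by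
  induction hy using Submodule.span_induction with
  | mem y hy =>
    obtain ⟨x, F, hx, rfl⟩ := hy
    rw [ract_push_pd_mk]
    exact Submodule.subset_span ⟨x, _, hx, rfl⟩
  | zero => rw [map_zero]; exact Submodule.zero_mem _
  | add x y _ _ hx hy => rw [map_add]; exact Submodule.add_mem _ hx hy
  | smul c x _ hx => rw [map_smul]; exact Submodule.smul_mem _ _ hx

theorem ract_z_mem_tgtDeg {p : ℤ} {y : DiagOn k d M B} (hy : y ∈ tgtDeg 𝓜 B p)
    (c : B × Fin d) : ract (wz k c) y ∈ tgtDeg 𝓜 B p := by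
  induction hy using Submodule.span_induction with
  | mem y hy =>
    obtain ⟨x, F, hx, rfl⟩ := hy
    rw [ract_push_z_mk]
    exact Submodule.add_mem _ (Submodule.subset_span ⟨_, F, 𝓜.smul_mem _ _ _ hx, rfl⟩)
      (Submodule.subset_span ⟨x, _, hx, rfl⟩)
  | zero => rw [map_zero]; exact Submodule.zero_mem _
  | add x y _ _ hx hy => rw [map_add]; exact Submodule.add_mem _ hx hy
  | smul c x _ hx => rw [map_smul]; exact Submodule.smul_mem _ _ hx

theorem diagSubst_mem_tgtDeg (π : I → K) {p : ℤ} {y : DiagOn k d M K} (hy : y ∈ tgtDeg 𝓜 K p) :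
    diagSubst π y ∈ tgtDeg 𝓜 I p := by
  induction hy using Submodule.span_induction with
  | mem y hy =>
    obtain ⟨x, F, hx, rfl⟩ := hy
    rw [diagSubst, substMap_mk]
    exact Submodule.subset_span ⟨x, _, hx, rfl⟩
  | zero => rw [map_zero]; exact Submodule.zero_mem _
  | add x y _ _ hx hy => rw [map_add]; exact Submodule.add_mem _ hx hy
  | smul c x _ hx => rw [map_smul]; exact Submodule.smul_mem _ _ hx

theorem insertPush_one {i : K} (e : I ≃ {j : K // j ≠ i} ⊕ B) (m'' : K → M) (x : M) :
    insertPush (k := k) (d := d) e m'' (puMk _ x 1) =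
      puMk _ (box k (Function.update m'' i x)) 1 := by
  rw [insertPush_mk, map_one]

variable {𝓜} in
/-- The degree of an operation applied to an inserted element. -/
theorem outerOn_insertPush_mem {i : K} (e : I ≃ {j : K // j ≠ i} ⊕ B) {p : ℤ} {μ : OpOn k d M K}
    (hμ : IsHom 𝓜 p μ) {ε : K → ℤ} {m'' : K → M} (hm : ∀ j, j ≠ i → m'' j ∈ 𝓜.deg (ε j)) {f : ℤ}
    {y : DiagOn k d M B} (hy : y ∈ tgtDeg 𝓜 B f) {r : ℕ}
    {b : Jou k d (partialGraph (collapse e))} (hb : b ∈ jdeg r) :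
    outerOn (collapse e) μ hμ.1 (jmMk _ (insertPush e m'' y) b) ∈
      tgtDeg 𝓜 I (∑ j, Function.update ε i f j + r + p) := by
  suffices h : ∀ b : Jou k d (partialGraph (collapse e)), b ∈ jdeg r →
      outerOn (collapse e) μ hμ.1 (jmMk _ (insertPush e m'' y) b) ∈
        tgtDeg 𝓜 I (∑ j, Function.update ε i f j + r + p) from h b hb
  refine tgtDeg_induction (𝓜 := 𝓜) (P := fun y => ∀ b : Jou k d (partialGraph (collapse e)),
    b ∈ jdeg r → outerOn (collapse e) μ hμ.1 (jmMk _ (insertPush e m'' y) b) ∈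
      tgtDeg 𝓜 I (∑ j, Function.update ε i f j + r + p)) (fun x hx b hb => ?_)
    (fun c y hy b hb => ?_) (fun y y' hy hy' b hb => ?_) (fun c y hy b hb => ?_) hy
  · rw [insertPush_one, outerOn_one]
    refine diagSubst_mem_tgtDeg 𝓜 _ (hμ.mk_mem (fun j => ?_) (jmap_mem_jdeg _ hb))
    by_cases h : j = i
    · subst h; simpa using hx
    · simpa [h] using hm j h
  · simp only [map_smul, LinearMap.smul_apply]
    exact Submodule.smul_mem _ _ (hy b hb)
  · simp only [map_add, LinearMap.add_apply]
    exact Submodule.add_mem _ (hy b hb) (hy' b hb)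
  · rw [insertPush_pd, outerOn_pd]
    exact Submodule.add_mem _ (ract_pd_mem_tgtDeg 𝓜 (hy b hb) _)
      (hy _ (jpd_mem_jdeg _ _ hb))

theorem outerOn_add {N : Type*} [AddCommGroup N] [Module k N]
    [Module (Weyl k (K × Fin d))ᵐᵒᵖ N] [IsScalarTower k (Weyl k (K × Fin d))ᵐᵒᵖ N] (π : I → K)
    {μ μ' : JModel k d (⊤ : SimpleGraph K) N →ₗ[k] DiagOn k d M K}
    (hμ : ∀ (P : (Weyl k (K × Fin d))ᵐᵒᵖ) x, μ (P • x) = P • μ x)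
    (hμ' : ∀ (P : (Weyl k (K × Fin d))ᵐᵒᵖ) x, μ' (P • x) = P • μ' x)
    (h : ∀ (P : (Weyl k (K × Fin d))ᵐᵒᵖ) x, (μ + μ') (P • x) = P • (μ + μ') x) :
    outerOn π (μ + μ') h = outerOn π μ hμ + outerOn π μ' hμ' :=
  outerOn_eq π h (fun c y => by simp only [LinearMap.add_apply, outerOn_ract, map_add])
    fun n b => by simp only [LinearMap.add_apply, outerOn_one, map_add]

theorem outerOn_smul_left {N : Type*} [AddCommGroup N] [Module k N]
    [Module (Weyl k (K × Fin d))ᵐᵒᵖ N] [IsScalarTower k (Weyl k (K × Fin d))ᵐᵒᵖ N] (π : I → K)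
    (c : k) {μ : JModel k d (⊤ : SimpleGraph K) N →ₗ[k] DiagOn k d M K}
    (hμ : ∀ (P : (Weyl k (K × Fin d))ᵐᵒᵖ) x, μ (P • x) = P • μ x)
    (h : ∀ (P : (Weyl k (K × Fin d))ᵐᵒᵖ) x, (c • μ) (P • x) = P • (c • μ) x) :
    outerOn π (c • μ) h = c • outerOn π μ hμ :=
  outerOn_eq π h (fun c y => by simp only [LinearMap.smul_apply, outerOn_ract, map_smul])
    fun n b => by simp only [LinearMap.smul_apply, outerOn_one, map_smul]

variable {i : K} (e : I ≃ {j : K // j ≠ i} ⊕ B)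

theorem insertOp_add (τ : K → Module.End k M) (ν ν' : OpOn k d M B) :
    insertOp e τ (ν + ν') = insertOp e τ ν + insertOp e τ ν' :=
  box_ext fun m => LinearMap.ext fun a => by
    simp only [LinearMap.add_apply, insertOp_box, map_add]

theorem insertOp_smul (τ : K → Module.End k M) (c : k) (ν : OpOn k d M B) :
    insertOp e τ (c • ν) = c • insertOp e τ ν :=
  box_ext fun m => LinearMap.ext fun a => by
    simp only [LinearMap.smul_apply, insertOp_box, map_smul]

/-- The sum over the complement of a block. -/
theorem sum_glue (ε : K → ℤ) (ε' : B → ℤ) :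
    ∑ a, glue e ε ε' a = (∑ j, Function.update ε i 0 j) + ∑ b, ε' b := by
  rw [← e.symm.sum_comp, Fintype.sum_sum_type]
  congr 1
  · rw [← Finset.sum_erase_add _ _ (Finset.mem_univ i), Function.update_self, add_zero]
    refine (Finset.sum_subtype (Finset.univ.erase i) (p := (· ≠ i)) (by simp)
      (Function.update ε i 0)).trans (Finset.sum_congr rfl fun j _ => ?_) |>.symm
    rw [Function.update_of_ne j.2]
    simp [glue]
  · simp [glue]

theorem sum_update (ε : K → ℤ) (f : ℤ) :
    ∑ j, Function.update ε i f j = (∑ j, Function.update ε i 0 j) + f := by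
  rw [← Finset.sum_erase_add (s := Finset.univ) (f := Function.update ε i f) (a := i)
    (Finset.mem_univ i), ← Finset.sum_erase_add (s := Finset.univ) (f := Function.update ε i 0)
    (a := i) (Finset.mem_univ i), Function.update_self, Function.update_self, add_zero]
  congr 1
  refine Finset.sum_congr rfl fun j hj => ?_
  rw [Function.update_of_ne (Finset.ne_of_mem_erase hj),
    Function.update_of_ne (Finset.ne_of_mem_erase hj)]

theorem negOnePow_smul_mem {X : Type*} [AddCommGroup X] [Module k X] (S : Submodule k X) (p : ℤ)
    {x : X} (hx : x ∈ S) : p.negOnePow • x ∈ S := by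
  rw [Units.smul_def]
  exact zsmul_mem hx _

/-- A family on `I` is glued from its restrictions. -/
theorem eq_glue (m : I → M) : m = glue e (outerFam e m) (fun b => m (incl e b)) := by
  ext a
  obtain ⟨j, rfl⟩ | ⟨b, rfl⟩ := idx_cases e a
  · rw [glue_outerIdx, outerFam, dif_neg j.2]
  · rw [glue_incl]

theorem outerFam_mem {ε : I → ℤ} {m : I → M} (hm : ∀ a, m a ∈ 𝓜.deg (ε a)) :
    ∃ ε' : K → ℤ, ε = glue e ε' (fun b => ε (incl e b)) ∧
      ∀ j, outerFam e m j ∈ 𝓜.deg (ε' j) := by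
  refine ⟨fun j => if h : j = i then 0 else ε (outerIdx e ⟨j, h⟩), ?_, fun j => ?_⟩
  · ext a
    obtain ⟨j, rfl⟩ | ⟨b, rfl⟩ := idx_cases e a
    · rw [glue_outerIdx, dif_neg j.2]
    · rw [glue_incl]
  · by_cases hj : j = i
    · simp [outerFam, hj]
    · simp only [outerFam, hj, dite_false]; exact hm _

variable [Preorder K] [DecidableLT K]

variable (i) in
/-- The signs for moving a map of parity `s` past the inputs before `i`, and an element of parity
`t` past the inputs after `i`. -/
def koszulOps (s t : ℤ) (j : K) : Module.End k M :=
  signOp 𝓜 (if j < i then s else if i < j then t else 0)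

theorem koszulOps_ract (s t : ℤ) (j : K) (P : Weyl k (Fin d)) :
    koszulOps 𝓜 i s t j * ract P = ract P * koszulOps 𝓜 i s t j := 𝓜.degScale_ract _ P

theorem insertPush_koszulOps (s t : ℤ) {ε : K → ℤ} {m'' : K → M}
    (hm : ∀ j, j ≠ i → m'' j ∈ 𝓜.deg (ε j)) :
    insertPush (k := k) (d := d) e (fun j => koszulOps 𝓜 i s t j (m'' j)) =
      (s * ∑ j with j < i, ε j + t * ∑ j with i < j, ε j).negOnePow • insertPush e m'' := by
  rw [insertPush_congr e (m := fun j => koszulOps 𝓜 i s t j (m'' j)) (m' := fun j =>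
    ((if j < i then s else if i < j then t else 0) * ε j).negOnePow • m'' j)
    fun j hj => signOp_of_mem 𝓜 _ (hm j hj), insertPush_sign]
  congr 2
  rw [Finset.mul_sum, Finset.mul_sum, Finset.sum_filter, Finset.sum_filter,
    ← Finset.sum_add_distrib]
  refine Finset.sum_congr rfl fun j _ => ?_
  by_cases h : j = i
  · subst h; simp
  · by_cases h1 : j < i
    · simp [h, h1, h1.not_gt]
    · simp [h, h1]

/-- The composition of operations
`((m'' ⊠ m') ⊗ a b) ↦ ± μ (w ((m'' ⊠ ν (m' ⊗ a)) ⊗ b))`, where the sign is implemented by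
decomposing `ν` and `a` according to parity. -/
def compOn {μ : OpOn k d M K} (hμ : IsDLin μ) {ν : OpOn k d M B} (hν : IsDLin ν) : OpOn k d M I :=
  ∑ s ∈ Finset.range 2, ∑ t ∈ Finset.range 2, coreComp e (koszulOps 𝓜 i s t)
    (koszulOps_ract 𝓜 s t) hμ (parityPart_isDLin 𝓜 s t hν)

variable {μ : OpOn k d M K} (hμ : IsDLin μ) {ν : OpOn k d M B} (hν : IsDLin ν)

theorem compOn_isDLin : IsDLin (compOn 𝓜 e hμ hν) := fun P x => by
  simp only [compOn, LinearMap.sum_apply, coreComp_isDLin e _ _ hμ _ P x, Finset.smul_sum]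

theorem compOn_mk_mul (n : Box k I M) (a : Jou k d (⊤ : SimpleGraph B))
    (b : Jou k d (partialGraph (collapse e))) :
    compOn 𝓜 e hμ hν (jmMk _ n (jmap (blockHom e) a * jmap (partialGraphHom _) b)) =
      ∑ s ∈ Finset.range 2, ∑ t ∈ Finset.range 2, outerOn (collapse e) μ hμ (jmMk _
        (insertOp e (koszulOps 𝓜 i s t) (parityPart 𝓜 s t ν) n a) b) := by
  simp only [compOn, LinearMap.sum_apply, coreComp_mk]

/-- The defining property of the composition. -/
theorem compOn_mk [CharZero k] {q : ℤ} (hν' : IsHom 𝓜 q ν) {ε : K → ℤ} {m'' : K → M}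
    (hm : ∀ j, j ≠ i → m'' j ∈ 𝓜.deg (ε j)) (m' : B → M) {r : ℕ}
    {a : Jou k d (⊤ : SimpleGraph B)} (ha : a ∈ jdeg r)
    (b : Jou k d (partialGraph (collapse e))) :
    compOn 𝓜 e hμ hν (jmMk _ (box k (glue e m'' m'))
        (jmap (blockHom e) a * jmap (partialGraphHom _) b)) =
      (q * ∑ j with j < i, ε j + r * ∑ j with i < j, ε j).negOnePow •
        outerOn (collapse e) μ hμ (jmMk _ (insertPush e m'' (ν (jmMk _ (box k m') a))) b) := by
  have key : ∀ s t : ℕ, outerOn (collapse e) μ hμ (jmMk _ (insertOp e (koszulOps 𝓜 i s t)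
      (parityPart 𝓜 s t ν) (box k (glue e m'' m')) a) b) =
      if Even (s + q) ∧ Even ((t : ℤ) + r) then
        (q * ∑ j with j < i, ε j + r * ∑ j with i < j, ε j).negOnePow •
        outerOn (collapse e) μ hμ (jmMk _ (insertPush e m'' (ν (jmMk _ (box k m') a))) b)
      else 0 := by
    intro s t
    rw [insertOp_glue, parityPart_mk 𝓜 _ _ hν' _ ha]
    split_ifs with h
    · rw [insertPush_koszulOps 𝓜 e s t hm, negOnePow_smul_apply, map_negOnePow_smul,
        negOnePow_smul_apply, map_negOnePow_smul]
      congr 1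
      refine negOnePow_congr ?_
      have e1 : Even ((s : ℤ) - q) := by
        have := h.1.sub (even_two_mul q); rwa [show (s : ℤ) + q - 2 * q = s - q by ring] at this
      have e2 : Even ((t : ℤ) - r) := by
        have := h.2.sub (even_two_mul (r : ℤ))
        rwa [show (t : ℤ) + r - 2 * r = t - r by ring] at this
      have := (e1.mul_right (∑ j with j < i, ε j)).add (e2.mul_right (∑ j with i < j, ε j))
      rwa [sub_mul, sub_mul, sub_add_sub_comm] at this
    · simp
  rw [compOn_mk_mul]
  simp only [key, Finset.sum_range_succ, Finset.sum_range_zero, zero_add]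
  -- exactly one of the four pairs `(s, t)` has the parities of `q` and `r`
  rcases Int.even_or_odd q with hq | hq <;> rcases Int.even_or_odd (r : ℤ) with hr | hr <;>
    simp [hq, hr, Int.not_even_iff_odd.2]

theorem compOn_isHom [CharZero k] {p q : ℤ} (hμ' : IsHom 𝓜 p μ) (hν' : IsHom 𝓜 q ν) :
    IsHom 𝓜 (p + q) (compOn 𝓜 e hμ hν) := by
  refine isHom_of_mk 𝓜 (compOn_isDLin 𝓜 e hμ hν) fun ε m r α hm hα => ?_
  have hα' := jdeg_le_span (blockHom e) (partialGraphHom (collapse e)) (fun i => ⟨i, rfl⟩)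
    (dart_cases e) r hα
  clear hα
  induction hα' using Submodule.span_induction with
  | mem α hα =>
    obtain ⟨r₁, r₂, a, b, ha, hb, rfl, rfl⟩ := hα
    obtain ⟨ε', hε, hm'⟩ := outerFam_mem 𝓜 e hm
    rw [eq_glue e m, compOn_mk 𝓜 e hμ hν hν' (fun j _ => hm' j) _ ha]
    refine negOnePow_smul_mem _ _ ?_
    have := outerOn_insertPush_mem e hμ' (fun j _ => hm' j)
      (hν'.mk_mem (fun b => hm (incl e b)) ha) hb
    rw [sum_update] at this
    rw [hε, sum_glue]
    convert this using 2
    push_cast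
    ring
  | zero => rw [map_zero, map_zero]; exact Submodule.zero_mem _
  | add x y _ _ hx hy => rw [map_add, map_add]; exact Submodule.add_mem _ hx hy
  | smul c x _ hx => rw [map_smul, map_smul]; exact Submodule.smul_mem _ _ hx

theorem compOn_add_left {μ' : OpOn k d M K} (hμ' : IsDLin μ') :
    compOn 𝓜 e (hμ.add hμ') hν = compOn 𝓜 e hμ hν + compOn 𝓜 e hμ' hν :=
  jm_ext fun n α => LinearMap.congr_fun (f := compOn 𝓜 e (hμ.add hμ') hν ∘ₗ jmMk _ n)
    (g := (compOn 𝓜 e hμ hν + compOn 𝓜 e hμ' hν) ∘ₗ jmMk _ n) (jou_ext_block e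
      fun _ _ a _ b _ => by
        simp only [LinearMap.comp_apply, LinearMap.add_apply, compOn_mk_mul,
          outerOn_add _ hμ hμ', Finset.sum_add_distrib]) α

theorem compOn_smul_left (c : k) :
    compOn 𝓜 e (hμ.smul c) hν = c • compOn 𝓜 e hμ hν :=
  jm_ext fun n α => LinearMap.congr_fun (f := compOn 𝓜 e (hμ.smul c) hν ∘ₗ jmMk _ n)
    (g := (c • compOn 𝓜 e hμ hν) ∘ₗ jmMk _ n) (jou_ext_block e
      fun _ _ a _ b _ => by
        simp only [LinearMap.comp_apply, LinearMap.smul_apply, compOn_mk_mul,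
          outerOn_smul_left _ c hμ, Finset.smul_sum]) α

theorem compOn_add_right {ν' : OpOn k d M B} (hν' : IsDLin ν') :
    compOn 𝓜 e hμ (hν.add hν') = compOn 𝓜 e hμ hν + compOn 𝓜 e hμ hν' :=
  jm_ext fun n α => LinearMap.congr_fun (f := compOn 𝓜 e hμ (hν.add hν') ∘ₗ jmMk _ n)
    (g := (compOn 𝓜 e hμ hν + compOn 𝓜 e hμ hν') ∘ₗ jmMk _ n) (jou_ext_block e
      fun _ _ a _ b _ => by
        simp only [LinearMap.comp_apply, LinearMap.add_apply, compOn_mk_mul, map_add,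
          insertOp_add, Finset.sum_add_distrib]) α

theorem compOn_smul_right (c : k) :
    compOn 𝓜 e hμ (hν.smul c) = c • compOn 𝓜 e hμ hν :=
  jm_ext fun n α => LinearMap.congr_fun (f := compOn 𝓜 e hμ (hν.smul c) ∘ₗ jmMk _ n)
    (g := (c • compOn 𝓜 e hμ hν) ∘ₗ jmMk _ n) (jou_ext_block e
      fun _ _ a _ b _ => by
        simp only [LinearMap.comp_apply, LinearMap.smul_apply, compOn_mk_mul, map_smul,
          insertOp_smul, Finset.smul_sum]) α

end Comp

/-! ### The graded spaces of chiral operations -/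

section Chiral

variable {k : Type*} [Field k] {d : ℕ} {M : Type*} [AddCommGroup M] [Module k M]
    [Module (Weyl k (Fin d))ᵐᵒᵖ M] [IsScalarTower k (Weyl k (Fin d))ᵐᵒᵖ M]
    {𝓜 : DGStructure k d M}

/-- The underlying map of a chiral operation. -/
abbrev toOp {n : ℕ} (f : ChiralOp 𝓜 n) : OpOn k d M (Fin n) := f

theorem dlin {n : ℕ} (f : ChiralOp 𝓜 n) : IsDLin (toOp f) := chiralOp_map_smul f

variable (𝓜) in
/-- The chiral operations of degree `p`. -/
def chiralDeg (n : ℕ) (p : ℤ) : Submodule k (ChiralOp 𝓜 n) :=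
  (HomDeg 𝓜 n p).comap (ChiralOp 𝓜 n).subtype

theorem mem_chiralDeg {n : ℕ} {p : ℤ} {f : ChiralOp 𝓜 n} :
    f ∈ chiralDeg 𝓜 n p ↔ IsHom 𝓜 p (toOp f) := Iff.rfl

theorem chiralOp_zero_eq (f : ChiralOp 𝓜 0) : f = 0 :=
  Subtype.ext ((Submodule.mem_bot k).1 (show (toOp f) ∈ (⊥ : Submodule k _) from f.2))

theorem homDeg_le_chiralOp {n : ℕ} (hn : n ≠ 0) (p : ℤ) : HomDeg 𝓜 n p ≤ ChiralOp 𝓜 n := by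
  unfold ChiralOp
  rw [if_neg hn]
  exact le_iSup (HomDeg 𝓜 n) p

theorem iSup_chiralDeg (n : ℕ) : ⨆ p, chiralDeg 𝓜 n p = ⊤ := by
  rcases eq_or_ne n 0 with rfl | hn
  · refine eq_top_iff.2 fun f _ => ?_
    rw [chiralOp_zero_eq f]
    exact Submodule.zero_mem _
  · have key : ∀ g ∈ ⨆ p, HomDeg 𝓜 n p, ∃ h : g ∈ ChiralOp 𝓜 n,
        (⟨g, h⟩ : ChiralOp 𝓜 n) ∈ ⨆ p, chiralDeg 𝓜 n p := by
      intro g hg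
      induction hg using Submodule.iSup_induction' with
      | mem p g hg =>
        exact ⟨homDeg_le_chiralOp hn p hg, Submodule.mem_iSup_of_mem p hg⟩
      | zero => exact ⟨Submodule.zero_mem _, Submodule.zero_mem _⟩
      | add g g' _ _ hg hg' =>
        obtain ⟨h, hg⟩ := hg
        obtain ⟨h', hg'⟩ := hg'
        exact ⟨Submodule.add_mem _ h h', Submodule.add_mem _ hg hg'⟩
    refine eq_top_iff.2 ?_
    rintro ⟨f, hf⟩ -
    have hf' : f ∈ ⨆ p, HomDeg 𝓜 n p := by
      unfold ChiralOp at hf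
      rwa [if_neg hn] at hf
    exact (key _ hf').2

/-- Additive properties of chiral operations may be tested on homogeneous operations. -/
theorem chiral_induction {n : ℕ} {P : ChiralOp 𝓜 n → Prop}
    (h : ∀ (p : ℤ) (f : ChiralOp 𝓜 n), IsHom 𝓜 p (toOp f) → P f)
    (ha : ∀ f g, P f → P g → P (f + g)) (f : ChiralOp 𝓜 n) : P f := by
  have hf : f ∈ ⨆ p, chiralDeg 𝓜 n p := by rw [iSup_chiralDeg]; trivial
  induction hf using Submodule.iSup_induction' with
  | mem p f hf => exact h p f hf
  | zero => exact h 0 0 (Submodule.zero_mem (HomDeg 𝓜 n 0))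
  | add f g _ _ hf hg => exact ha f g hf hg

theorem isInternal_chiralDeg (n : ℕ) : DirectSum.IsInternal (chiralDeg 𝓜 n) := by
  rw [DirectSum.isInternal_submodule_iff_iSupIndep_and_iSup_eq_top]
  refine ⟨fun p => Submodule.disjoint_def.2 fun f hf hf' => ?_, iSup_chiralDeg n⟩
  refine Subtype.ext (jouBox_hom_ext 𝓜 fun ε m r a hm ha => ?_)
  -- the projection of `Δ_* M` to the part in which the values of a map of degree `p` lie
  have hT : ∀ P : Weyl k (Fin d), 𝓜.degScale (fun q => if q = ∑ j, ε j + r + p then 1 else 0) *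
      ract P = ract P * 𝓜.degScale (fun q => if q = ∑ j, ε j + r + p then 1 else 0) :=
    𝓜.degScale_ract _
  have key : ∀ q, ∀ y ∈ tgtDeg 𝓜 (Fin n) q,
      diagEnd _ hT y = if q = ∑ j, ε j + r + p then y else 0 := by
    intro q y hy
    induction hy using Submodule.span_induction with
    | mem y hy =>
      obtain ⟨x, F, hx, rfl⟩ := hy
      rw [diagEnd_mk, 𝓜.degScale_of_mem _ hx]
      split_ifs <;> simp
    | zero => simp
    | add x y _ _ hx hy => rw [map_add, hx, hy]; split_ifs <;> simp
    | smul c x _ hx => rw [map_smul, hx]; split_ifs <;> simp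
  have h1 := key _ _ ((mem_chiralDeg.1 hf).mk_mem hm ha)
  rw [if_pos rfl] at h1
  have h2 : ∀ g ∈ ⨆ q, ⨆ (_ : q ≠ p), chiralDeg 𝓜 n q,
      diagEnd _ hT ((toOp g) (jmMk _ (box k m) a)) = 0 := by
    intro g hg
    have : (⨆ q, ⨆ (_ : q ≠ p), chiralDeg 𝓜 n q) ≤ LinearMap.ker (diagEnd _ hT ∘ₗ
        (LinearMap.applyₗ (jmMk _ (box k m) a)) ∘ₗ (ChiralOp 𝓜 n).subtype) := by
      refine iSup₂_le fun q hq g hg => ?_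
      refine LinearMap.mem_ker.2 ((key _ _ ((mem_chiralDeg.1 hg).mk_mem hm ha)).trans (if_neg ?_))
      omega
    exact LinearMap.mem_ker.1 (this hg)
  exact h1.symm.trans (h2 f hf')

variable [CharZero k]

theorem compOn_mem {m n : ℕ} (i : Fin (m + 1)) (μ : ChiralOp 𝓜 (m + 1)) (ν : ChiralOp 𝓜 n) :
    compOn 𝓜 (insEquiv i n) (dlin μ) (dlin ν) ∈ ChiralOp 𝓜 (m + n) := by
  rcases eq_or_ne n 0 with rfl | hn
  · have h : compOn 𝓜 (insEquiv i 0) (dlin μ) (dlin ν) =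
        compOn 𝓜 (insEquiv i 0) (dlin μ) ((dlin ν).smul 0) := by
      congr 1
      rw [chiralOp_zero_eq ν]
      simp
    rw [h, compOn_smul_right 𝓜 _ _ (dlin ν), zero_smul]
    exact Submodule.zero_mem _
  · induction μ using chiral_induction with
    | ha μ μ' h h' =>
      have := compOn_add_left 𝓜 (insEquiv i n) (dlin μ) (dlin ν) (dlin μ')
      exact this ▸ Submodule.add_mem _ h h'
    | h p μ hμ =>
      induction ν using chiral_induction with
      | ha ν ν' h h' =>
        have := compOn_add_right 𝓜 (insEquiv i n) (dlin μ) (dlin ν) (dlin ν')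
        exact this ▸ Submodule.add_mem _ h h'
      | h q ν hν =>
        exact homDeg_le_chiralOp (by omega) (p + q) (compOn_isHom 𝓜 _ _ _ hμ hν)

/-- The partial composition of chiral operations. -/
def chiralComp {m n : ℕ} (i : Fin (m + 1)) :
    ChiralOp 𝓜 (m + 1) →ₗ[k] ChiralOp 𝓜 n →ₗ[k] ChiralOp 𝓜 (m + n) :=
  LinearMap.mk₂ k (fun μ ν => ⟨compOn 𝓜 (insEquiv i n) (dlin μ) (dlin ν), compOn_mem i μ ν⟩)
    (fun μ μ' ν => Subtype.ext (compOn_add_left 𝓜 _ (dlin μ) (dlin ν) (dlin μ')))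
    (fun c μ ν => Subtype.ext (compOn_smul_left 𝓜 _ (dlin μ) (dlin ν) c))
    (fun μ ν ν' => Subtype.ext (compOn_add_right 𝓜 _ (dlin μ) (dlin ν) (dlin ν')))
    (fun c μ ν => Subtype.ext (compOn_smul_right 𝓜 _ (dlin μ) (dlin ν) c))

theorem chiralComp_toOp {m n : ℕ} (i : Fin (m + 1)) (μ : ChiralOp 𝓜 (m + 1)) (ν : ChiralOp 𝓜 n) :
    toOp (chiralComp i μ ν) = compOn 𝓜 (insEquiv i n) (dlin μ) (dlin ν) := rfl

theorem chiralComp_mem {m n : ℕ} (i : Fin (m + 1)) (p q : ℤ) (μ : ChiralOp 𝓜 (m + 1))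
    (ν : ChiralOp 𝓜 n) (hμ : μ ∈ chiralDeg 𝓜 (m + 1) p) (hν : ν ∈ chiralDeg 𝓜 n q) :
    chiralComp i μ ν ∈ chiralDeg 𝓜 (m + n) (p + q) :=
  compOn_isHom 𝓜 (insEquiv i n) (dlin μ) (dlin ν) hμ hν

end Chiral

/-! ### The differential of an operation -/

section Differential

variable {k : Type*} [Field k] {d : ℕ} {M : Type*} [AddCommGroup M] [Module k M]
    [Module (Weyl k (Fin d))ᵐᵒᵖ M] [IsScalarTower k (Weyl k (Fin d))ᵐᵒᵖ M]
    (𝓜 : DGStructure k d M) {n : ℕ}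

theorem update_mem_deg {B : Type*} [DecidableEq B] {ε : B → ℤ} {m : B → M}
    (hm : ∀ j, m j ∈ 𝓜.deg (ε j)) (i : B) {f : ℤ} {x : M} (hx : x ∈ 𝓜.deg f) (j : B) :
    Function.update m i x j ∈ 𝓜.deg (Function.update ε i f j) := by
  by_cases h : j = i
  · subst h; simpa using hx
  · simpa [h] using hm j

theorem boxDiff_box {ε : Fin n → ℤ} {m : Fin n → M} (hm : ∀ j, m j ∈ 𝓜.deg (ε j)) :
    boxDiff 𝓜 n (box k m) = ∑ i, (∑ j with j < i, ε j).negOnePow •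
      box k (Function.update m i (𝓜.diff (m i))) := by
  rw [boxDiff, LinearMap.sum_apply]
  refine Finset.sum_congr rfl fun i _ => ?_
  rw [boxMap_box, Finset.sum_filter, ← box_signs (fun j => if j < i then ε j else 0)]
  congr 1
  ext j
  by_cases h : j < i
  · simp [h, h.ne, parity_of_mem 𝓜 (hm j)]
  · by_cases h' : j = i
    · subst h'; simp
    · simp [h, h']

theorem boxDiff_ract (c : Fin n × Fin d) (m : Box k (Fin n) M) :
    boxDiff 𝓜 n (ract (wpd k c) m) = ract (wpd k c) (boxDiff 𝓜 n m) := by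
  rw [boxDiff, LinearMap.sum_apply, LinearMap.sum_apply, map_sum]
  refine Finset.sum_congr rfl fun i _ => boxMap_ract_pd _ (fun j P => ?_) c m
  split_ifs
  · exact parity_ract 𝓜 P
  · exact 𝓜.diff_ract P
  · simp

theorem jouBoxDiff_jmMk (m : Box k (Fin n) M) (a : Jou k d (⊤ : SimpleGraph (Fin n))) :
    jouBoxDiff 𝓜 n (jmMk _ m a) =
      jmMk _ (boxDiff 𝓜 n m) a + jmMk _ (boxMap (fun _ => 𝓜.parity) m) (jd a) :=
  jmLift_mk _ _ _ _

theorem jouBoxDiff_box {ε : Fin n → ℤ} {m : Fin n → M} (hm : ∀ j, m j ∈ 𝓜.deg (ε j))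
    (a : Jou k d (⊤ : SimpleGraph (Fin n))) :
    jouBoxDiff 𝓜 n (jmMk _ (box k m) a) = ∑ i, (∑ j with j < i, ε j).negOnePow •
      jmMk _ (box k (Function.update m i (𝓜.diff (m i)))) a +
        (∑ j, ε j).negOnePow • jmMk _ (box k m) (jd a) := by
  rw [jouBoxDiff_jmMk, boxDiff_box 𝓜 hm, boxMap_parity 𝓜 hm]
  simp only [map_sum, map_negOnePow_smul, LinearMap.sum_apply, negOnePow_smul_apply]

theorem jouBoxDiff_ract (P : (Weyl k (Fin n × Fin d))ᵐᵒᵖ) (x : JouBox k d M n) :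
    jouBoxDiff 𝓜 n (P • x) = P • jouBoxDiff 𝓜 n x := by
  refine map_smul_of_map_ract _ (fun c x => ?_) (fun c x => ?_) P x
  · refine LinearMap.congr_fun (f := jouBoxDiff 𝓜 n ∘ₗ ract (wz k c))
      (g := ract (wz k c) ∘ₗ jouBoxDiff 𝓜 n) (jm_ext fun m a => ?_) x
    simp only [LinearMap.comp_apply]
    rw [ract_jm_z, jouBoxDiff_jmMk, jouBoxDiff_jmMk, map_add, ract_jm_z, ract_jm_z, jd_z_mul]
  · refine LinearMap.congr_fun (f := jouBoxDiff 𝓜 n ∘ₗ ract (wpd k c))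
      (g := ract (wpd k c) ∘ₗ jouBoxDiff 𝓜 n) (jm_ext fun m a => ?_) x
    simp only [LinearMap.comp_apply]
    rw [ract_jm_pd, map_sub, jouBoxDiff_jmMk, jouBoxDiff_jmMk, jouBoxDiff_jmMk, map_add,
      ract_jm_pd, ract_jm_pd, boxDiff_ract, boxMap_ract_pd _ fun _ => parity_ract 𝓜, jpd_jd]
    abel

variable {𝓜} in
theorem jouBoxDiff_mem {p : ℤ} {x : JouBox k d M n} (hx : x ∈ srcDeg 𝓜 (Fin n) p) :
    jouBoxDiff 𝓜 n x ∈ srcDeg 𝓜 (Fin n) (p + 1) := by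
  induction hx using Submodule.span_induction with
  | mem x hx =>
    obtain ⟨ε, m, r, a, hm, ha, rfl, rfl⟩ := hx
    rw [jouBoxDiff_box 𝓜 hm]
    refine Submodule.add_mem _ (Submodule.sum_mem _ fun i _ => negOnePow_smul_mem _ _
      (Submodule.subset_span ⟨_, _, r, a, update_mem_deg 𝓜 hm i (𝓜.diff_mem _ _ (hm i)), ha, ?_,
        rfl⟩)) (negOnePow_smul_mem _ _
      (Submodule.subset_span ⟨ε, m, r + 1, _, hm, jd_mem_jdeg ha, ?_, rfl⟩))
    · have := sum_update (i := i) ε (ε i)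
      rw [Function.update_eq_self] at this
      rw [sum_update, this]
      ring
    · push_cast; ring
  | zero => rw [map_zero]; exact Submodule.zero_mem _
  | add x y _ _ hx hy => rw [map_add]; exact Submodule.add_mem _ hx hy
  | smul c x _ hx => rw [map_smul]; exact Submodule.smul_mem _ _ hx

theorem negOnePow_smul_eq_neg {X : Type*} [AddCommGroup X] {p q : ℤ} (h : Odd (p - q)) (x : X) :
    p.negOnePow • x = -(q.negOnePow • x) := by
  have h' : p.negOnePow = -q.negOnePow := by
    rw [← Int.negOnePow_succ]
    refine negOnePow_congr ?_
    obtain ⟨c, hc⟩ := h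
    exact ⟨c, by omega⟩
  rw [h', Units.neg_smul]

theorem sum_filter_update {B : Type*} [Fintype B] [DecidableEq B] (p : B → Prop) [DecidablePred p]
    (ε : B → ℤ) (i : B) (f : ℤ) : ∑ l with p l, Function.update ε i (ε i + f) l =
      (∑ l with p l, ε l) + if p i then f else 0 := by
  have h : (if p i then f else 0) = ∑ l, if l = i then (if p l then f else 0) else 0 := by simp
  rw [h, Finset.sum_filter, Finset.sum_filter, ← Finset.sum_add_distrib]
  refine Finset.sum_congr rfl fun l _ => ?_
  by_cases h : l = i
  · subst h; by_cases hp : p l <;> simp [hp]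
  · simp [h]

theorem sum_eq_zero_of_antisymm [CharZero k] {B X : Type*} [Fintype B] [AddCommGroup X] [Module k X]
    (A : B → B → X) (h : ∀ i j, A i j = -A j i) : ∑ i, ∑ j, A i j = 0 := by
  have h1 : ∑ i, ∑ j, A i j = -∑ i, ∑ j, A i j := by
    conv_lhs => rw [Finset.sum_comm]
    simp only [← Finset.sum_neg_distrib]
    exact Finset.sum_congr rfl fun i _ => Finset.sum_congr rfl fun j _ => h j i
  have h2 : (2 : k) • ∑ i, ∑ j, A i j = 0 := by
    rw [two_smul]; nth_rewrite 1 [h1]; exact neg_add_cancel _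
  exact (smul_eq_zero.1 h2).resolve_left two_ne_zero

theorem jouBoxDiff_jouBoxDiff [CharZero k] (x : JouBox k d M n) :
    jouBoxDiff 𝓜 n (jouBoxDiff 𝓜 n x) = 0 := by
  refine LinearMap.congr_fun (f := jouBoxDiff 𝓜 n ∘ₗ jouBoxDiff 𝓜 n) (g := 0)
    (jouBox_hom_ext 𝓜 fun ε m r a hm ha => ?_) x
  have hu := fun i => update_mem_deg 𝓜 hm i (𝓜.diff_mem _ _ (hm i))
  simp only [LinearMap.comp_apply, LinearMap.zero_apply]
  rw [jouBoxDiff_box 𝓜 hm]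
  simp only [map_add, map_sum, map_negOnePow_smul, jouBoxDiff_box 𝓜 hm, jouBoxDiff_box 𝓜 (hu _),
    jd_jd, map_zero, smul_zero, add_zero, sum_filter_update, smul_add, Finset.smul_sum,
    negOnePow_smul_smul, Finset.sum_add_distrib]
  have h1 : ∀ i, ∑ l, Function.update ε i (ε i + 1) l = ∑ l, ε l + 1 := fun i => by
    simpa using sum_filter_update (fun _ => True) ε i 1
  -- the terms with `δ` at two inputs cancel in pairs, and those with one `δ` and one `𝐝` cancel
  -- each other
  rw [add_assoc, ← Finset.sum_add_distrib, sum_eq_zero_of_antisymm (k := k), zero_add]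
  · refine Finset.sum_eq_zero fun i _ => ?_
    rw [h1, negOnePow_smul_eq_neg (q := ∑ j, ε j + ∑ j with j < i, ε j) ⟨0, by ring⟩,
      neg_add_cancel]
  · intro i j
    rcases eq_or_ne i j with rfl | hij
    · simp [𝓜.diff_diff, MultilinearMap.map_update_zero]
    · rw [Function.update_of_ne hij, Function.update_of_ne hij.symm, Function.update_comm hij]
      refine negOnePow_smul_eq_neg ?_ _
      rcases lt_or_gt_of_ne hij with h | h
      · rw [if_pos h, if_neg h.not_gt]
        exact ⟨0, by ring⟩
      · rw [if_pos h, if_neg h.not_gt]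
        exact ⟨-1, by ring⟩

/-- The differential of `Δ_* M` in terms of the differential of `M`. -/
theorem diagDiff_eq : diagDiff 𝓜 n = diagEnd 𝓜.diff 𝓜.diff_ract := rfl

theorem diagDiff_mem {p : ℤ} {y : Diag k d M n} (hy : y ∈ tgtDeg 𝓜 (Fin n) p) :
    diagDiff 𝓜 n y ∈ tgtDeg 𝓜 (Fin n) (p + 1) := by
  rw [diagDiff_eq]
  induction hy using Submodule.span_induction with
  | mem y hy =>
    obtain ⟨x, F, hx, rfl⟩ := hy
    rw [diagEnd_mk]
    exact Submodule.subset_span ⟨_, F, 𝓜.diff_mem _ _ hx, rfl⟩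
  | zero => rw [map_zero]; exact Submodule.zero_mem _
  | add x y _ _ hx hy => rw [map_add]; exact Submodule.add_mem _ hx hy
  | smul c x _ hx => rw [map_smul]; exact Submodule.smul_mem _ _ hx

theorem diagDiff_diagDiff (y : Diag k d M n) : diagDiff 𝓜 n (diagDiff 𝓜 n y) = 0 := by
  rw [diagDiff_eq]
  induction y using push_induction with
  | ha y y' hy hy' => rw [map_add, map_add, hy, hy', add_zero]
  | hm x F => rw [diagEnd_mk, diagEnd_mk, 𝓜.diff_diff, map_zero, LinearMap.zero_apply]

/-- The differential `f ↦ δ f - (-1)^|f| f d` on linear maps `𝐉^n(M^{⊠ n}) → Δ_* M`. -/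
def opDiff : Module.End k (OpOn k d M (Fin n)) :=
  LinearMap.compRight k (diagDiff 𝓜 n) - LinearMap.lcomp k _ (jouBoxDiff 𝓜 n) ∘ₗ opPar 𝓜

theorem opDiff_eq {p : ℤ} {f : OpOn k d M (Fin n)} (hf : IsHom 𝓜 p f) :
    opDiff 𝓜 f = diagDiff 𝓜 n ∘ₗ f - p.negOnePow • f ∘ₗ jouBoxDiff 𝓜 n := by
  rw [opDiff, LinearMap.sub_apply, LinearMap.comp_apply, hf.opPar]
  rfl

theorem opDiff_apply {p : ℤ} {f : OpOn k d M (Fin n)} (hf : IsHom 𝓜 p f) (x : JouBox k d M n) :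
    opDiff 𝓜 f x = diagDiff 𝓜 n (f x) - p.negOnePow • f (jouBoxDiff 𝓜 n x) := by
  rw [opDiff_eq 𝓜 hf, LinearMap.sub_apply, Units.smul_def, Units.smul_def]
  rfl

variable {𝓜} in
theorem IsHom.opDiff {p : ℤ} {f : OpOn k d M (Fin n)} (hf : IsHom 𝓜 p f) :
    IsHom 𝓜 (p + 1) (opDiff 𝓜 f) := by
  refine ⟨fun P x => ?_, fun q x hx => ?_⟩
  · rw [opDiff_apply 𝓜 hf, opDiff_apply 𝓜 hf, jouBoxDiff_ract, hf.1, hf.1, diagDiff_eq,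
      diagEnd_smul, smul_sub, smul_comm]
  · rw [opDiff_apply 𝓜 hf]
    refine Submodule.sub_mem _ ?_ (negOnePow_smul_mem _ _ ?_)
    · rw [← add_assoc]; exact diagDiff_mem 𝓜 (hf.2 _ _ hx)
    · have := hf.2 _ _ (jouBoxDiff_mem hx)
      rwa [add_right_comm, add_assoc] at this

theorem opDiff_opDiff [CharZero k] {p : ℤ} {f : OpOn k d M (Fin n)} (hf : IsHom 𝓜 p f) :
    opDiff 𝓜 (opDiff 𝓜 f) = 0 := by
  refine LinearMap.ext fun x => ?_
  rw [opDiff_apply 𝓜 hf.opDiff, opDiff_apply 𝓜 hf, opDiff_apply 𝓜 hf, map_sub,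
    diagDiff_diagDiff, jouBoxDiff_jouBoxDiff, map_zero, smul_zero, sub_zero, zero_sub,
    map_negOnePow_smul, Int.negOnePow_succ]
  simp

theorem opDiff_mem (f : ChiralOp 𝓜 n) : opDiff 𝓜 (toOp f) ∈ ChiralOp 𝓜 n := by
  rcases eq_or_ne n 0 with rfl | hn
  · have : toOp f = 0 := congrArg toOp (chiralOp_zero_eq f)
    rw [this, map_zero]
    exact Submodule.zero_mem _
  · induction f using chiral_induction with
    | h p f hf => exact homDeg_le_chiralOp hn _ hf.opDiff
    | ha f g hf hg =>
      have : opDiff 𝓜 (toOp (f + g)) = opDiff 𝓜 (toOp f) + opDiff 𝓜 (toOp g) := map_add _ _ _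
      rw [this]
      exact Submodule.add_mem _ hf hg

/-- The differential on chiral operations. -/
def chiralDiff (n : ℕ) : Module.End k (ChiralOp 𝓜 n) :=
  ((opDiff 𝓜).comp (ChiralOp 𝓜 n).subtype).codRestrict _ (opDiff_mem 𝓜)

theorem chiralDiff_chiralDiff [CharZero k] (f : ChiralOp 𝓜 n) :
    chiralDiff 𝓜 n (chiralDiff 𝓜 n f) = 0 := by
  induction f using chiral_induction with
  | h p f hf => exact Subtype.ext (opDiff_opDiff 𝓜 hf)
  | ha f g hf hg => rw [map_add, map_add, hf, hg, add_zero]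

end Differential

/-! ### Koszul signs -/

section Koszul

variable {n : ℕ}

/-- The exponent of the Koszul sign of a permutation of homogeneous elements of degrees `ε i`. -/
def koszulExp (σ : Equiv.Perm (Fin n)) (ε : Fin n → ℤ) : ℤ :=
  ∑ i, ∑ j, if i < j ∧ σ j < σ i then ε i * ε j else 0

theorem even_of_eq {a b : ℤ} (h : Even a) (e : a = b) : Even b := e ▸ h

theorem negOnePow_sum {ι : Type*} (s : Finset ι) (f : ι → ℤ) :
    (∑ i ∈ s, f i).negOnePow = ∏ i ∈ s, (f i).negOnePow := by
  classical
  induction s using Finset.induction_on with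
  | empty => simp
  | insert a s ha ih => rw [Finset.sum_insert ha, Finset.prod_insert ha, Int.negOnePow_add, ih]

theorem koszulSign_eq (σ : Equiv.Perm (Fin n)) (ε : Fin n → ℤ) :
    koszulSign (fun i => (ε i : ZMod 2)) σ = ((koszulExp σ ε).negOnePow : ℤ) := by
  rw [koszulSign, koszulExp, negOnePow_sum]
  push_cast
  refine Finset.prod_congr rfl fun i _ => ?_
  rw [negOnePow_sum]
  push_cast
  refine Finset.prod_congr rfl fun j _ => ?_
  by_cases h : i < j ∧ σ j < σ i
  · rw [if_pos h]
    simp only [h, true_and, ZMod.intCast_eq_one_iff_odd]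
    by_cases h' : Odd (ε i) ∧ Odd (ε j)
    · rw [if_pos h', Int.negOnePow_odd _ (h'.1.mul h'.2)]; rfl
    · rw [if_neg h', Int.negOnePow_even]; · rfl
      rw [← Int.not_odd_iff_even, Int.odd_mul]
      exact h'
  · rw [if_neg h, if_neg fun h' => h ⟨h'.1, h'.2.1⟩]; rfl

/-- The sum over the indices whose order with respect to `i` is changed by `σ`. -/
def invSum (σ : Equiv.Perm (Fin n)) (i : Fin n) (ε : Fin n → ℤ) : ℤ :=
  ∑ j, if (i < j ∧ σ j < σ i) ∨ (j < i ∧ σ i < σ j) then ε j else 0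

/-- The part of the Koszul sign which is due to the element at the index `i`. -/
theorem koszulExp_update (σ : Equiv.Perm (Fin n)) (ε : Fin n → ℤ) (i : Fin n) (f : ℤ) :
    koszulExp σ (Function.update ε i f) =
      koszulExp σ (Function.update ε i 0) + f * invSum σ i ε := by
  have h : f * invSum σ i ε = (∑ a, ∑ b, if a = i then
      (if i < b ∧ σ b < σ i then f * ε b else 0) else 0) + ∑ a, ∑ b, if b = i then
      (if a < i ∧ σ i < σ a then f * ε a else 0) else 0 := by
    have h1 : ∀ a : Fin n, ∑ b, (if b = i then (if a < i ∧ σ i < σ a then f * ε a else 0) else 0) =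
        if a < i ∧ σ i < σ a then f * ε a else 0 := fun a => by simp
    have h2 : ∀ a : Fin n, ∑ b, (if a = i then (if i < b ∧ σ b < σ i then f * ε b else 0) else 0) =
        if a = i then ∑ b, (if i < b ∧ σ b < σ i then f * ε b else 0) else 0 := fun a => by
      split_ifs <;> simp
    simp only [h1, h2, Finset.sum_ite_eq', Finset.mem_univ, if_true]
    rw [← Finset.sum_add_distrib, invSum, Finset.mul_sum]
    refine Finset.sum_congr rfl fun j _ => ?_
    by_cases hj : i < j
    · simp [hj, hj.not_gt]
    · simp [hj]
  rw [h, koszulExp, koszulExp, ← Finset.sum_add_distrib, ← Finset.sum_add_distrib]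
  refine Finset.sum_congr rfl fun a _ => ?_
  rw [← Finset.sum_add_distrib, ← Finset.sum_add_distrib]
  refine Finset.sum_congr rfl fun b _ => ?_
  by_cases ha : a = i
  · subst ha
    by_cases hb : b = a
    · subst hb; simp
    · simp [hb]
  · by_cases hb : b = i
    · subst hb; simp [ha, mul_comm]
    · simp [ha, hb]

theorem even_invSum (σ : Equiv.Perm (Fin n)) (ε : Fin n → ℤ) (i : Fin n) :
    Even ((∑ j with j < i, ε j) + (∑ j with σ j < σ i, ε j) + invSum σ i ε) := by
  rw [invSum, Finset.sum_filter, Finset.sum_filter, ← Finset.sum_add_distrib,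
    ← Finset.sum_add_distrib]
  refine Finset.even_sum _ fun j _ => ?_
  rcases lt_trichotomy j i with h | h | h
  · rcases lt_or_gt_of_ne (fun h' => h.ne (σ.injective h')) with h' | h' <;>
      simp [h, h', h.not_gt, h'.not_gt]
  · subst h; simp
  · rcases lt_or_gt_of_ne (fun h' => h.ne (σ.injective h')) with h' | h' <;>
      simp [h, h', h.not_gt, h'.not_gt]

theorem even_invSum_gt (σ : Equiv.Perm (Fin n)) (ε : Fin n → ℤ) (i : Fin n) :
    Even ((∑ j with i < j, ε j) + (∑ j with σ i < σ j, ε j) + invSum σ i ε) := by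
  rw [invSum, Finset.sum_filter, Finset.sum_filter, ← Finset.sum_add_distrib,
    ← Finset.sum_add_distrib]
  refine Finset.even_sum _ fun j _ => ?_
  rcases lt_trichotomy j i with h | h | h
  · rcases lt_or_gt_of_ne (fun h' => h.ne (σ.injective h')) with h' | h' <;>
      simp [h, h', h.not_gt, h'.not_gt]
  · subst h; simp
  · rcases lt_or_gt_of_ne (fun h' => h.ne (σ.injective h')) with h' | h' <;>
      simp [h, h', h.not_gt, h'.not_gt]

theorem sum_sum_eq_of_lt (F : Fin n → Fin n → ℤ) (h : ∀ i, F i i = 0) :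
    ∑ i, ∑ j, F i j = ∑ i, ∑ j, if i < j then F i j + F j i else 0 := by
  have h1 : ∀ i j, F i j = (if i < j then F i j else 0) + if j < i then F i j else 0 := by
    intro i j
    rcases lt_trichotomy i j with h' | h' | h'
    · simp [h', h'.not_gt]
    · subst h'; simp [h]
    · simp [h', h'.not_gt]
  have h2 : ∑ i, ∑ j, (if j < i then F i j else 0) = ∑ i, ∑ j, if i < j then F j i else 0 :=
    Finset.sum_comm
  rw [Finset.sum_congr rfl fun i _ => Finset.sum_congr rfl fun j _ => h1 i j]
  simp only [Finset.sum_add_distrib]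
  rw [h2, ← Finset.sum_add_distrib]
  refine Finset.sum_congr rfl fun i _ => ?_
  rw [← Finset.sum_add_distrib]
  refine Finset.sum_congr rfl fun j _ => ?_
  split_ifs <;> simp

/-- The cocycle property of Koszul signs. -/
theorem even_koszulExp_mul (σ τ : Equiv.Perm (Fin n)) (ε : Fin n → ℤ) :
    Even (koszulExp (σ * τ) ε + koszulExp τ ε + koszulExp σ fun i => ε (τ.symm i)) := by
  have h : (koszulExp σ fun i => ε (τ.symm i)) =
      ∑ i, ∑ j, if τ i < τ j ∧ σ (τ j) < σ (τ i) then ε i * ε j else 0 := by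
    rw [koszulExp, ← Equiv.sum_comp τ]
    refine Finset.sum_congr rfl fun i _ => ?_
    rw [← Equiv.sum_comp τ]
    simp
  rw [h, koszulExp, koszulExp, ← Finset.sum_add_distrib, ← Finset.sum_add_distrib]
  simp_rw [← Finset.sum_add_distrib]
  rw [sum_sum_eq_of_lt _ fun i => by simp]
  refine Finset.even_sum _ fun i _ => Finset.even_sum _ fun j _ => ?_
  by_cases hij : i < j
  · have ht : τ i ≠ τ j := fun h => hij.ne (τ.injective h)
    have hs : σ (τ i) ≠ σ (τ j) := fun h => ht (σ.injective h)
    simp only [Equiv.Perm.mul_apply, hij, true_and, hij.not_gt, false_and, if_false, if_true]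
    rcases lt_or_gt_of_ne ht with h | h <;> rcases lt_or_gt_of_ne hs with h' | h' <;>
      simp [h, h', h.not_gt, h'.not_gt, mul_comm (ε j)]
  · rw [if_neg hij]; exact Even.zero

end Koszul

/-! ### The action of permutations -/

section Perm

variable {k : Type*} [Field k] {d : ℕ} {M : Type*} [AddCommGroup M] [Module k M]
    [Module (Weyl k (Fin d))ᵐᵒᵖ M] [IsScalarTower k (Weyl k (Fin d))ᵐᵒᵖ M]
    (𝓜 : DGStructure k d M) {n : ℕ}

/-- The map of complete graphs given by a permutation. -/
abbrev permHom (σ : Equiv.Perm (Fin n)) : (⊤ : SimpleGraph (Fin n)) →g (⊤ : SimpleGraph (Fin n)) :=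
  topHom σ σ.injective

theorem boxPerm_hom (σ : Equiv.Perm (Fin n)) {ε : Fin n → ℤ} {m : Fin n → M}
    (hm : ∀ j, m j ∈ 𝓜.deg (ε j)) : boxPerm 𝓜 σ (box k m) =
      (koszulExp σ ε).negOnePow • box k fun i => m (σ.symm i) := by
  rw [boxPerm_box 𝓜 σ ε m hm, koszulSign_eq, Units.smul_def]

theorem jouBoxPerm_jmMk (σ : Equiv.Perm (Fin n)) (m : Box k (Fin n) M)
    (a : Jou k d (⊤ : SimpleGraph (Fin n))) :
    jouBoxPerm 𝓜 σ (jmMk _ m a) = jmMk _ (boxPerm 𝓜 σ m) (jmap (permHom σ) a) :=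
  jmLift_mk _ _ _ _

theorem jouBoxPerm_box (σ : Equiv.Perm (Fin n)) {ε : Fin n → ℤ} {m : Fin n → M}
    (hm : ∀ j, m j ∈ 𝓜.deg (ε j)) (a : Jou k d (⊤ : SimpleGraph (Fin n))) :
    jouBoxPerm 𝓜 σ (jmMk _ (box k m) a) =
      (koszulExp σ ε).negOnePow • jmMk _ (box k fun i => m (σ.symm i)) (jmap (permHom σ) a) := by
  rw [jouBoxPerm_jmMk, boxPerm_hom 𝓜 σ hm, map_negOnePow_smul, negOnePow_smul_apply]

theorem update_comp_symm (σ : Equiv.Perm (Fin n)) (m : Fin n → M) (i : Fin n) (x : M) :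
    (fun j => Function.update m i x (σ.symm j)) =
      Function.update (fun j => m (σ.symm j)) (σ i) x := by
  ext j
  by_cases h : j = σ i
  · subst h; simp
  · have : σ.symm j ≠ i := fun h' => h (by rw [← h', Equiv.apply_symm_apply])
    simp [h, this]

theorem boxPerm_pd (σ : Equiv.Perm (Fin n)) (c : Fin n × Fin d) (m : Box k (Fin n) M) :
    boxPerm 𝓜 σ (ract (wpd k c) m) = ract (wpd k (σ c.1, c.2)) (boxPerm 𝓜 σ m) := by
  refine LinearMap.congr_fun (f := boxPerm 𝓜 σ ∘ₗ ract (wpd k c))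
    (g := ract (wpd k (σ c.1, c.2)) ∘ₗ boxPerm 𝓜 σ) (box_hom_ext 𝓜 fun ε m hm => ?_) m
  have hu := update_mem_deg 𝓜 hm c.1 (𝓜.smul_mem _ (MulOpposite.op (wpd k c.2)) _ (hm c.1))
  rw [Function.update_eq_self] at hu
  rw [LinearMap.comp_apply, LinearMap.comp_apply, boxPerm_hom 𝓜 σ hm, map_negOnePow_smul,
    ract_box_pd, ract_box_pd, slot_box, slot_box]
  refine (boxPerm_hom 𝓜 σ hu).trans ?_
  rw [update_comp_symm]
  simp [ract_apply]

theorem jouBoxPerm_z (σ : Equiv.Perm (Fin n)) (c : Fin n × Fin d) (x : JouBox k d M n) :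
    jouBoxPerm 𝓜 σ (ract (wz k c) x) = ract (wz k (σ c.1, c.2)) (jouBoxPerm 𝓜 σ x) := by
  refine LinearMap.congr_fun (f := jouBoxPerm 𝓜 σ ∘ₗ ract (wz k c))
    (g := ract (wz k (σ c.1, c.2)) ∘ₗ jouBoxPerm 𝓜 σ) (jm_ext fun m a => ?_) x
  simp only [LinearMap.comp_apply]
  rw [ract_jm_z, jouBoxPerm_jmMk, jouBoxPerm_jmMk, ract_jm_z, map_mul, jmap_z]
  rfl

theorem jouBoxPerm_pd (σ : Equiv.Perm (Fin n)) (c : Fin n × Fin d) (x : JouBox k d M n) :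
    jouBoxPerm 𝓜 σ (ract (wpd k c) x) = ract (wpd k (σ c.1, c.2)) (jouBoxPerm 𝓜 σ x) := by
  refine LinearMap.congr_fun (f := jouBoxPerm 𝓜 σ ∘ₗ ract (wpd k c))
    (g := ract (wpd k (σ c.1, c.2)) ∘ₗ jouBoxPerm 𝓜 σ) (jm_ext fun m a => ?_) x
  simp only [LinearMap.comp_apply]
  have h : jpd (σ c.1) c.2 (jmap (permHom σ) a) = jmap (permHom σ) (jpd c.1 c.2 a) :=
    jpd_jmap_of_injective (permHom σ) σ.injective c.1 c.2 a
  rw [ract_jm_pd, map_sub, jouBoxPerm_jmMk, jouBoxPerm_jmMk, jouBoxPerm_jmMk, ract_jm_pd,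
    boxPerm_pd, h]

variable {𝓜} in
theorem jouBoxPerm_mem (σ : Equiv.Perm (Fin n)) {p : ℤ} {x : JouBox k d M n}
    (hx : x ∈ srcDeg 𝓜 (Fin n) p) : jouBoxPerm 𝓜 σ x ∈ srcDeg 𝓜 (Fin n) p := by
  induction hx using Submodule.span_induction with
  | mem x hx =>
    obtain ⟨ε, m, r, a, hm, ha, rfl, rfl⟩ := hx
    rw [jouBoxPerm_box 𝓜 σ hm]
    refine negOnePow_smul_mem _ _ (Submodule.subset_span ⟨fun i => ε (σ.symm i), _, r, _,
      fun i => hm _, jmap_mem_jdeg _ ha, ?_, rfl⟩)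
    rw [Equiv.sum_comp σ.symm]
  | zero => rw [map_zero]; exact Submodule.zero_mem _
  | add x y _ _ hx hy => rw [map_add]; exact Submodule.add_mem _ hx hy
  | smul c x _ hx => rw [map_smul]; exact Submodule.smul_mem _ _ hx

theorem jouBoxPerm_one : jouBoxPerm 𝓜 (1 : Equiv.Perm (Fin n)) = LinearMap.id :=
  jouBox_hom_ext 𝓜 fun ε m r a hm _ => by
    have h : koszulExp 1 ε = 0 := Finset.sum_eq_zero fun i _ => Finset.sum_eq_zero fun j _ =>
      if_neg fun h => h.1.not_gt h.2
    rw [jouBoxPerm_box 𝓜 1 hm, h, Int.negOnePow_zero, one_smul, jmap_id _ fun _ => rfl]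
    rfl

theorem jouBoxPerm_mul (σ τ : Equiv.Perm (Fin n)) (x : JouBox k d M n) :
    jouBoxPerm 𝓜 (σ * τ) x = jouBoxPerm 𝓜 σ (jouBoxPerm 𝓜 τ x) := by
  refine LinearMap.congr_fun (g := jouBoxPerm 𝓜 σ ∘ₗ jouBoxPerm 𝓜 τ)
    (jouBox_hom_ext 𝓜 fun ε m r a hm _ => ?_) x
  rw [LinearMap.comp_apply, jouBoxPerm_box 𝓜 τ hm, map_negOnePow_smul,
    jouBoxPerm_box 𝓜 σ fun j => hm (τ.symm j), jouBoxPerm_box 𝓜 (σ * τ) hm, negOnePow_smul_smul,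
    jmap_jmap (permHom τ) (permHom σ) (permHom (σ * τ)) fun _ => rfl]
  refine congrArg₂ _ (negOnePow_congr ?_) rfl
  have := (even_koszulExp_mul σ τ ε).sub (even_two_mul
    (koszulExp τ ε + koszulExp σ fun i => ε (τ.symm i)))
  exact even_of_eq this (by ring)

theorem jouBoxPerm_jouBoxDiff (σ : Equiv.Perm (Fin n)) (x : JouBox k d M n) :
    jouBoxPerm 𝓜 σ (jouBoxDiff 𝓜 n x) = jouBoxDiff 𝓜 n (jouBoxPerm 𝓜 σ x) := by
  refine LinearMap.congr_fun (f := jouBoxPerm 𝓜 σ ∘ₗ jouBoxDiff 𝓜 n)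
    (g := jouBoxDiff 𝓜 n ∘ₗ jouBoxPerm 𝓜 σ) (jouBox_hom_ext 𝓜 fun ε m r a hm _ => ?_) x
  have hu := fun i => update_mem_deg 𝓜 hm i (𝓜.diff_mem _ _ (hm i))
  rw [LinearMap.comp_apply, LinearMap.comp_apply, jouBoxDiff_box 𝓜 hm, jouBoxPerm_box 𝓜 σ hm,
    map_add, map_sum, map_negOnePow_smul, map_negOnePow_smul, jouBoxPerm_box 𝓜 σ hm,
    jouBoxDiff_box 𝓜 (fun j => hm (σ.symm j)), smul_add, Equiv.sum_comp σ.symm]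
  congr 1
  · rw [Finset.smul_sum]
    refine Eq.trans ?_ (Equiv.sum_comp σ _)
    refine Finset.sum_congr rfl fun i _ => ?_
    rw [map_negOnePow_smul, jouBoxPerm_box 𝓜 σ (hu i), negOnePow_smul_smul, negOnePow_smul_smul,
      update_comp_symm, Equiv.symm_apply_apply]
    refine congrArg₂ _ (negOnePow_congr ?_) rfl
    have h1 : ∑ j with j < σ i, ε (σ.symm j) = ∑ j with σ j < σ i, ε j := by
      rw [Finset.sum_filter, Finset.sum_filter, ← Equiv.sum_comp σ]
      simp
    have h2 := koszulExp_update σ ε i (ε i)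
    rw [Function.update_eq_self] at h2
    rw [h1, koszulExp_update, h2]
    have := (even_invSum σ ε i).sub (even_two_mul (∑ j with σ j < σ i, ε j))
    exact even_of_eq this (by ring)
  · rw [negOnePow_smul_smul, negOnePow_smul_smul, add_comm, jmap_jd]

theorem diagPerm_mk (σ : Equiv.Perm (Fin n)) (x : M) (F : MvPolynomial (Fin n × Fin d) k) :
    diagPerm σ (puMk (fun c : Fin n × Fin d => c.2) x F) =
      puMk _ x (MvPolynomial.rename (fun c : Fin n × Fin d => (σ c.1, c.2)) F) :=
  puLift_mk _ _ _ _

theorem diagPerm_pd (σ : Equiv.Perm (Fin n)) (c : Fin n × Fin d) (y : Diag k d M n) :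
    diagPerm σ (ract (wpd k c) y) = ract (wpd k (σ c.1, c.2)) (diagPerm σ y) := by
  induction y using push_induction with
  | ha y y' hy hy' => simp only [map_add, hy, hy']
  | hm x F => rw [ract_push_pd_mk, diagPerm_mk, diagPerm_mk, ract_push_pd_mk, map_mul,
      MvPolynomial.rename_X]

theorem diagPerm_z (σ : Equiv.Perm (Fin n)) (c : Fin n × Fin d) (y : Diag k d M n) :
    diagPerm σ (ract (wz k c) y) = ract (wz k (σ c.1, c.2)) (diagPerm σ y) := by
  induction y using push_induction with
  | ha y y' hy hy' => simp only [map_add, hy, hy']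
  | hm x F =>
    have h : Function.Injective fun c : Fin n × Fin d => (σ c.1, c.2) := fun a b hab =>
      Prod.ext (σ.injective (Prod.ext_iff.1 hab).1) (Prod.ext_iff.1 hab).2
    rw [ract_push_z_mk, map_add, diagPerm_mk, diagPerm_mk, diagPerm_mk, ract_push_z_mk,
      ← MvPolynomial.pderiv_rename h]

theorem diagPerm_mem (σ : Equiv.Perm (Fin n)) {p : ℤ} {y : Diag k d M n}
    (hy : y ∈ tgtDeg 𝓜 (Fin n) p) : diagPerm σ y ∈ tgtDeg 𝓜 (Fin n) p := by
  induction hy using Submodule.span_induction with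
  | mem y hy =>
    obtain ⟨x, F, hx, rfl⟩ := hy
    rw [diagPerm_mk]
    exact Submodule.subset_span ⟨_, _, hx, rfl⟩
  | zero => rw [map_zero]; exact Submodule.zero_mem _
  | add x y _ _ hx hy => rw [map_add]; exact Submodule.add_mem _ hx hy
  | smul c x _ hx => rw [map_smul]; exact Submodule.smul_mem _ _ hx

theorem diagPerm_one (y : Diag k d M n) : diagPerm 1 y = y := by
  induction y using push_induction with
  | ha y y' hy hy' => rw [map_add, hy, hy']
  | hm x F => rw [diagPerm_mk]; exact congrArg _ (MvPolynomial.rename_id_apply F)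

theorem diagPerm_mul (σ τ : Equiv.Perm (Fin n)) (y : Diag k d M n) :
    diagPerm (σ * τ) y = diagPerm σ (diagPerm τ y) := by
  induction y using push_induction with
  | ha y y' hy hy' => simp only [map_add, hy, hy']
  | hm x F => rw [diagPerm_mk, diagPerm_mk, diagPerm_mk, MvPolynomial.rename_rename]; rfl

theorem diagPerm_diagDiff (σ : Equiv.Perm (Fin n)) (y : Diag k d M n) :
    diagPerm σ (diagDiff 𝓜 n y) = diagDiff 𝓜 n (diagPerm σ y) := by
  rw [diagDiff_eq]
  induction y using push_induction with
  | ha y y' hy hy' => simp only [map_add, hy, hy']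
  | hm x F => rw [diagEnd_mk, diagPerm_mk, diagPerm_mk, diagEnd_mk]

/-- The action of a permutation on operations. -/
def opPerm (σ : Equiv.Perm (Fin n)) : Module.End k (OpOn k d M (Fin n)) :=
  LinearMap.compRight k (diagPerm σ) ∘ₗ LinearMap.lcomp k _ (jouBoxPerm 𝓜 σ⁻¹)

theorem opPerm_apply (σ : Equiv.Perm (Fin n)) (f : OpOn k d M (Fin n)) (x : JouBox k d M n) :
    opPerm 𝓜 σ f x = diagPerm σ (f (jouBoxPerm 𝓜 σ⁻¹ x)) := rfl

theorem opPerm_jouBoxPerm (σ : Equiv.Perm (Fin n)) (f : OpOn k d M (Fin n)) (x : JouBox k d M n) :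
    opPerm 𝓜 σ f (jouBoxPerm 𝓜 σ x) = diagPerm σ (f x) := by
  rw [opPerm_apply, ← jouBoxPerm_mul, inv_mul_cancel, jouBoxPerm_one, LinearMap.id_apply]

theorem opPerm_isDLin (σ : Equiv.Perm (Fin n)) {f : OpOn k d M (Fin n)} (hf : IsDLin f) :
    IsDLin (opPerm 𝓜 σ f) := by
  refine isDLin_of_ract (fun c x => ?_) (fun c x => ?_)
  · rw [opPerm_apply, opPerm_apply, jouBoxPerm_z, hf.ract, diagPerm_z]
    simp
  · rw [opPerm_apply, opPerm_apply, jouBoxPerm_pd, hf.ract, diagPerm_pd]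
    simp

variable {𝓜} in
theorem IsHom.opPerm (σ : Equiv.Perm (Fin n)) {p : ℤ} {f : OpOn k d M (Fin n)}
    (hf : IsHom 𝓜 p f) : IsHom 𝓜 p (opPerm 𝓜 σ f) :=
  ⟨opPerm_isDLin 𝓜 σ hf.1, fun q _ hx => diagPerm_mem 𝓜 σ (hf.2 q _ (jouBoxPerm_mem _ hx))⟩

theorem opPerm_mem (σ : Equiv.Perm (Fin n)) (f : ChiralOp 𝓜 n) :
    opPerm 𝓜 σ (toOp f) ∈ ChiralOp 𝓜 n := by
  rcases eq_or_ne n 0 with rfl | hn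
  · have : toOp f = 0 := congrArg toOp (chiralOp_zero_eq f)
    rw [this, map_zero]
    exact Submodule.zero_mem _
  · induction f using chiral_induction with
    | h p f hf => exact homDeg_le_chiralOp hn _ (hf.opPerm σ)
    | ha f g hf hg =>
      have : opPerm 𝓜 σ (toOp (f + g)) = opPerm 𝓜 σ (toOp f) + opPerm 𝓜 σ (toOp g) :=
        map_add _ _ _
      rw [this]
      exact Submodule.add_mem _ hf hg

/-- The action of the symmetric group on chiral operations. -/
def chiralAct (n : ℕ) : Representation k (Equiv.Perm (Fin n)) (ChiralOp 𝓜 n) where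
  toFun σ := ((opPerm 𝓜 σ).comp (ChiralOp 𝓜 n).subtype).codRestrict _ (opPerm_mem 𝓜 σ)
  map_one' := LinearMap.ext fun f => Subtype.ext <| LinearMap.ext fun x =>
    (opPerm_apply 𝓜 1 (toOp f) x).trans <| by
      rw [inv_one, jouBoxPerm_one, diagPerm_one]; rfl
  map_mul' σ τ := LinearMap.ext fun f => Subtype.ext <| LinearMap.ext fun x =>
    (opPerm_apply 𝓜 (σ * τ) (toOp f) x).trans <| by
      rw [mul_inv_rev, jouBoxPerm_mul, diagPerm_mul]; rfl

theorem chiralDiff_chiralAct (σ : Equiv.Perm (Fin n)) (f : ChiralOp 𝓜 n) :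
    chiralDiff 𝓜 n (chiralAct 𝓜 n σ f) = chiralAct 𝓜 n σ (chiralDiff 𝓜 n f) := by
  induction f using chiral_induction with
  | h p f hf =>
    refine Subtype.ext (LinearMap.ext fun x => ?_)
    refine (opDiff_apply 𝓜 (hf.opPerm σ) x).trans ?_
    refine Eq.trans ?_ (congrArg (diagPerm σ) (opDiff_apply 𝓜 hf (jouBoxPerm 𝓜 σ⁻¹ x))).symm
    rw [opPerm_apply, opPerm_apply, jouBoxPerm_jouBoxDiff, map_sub, diagPerm_diagDiff,
      map_negOnePow_smul]
  | ha f g hf hg => simp only [map_add, hf, hg]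

end Perm

/-! ### The unit -/

section Unit

variable {k : Type*} [Field k] {d : ℕ} {M : Type*} [AddCommGroup M] [Module k M]
    [Module (Weyl k (Fin d))ᵐᵒᵖ M] [IsScalarTower k (Weyl k (Fin d))ᵐᵒᵖ M]
    (𝓜 : DGStructure k d M)

instance : IsEmpty (⊤ : SimpleGraph (Fin 1)).Dart :=
  ⟨fun e => SimpleGraph.ne_of_adj _ e.adj (Subsingleton.elim _ _)⟩

/-- The action of the polynomial ring `𝐉^1` on `Δ_* M`, where `Δ` is the identity of `𝔸^d`. -/
def unitAct : Jou k d (⊤ : SimpleGraph (Fin 1)) →ₐ[k] Module.End k (Diag k d M 1) :=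
  jlift (fun g => match g with
    | .z i s => ract (wz k (i, s))
    | .x e _ => isEmptyElim e
    | .dx e _ => isEmptyElim e)
    (fun i s g => match g with
      | .z j t => by simp only [← ract_mul, wz_comm]
      | .x e _ => isEmptyElim e
      | .dx e _ => isEmptyElim e)
    (fun e => isEmptyElim e) (fun e => isEmptyElim e) (fun e => isEmptyElim e)
    (fun e => isEmptyElim e) (fun e => isEmptyElim e) (fun e => isEmptyElim e)
    (fun e => isEmptyElim e)

theorem unitAct_z (i : Fin 1) (s : Fin d) :
    unitAct (M := M) (jgen k (.z i s)) = ract (wz k (i, s)) := jlift_gen _ _ _ _ _ _ _ _ _ _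

theorem ract_pd_z_comm (c c' : Fin 1 × Fin d) (y : Diag k d M 1) :
    ract (wpd k c) (ract (wz k c') y) + (if c' = c then y else 0) =
      ract (wz k c') (ract (wpd k c) y) := by
  simp only [← Module.End.mul_apply, ← ract_mul]
  by_cases h : c' = c
  · subst h
    rw [if_pos rfl, wpd_wz_same, ract_add, ract_one]
    rfl
  · rw [if_neg h, wpd_wz_ne (Ne.symm h), add_zero]

theorem unitAct_pd (c : Fin 1 × Fin d) (a : Jou k d (⊤ : SimpleGraph (Fin 1)))
    (y : Diag k d M 1) : unitAct a (ract (wpd k c) y) =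
      ract (wpd k c) (unitAct a y) + unitAct (jpd c.1 c.2 a) y := by
  induction a using jou_induction generalizing y with
  | hs r => rw [jpd_algebraMap, AlgHom.commutes, map_zero, LinearMap.zero_apply, add_zero,
    Module.algebraMap_end_apply, Module.algebraMap_end_apply, map_smul]
  | hg g =>
    match g with
    | .z i s =>
      rw [unitAct_z, jpd_z, ← ract_pd_z_comm]
      congr 1
      by_cases h : (i, s) = c
      · subst h; simp
      · rw [if_neg h, if_neg fun h' => h (Prod.ext h'.1 h'.2)]; simp
    | .x e _ => exact isEmptyElim e
    | .dx e _ => exact isEmptyElim e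
  | hm a b ha hb =>
    simp only [map_mul, Module.End.mul_apply, hb, ha, map_add, jpd_mul, LinearMap.add_apply]
    abel
  | ha a b ha hb =>
    simp only [map_add, LinearMap.add_apply, ha, hb]
    abel

/-- The identification `M^{⊠ 1} = M`. -/
def boxOne : Box k (Fin 1) M →ₗ[k] M :=
  (PiTensorProduct.subsingletonEquiv (R := k) (s := fun _ => M) (0 : Fin 1)).toLinearMap

theorem boxOne_box (m : Fin 1 → M) : boxOne (box k m) = m 0 := by
  have : m = fun _ => m 0 := by ext i; rw [Subsingleton.elim i 0]
  rw [this]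
  exact PiTensorProduct.subsingletonEquiv_apply_tprod (R := k)
    (s := fun _ => M) (0 : Fin 1) (fun _ => m 0)

theorem boxOne_slot (i : Fin 1) (f : Module.End k M) (n : Box k (Fin 1) M) :
    boxOne (slot i f n) = f (boxOne n) := by
  refine LinearMap.congr_fun (f := boxOne ∘ₗ slot i f) (g := f ∘ₗ boxOne)
    (box_ext fun m => ?_) n
  rw [LinearMap.comp_apply, LinearMap.comp_apply, slot_box, boxOne_box, boxOne_box,
    Subsingleton.elim i 0, Function.update_self]

theorem ract_z_mk_one {B : Type*} [Fintype B] [DecidableEq B] (c : B × Fin d) (x : M) :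
    ract (wz k c) (puMk (k := k) (fun c : B × Fin d => c.2) x 1) =
      puMk (fun c : B × Fin d => c.2) (ract (wz k c.2) x) 1 := by
  rw [ract_push_z_mk]
  simp

/-- The unit `m ⊗ a ↦ (m ⊗ 1) a`. -/
def unitOp : OpOn k d M (Fin 1) :=
  jmLift (LinearMap.mk₂ k (fun n a => unitAct a (puMk _ (boxOne n) 1))
    (fun n n' a => by simp) (fun c n a => by simp) (fun n a a' => by simp)
    (fun c n a => by simp)) fun c n a => by
    rw [LinearMap.mk₂_apply, LinearMap.mk₂_apply, jz_central, map_mul, Module.End.mul_apply,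
      unitAct_z, ract_z_mk_one, ract_box_z, boxOne_slot]

theorem unitOp_mk (n : Box k (Fin 1) M) (a : Jou k d (⊤ : SimpleGraph (Fin 1))) :
    unitOp (jmMk _ n a) = unitAct a (puMk _ (boxOne n) 1) := jmLift_mk _ _ _ _

theorem unitOp_box (m : Fin 1 → M) : unitOp (jmMk _ (box k m) 1) =
    puMk (fun c : Fin 1 × Fin d => c.2) (m 0) 1 := by
  rw [unitOp_mk, map_one, boxOne_box]; rfl

theorem puMk_pd_one (c : Fin 1 × Fin d) (x : M) :
    puMk (k := k) (fun c : Fin 1 × Fin d => c.2) (ract (wpd k c.2) x) 1 =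
      ract (wpd k c) (puMk (fun c : Fin 1 × Fin d => c.2) x 1) := by
  rw [puMk_pd, ract_push_pd_mk]
  congr 2
  rw [Finset.sum_eq_single c]
  · simp
  · rintro ⟨i, s⟩ - h
    refine if_neg fun h' => h (Prod.ext (Subsingleton.elim _ _) h')
  · simp

theorem unitOp_isDLin : IsDLin (unitOp (k := k) (d := d) (M := M)) := by
  refine isDLin_of_mk (fun c n a => ?_) (fun c n a => ?_)
  · rw [ract_jm_z, unitOp_mk, unitOp_mk, map_mul, unitAct_z]
    rfl
  · rw [ract_jm_pd, map_sub, unitOp_mk, unitOp_mk, unitOp_mk, ract_box_pd, boxOne_slot,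
      puMk_pd_one, unitAct_pd, add_sub_cancel_right]

variable {𝓜} in
theorem unitAct_mem {p : ℤ} {y : Diag k d M 1} (hy : y ∈ tgtDeg 𝓜 (Fin 1) p) {r : ℕ}
    {a : Jou k d (⊤ : SimpleGraph (Fin 1))} (ha : a ∈ jdeg r) :
    unitAct a y ∈ tgtDeg 𝓜 (Fin 1) (p + r) := by
  refine jdeg_le (k := k) (d := d) (S := fun r => (tgtDeg 𝓜 (Fin 1) (p + (r : ℕ))).comap
    ((LinearMap.applyₗ y) ∘ₗ (unitAct (M := M)).toLinearMap)) ?_ (fun i s r a h => ?_)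
    (fun e => isEmptyElim e) (fun e => isEmptyElim e) r ha
  · simpa using hy
  · simp only [Submodule.mem_comap, LinearMap.comp_apply, AlgHom.toLinearMap_apply,
      LinearMap.applyₗ_apply_apply, map_mul, Module.End.mul_apply, unitAct_z] at h ⊢
    exact ract_z_mem_tgtDeg 𝓜 h _

theorem unitOp_isHom : IsHom 𝓜 0 (unitOp (k := k) (d := d) (M := M)) := by
  refine isHom_of_mk 𝓜 unitOp_isDLin fun ε m r a hm ha => ?_
  rw [unitOp_mk, boxOne_box, add_zero, Fin.sum_univ_one]
  exact unitAct_mem (Submodule.subset_span ⟨_, _, hm 0, rfl⟩) ha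

theorem jd_fin_one (a : Jou k d (⊤ : SimpleGraph (Fin 1))) : jd a = 0 := by
  induction a using jou_induction with
  | hs r => exact jd_algebraMap r
  | hg g =>
    match g with
    | .z i s => exact jd_z i s
    | .x e _ => exact isEmptyElim e
    | .dx e _ => exact isEmptyElim e
  | hm a b ha hb => rw [jd_mul, ha, hb, zero_mul, mul_zero, add_zero]
  | ha a b ha hb => rw [map_add, ha, hb, add_zero]

theorem diagDiff_unitAct (a : Jou k d (⊤ : SimpleGraph (Fin 1))) (y : Diag k d M 1) :
    diagDiff 𝓜 1 (unitAct a y) = unitAct a (diagDiff 𝓜 1 y) := by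
  induction a using jou_induction generalizing y with
  | hs r => rw [AlgHom.commutes, Module.algebraMap_end_apply, Module.algebraMap_end_apply, map_smul]
  | hg g =>
    match g with
    | .z i s =>
      rw [unitAct_z, diagDiff_eq]
      exact diagEnd_smul _ _ (MulOpposite.op (wz k (i, s))) y
    | .x e _ => exact isEmptyElim e
    | .dx e _ => exact isEmptyElim e
  | hm a b ha hb => rw [map_mul, Module.End.mul_apply, Module.End.mul_apply, ha, hb]
  | ha a b ha hb => simp only [map_add, LinearMap.add_apply, ha, hb]

theorem unitOp_diff : opDiff 𝓜 (unitOp (k := k) (d := d) (M := M)) = 0 := by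
  refine jouBox_hom_ext 𝓜 fun ε m r a hm _ => ?_
  rw [opDiff_apply 𝓜 (unitOp_isHom 𝓜), jouBoxDiff_box 𝓜 hm, jd_fin_one, map_zero, smul_zero,
    add_zero, Fin.sum_univ_one, unitOp_mk, diagDiff_unitAct, map_negOnePow_smul, unitOp_mk,
    boxOne_box, boxOne_box, Function.update_self, diagDiff_eq, diagEnd_mk]
  simp

/-- The unit of the operad of chiral operations. -/
def chiralOne : ChiralOp 𝓜 1 := ⟨unitOp, homDeg_le_chiralOp one_ne_zero 0 (unitOp_isHom 𝓜)⟩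

end Unit

/-! ### Unitality -/

section Unital

variable {k : Type*} [Field k] {d : ℕ} {M : Type*} [AddCommGroup M] [Module k M]
    [Module (Weyl k (Fin d))ᵐᵒᵖ M] [IsScalarTower k (Weyl k (Fin d))ᵐᵒᵖ M]
    {𝓜 : DGStructure k d M}

/-- If the block is a point, its Jouanolou algebra lies in the image of the partial one. -/
theorem exists_partial_fin_one {I K : Type*} {i : K} (e : I ≃ {j : K // j ≠ i} ⊕ Fin 1)
    (a : Jou k d (⊤ : SimpleGraph (Fin 1))) :
    ∃ b : Jou k d (partialGraph (collapse e)),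
      jmap (blockHom e) a = jmap (partialGraphHom _) b := by
  induction a using jou_induction with
  | hs r => exact ⟨algebraMap k _ r, by rw [AlgHom.commutes, AlgHom.commutes]⟩
  | hg g =>
    match g with
    | .z i s => exact ⟨jgen k (.z (incl e i) s), by rw [jmap_z, jmap_z]; rfl⟩
    | .x e _ => exact isEmptyElim e
    | .dx e _ => exact isEmptyElim e
  | hm a b ha hb =>
    obtain ⟨x, hx⟩ := ha
    obtain ⟨y, hy⟩ := hb
    exact ⟨x * y, by rw [map_mul, map_mul, hx, hy]⟩
  | ha a b ha hb =>
    obtain ⟨x, hx⟩ := ha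
    obtain ⟨y, hy⟩ := hb
    exact ⟨x + y, by rw [map_add, map_add, hx, hy]⟩

theorem collapse_insEquiv_one {m : ℕ} (i : Fin (m + 1)) (a : Fin (m + 1)) :
    collapse (insEquiv i 1) a = a := by
  unfold collapse insEquiv
  simp only [Equiv.coe_fn_mk]
  split_ifs with h h'
  · rfl
  · ext; simp only [Sum.elim_inr]; omega
  · ext; simp

theorem glue_insEquiv_one {m : ℕ} (i : Fin (m + 1)) (m'' : Fin (m + 1) → M) (m' : Fin 1 → M) :
    glue (insEquiv i 1) m'' m' = Function.update m'' i (m' 0) := by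
  ext a
  obtain ⟨j, rfl⟩ | ⟨b, rfl⟩ := idx_cases (insEquiv i 1) a
  · have h := collapse_outerIdx (insEquiv i 1) j
    rw [collapse_insEquiv_one] at h
    rw [glue_outerIdx, h, Function.update_of_ne j.2]
  · have h := collapse_incl (insEquiv i 1) b
    rw [collapse_insEquiv_one] at h
    rw [glue_incl, h, Function.update_self, Subsingleton.elim b 0]

theorem jmap_congr {I I' : Type*} {G : SimpleGraph I} {G' : SimpleGraph I'} {φ ψ : G →g G'}
    (h : ∀ i, φ i = ψ i) (a : Jou k d G) : jmap φ a = jmap ψ a := by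
  rw [show φ = ψ from RelHom.ext h]

theorem diagSubst_id {B : Type*} [Fintype B] [DecidableEq B] {π : B → B} (h : ∀ b, π b = b)
    (y : DiagOn k d M B) : diagSubst π y = y :=
  substMap_id _ _ (liftIdx π) (fun c => Prod.ext (h c.1) rfl) _ y

theorem diagSubst_pd_equiv {I B : Type*} [Fintype I] [Fintype B] [DecidableEq I] [DecidableEq B]
    (c : B ≃ I) (x : B × Fin d) (y : DiagOn k d M B) :
    diagSubst c.symm (ract (wpd k x) y) = ract (wpd k (c x.1, x.2)) (diagSubst c.symm y) := by
  rw [diagSubst_pd, Finset.sum_eq_single (c x.1, x.2)]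
  · have h0 : liftIdx (d := d) c.symm (c x.1, x.2) = x := Prod.ext (c.symm_apply_apply _) rfl
    rw [if_pos h0]
  · rintro ⟨i, s⟩ - h
    refine if_neg fun h' => h ?_
    subst h'
    exact Prod.ext (c.apply_symm_apply i).symm rfl
  · simp

theorem chiralComp_one [CharZero k] {m : ℕ} (i : Fin (m + 1)) (μ : ChiralOp 𝓜 (m + 1)) :
    chiralComp i μ (chiralOne 𝓜) = μ := by
  refine Subtype.ext (jouBox_glue_ext 𝓜 (insEquiv i 1) fun ε ε' m'' m' r r' a b hm _ ha _ => ?_)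
  obtain ⟨b', hb'⟩ := exists_partial_fin_one (insEquiv i 1) a
  have h1 := compOn_mk 𝓜 (insEquiv i 1) (dlin μ) (dlin (chiralOne 𝓜)) (unitOp_isHom 𝓜)
    (fun j _ => hm j) m' (one_mem_jdeg (G := ⊤)) (b' * b)
  rw [map_one, one_mul, map_mul, ← hb'] at h1
  refine h1.trans ?_
  have h2 : toOp (chiralOne 𝓜) (jmMk _ (box k m') 1) = puMk _ (m' 0) 1 := unitOp_box m'
  have h3 : restrictDiag (collapse (insEquiv i 1)) (b' * b) =
      jmap (partialGraphHom _) (b' * b) := jmap_congr (collapse_insEquiv_one i) _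
  rw [h2, insertPush_one, outerOn_one, h3, map_mul, ← hb', glue_insEquiv_one,
    diagSubst_id (collapse_insEquiv_one i)]
  simp

/-- Transport of an operation along an equality of arities is a renaming of the inputs. -/
theorem recast_apply {a b : ℕ} (h : a = b) (μ : ChiralOp 𝓜 a) (m : Fin b → M)
    (α : Jou k d (⊤ : SimpleGraph (Fin a))) :
    toOp (recast (P := fun n => ChiralOp 𝓜 n) h μ)
      (jmMk _ (box k m) (jmap (topHom (finCongr h) (finCongr h).injective) α)) =
      diagSubst (finCongr h).symm (toOp μ (jmMk _ (box k fun i => m (finCongr h i)) α)) := by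
  subst h
  rw [jmap_id _ fun _ => rfl, diagSubst_id (π := ⇑(finCongr rfl).symm) fun _ => rfl]
  rfl

theorem incl_insEquiv_zero {n : ℕ} (b : Fin n) :
    incl (insEquiv (m := 0) 0 n) b = finCongr (Nat.zero_add n).symm b := by
  ext
  simp [incl, insEquiv]

/-- Insertion into the unit. -/
theorem outerOn_unitOp {n : ℕ} (m'' : Fin 1 → M) (y : DiagOn k d M (Fin n)) :
    outerOn (collapse (insEquiv (m := 0) 0 n)) unitOp unitOp_isDLin
      (jmMk _ (insertPush (insEquiv 0 n) m'' y) 1) =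
      diagSubst (finCongr (Nat.zero_add n).symm).symm y := by
  induction y using push_induction with
  | ha y y' hy hy' => simp only [map_add, LinearMap.add_apply, hy, hy']
  | hm x F =>
    refine puMk_induction (P := fun y => outerOn (collapse (insEquiv (m := 0) 0 n)) unitOp
      unitOp_isDLin (jmMk _ (insertPush (insEquiv 0 n) m'' y) 1) =
      diagSubst (finCongr (Nat.zero_add n).symm).symm y) x ?_ (fun c y hy => ?_)
      (fun y y' hy hy' => ?_) (fun c y hy => ?_) F
    · rw [insertPush_one, outerOn_one, map_one, unitOp_box, diagSubst_mk_one, diagSubst_mk_one,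
        Function.update_self]
    · simp only [map_smul, LinearMap.smul_apply, hy]
    · simp only [map_add, LinearMap.add_apply, hy, hy']
    · rw [insertPush_pd, outerOn_pd, jpd_one, map_zero, map_zero, add_zero, hy, diagSubst_pd_equiv]
      congr 3
      exact Prod.ext (incl_insEquiv_zero c.1) rfl

theorem recast_add {a b : ℕ} (h : a = b) (f g : ChiralOp 𝓜 a) :
    recast (P := fun n => ChiralOp 𝓜 n) h (f + g) = recast (P := fun n => ChiralOp 𝓜 n) h f +
      recast (P := fun n => ChiralOp 𝓜 n) h g := by
  subst h; rfl

theorem chiralOne_comp [CharZero k] {n : ℕ} (μ : ChiralOp 𝓜 n) :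
    chiralComp (m := 0) 0 (chiralOne 𝓜) μ =
      recast (P := fun n => ChiralOp 𝓜 n) (Nat.zero_add n).symm μ := by
  induction μ using chiral_induction with
  | ha f g hf hg =>
    rw [map_add, hf, hg, recast_add]
  | h q μ hμ =>
  refine Subtype.ext (jouBox_hom_ext 𝓜 fun ε m r α hm hα => ?_)
  set c := finCongr (Nat.zero_add n).symm with hc
  obtain ⟨a, ha, rfl⟩ : ∃ a ∈ jdeg r, jmap (topHom c c.injective) a = α :=
    ⟨jmap (topHom c.symm c.symm.injective) α, jmap_mem_jdeg _ hα, by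
      rw [jmap_jmap _ _ (RelHom.id _) fun i => c.apply_symm_apply i, jmap_id _ fun _ => rfl]⟩
  refine Eq.trans ?_ (recast_apply (Nat.zero_add n).symm μ m a).symm
  have h1 := compOn_mk 𝓜 (insEquiv (m := 0) 0 n) (dlin (chiralOne 𝓜)) (dlin μ) hμ
    (ε := 0) (m'' := fun _ => 0) (fun j hj => absurd (Subsingleton.elim (α := Fin 1) _ _) hj)
    (fun i => m (c i)) ha 1
  have h2 : glue (insEquiv (m := 0) 0 n) (fun _ => 0) (fun i => m (c i)) = m := by
    ext i
    obtain ⟨j, rfl⟩ | ⟨b, rfl⟩ := idx_cases (insEquiv (m := 0) 0 n) i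
    · exact absurd (Subsingleton.elim (α := Fin 1) _ _) j.2
    · rw [glue_incl, incl_insEquiv_zero]
  have h3 : jmap (blockHom (insEquiv (m := 0) 0 n)) a = jmap (topHom c c.injective) a :=
    jmap_congr (fun b => incl_insEquiv_zero b) a
  rw [map_one, mul_one, h2, h3] at h1
  refine h1.trans ?_
  simp only [Pi.zero_apply, Finset.sum_const_zero, mul_zero, add_zero, Int.negOnePow_zero,
    one_smul]
  exact outerOn_unitOp _ _

end Unital


/-! ### The Leibniz rule -/

section Leibniz

variable {k : Type*} [Field k] {d : ℕ} {M : Type*} [AddCommGroup M] [Module k M]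
    [Module (Weyl k (Fin d))ᵐᵒᵖ M] [IsScalarTower k (Weyl k (Fin d))ᵐᵒᵖ M]
    {𝓜 : DGStructure k d M}

/-- The inclusions of `B` and of `K ∖ {i}` into `I` are monotone, and `B` replaces the element `i`
of `K`. -/
structure IsOrdered {I K B : Type*} [LT I] [LT K] [LT B] {i : K}
    (e : I ≃ {j : K // j ≠ i} ⊕ B) : Prop where
  outer_lt_outer : ∀ j l, outerIdx e j < outerIdx e l ↔ (j : K) < l
  incl_lt_incl : ∀ b c, incl e b < incl e c ↔ b < c
  outer_lt_incl : ∀ j b, outerIdx e j < incl e b ↔ (j : K) < i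
  incl_lt_outer : ∀ j b, incl e b < outerIdx e j ↔ i < (j : K)

theorem val_outerIdx_insEquiv {m n : ℕ} (i : Fin (m + 1)) (j : {j : Fin (m + 1) // j ≠ i}) :
    ((outerIdx (insEquiv i n) j : Fin (m + n)) : ℕ) =
      if (j.1 : ℕ) < i then (j.1 : ℕ) else j.1 + n - 1 := by
  simp only [outerIdx, insEquiv, Equiv.coe_fn_symm_mk, Sum.elim_inl, Fin.lt_def]
  split_ifs <;> rfl

theorem val_incl_insEquiv {m n : ℕ} (i : Fin (m + 1)) (b : Fin n) :
    ((incl (insEquiv i n) b : Fin (m + n)) : ℕ) = i + b := rfl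

theorem isOrdered_insEquiv {m : ℕ} (i : Fin (m + 1)) (n : ℕ) : IsOrdered (insEquiv i n) := by
  have h : ∀ j : {j : Fin (m + 1) // j ≠ i}, (j.1 : ℕ) ≠ i := fun j e => j.2 (Fin.ext e)
  refine ⟨fun j l => ?_, fun b c => ?_, fun j b => ?_, fun j b => ?_⟩
  · have := h j; have := h l
    rw [Fin.lt_def, val_outerIdx_insEquiv, val_outerIdx_insEquiv, Fin.lt_def]; split_ifs <;> omega
  · rw [Fin.lt_def, val_incl_insEquiv, val_incl_insEquiv, Fin.lt_def]; omega
  · have := h j; have := b.2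
    rw [Fin.lt_def, val_outerIdx_insEquiv, val_incl_insEquiv, Fin.lt_def]; split_ifs <;> omega
  · have := h j; have := b.2
    rw [Fin.lt_def, val_outerIdx_insEquiv, val_incl_insEquiv, Fin.lt_def]; split_ifs <;> omega

section Sums

variable {I K B : Type*} [Fintype I] [Fintype K] [Fintype B] [DecidableEq K] {i : K}
  (e : I ≃ {j : K // j ≠ i} ⊕ B)

theorem sum_index {X : Type*} [AddCommMonoid X] (F : I → X) :
    ∑ a, F a = ∑ j, F (outerIdx e j) + ∑ b, F (incl e b) := by
  rw [← e.symm.sum_comp, Fintype.sum_sum_type]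
  rfl

theorem sum_filter_outer (p : K → Prop) [DecidablePred p] (ε : K → ℤ) :
    ∑ j with p j, ε j = (if p i then ε i else 0) +
      ∑ j : {j : K // j ≠ i}, if p j then ε j else 0 := by
  rw [Finset.sum_filter, Fintype.sum_eq_add_sum_subtype_ne _ i]

theorem sum_filter_glue (p : I → Prop) [DecidablePred p] (ε : K → ℤ) (ε' : B → ℤ) :
    ∑ a with p a, glue e ε ε' a = (∑ j : {j : K // j ≠ i}, if p (outerIdx e j) then ε j else 0) +
      ∑ b with p (incl e b), ε' b := by
  rw [Finset.sum_filter, sum_index e, Finset.sum_filter]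
  simp only [glue_outerIdx, glue_incl]

theorem glue_update_outer [DecidableEq I] {X : Type*} (m'' : K → X) (m' : B → X)
    (j : {j : K // j ≠ i}) (x : X) :
    Function.update (glue e m'' m') (outerIdx e j) x = glue e (Function.update m'' j x) m' := by
  ext a
  obtain ⟨l, rfl⟩ | ⟨b, rfl⟩ := idx_cases e a
  · rw [glue_outerIdx]
    by_cases h : l = j
    · subst h; simp
    · rw [Function.update_of_ne fun h' => h (outerIdx_injective e h'), glue_outerIdx,
        Function.update_of_ne fun h' => h (Subtype.ext h')]
  · rw [glue_incl, Function.update_of_ne (outerIdx_ne_incl e j b).symm, glue_incl]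

theorem glue_update_incl [DecidableEq I] [DecidableEq B] {X : Type*} (m'' : K → X) (m' : B → X)
    (b : B) (x : X) :
    Function.update (glue e m'' m') (incl e b) x = glue e m'' (Function.update m' b x) := by
  ext a
  obtain ⟨l, rfl⟩ | ⟨c, rfl⟩ := idx_cases e a
  · rw [glue_outerIdx, Function.update_of_ne (outerIdx_ne_incl e l b), glue_outerIdx]
  · rw [glue_incl]
    by_cases h : c = b
    · subst h; simp
    · rw [Function.update_of_ne fun h' => h (incl_injective e h'), glue_incl,
        Function.update_of_ne h]

theorem sum_filter_update_add (p : K → Prop) [DecidablePred p] (ε : K → ℤ) (i : K) (f g : ℤ) :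
    ∑ l with p l, Function.update ε i (f + g) l =
      ∑ l with p l, Function.update ε i f l + if p i then g else 0 := by
  have := sum_filter_update p (Function.update ε i f) i g
  rwa [Function.update_self, Function.update_idem] at this

end Sums

theorem sum_update_zero {K : Type*} [Fintype K] [LinearOrder K] (ε : K → ℤ) (i : K) :
    ∑ j, Function.update ε i 0 j = ∑ j with j < i, ε j + ∑ j with i < j, ε j := by
  rw [Finset.sum_filter, Finset.sum_filter, ← Finset.sum_add_distrib]
  refine Finset.sum_congr rfl fun j _ => ?_
  rcases lt_trichotomy j i with h | rfl | h
  · simp [h, h.ne, h.not_gt]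
  · simp
  · simp [h, h.ne', h.not_gt]

section Order

variable {I K B : Type*} [Fintype I] [Fintype K] [Fintype B] [DecidableEq K] {i : K}
  {e : I ≃ {j : K // j ≠ i} ⊕ B} [LinearOrder I] [LinearOrder B]

/-- The sum over the indices before an outer index. -/
theorem IsOrdered.sum_lt_outer [LT K] [DecidableLT K] (he : IsOrdered e) (ε : K → ℤ) (ε' : B → ℤ)
    (j : {j : K // j ≠ i}) :
    ∑ a with a < outerIdx e j, glue e ε ε' a =
      ∑ l with l < (j : K), Function.update ε i (∑ b, ε' b) l := by
  rw [sum_filter_glue, sum_filter_outer (i := i)]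
  simp only [he.outer_lt_outer, he.incl_lt_outer, Function.update_self]
  rw [add_comm]
  congr 1
  · split_ifs with h <;> simp [h]
  · refine Finset.sum_congr rfl fun l _ => ?_
    rw [Function.update_of_ne l.2]

theorem IsOrdered.sum_gt_outer [LT K] [DecidableLT K] (he : IsOrdered e) (ε : K → ℤ) (ε' : B → ℤ)
    (j : {j : K // j ≠ i}) :
    ∑ a with outerIdx e j < a, glue e ε ε' a =
      ∑ l with (j : K) < l, Function.update ε i (∑ b, ε' b) l := by
  rw [sum_filter_glue, sum_filter_outer (i := i)]
  simp only [he.outer_lt_outer, he.outer_lt_incl, Function.update_self]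
  rw [add_comm]
  congr 1
  · split_ifs with h <;> simp [h]
  · refine Finset.sum_congr rfl fun l _ => ?_
    rw [Function.update_of_ne l.2]

/-- The sum over the indices before an index of the block. -/
theorem IsOrdered.sum_lt_incl [Preorder K] [DecidableLT K]
    (he : IsOrdered e) (ε : K → ℤ) (ε' : B → ℤ) (b : B) :
    ∑ a with a < incl e b, glue e ε ε' a = ∑ l with l < i, ε l + ∑ c with c < b, ε' c := by
  rw [sum_filter_glue, sum_filter_outer (i := i), if_neg (lt_irrefl i), zero_add]
  simp only [he.outer_lt_incl, he.incl_lt_incl]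

theorem IsOrdered.sum_gt_incl [Preorder K] [DecidableLT K]
    (he : IsOrdered e) (ε : K → ℤ) (ε' : B → ℤ) (b : B) :
    ∑ a with incl e b < a, glue e ε ε' a = ∑ l with i < l, ε l + ∑ c with b < c, ε' c := by
  rw [sum_filter_glue, sum_filter_outer (i := i), if_neg (lt_irrefl i), zero_add]
  simp only [he.incl_lt_outer, he.incl_lt_incl]

end Order

theorem diagSubst_diagEnd {I K : Type*} [Fintype I] [DecidableEq I] [Fintype K] [DecidableEq K]
    (π : I → K) (f : Module.End k M) (hf : ∀ P : Weyl k (Fin d), f * ract P = ract P * f)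
    (y : DiagOn k d M K) : diagSubst π (diagEnd f hf y) = diagEnd f hf (diagSubst π y) := by
  induction y using push_induction with
  | ha y y' hy hy' => simp only [map_add, hy, hy']
  | hm x F => rw [diagEnd_mk, diagSubst, substMap_mk, substMap_mk, diagEnd_mk]

/-- The differential of an operation, applied to an inserted element. The formula is the definition
of the differential for `y = x ⊗ 1`, and both sides behave in the same way under derivatives of
`y`. -/
theorem outerOn_opDiff {m n : ℕ} {i : Fin (m + 1)} {μ : OpOn k d M (Fin (m + 1))} {p : ℤ}
    (hμ : IsHom 𝓜 p μ) (e : Fin (m + n) ≃ {j : Fin (m + 1) // j ≠ i} ⊕ Fin n) {ε : Fin (m + 1) → ℤ}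
    {m'' : Fin (m + 1) → M} (hm : ∀ j, m'' j ∈ 𝓜.deg (ε j)) {f : ℤ} {y : Diag k d M n}
    (hy : y ∈ tgtDeg 𝓜 (Fin n) f) (b : Jou k d (partialGraph (collapse e))) :
    outerOn (collapse e) (opDiff 𝓜 μ) hμ.opDiff.1 (jmMk _ (insertPush e m'' y) b) =
      diagDiff 𝓜 (m + n) (outerOn (collapse e) μ hμ.1 (jmMk _ (insertPush e m'' y) b)) -
        p.negOnePow • ((∑ l with l < i, ε l).negOnePow •
            outerOn (collapse e) μ hμ.1 (jmMk _ (insertPush e m'' (diagDiff 𝓜 n y)) b) +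
          ∑ j : {j : Fin (m + 1) // j ≠ i},
            (∑ l with l < (j : Fin (m + 1)), Function.update ε i f l).negOnePow •
            outerOn (collapse e) μ hμ.1 (jmMk _ (insertPush e
              (Function.update m'' j (𝓜.diff (m'' j))) y) b) +
          (∑ l, Function.update ε i f l).negOnePow •
            outerOn (collapse e) μ hμ.1 (jmMk _ (insertPush e m'' y) (jd b))) := by
  refine tgtDeg_induction (𝓜 := 𝓜) (P := fun y => ∀ b,
    outerOn (collapse e) (opDiff 𝓜 μ) hμ.opDiff.1 (jmMk _ (insertPush e m'' y) b) =
      diagDiff 𝓜 (m + n) (outerOn (collapse e) μ hμ.1 (jmMk _ (insertPush e m'' y) b)) -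
        p.negOnePow • ((∑ l with l < i, ε l).negOnePow •
            outerOn (collapse e) μ hμ.1 (jmMk _ (insertPush e m'' (diagDiff 𝓜 n y)) b) +
          ∑ j : {j : Fin (m + 1) // j ≠ i},
            (∑ l with l < (j : Fin (m + 1)), Function.update ε i f l).negOnePow •
            outerOn (collapse e) μ hμ.1 (jmMk _ (insertPush e
              (Function.update m'' j (𝓜.diff (m'' j))) y) b) +
          (∑ l, Function.update ε i f l).negOnePow •
            outerOn (collapse e) μ hμ.1 (jmMk _ (insertPush e m'' y) (jd b))))
    (fun x hx b => ?_) (fun c y hy b => ?_) (fun y y' hy hy' b => ?_) (fun c y hy b => ?_) hy b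
  · rw [diagDiff_eq, diagDiff_eq, diagEnd_mk, insertPush_one, insertPush_one, outerOn_one,
      outerOn_one,
      outerOn_one, outerOn_one, opDiff_apply 𝓜 hμ, jouBoxDiff_box 𝓜 (update_mem_deg 𝓜 hm i hx),
      Fintype.sum_eq_add_sum_subtype_ne _ i, diagDiff_eq, map_sub, diagSubst_diagEnd,
      map_negOnePow_smul, map_add, map_add, map_add, map_add]
    simp only [map_sum, map_negOnePow_smul, Function.update_self, Function.update_idem]
    congr 4
    · congr 2
      refine Finset.sum_congr rfl fun l hl => ?_
      rw [Function.update_of_ne (Finset.mem_filter.1 hl).2.ne]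
    · refine Finset.sum_congr rfl fun j _ => ?_
      rw [Function.update_of_ne j.2, ← Function.update_comm j.2, insertPush_one, outerOn_one]
    · rw [restrictDiag, jmap_jd]
  · have h := congrArg (c • ·) (hy b)
    simp only [map_smul, LinearMap.smul_apply] at h ⊢
    rw [h]
    simp only [smul_sub, smul_add, Finset.smul_sum, smul_comm c (Int.negOnePow _)]
  · simp only [map_add, LinearMap.add_apply, hy, hy', smul_add, Finset.sum_add_distrib]
    abel
  · have h0 : diagDiff 𝓜 n (ract (wpd k c) y) = ract (wpd k c) (diagDiff 𝓜 n y) := by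
      rw [diagDiff_eq, diagEnd_ract_pd]
    have h1 : ∀ y : Diag k d M (m + n), diagDiff 𝓜 (m + n) (ract (wpd k (liftIdx (incl e) c)) y) =
        ract (wpd k (liftIdx (incl e) c)) (diagDiff 𝓜 (m + n) y) := fun y => by
      rw [diagDiff_eq, diagEnd_ract_pd]
    simp only [h0, insertPush_pd, outerOn_pd, hy, map_add, map_sub, map_sum, map_negOnePow_smul, h1,
      jpd_jd, smul_add, Finset.sum_add_distrib]
    abel

theorem glue_mem_deg {I K B : Type*} {i : K} (e : I ≃ {j : K // j ≠ i} ⊕ B) {ε : K → ℤ} {ε' : B → ℤ}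
    {m'' : K → M} {m' : B → M} (hm : ∀ j, m'' j ∈ 𝓜.deg (ε j))
    (hm' : ∀ b, m' b ∈ 𝓜.deg (ε' b)) (a : I) :
    glue e m'' m' a ∈ 𝓜.deg (glue e ε ε' a) := by
  obtain ⟨l, rfl⟩ | ⟨c, rfl⟩ := idx_cases e a
  · rw [glue_outerIdx, glue_outerIdx]; exact hm l
  · rw [glue_incl, glue_incl]; exact hm' c

section

variable [CharZero k] {m n : ℕ} {i : Fin (m + 1)}
  {e : Fin (m + n) ≃ {j : Fin (m + 1) // j ≠ i} ⊕ Fin n}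
  {μ : OpOn k d M (Fin (m + 1))} (hμ : IsDLin μ) {q : ℤ} {ν : OpOn k d M (Fin n)} (hν : IsHom 𝓜 q ν)
  {ε : Fin (m + 1) → ℤ} {ε' : Fin n → ℤ} {m'' : Fin (m + 1) → M} {m' : Fin n → M} {r : ℕ}
  {a : Jou k d (⊤ : SimpleGraph (Fin n))}

include hν in
theorem compOn_update_outer (hm : ∀ j, m'' j ∈ 𝓜.deg (ε j)) (ha : a ∈ jdeg r)
    (b : Jou k d (partialGraph (collapse e))) (j : {j : Fin (m + 1) // j ≠ i}) :
    compOn 𝓜 e hμ hν.1 (jmMk _ (box k (Function.update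
      (glue e m'' m') (outerIdx e j) (𝓜.diff (glue e m'' m' (outerIdx e j)))))
      (jmap (blockHom e) a * jmap (partialGraphHom (collapse e)) b)) =
      (q * ∑ j with j < i, ε j + r * ∑ j with i < j, ε j +
        (if (j : Fin (m + 1)) < i then q else (r : ℤ))).negOnePow •
        outerOn (collapse e) μ hμ (jmMk _ (insertPush e
          (Function.update m'' j (𝓜.diff (m'' j))) (ν (jmMk _ (box k m') a))) b) := by
  rw [glue_update_outer, glue_outerIdx, compOn_mk 𝓜 e hμ hν.1 hν (fun l _ => update_mem_deg 𝓜 hm j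
    (𝓜.diff_mem _ _ (hm j)) l) m' ha b, sum_filter_update, sum_filter_update]
  congr 2
  rcases lt_or_gt_of_ne j.2 with h | h
  · rw [if_pos h, if_neg h.not_gt, if_pos h]; ring
  · rw [if_neg h.not_gt, if_pos h, if_neg h.not_gt]; ring

include hν in
theorem compOn_update_incl (hm : ∀ j, m'' j ∈ 𝓜.deg (ε j)) (ha : a ∈ jdeg r)
    (b : Jou k d (partialGraph (collapse e))) (c : Fin n) :
    compOn 𝓜 e hμ hν.1 (jmMk _ (box k (Function.update
      (glue e m'' m') (incl e c) (𝓜.diff (glue e m'' m' (incl e c)))))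
      (jmap (blockHom e) a * jmap (partialGraphHom (collapse e)) b)) =
      (q * ∑ j with j < i, ε j + r * ∑ j with i < j, ε j).negOnePow •
        outerOn (collapse e) μ hμ (jmMk _ (insertPush e m'' (ν (jmMk _ (box k
          (Function.update m' c (𝓜.diff (m' c)))) a))) b) := by
  rw [glue_update_incl, glue_incl, compOn_mk 𝓜 e hμ hν.1 hν (fun l _ => hm l) _ ha b]

include hν in
theorem compOn_jd (hm : ∀ j, m'' j ∈ 𝓜.deg (ε j)) (ha : a ∈ jdeg r)
    (b : Jou k d (partialGraph (collapse e))) :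
    compOn 𝓜 e hμ hν.1 (jmMk _ (box k (glue e m'' m'))
      (jd (jmap (blockHom e) a * jmap (partialGraphHom (collapse e)) b))) =
      (q * ∑ j with j < i, ε j + r * ∑ j with i < j, ε j + ∑ j with i < j, ε j).negOnePow •
        outerOn (collapse e) μ hμ (jmMk _ (insertPush e m'' (ν (jmMk _ (box k m') (jd a)))) b) +
      (q * ∑ j with j < i, ε j + r * ∑ j with i < j, ε j + (r : ℤ)).negOnePow •
        outerOn (collapse e) μ hμ (jmMk _ (insertPush e m'' (ν (jmMk _ (box k m') a))) (jd b)) := by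
  rw [jd_mul, ← jmap_jd, ← jmap_jd, jpar_of_mem (jmap_mem_jdeg _ ha), smul_mul_assoc, map_add,
      map_add,
    map_negOnePow_smul, map_negOnePow_smul, compOn_mk 𝓜 e hμ hν.1 hν (fun l _ => hm l)
        _ (jd_mem_jdeg ha) b,
    compOn_mk 𝓜 e hμ hν.1 hν (fun l _ => hm l) _ ha (jd b), negOnePow_smul_smul, add_comm (r : ℤ)]
  congr 3
  push_cast; ring

include hν in
/-- A composition of operations, applied to the differential of an element. -/
theorem compOn_jouBoxDiff (he : IsOrdered e) (hm : ∀ j, m'' j ∈ 𝓜.deg (ε j))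
    (hm' : ∀ j, m' j ∈ 𝓜.deg (ε' j))
    (ha : a ∈ jdeg r) (b : Jou k d (partialGraph (collapse e))) :
    compOn 𝓜 e hμ hν.1 (jouBoxDiff 𝓜 (m + n) (jmMk _ (box k (glue e m'' m'))
      (jmap (blockHom e) a * jmap (partialGraphHom (collapse e)) b))) =
    (q * ∑ j with j < i, ε j + r * ∑ j with i < j, ε j).negOnePow •
      ((∑ j with j < i, ε j).negOnePow • outerOn (collapse e) μ hμ (jmMk _
          (insertPush e m'' (ν (jouBoxDiff 𝓜 n (jmMk _ (box k m') a)))) b) +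
        q.negOnePow • (∑ j : {j : Fin (m + 1) // j ≠ i}, (∑ l with l < (j : Fin (m + 1)),
            Function.update ε i (∑ j, ε' j + r + q) l).negOnePow •
          outerOn (collapse e) μ hμ (jmMk _ (insertPush e
            (Function.update m'' j (𝓜.diff (m'' j))) (ν (jmMk _ (box k m') a))) b) +
        (∑ l, Function.update ε i (∑ j, ε' j + r + q) l).negOnePow •
          outerOn (collapse e) μ hμ
            (jmMk _ (insertPush e m'' (ν (jmMk _ (box k m') a))) (jd b)))) := by
  rw [jouBoxDiff_box 𝓜 (glue_mem_deg e hm hm'), sum_index e, map_add, map_add, map_sum, map_sum,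
    map_negOnePow_smul _ (∑ j, glue e ε ε' j), compOn_jd hμ hν hm ha, jouBoxDiff_box 𝓜 hm']
  simp only [map_negOnePow_smul, map_add, map_sum, LinearMap.add_apply,
    LinearMap.sum_apply, negOnePow_smul_apply, compOn_update_outer hμ hν hm ha,
    compOn_update_incl hμ hν hm ha, smul_add, Finset.smul_sum, negOnePow_smul_smul, he.sum_lt_outer,
    he.sum_lt_incl]
  have key : ∀ {X₁ X₂ X₃ X₄ Y₁ Y₂ Y₃ Y₄ : Diag k d M (m + n)},
      X₁ = Y₁ → X₂ = Y₂ → X₃ = Y₃ → X₄ = Y₄ →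
      X₁ + X₂ + (X₃ + X₄) = Y₂ + Y₃ + (Y₁ + Y₄) := by
    rintro X₁ X₂ X₃ X₄ _ _ _ _ rfl rfl rfl rfl; abel
  refine key (Finset.sum_congr rfl fun j _ => congrArg (· • _) (negOnePow_congr ?_))
    (Finset.sum_congr rfl fun x _ => congrArg (· • _) (congrArg _ (add_comm _ _)))
        (congrArg (· • _) (negOnePow_congr ?_))
    (congrArg (· • _) (negOnePow_congr ?_))
  · rw [add_assoc (∑ j, ε' j), sum_filter_update_add]
    rcases lt_or_gt_of_ne j.2 with h | h
    · rw [if_pos h, if_neg h.not_gt]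
      exact even_of_eq Even.zero (by ring)
    · rw [if_neg h.not_gt, if_pos h]
      exact even_of_eq (even_two_mul (-q)) (by ring)
  · rw [sum_glue, sum_update_zero]
    exact even_of_eq (even_two_mul (∑ j with i < j, ε j)) (by ring)
  · rw [sum_glue, sum_update ε (∑ j, ε' j + (r : ℤ) + q)]
    exact even_of_eq (even_two_mul (-q)) (by ring)

end

/-- The comparison of signs in the Leibniz rule. Here `s` is the sign in the composition, `t` the
sign of moving the differential past the inputs before `i`, and `p` and `q` are the signs of `μ` and
`ν`; `A` is the differential of the value, `B` and `E` are the terms with `ν (d (m' ⊗ a))` and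
`d (ν (m' ⊗ a))`, and `C` and `D` those with the differential on the other inputs and on the
variables. -/
theorem leibniz_signs {X : Type*} [AddCommGroup X] (s t p q : ℤˣ) (A B C D E : X) :
    s • A - (p * q) • s • (t • B + q • (C + D)) =
      s • (A - p • (t • E + C + D)) + p • (s * t) • (E - q • B) := by
  have hq : q * q = 1 := Int.units_mul_self _
  have h6 : p * q * (s * q) = s * p := by
    rw [show p * q * (s * q) = s * p * (q * q) by ac_rfl, hq, mul_one]
  simp only [smul_add, smul_sub, smul_smul]
  rw [h6, show p * q * (s * t) = p * (s * t * q) by ac_rfl,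
      show s * (p * t) = p * (s * t) by ac_rfl]
  abel

/-- The Leibniz rule for partial compositions. -/
theorem chiralDiff_comp [CharZero k] {m n : ℕ} (i : Fin (m + 1)) (p : ℤ) (μ : ChiralOp 𝓜 (m + 1))
    (ν : ChiralOp 𝓜 n) (hμ : μ ∈ chiralDeg 𝓜 (m + 1) p) :
    chiralDiff 𝓜 (m + n) (chiralComp i μ ν) =
      chiralComp i (chiralDiff 𝓜 (m + 1) μ) ν +
        p.negOnePow • chiralComp i μ (chiralDiff 𝓜 n ν) := by
  induction ν using chiral_induction with
  | ha ν ν' h h' => simp only [map_add, h, h', smul_add]; abel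
  | h q ν hν =>
  have hμ : IsHom 𝓜 p (toOp μ) := hμ
  refine Subtype.ext (jouBox_glue_ext 𝓜 (insEquiv i n) fun ε ε' m'' m' r r' a b hm hm' ha hb => ?_)
  have hy := hν.mk_mem hm' ha
  have h3 := opDiff_apply 𝓜 (compOn_isHom 𝓜 (insEquiv i n) hμ.1 hν.1 hμ hν)
      (jmMk _ (box k (glue (insEquiv i n) m'' m'))
    (jmap (blockHom (insEquiv i n)) a * jmap (partialGraphHom (collapse (insEquiv i n))) b))
  rw [compOn_jouBoxDiff hμ.1 hν (isOrdered_insEquiv i n) hm hm' ha,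
    compOn_mk 𝓜 (insEquiv i n) hμ.1 hν.1 hν (fun j _ => hm j) m' ha b] at h3
  refine h3.trans ?_
  have h4 : toOp (chiralComp i (chiralDiff 𝓜 (m + 1) μ) ν +
      p.negOnePow • chiralComp i μ (chiralDiff 𝓜 n ν)) =
      compOn 𝓜 (insEquiv i n) (hμ.opDiff.1) hν.1 +
        p.negOnePow • compOn 𝓜 (insEquiv i n) hμ.1 (hν.opDiff.1) := by
    rw [Units.smul_def, Units.smul_def]; rfl
  refine Eq.trans ?_ (LinearMap.congr_fun h4 _).symm
  rw [LinearMap.add_apply, negOnePow_smul_apply, compOn_mk 𝓜 (insEquiv i n) (hμ.opDiff.1)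
      hν.1 hν (fun j _ => hm j) m' ha b,
    outerOn_opDiff hμ (insEquiv i n) hm hy b, compOn_mk 𝓜 (insEquiv i n) hμ.1 (hν.opDiff.1)
        hν.opDiff (fun j _ => hm j) m' ha b,
    opDiff_apply 𝓜 hν]
  simp only [map_negOnePow_smul, map_sub, LinearMap.sub_apply, negOnePow_smul_apply]
  have h5 : ((q + 1) * ∑ j with j < i, ε j + r * ∑ j with i < j, ε j).negOnePow =
      (q * ∑ j with j < i, ε j + r * ∑ j with i < j, ε j).negOnePow *
        (∑ j with j < i, ε j).negOnePow := by
    rw [← Int.negOnePow_add]; congr 1; ring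
  rw [h5, Int.negOnePow_add p q]
  exact leibniz_signs _ _ _ _ _ _ _ _ _

end Leibniz


/-! ### Sequential associativity -/

section Seq

variable {k : Type*} [Field k] {d : ℕ} {M : Type*} [AddCommGroup M] [Module k M]
    [Module (Weyl k (Fin d))ᵐᵒᵖ M] [IsScalarTower k (Weyl k (Fin d))ᵐᵒᵖ M]
    {𝓜 : DGStructure k d M}

/-- Compatibility of the identifications of the inputs of `(κ ∘_i μ) ∘ ν` and of `κ ∘_i (μ ∘_j ν)`:
the inputs of `κ` are indexed by `K`, those of `μ` by `B`, those of `ν` by `C`, those of `κ ∘_i μ`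
by `K'`, those of `μ ∘_j ν` by `J`, and those of the iterated composition by `I`. -/
structure SeqCompat {I J K K' B C : Type*} {i : K} {j : B} {i' : K'}
    (e₁ : I ≃ {x : K' // x ≠ i'} ⊕ C) (e₂ : K' ≃ {x : K // x ≠ i} ⊕ B)
    (e₃ : J ≃ {x : B // x ≠ j} ⊕ C) (e₄ : I ≃ {x : K // x ≠ i} ⊕ J) : Prop where
  incl_eq : incl e₂ j = i'
  outer : ∀ a (h : outerIdx e₂ a ≠ i'), outerIdx e₁ ⟨outerIdx e₂ a, h⟩ = outerIdx e₄ a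
  middle : ∀ (b : {x : B // x ≠ j}) (h : incl e₂ b ≠ i'),
    outerIdx e₁ ⟨incl e₂ b, h⟩ = incl e₄ (outerIdx e₃ b)
  inner : ∀ c, incl e₁ c = incl e₄ (incl e₃ c)

namespace SeqCompat

variable {I J K K' B C : Type*} {i : K} {j : B} {i' : K'}
    {e₁ : I ≃ {x : K' // x ≠ i'} ⊕ C} {e₂ : K' ≃ {x : K // x ≠ i} ⊕ B}
    {e₃ : J ≃ {x : B // x ≠ j} ⊕ C} {e₄ : I ≃ {x : K // x ≠ i} ⊕ J} (h : SeqCompat e₁ e₂ e₃ e₄)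

include h

theorem outer_ne (a : {x : K // x ≠ i}) : outerIdx e₂ a ≠ i' :=
  h.incl_eq ▸ outerIdx_ne_incl e₂ a j

theorem middle_ne (b : {x : B // x ≠ j}) : incl e₂ b ≠ i' :=
  h.incl_eq ▸ fun h' => b.2 (incl_injective e₂ h')

theorem collapse_outer (a : {x : K // x ≠ i}) : collapse e₁ (outerIdx e₄ a) = outerIdx e₂ a := by
  rw [← h.outer a (h.outer_ne a), collapse_outerIdx]

theorem collapse_block (x : J) : collapse e₁ (incl e₄ x) = incl e₂ (collapse e₃ x) := by
  obtain ⟨b, rfl⟩ | ⟨c, rfl⟩ := idx_cases e₃ x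
  · rw [← h.middle b (h.middle_ne b), collapse_outerIdx, collapse_outerIdx]
  · rw [← h.inner, collapse_incl, collapse_incl, h.incl_eq]

theorem collapse_collapse (a : I) : collapse e₂ (collapse e₁ a) = collapse e₄ a := by
  obtain ⟨a, rfl⟩ | ⟨x, rfl⟩ := idx_cases e₄ a
  · rw [h.collapse_outer, collapse_outerIdx, collapse_outerIdx]
  · rw [h.collapse_block, collapse_incl, collapse_incl]

theorem glue_glue {X : Type*} (mL : K → X) (mB : B → X) (mC : C → X) :
    glue e₄ mL (glue e₃ mB mC) = glue e₁ (glue e₂ mL mB) mC := by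
  ext a
  obtain ⟨a, rfl⟩ | ⟨x, rfl⟩ := idx_cases e₄ a
  · rw [glue_outerIdx, ← h.outer a (h.outer_ne a), glue_outerIdx, glue_outerIdx]
  · rw [glue_incl]
    obtain ⟨b, rfl⟩ | ⟨c, rfl⟩ := idx_cases e₃ x
    · rw [glue_outerIdx, ← h.middle b (h.middle_ne b), glue_outerIdx, glue_incl]
    · rw [glue_incl, ← h.inner, glue_incl]

/-- The inclusion of the partial graph on `J` for the block `C` into the one on `I`. -/
def innerHom : partialGraph (collapse e₃) →g partialGraph (collapse e₁) :=
  partialHom (incl e₄) fun a b hab => by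
    rw [h.collapse_block, h.collapse_block] at hab
    exact incl_injective e₂ hab

/-- The inclusion of the partial graph on `I` for the block `J` into the one for the block `C`. -/
def outerHom : partialGraph (collapse e₄) →g partialGraph (collapse e₁) :=
  partialHom id fun a b (hab : collapse e₁ a = collapse e₁ b) => by
    rw [← h.collapse_collapse, ← h.collapse_collapse, hab]

/-- The map of partial graphs which collapses the block `C`. -/
def collapseHom : partialGraph (collapse e₄) →g partialGraph (collapse e₂) :=
  partialHom (collapse e₁) fun a b hab => by
    rw [← h.collapse_collapse, ← h.collapse_collapse, hab]

end SeqCompat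

variable {I J K K' B C : Type*} [Fintype I] [DecidableEq I] [Fintype J] [DecidableEq J]
  [Fintype K] [DecidableEq K] [Preorder K] [DecidableLT K] [Fintype K'] [LinearOrder K']
  [Fintype B] [LinearOrder B] [Fintype C] [DecidableEq C] {i : K} {j : B} {i' : K'}
    {e₁ : I ≃ {x : K' // x ≠ i'} ⊕ C} {e₂ : K' ≃ {x : K // x ≠ i} ⊕ B}
    {e₃ : J ≃ {x : B // x ≠ j} ⊕ C} {e₄ : I ≃ {x : K // x ≠ i} ⊕ J}

/-- Insertion of an element which is pushed forward along the collapse of `C` in `J`. -/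
theorem insertPush_diagSubst (h : SeqCompat e₁ e₂ e₃ e₄) (mL : K → M) (z : DiagOn k d M B)
    (h' : ∀ a, liftIdx (d := d) (collapse e₂) (liftIdx (collapse e₁) a) = liftIdx (collapse e₄) a) :
    insertPush e₄ mL (diagSubst (collapse e₃) z) =
      substMap (liftIdx (collapse e₁)) (liftIdx (collapse e₂)) (liftIdx (collapse e₄)) h' _
        (insertPush e₂ mL z) := by
  induction z using push_induction with
  | ha y y' hy hy' => simp only [map_add, hy, hy']
  | hm x F =>
  refine puMk_induction (P := fun z => insertPush e₄ mL (diagSubst (collapse e₃) z) =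
      substMap (liftIdx (collapse e₁)) (liftIdx (collapse e₂)) (liftIdx (collapse e₄)) h' _
        (insertPush e₂ mL z)) x ?_ (fun c y hy => by simp only [map_smul, hy])
    (fun y y' hy hy' => by simp only [map_add, hy, hy']) (fun c y hy => ?_) F
  · rw [diagSubst_mk_one, insertPush_one, insertPush_one, substMap_mk, map_one (substSum k _)]
  · rw [diagSubst_pd, insertPush_pd, substMap_pd, map_sum, ← hy, Fintype.sum_prod_type,
      Fintype.sum_prod_type, sum_index e₄]
    refine ((zero_add _).symm.trans (congrArg₂ (· + ·) (Finset.sum_eq_zero fun a _ =>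
      Finset.sum_eq_zero fun s _ => if_neg fun h'' => ?_).symm (Finset.sum_congr rfl fun x _ =>
        Finset.sum_congr rfl fun s _ => ?_)))
    · have h1 : collapse e₁ (outerIdx e₄ a) = incl e₂ c.1 := congrArg Prod.fst h''
      rw [h.collapse_outer] at h1
      exact outerIdx_ne_incl e₂ a c.1 h1
    · have h1 : liftIdx (d := d) (collapse e₁) (incl e₄ x, s) = liftIdx (incl e₂) c ↔
          liftIdx (collapse e₃) (x, s) = c := by
        rw [← (liftIdx_incl_injective e₂).eq_iff]
        simp only [liftIdx, h.collapse_block]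
      by_cases hc : liftIdx (collapse e₃) (x, s) = c
      · rw [if_pos hc, if_pos (h1.2 hc), insertPush_pd]; rfl
      · rw [if_neg hc, if_neg fun h'' => hc (h1.1 h''), map_zero]

variable [CharZero k]

/-- The composition `κ ∘_i μ`, applied to an inserted element. For `y = x ⊗ 1` this is the formula
for the composition, combined with the transitivity of restriction to diagonals; the general case
follows by moving derivatives. -/
theorem outerOn_compOn (h : SeqCompat e₁ e₂ e₃ e₄) {κ : OpOn k d M K} (hκ : IsDLin κ) {p : ℤ}
    {μ : OpOn k d M B} (hμ : IsHom 𝓜 p μ) {ε : K → ℤ} {mL : K → M}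
    (hm : ∀ a, mL a ∈ 𝓜.deg (ε a)) (mB : B → M) {r : ℕ} {b : Jou k d (partialGraph (collapse e₃))}
    (hb : b ∈ jdeg r) (c : Jou k d (partialGraph (collapse e₄))) (y : DiagOn k d M C) :
    outerOn (collapse e₁) (compOn 𝓜 e₂ hκ hμ.1) (compOn_isDLin 𝓜 e₂ hκ hμ.1)
        (jmMk _ (insertPush e₁ (glue e₂ mL mB) y) (jmap h.innerHom b * jmap h.outerHom c)) =
      (p * ∑ l with l < i, ε l + r * ∑ l with i < l, ε l).negOnePow •
        outerOn (collapse e₄) κ hκ (jmMk _ (insertPush e₄ mL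
          (outerOn (collapse e₃) μ hμ.1 (jmMk _ (insertPush e₃ mB y) b))) c) := by
  induction y using push_induction with
  | ha y y' hy hy' => simp only [map_add, LinearMap.add_apply, hy, hy', smul_add]
  | hm x F =>
  refine puMk_induction (P := fun y => ∀ b ∈ jdeg r, ∀ c,
      outerOn (collapse e₁) (compOn 𝓜 e₂ hκ hμ.1) (compOn_isDLin 𝓜 e₂ hκ hμ.1)
        (jmMk _ (insertPush e₁ (glue e₂ mL mB) y) (jmap h.innerHom b * jmap h.outerHom c)) =
      (p * ∑ l with l < i, ε l + r * ∑ l with i < l, ε l).negOnePow •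
        outerOn (collapse e₄) κ hκ (jmMk _ (insertPush e₄ mL
          (outerOn (collapse e₃) μ hμ.1 (jmMk _ (insertPush e₃ mB y) b))) c)) x
    (fun b hb c => ?_) (fun a y hy b hb c => ?_) (fun y y' hy hy' b hb c => ?_)
    (fun a y hy b hb c => ?_) F b hb c
  · have h' : ∀ a, liftIdx (d := d) (collapse e₂) (liftIdx (collapse e₁) a) =
        liftIdx (collapse e₄) a := fun a => Prod.ext (h.collapse_collapse _) rfl
    have h1 : restrictDiag (collapse e₁) (jmap h.innerHom b) =
        jmap (k := k) (d := d) (blockHom e₂) (restrictDiag (collapse e₃) b) :=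
      (jmap_jmap _ _ ((blockHom e₂).comp (SimpleGraph.Hom.comap (collapse e₃) ⊤))
        h.collapse_block b).trans (jmap_jmap _ _ _ (fun _ => rfl) b).symm
    have h2 : restrictDiag (collapse e₁) (jmap h.outerHom c) =
        jmap (k := k) (d := d) (partialGraphHom (collapse e₂)) (jmap h.collapseHom c) :=
      (jmap_jmap _ _ ((partialGraphHom (collapse e₂)).comp h.collapseHom)
        (fun _ => rfl) c).trans (jmap_jmap _ _ _ (fun _ => rfl) c).symm
    have hb' : restrictDiag (collapse e₃) b ∈ jdeg r := jmap_mem_jdeg _ hb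
    have h3 : Function.update (glue e₂ mL mB) i' x = glue e₂ mL (Function.update mB j x) := by
      rw [← h.incl_eq, glue_update_incl]
    rw [insertPush_one, insertPush_one, outerOn_one, outerOn_one, map_mul, h1, h2, h3,
        compOn_mk 𝓜 e₂ hκ hμ.1 hμ (fun l _ => hm l) _ hb',
      map_negOnePow_smul, insertPush_diagSubst h mL _ h',
      outerOn_substMap (collapse e₁) (collapse e₂) (collapse e₄) h.collapse_collapse hκ h'
        fun a b hab => by rw [← h.collapse_collapse, ← h.collapse_collapse, hab]]
    rfl
  · simp only [map_smul, LinearMap.smul_apply, hy b hb c, smul_comm a]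
  · simp only [map_add, LinearMap.add_apply, hy b hb c, hy' b hb c, smul_add]
  · have h1 : jpd (incl e₁ a.1) a.2 (jmap h.innerHom b) =
        jmap h.innerHom (jpd (incl e₃ a.1) a.2 b) := by
      rw [h.inner]; exact jpd_jmap_of_injective h.innerHom (incl_injective e₄) _ _ b
    have h2 : jpd (incl e₁ a.1) a.2 (jmap h.outerHom c) =
        jmap h.outerHom (jpd (incl e₁ a.1) a.2 c) :=
      jpd_jmap_of_injective h.outerHom Function.injective_id _ _ c
    have h3 : liftIdx (d := d) (incl e₄) (liftIdx (incl e₃) a) = liftIdx (incl e₁) a :=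
      Prod.ext (h.inner _).symm rfl
    have h4 : (liftIdx (incl e₁) a).1 = incl e₁ a.1 := rfl
    have h5 : (liftIdx (incl e₁) a).2 = a.2 := rfl
    rw [insertPush_pd, insertPush_pd, outerOn_pd, outerOn_pd, h4, h5, jpd_mul, h1, h2, map_add,
        map_add,
      hy b hb c, hy _ (jpd_mem_jdeg _ _ hb) c, hy b hb, map_add, insertPush_pd, map_add,
      LinearMap.add_apply, map_add, h3, outerOn_pd, map_negOnePow_smul, h4, h5, smul_add, smul_add]
    simp only [liftIdx]
    abel

/-- Sequential associativity. It is checked on the products `a c b` of elements of the Jouanolou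
algebras for the three levels of the composition. -/
theorem compOn_compOn (h : SeqCompat e₁ e₂ e₃ e₄) (he : IsOrdered e₂)
    {κ : OpOn k d M K} (hκ : IsDLin κ) {p q : ℤ}
    {μ : OpOn k d M B} (hμ : IsHom 𝓜 p μ) {ν : OpOn k d M C} (hν : IsHom 𝓜 q ν) :
    compOn 𝓜 e₁ (compOn_isDLin 𝓜 e₂ hκ hμ.1) hν.1 =
      compOn 𝓜 e₄ hκ (compOn_isDLin 𝓜 e₃ hμ.1 hν.1) := by
  refine jouBox_glue_ext 𝓜 e₄ fun ε ε' m'' m' r r' a b hm hm' _ _ => ?_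
  obtain ⟨ε'', hε, hm''⟩ := outerFam_mem 𝓜 e₃ hm'
  set mB := outerFam e₃ m'
  rw [eq_glue e₃ m']
  refine LinearMap.congr_fun (f := compOn 𝓜 e₁ (compOn_isDLin 𝓜 e₂ hκ hμ.1) hν.1 ∘ₗ jmMk _ _ ∘ₗ
    (LinearMap.mulRight k (jmap (partialGraphHom (collapse e₄)) b)) ∘ₗ
        (jmap (blockHom e₄)).toLinearMap)
    (g := compOn 𝓜 e₄ hκ (compOn_isDLin 𝓜 e₃ hμ.1 hν.1) ∘ₗ jmMk _ _ ∘ₗ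
    (LinearMap.mulRight k (jmap (partialGraphHom (collapse e₄)) b)) ∘ₗ
        (jmap (blockHom e₄)).toLinearMap)
    (jou_ext_block e₃ fun r₁ r₂ a ha c hc => ?_) a
  have hel : jmap (blockHom e₄) (jmap (blockHom e₃) a * jmap (partialGraphHom _) c) *
      jmap (partialGraphHom _) b = jmap (blockHom e₁) a *
        jmap (partialGraphHom _) (jmap h.innerHom c * jmap h.outerHom b) := by
    have h1 : jmap (blockHom e₄) (jmap (blockHom e₃) a) = jmap (k := k) (d := d) (blockHom e₁) a :=
      jmap_jmap _ _ _ (fun x => (h.inner x).symm) a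
    have h2 : jmap (blockHom e₄) (jmap (partialGraphHom _) c) =
        jmap (k := k) (d := d) (partialGraphHom _) (jmap h.innerHom c) :=
      (jmap_jmap _ _ ((partialGraphHom _).comp h.innerHom) (fun _ => rfl) c).trans
        (jmap_jmap _ _ _ (fun _ => rfl) c).symm
    have h3 : jmap (partialGraphHom _) b =
        jmap (k := k) (d := d) (partialGraphHom _) (jmap h.outerHom b) :=
      (jmap_jmap _ _ _ (fun _ => rfl) b).symm
    rw [map_mul, map_mul, h1, h2, h3, mul_assoc]
  have L := compOn_mk 𝓜 e₁ (compOn_isDLin 𝓜 e₂ hκ hμ.1) hν.1 hν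
    (fun l _ => glue_mem_deg e₂ hm hm'' l) (fun x => m' (incl e₃ x)) ha
    (jmap h.innerHom c * jmap h.outerHom b)
  have R := compOn_mk 𝓜 e₄ hκ (compOn_isDLin 𝓜 e₃ hμ.1 hν.1) (compOn_isHom 𝓜 e₃ hμ.1 hν.1 hμ hν)
    (fun l _ => hm l) (glue e₃ mB fun x => m' (incl e₃ x))
    (mul_mem_jdeg (jmap_mem_jdeg (blockHom e₃) ha) (jmap_mem_jdeg (partialGraphHom _) hc)) b
  rw [outerOn_compOn h hκ hμ hm mB hc] at L
  rw [compOn_mk 𝓜 e₃ hμ.1 hν.1 hν (fun l _ => hm'' l) _ ha, hel, h.glue_glue] at R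
  simp only [LinearMap.comp_apply, LinearMap.mulRight_apply, AlgHom.toLinearMap_apply]
  rw [hel, h.glue_glue, L, R, map_negOnePow_smul, map_negOnePow_smul, negOnePow_smul_apply,
    map_negOnePow_smul, negOnePow_smul_smul, negOnePow_smul_smul, ← h.incl_eq, he.sum_lt_incl,
    he.sum_gt_incl]
  congr 2
  push_cast
  ring

end Seq


section SeqChiral

variable {k : Type*} [Field k] {d : ℕ} {M : Type*} [AddCommGroup M] [Module k M]
    [Module (Weyl k (Fin d))ᵐᵒᵖ M] [IsScalarTower k (Weyl k (Fin d))ᵐᵒᵖ M]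
    {𝓜 : DGStructure k d M}

theorem compOn_congr {I K B : Type*} [Fintype I] [DecidableEq I] [Fintype K] [DecidableEq K]
    [Preorder K] [DecidableLT K] [Fintype B] [DecidableEq B] {i : K} (e : I ≃ {j : K // j ≠ i} ⊕ B)
    {μ μ' : OpOn k d M K} (hμ : IsDLin μ) (hμ' : IsDLin μ') {ν ν' : OpOn k d M B} (hν : IsDLin ν)
    (hν' : IsDLin ν') (h : μ = μ') (h' : ν = ν') : compOn 𝓜 e hμ hν = compOn 𝓜 e hμ' hν' := by
  subst h h'; rfl

/-- Transport along an equality of arities is absorbed into the identification of the inputs. -/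
theorem toOp_recast {a b : ℕ} (h : a = b) (x : ChiralOp 𝓜 a) {K B : Type*} [Fintype K]
    [DecidableEq K] [Preorder K] [DecidableLT K] [Fintype B] [DecidableEq B] {i : K}
    {e : Fin a ≃ {j : K // j ≠ i} ⊕ B} {μ : OpOn k d M K} {hμ : IsDLin μ} {ν : OpOn k d M B}
    {hν : IsDLin ν}
    (hx : toOp x = compOn 𝓜 e hμ hν) :
    toOp (recast (P := fun n => ChiralOp 𝓜 n) h x) =
      compOn 𝓜 ((finCongr h.symm).trans e) hμ hν := by
  subst h; exact hx

theorem val_outerIdx_finCongr {a b : ℕ} (h : b = a) {K B : Type*} {i : K}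
    (e : Fin a ≃ {j : K // j ≠ i} ⊕ B) (j) :
    ((outerIdx ((finCongr h).trans e) j : Fin b) : ℕ) = outerIdx e j := by
  subst h; rfl

theorem val_incl_finCongr {a b : ℕ} (h : b = a) {K B : Type*} {i : K}
    (e : Fin a ≃ {j : K // j ≠ i} ⊕ B) (j) :
    ((incl ((finCongr h).trans e) j : Fin b) : ℕ) = incl e j := by
  subst h; rfl

theorem seqCompat_insEquiv {l m n : ℕ} (i : Fin (l + 1)) (j : Fin (m + 1)) :
    SeqCompat (insEquiv (m := l + m) ⟨i + j, by omega⟩ n) (insEquiv i (m + 1)) (insEquiv j n)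
      ((finCongr (Nat.add_assoc l m n)).trans (insEquiv i (m + n))) where
  incl_eq := rfl
  outer a h := by
    have := j.2
    have ha : (a.1 : ℕ) ≠ i := fun h => a.2 (Fin.ext h)
    ext
    rw [val_outerIdx_finCongr, val_outerIdx_insEquiv, val_outerIdx_insEquiv, val_outerIdx_insEquiv]
    split_ifs <;> simp only at * <;> omega
  middle b h := by
    have hb : (b.1 : ℕ) ≠ j := fun h => b.2 (Fin.ext h)
    ext
    rw [val_incl_finCongr, val_outerIdx_insEquiv, val_incl_insEquiv, val_incl_insEquiv,
      val_outerIdx_insEquiv]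
    split_ifs <;> simp only at * <;> omega
  inner c := by
    ext
    rw [val_incl_finCongr, val_incl_insEquiv, val_incl_insEquiv, val_incl_insEquiv, Nat.add_assoc]

theorem chiralComp_assoc [CharZero k] {l m n : ℕ} (i : Fin (l + 1)) (j : Fin (m + 1))
    (κ : ChiralOp 𝓜 (l + 1)) (μ : ChiralOp 𝓜 (m + 1)) (ν : ChiralOp 𝓜 n) :
    chiralComp (m := l + m) ⟨i + j, by omega⟩ (chiralComp i κ μ) ν =
      recast (P := fun n => ChiralOp 𝓜 n) (Nat.add_assoc l m n).symm
        (chiralComp i κ (chiralComp j μ ν)) := by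
  induction μ using chiral_induction with
  | ha μ μ' h h' =>
    simp only [map_add, LinearMap.add_apply, recast_add] at h h' ⊢
    rw [← h, ← h']
  | h p μ hμ =>
  induction ν using chiral_induction with
  | ha ν ν' h h' => simp only [map_add, h, h', recast_add]
  | h q ν hν =>
  refine Subtype.ext (Eq.trans ?_ (toOp_recast (Nat.add_assoc l m n).symm
    (chiralComp i κ (chiralComp j μ ν)) (chiralComp_toOp i κ (chiralComp j μ ν))).symm)
  have hij : (i : ℕ) + j < l + m + 1 := by omega
  refine Eq.trans (chiralComp_toOp (m := l + m) ⟨i + j, hij⟩ (chiralComp i κ μ) ν) ?_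
  refine (compOn_congr (insEquiv (m := l + m) ⟨i + j, hij⟩ n)
    (dlin (n := l + m + 1) (chiralComp i κ μ)) (compOn_isDLin 𝓜 (insEquiv i (m + 1)) (dlin κ)
        hμ.1) _ hν.1
    (chiralComp_toOp i κ μ) rfl).trans (Eq.trans ?_ (compOn_congr _ (dlin κ) _
      (compOn_isDLin 𝓜 (insEquiv j n) hμ.1 hν.1) _ rfl (chiralComp_toOp j μ ν).symm))
  exact compOn_compOn (seqCompat_insEquiv i j) (isOrdered_insEquiv i (m + 1)) (dlin κ) hμ hν

end SeqChiral

/-! ### Parallel associativity -/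

section Comm

variable {k : Type*} [Field k] {d : ℕ} {I : Type*} {G : SimpleGraph I}

/-- Graded commutativity of the Jouanolou algebra. -/
theorem jou_mul_comm {r s : ℕ} {a b : Jou k d G} (ha : a ∈ jdeg r) (hb : b ∈ jdeg s) :
    a * b = ((r : ℤ) * s).negOnePow • (b * a) := by
  refine jdeg_le (k := k) (d := d) (S := fun r => LinearMap.eqLocus (LinearMap.mulRight k b)
    (((((r : ℕ) : ℤ) * s).negOnePow : ℤ) • LinearMap.mulLeft k b)) ?_ (fun i t r a h => ?_)
    (fun e t r a h => ?_) (fun e t r a h => ?_) r ha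
  · simp [LinearMap.mem_eqLocus]
  · simp only [LinearMap.mem_eqLocus, LinearMap.mulRight_apply, LinearMap.smul_apply,
      LinearMap.mulLeft_apply] at h ⊢
    rw [mul_assoc, h, mul_smul_comm, ← mul_assoc, ← mul_assoc, jz_central]
  · simp only [LinearMap.mem_eqLocus, LinearMap.mulRight_apply, LinearMap.smul_apply,
      LinearMap.mulLeft_apply] at h ⊢
    rw [mul_assoc, h, mul_smul_comm, ← mul_assoc, ← mul_assoc, jx_central]
  · simp only [LinearMap.mem_eqLocus, LinearMap.mulRight_apply, LinearMap.smul_apply,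
      LinearMap.mulLeft_apply, ← Units.smul_def] at h ⊢
    rw [mul_assoc, h, mul_smul_comm, ← mul_assoc, ← mul_assoc, jdx_mul, jpar_of_mem hb,
      smul_mul_assoc, smul_mul_assoc, smul_smul, ← Int.negOnePow_add]
    congr 2
    push_cast; ring

end Comm


section PushAux

variable {k : Type*} [Field k] {ι κ θ : Type*} [Fintype ι] [DecidableEq ι] [Fintype κ]
    [DecidableEq κ] [DecidableEq θ] (p : ι → κ) (q : κ → θ) (r : ι → θ) (h : ∀ i, q (p i) = r i)
    {N : Type*} [AddCommGroup N] [Module k N] [Module (Weyl k θ)ᵐᵒᵖ N]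
        [IsScalarTower k (Weyl k θ)ᵐᵒᵖ N]

theorem pushCollapseAux_pd (c : κ) (y : Push (k := k) q N) (G : MvPolynomial ι k) :
    pushCollapseAux p q r h N (ract (wpd k c) y) G =
      pushCollapseAux p q r h N y ((∑ i, if p i = c then MvPolynomial.X i else 0) * G) := by
  induction y using push_induction with
  | ha y y' hy hy' => simp only [map_add, LinearMap.add_apply, hy, hy']
  | hm n F => rw [ract_push_pd_mk, pushCollapseAux_mk, pushCollapseAux_mk, map_mul (substSum k _),
      substSum_X]; congr 1; ring

theorem ract_pushCollapseAux (c : ι) (y : Push (k := k) q N) (G : MvPolynomial ι k) :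
    pushCollapseAux p q r h N y (MvPolynomial.X c * G) =
      ract (wpd k c) (pushCollapseAux p q r h N y G) := by
  induction y using push_induction with
  | ha y y' hy hy' => simp only [map_add, LinearMap.add_apply, hy, hy']
  | hm n F => rw [pushCollapseAux_mk, pushCollapseAux_mk, ract_push_pd_mk]; congr 1; ring

theorem pushCollapseAux_one (y : Push (k := k) q N) :
    pushCollapseAux p q r h N y 1 = substMap p q r h N y := by
  induction y using push_induction with
  | ha y y' hy hy' => simp only [map_add, LinearMap.add_apply, hy, hy']
  | hm n F => rw [pushCollapseAux_mk, substMap_mk, mul_one]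

/-- The sum of the variables of the block is the variable at `i` of the collapsed index set. -/
theorem rename_incl_sum {I K B : Type*} [Fintype I] [DecidableEq I] [Fintype K] [DecidableEq K]
    [Fintype B] [DecidableEq B] {d : ℕ} {i : K} (e : I ≃ {j : K // j ≠ i} ⊕ B) (s : Fin d) :
    MvPolynomial.rename (R := k) (liftIdx (incl e)) (∑ b : B × Fin d,
        if b.2 = s then MvPolynomial.X b else 0) =
      ∑ a, if liftIdx (collapse e) a = (i, s) then MvPolynomial.X a else 0 := by
  rw [map_sum, Fintype.sum_prod_type, Fintype.sum_prod_type, sum_index e]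
  refine (zero_add _).symm.trans (congrArg₂ (· + ·) (Finset.sum_eq_zero fun a _ =>
    Finset.sum_eq_zero fun t _ => if_neg fun h => ?_).symm (Finset.sum_congr rfl fun b _ =>
      Finset.sum_congr rfl fun t _ => ?_))
  · exact a.2 ((collapse_outerIdx e a).symm.trans (congrArg Prod.fst h))
  · have h1 : liftIdx (collapse e) (incl e b, t) = (i, s) ↔ t = s :=
      ⟨fun h => congrArg Prod.snd h, fun h => Prod.ext (collapse_incl e b) h⟩
    by_cases h : t = s
    · rw [if_pos h, if_pos (h1.2 h), MvPolynomial.rename_X]; rfl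
    · rw [if_neg h, if_neg fun h' => h (h1.1 h'), map_zero]

end PushAux

section Par

/-- Compatibility of the identifications of the inputs of `(κ ∘_i μ) ∘_j ν` and of
`(κ ∘_j ν) ∘_i μ`: the inputs of `κ` are indexed by `K`, those of `μ` by `B`, those of `ν` by `C`,
those of `κ ∘_i μ` by `K₁`, those of `κ ∘_j ν` by `K₂`, and those of the iterated composition by
`I`. -/
structure ParCompat {I K K₁ K₂ B C : Type*} {i j : K} {j' : K₁} {i' : K₂}
    (e₁ : K₁ ≃ {x : K // x ≠ i} ⊕ B) (f₁ : I ≃ {x : K₁ // x ≠ j'} ⊕ C)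
    (e₂ : K₂ ≃ {x : K // x ≠ j} ⊕ C) (f₂ : I ≃ {x : K₂ // x ≠ i'} ⊕ B) : Prop where
  ne : i ≠ j
  eq₁ : outerIdx e₁ ⟨j, ne.symm⟩ = j'
  eq₂ : outerIdx e₂ ⟨i, ne⟩ = i'
  outer : ∀ (a : K) (hi : a ≠ i) (hj : a ≠ j) (hj' : outerIdx e₁ ⟨a, hi⟩ ≠ j')
    (hi' : outerIdx e₂ ⟨a, hj⟩ ≠ i'), outerIdx f₁ ⟨_, hj'⟩ = outerIdx f₂ ⟨_, hi'⟩
  left : ∀ b (h : incl e₁ b ≠ j'), outerIdx f₁ ⟨incl e₁ b, h⟩ = incl f₂ b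
  right : ∀ c (h : incl e₂ c ≠ i'), outerIdx f₂ ⟨incl e₂ c, h⟩ = incl f₁ c

namespace ParCompat

variable {I K K₁ K₂ B C : Type*} {i j : K} {j' : K₁} {i' : K₂}
    {e₁ : K₁ ≃ {x : K // x ≠ i} ⊕ B} {f₁ : I ≃ {x : K₁ // x ≠ j'} ⊕ C}
    {e₂ : K₂ ≃ {x : K // x ≠ j} ⊕ C} {f₂ : I ≃ {x : K₂ // x ≠ i'} ⊕ B}
    (h : ParCompat e₁ f₁ e₂ f₂)

include h

theorem symm : ParCompat e₂ f₂ e₁ f₁ :=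
  ⟨h.ne.symm, h.eq₂, h.eq₁, fun a hi hj hj' hi' => (h.outer a hj hi hi' hj').symm, h.right, h.left⟩

theorem left_ne (b : B) : incl e₁ b ≠ j' := h.eq₁ ▸ (outerIdx_ne_incl e₁ _ b).symm

theorem outer_ne (a : K) (hi : a ≠ i) (hj : a ≠ j) : outerIdx e₁ ⟨a, hi⟩ ≠ j' := fun h' =>
  hj (congrArg Subtype.val (outerIdx_injective e₁ (h'.trans h.eq₁.symm)))

theorem collapse_block (b : B) : collapse f₁ (incl f₂ b) = incl e₁ b := by
  rw [← h.left b (h.left_ne b), collapse_outerIdx]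

/-- Every index is an index of `K`, or of one of the two blocks. -/
theorem cases (a : I) : (∃ b, incl f₂ b = a) ∨ (∃ c, incl f₁ c = a) ∨
    ∃ (x : K) (hi : x ≠ i) (hj : x ≠ j), outerIdx f₁ ⟨_, h.outer_ne x hi hj⟩ = a := by
  obtain ⟨⟨x, hx⟩, rfl⟩ | ⟨c, rfl⟩ := idx_cases f₁ a
  · obtain ⟨⟨y, hy⟩, rfl⟩ | ⟨b, rfl⟩ := idx_cases e₁ x
    · refine Or.inr (Or.inr ⟨y, hy, fun hj => hx ?_, rfl⟩)
      subst hj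
      exact h.eq₁
    · exact Or.inl ⟨b, (h.left b hx).symm⟩
  · exact Or.inr (Or.inl ⟨c, rfl⟩)

theorem collapse_collapse (a : I) : collapse e₁ (collapse f₁ a) = collapse e₂ (collapse f₂ a) := by
  obtain ⟨b, rfl⟩ | ⟨c, rfl⟩ | ⟨x, hi, hj, rfl⟩ := h.cases a
  · rw [h.collapse_block, collapse_incl, collapse_incl, ← h.eq₂, collapse_outerIdx]
  · rw [h.symm.collapse_block, collapse_incl, collapse_incl, ← h.eq₁, collapse_outerIdx]
  · rw [collapse_outerIdx, collapse_outerIdx, h.outer x hi hj _ (h.symm.outer_ne x hj hi),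
      collapse_outerIdx, collapse_outerIdx]

theorem glue_glue {X : Type*} (mK : K → X) (mB : B → X) (mC : C → X) :
    glue f₁ (glue e₁ mK mB) mC = glue f₂ (glue e₂ mK mC) mB := by
  ext a
  obtain ⟨b, rfl⟩ | ⟨c, rfl⟩ | ⟨x, hi, hj, rfl⟩ := h.cases a
  · rw [glue_incl, ← h.left b (h.left_ne b), glue_outerIdx, glue_incl]
  · rw [glue_incl, ← h.right c (h.symm.left_ne c), glue_outerIdx, glue_incl]
  · rw [glue_outerIdx, glue_outerIdx, h.outer x hi hj _ (h.symm.outer_ne x hj hi), glue_outerIdx,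
      glue_outerIdx]

/-- The inclusion of the complete graph on `B` into the partial graph for the block `C`. -/
def leftHom : (⊤ : SimpleGraph B) →g partialGraph (collapse f₁) where
  toFun := incl f₂
  map_rel' {a b} hab := by
    rw [SimpleGraph.comap_adj, SimpleGraph.top_adj, h.collapse_block, h.collapse_block]
    exact fun h' => hab (incl_injective e₁ h')

omit h in
/-- The inclusion of the partial graph for both blocks into the partial graph for the block `C`. -/
def bothHom {ρ : I → K} (hρ : ∀ a, collapse e₁ (collapse f₁ a) = ρ a) :
    partialGraph ρ →g partialGraph (collapse f₁) :=
  partialHom id fun a b (hab : collapse f₁ a = collapse f₁ b) => by rw [← hρ, ← hρ, hab]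

omit h in
/-- The map of partial graphs which collapses the block `C`. -/
def collapseHom {ρ : I → K} (hρ : ∀ a, collapse e₁ (collapse f₁ a) = ρ a) :
    partialGraph ρ →g partialGraph (collapse e₁) :=
  partialHom (collapse f₁) fun a b hab => by rw [← hρ, ← hρ, hab]

theorem dart_cases {ρ : I → K} (hρ : ∀ a, collapse e₁ (collapse f₁ a) = ρ a)
    (a : (partialGraph (collapse f₁)).Dart) :
    (∃ x, h.leftHom.mapDart x = a) ∨ ∃ x, (bothHom hρ).mapDart x = a := by
  obtain ⟨⟨v, w⟩, hvw⟩ := a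
  by_cases hr : ρ v = ρ w
  · left
    obtain ⟨x, hx⟩ := exists_block e₁ (a := ⟨(collapse f₁ v, collapse f₁ w), hvw⟩)
      ((hρ v).trans (hr.trans (hρ w).symm))
    have h1 := congrArg SimpleGraph.Dart.toProd hx
    have h2 : ∀ (u : I) (b : B), incl e₁ b = collapse f₁ u → incl f₂ b = u := fun u b hu => by
      rw [← h.left b (h.left_ne b)]
      exact (eq_outerIdx f₁ (j := ⟨incl e₁ b, h.left_ne b⟩) hu.symm).symm
    exact ⟨x, SimpleGraph.Dart.ext _ _ (Prod.ext (h2 _ _ (Prod.ext_iff.1 h1).1)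
      (h2 _ _ (Prod.ext_iff.1 h1).2))⟩
  · exact Or.inr ⟨⟨(v, w), hr⟩, rfl⟩

end ParCompat

variable {k : Type*} [Field k] {d : ℕ} {M : Type*} [AddCommGroup M] [Module k M]
    [Module (Weyl k (Fin d))ᵐᵒᵖ M] [IsScalarTower k (Weyl k (Fin d))ᵐᵒᵖ M]
    {𝓜 : DGStructure k d M}

variable {I K K₁ K₂ B C : Type*} [Fintype I] [DecidableEq I] [Fintype K] [DecidableEq K]
  [Fintype K₁] [DecidableEq K₁] [Fintype K₂] [DecidableEq K₂]
  [Fintype B] [DecidableEq B] [Fintype C] [DecidableEq C] {i j : K} {j' : K₁} {i' : K₂}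
  {e₁ : K₁ ≃ {x : K // x ≠ i} ⊕ B} {f₁ : I ≃ {x : K₁ // x ≠ j'} ⊕ C}
  {e₂ : K₂ ≃ {x : K // x ≠ j} ⊕ C} {f₂ : I ≃ {x : K₂ // x ≠ i'} ⊕ B}
  (h : ParCompat e₁ f₁ e₂ f₂) {ρ : I → K} (hρ : ∀ a, collapse e₁ (collapse f₁ a) = ρ a)

include hρ in
omit [Fintype I] [DecidableEq I] [Fintype K] [DecidableEq K] [Fintype K₁] [DecidableEq K₁] in
theorem liftIdx_collapse (a : I × Fin d) :
    liftIdx (collapse e₁) (liftIdx (collapse f₁) a) = liftIdx ρ a := Prod.ext (hρ a.1) rfl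

/-- The insertion `(x₁ ⊗ F₁) ⊠ (x₂ ⊗ F₂)` of two elements of `Δ_* M` at the indices `i` and `j` of
an exterior product, where the first is inserted before the second. -/
def insertTwo (mK : K → M) (y : DiagOn k d M B) :
    DiagOn k d M C →ₗ[k] Push (k := k) (liftIdx (d := d) ρ) (Box k K M) :=
  puLift (LinearMap.mk₂ k (fun x F => pushCollapseAux (liftIdx (collapse f₁))
      (liftIdx (collapse e₁))
      (liftIdx ρ) (liftIdx_collapse hρ) _ (insertPush e₁ (Function.update mK j x) y)
      (MvPolynomial.rename (liftIdx (incl f₁)) F))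
    (fun x x' F => by rw [insertPush_update_add e₁ mK h.ne.symm, LinearMap.add_apply, map_add,
      LinearMap.add_apply])
    (fun c x F => by rw [insertPush_update_smul e₁ mK h.ne.symm, LinearMap.smul_apply, map_smul,
      LinearMap.smul_apply])
    (fun x F F' => by rw [map_add, map_add])
      fun c x F => by rw [map_smul, map_smul]) fun s x F => by
    have h1 := insertPush_update_pd e₁ (Function.update mK j x) ⟨j, h.ne.symm⟩ s y
    rw [Function.update_self, Function.update_idem] at h1
    rw [LinearMap.mk₂_apply, LinearMap.mk₂_apply, h1, h.eq₁, pushCollapseAux_pd,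
      map_mul (MvPolynomial.rename _), rename_incl_sum]

theorem insertTwo_mk_one (mK : K → M) (y : DiagOn k d M B) (x : M) :
    insertTwo h hρ mK y (puMk _ x 1) = substMap (liftIdx (collapse f₁)) (liftIdx (collapse e₁))
      (liftIdx ρ) (liftIdx_collapse hρ) _ (insertPush e₁ (Function.update mK j x) y) := by
  rw [insertTwo, puLift_mk, LinearMap.mk₂_apply, map_one, pushCollapseAux_one]

theorem insertTwo_pd (mK : K → M) (y : DiagOn k d M B) (c : C × Fin d) (z : DiagOn k d M C) :
    insertTwo h hρ mK y (ract (wpd k c) z) =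
      ract (wpd k (liftIdx (incl f₁) c)) (insertTwo h hρ mK y z) := by
  induction z using push_induction with
  | ha y y' hy hy' => simp only [map_add, hy, hy']
  | hm x F =>
    rw [ract_push_pd_mk, insertTwo, puLift_mk, puLift_mk, LinearMap.mk₂_apply, LinearMap.mk₂_apply,
      map_mul (MvPolynomial.rename _), MvPolynomial.rename_X, ract_pushCollapseAux]

theorem insertTwo_add (mK : K → M) (y y' : DiagOn k d M B) (z : DiagOn k d M C) :
    insertTwo h hρ mK (y + y') z = insertTwo h hρ mK y z + insertTwo h hρ mK y' z :=
  LinearMap.congr_fun (f := insertTwo h hρ mK (y + y'))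
    (g := insertTwo h hρ mK y + insertTwo h hρ mK y')
    (pu_ext fun x F => by
      simp only [LinearMap.add_apply]
      simp only [insertTwo, puLift_mk, LinearMap.mk₂_apply, map_add, LinearMap.add_apply]) z

theorem insertTwo_smul (mK : K → M) (c : k) (y : DiagOn k d M B) (z : DiagOn k d M C) :
    insertTwo h hρ mK (c • y) z = c • insertTwo h hρ mK y z :=
  LinearMap.congr_fun (f := insertTwo h hρ mK (c • y)) (g := c • insertTwo h hρ mK y)
    (pu_ext fun x F => by
      simp only [LinearMap.smul_apply]
      simp only [insertTwo, puLift_mk, LinearMap.mk₂_apply, map_smul, LinearMap.smul_apply]) z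

theorem insertTwo_left_pd (mK : K → M) (c : B × Fin d) (y : DiagOn k d M B) (z : DiagOn k d M C) :
    insertTwo h hρ mK (ract (wpd k c) y) z =
      ract (wpd k (liftIdx (incl f₂) c)) (insertTwo h hρ mK y z) := by
  induction z using push_induction with
  | ha z z' hz hz' => simp only [map_add, hz, hz']
  | hm x F =>
    refine puMk_induction (P := fun z => insertTwo h hρ mK (ract (wpd k c) y) z =
      ract (wpd k (liftIdx (incl f₂) c)) (insertTwo h hρ mK y z)) x ?_
      (fun c z hz => by simp only [map_smul, hz])
      (fun z z' hz hz' => by simp only [map_add, hz, hz'])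
      (fun c' z hz => ?_) F
    · rw [insertTwo_mk_one, insertTwo_mk_one, insertPush_pd, substMap_pd,
        Finset.sum_eq_single (liftIdx (incl f₂) c)]
      · have hc : liftIdx (d := d) (collapse f₁) (liftIdx (incl f₂) c) = liftIdx (incl e₁) c :=
          Prod.ext (h.collapse_block c.1) rfl
        exact if_pos hc
      · rintro ⟨a, s⟩ - hne
        refine if_neg fun h' => hne ?_
        have h1 : collapse f₁ a = incl e₁ c.1 := congrArg Prod.fst h'
        have h2 : s = c.2 := congrArg Prod.snd h'
        refine Prod.ext ?_ h2
        have h2 := eq_outerIdx f₁ (j := ⟨incl e₁ c.1, h.left_ne c.1⟩) h1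
        exact h2.trans (h.left c.1 _)
      · simp
    · rw [insertTwo_pd, insertTwo_pd, hz, ← Module.End.mul_apply, ← ract_mul,
        ← Module.End.mul_apply, ← ract_mul, wpd_comm]

/-- The insertion of two elements is symmetric. -/
theorem insertTwo_comm (hρ' : ∀ a, collapse e₂ (collapse f₂ a) = ρ a) (mK : K → M)
    (y : DiagOn k d M B) (z : DiagOn k d M C) :
    insertTwo h hρ mK y z = insertTwo h.symm hρ' mK z y := by
  induction y using push_induction with
  | ha y y' hy hy' => rw [map_add, insertTwo_add, hy, hy']
  | hm x F =>
    refine puMk_induction (P := fun y => insertTwo h hρ mK y z = insertTwo h.symm hρ' mK z y) x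
      ?_ (fun c y hy => by rw [map_smul, insertTwo_smul, hy])
      (fun y y' hy hy' => by rw [map_add, insertTwo_add, hy, hy'])
      (fun c y hy => by rw [insertTwo_pd, insertTwo_left_pd, hy]) F
    induction z using push_induction with
    | ha z z' hz hz' => rw [map_add, hz, hz', insertTwo_add]
    | hm x' F =>
      refine puMk_induction (P := fun z => insertTwo h hρ mK (puMk _ x 1) z =
        insertTwo h.symm hρ' mK z (puMk _ x 1)) x' ?_
        (fun c z hz => by rw [map_smul, hz, insertTwo_smul])
        (fun z z' hz hz' => by rw [map_add, hz, hz', insertTwo_add])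
        (fun c z hz => by rw [insertTwo_pd, insertTwo_left_pd, hz]) F
      rw [insertTwo_mk_one, insertTwo_mk_one, insertPush_one, insertPush_one, substMap_mk,
        substMap_mk, map_one (substSum k _), map_one (substSum k _), Function.update_comm h.ne]

end Par


section ParComp

variable {k : Type*} [Field k] {d : ℕ} {M : Type*} [AddCommGroup M] [Module k M]
    [Module (Weyl k (Fin d))ᵐᵒᵖ M] [IsScalarTower k (Weyl k (Fin d))ᵐᵒᵖ M]
    {𝓜 : DGStructure k d M}

variable {I K K₁ K₂ B C : Type*} [Fintype I] [DecidableEq I] [Fintype K] [LinearOrder K]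
  [Fintype K₁] [LinearOrder K₁] [Fintype K₂] [LinearOrder K₂]
  [Fintype B] [LinearOrder B] [Fintype C] [LinearOrder C] {i j : K} {j' : K₁} {i' : K₂}
  {e₁ : K₁ ≃ {x : K // x ≠ i} ⊕ B} {f₁ : I ≃ {x : K₁ // x ≠ j'} ⊕ C}
  {e₂ : K₂ ≃ {x : K // x ≠ j} ⊕ C} {f₂ : I ≃ {x : K₂ // x ≠ i'} ⊕ B}
  (h : ParCompat e₁ f₁ e₂ f₂) {ρ : I → K}

theorem sum_filter_update_zero (p : K → Prop) [DecidablePred p] (ε : K → ℤ) (i : K) (f : ℤ) :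
    ∑ l with p l, Function.update ε i f l =
      ∑ l with p l, Function.update ε i 0 l + if p i then f else 0 := by
  simpa using sum_filter_update_add p ε i 0 f

variable [CharZero k]

/-- The composition `κ ∘_i μ`, applied to an element inserted at another input `j` of `κ`. -/
theorem outerOn_compOn_insertTwo (hρ : ∀ a, collapse e₁ (collapse f₁ a) = ρ a) {κ : OpOn k d M K}
    (hκ : IsDLin κ) {p : ℤ} {μ : OpOn k d M B} (hμ : IsHom 𝓜 p μ) {ε : K → ℤ} {mK : K → M}
    (hm : ∀ l, mK l ∈ 𝓜.deg (ε l)) (mB : B → M) {r : ℕ} {a : Jou k d (⊤ : SimpleGraph B)}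
    (ha : a ∈ jdeg r) (c : Jou k d (partialGraph ρ)) {f : ℤ} {z : DiagOn k d M C}
    (hz : z ∈ tgtDeg 𝓜 C f) :
    outerOn (collapse f₁) (compOn 𝓜 e₁ hκ hμ.1) (compOn_isDLin 𝓜 e₁ hκ hμ.1)
        (jmMk _ (insertPush f₁ (glue e₁ mK mB) z)
          (jmap h.leftHom a * jmap (ParCompat.bothHom hρ) c)) =
      (p * ∑ l with l < i, Function.update ε j f l +
        r * ∑ l with i < l, Function.update ε j f l).negOnePow •
        outerOn ρ κ hκ (jmMk _ (insertTwo h hρ mK (μ (jmMk _ (box k mB) a)) z) c) := by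
  refine tgtDeg_induction (P := fun z => ∀ c : Jou k d (partialGraph ρ),
    outerOn (collapse f₁) (compOn 𝓜 e₁ hκ hμ.1) (compOn_isDLin 𝓜 e₁ hκ hμ.1)
        (jmMk _ (insertPush f₁ (glue e₁ mK mB) z)
          (jmap h.leftHom a * jmap (ParCompat.bothHom hρ) c)) =
      (p * ∑ l with l < i, Function.update ε j f l +
        r * ∑ l with i < l, Function.update ε j f l).negOnePow •
        outerOn ρ κ hκ (jmMk _ (insertTwo h hρ mK (μ (jmMk _ (box k mB) a)) z) c))
    (fun x hx c => ?_) (fun t z hz c => ?_) (fun z z' hz hz' c => ?_) (fun t z hz c => ?_) hz c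
  · have h1 : restrictDiag (collapse f₁) (jmap h.leftHom a) =
        jmap (k := k) (d := d) (blockHom e₁) a :=
      jmap_jmap _ _ _ h.collapse_block a
    have h2 : restrictDiag (collapse f₁) (jmap (ParCompat.bothHom hρ) c) =
        jmap (k := k) (d := d) (partialGraphHom (collapse e₁))
          (jmap (ParCompat.collapseHom hρ) c) :=
      (jmap_jmap _ _ ((partialGraphHom (collapse e₁)).comp (ParCompat.collapseHom hρ))
        (fun _ => rfl) c).trans (jmap_jmap _ _ _ (fun _ => rfl) c).symm
    have h3 : Function.update (glue e₁ mK mB) j' x = glue e₁ (Function.update mK j x) mB := by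
      rw [← h.eq₁, glue_update_outer]
    rw [insertPush_one, outerOn_one, map_mul, h1, h2, h3,
      compOn_mk 𝓜 e₁ hκ hμ.1 hμ (fun l _ => update_mem_deg 𝓜 hm j hx l) _ ha, map_negOnePow_smul,
      insertTwo_mk_one, outerOn_substMap (collapse f₁) (collapse e₁) ρ hρ hκ
        (liftIdx_collapse hρ) fun a b hab => by rw [← hρ, ← hρ, hab]]
    rfl
  · rw [map_smul, map_smul, LinearMap.smul_apply, map_smul, hz c, map_smul, map_smul,
      LinearMap.smul_apply, map_smul, smul_comm t]
  · rw [map_add, map_add, LinearMap.add_apply, map_add, hz c, hz' c, map_add, map_add,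
      LinearMap.add_apply, map_add, smul_add]
  · have h1 : jpd (incl f₁ t.1) t.2 (jmap h.leftHom a) = 0 :=
      jpd_jmap_of_notMem h.leftHom (liftIdx (incl f₁) t) (fun b hb => by
        have hb' : incl f₂ b = incl f₁ t.1 := hb
        rw [← h.right t.1 (h.symm.left_ne t.1)] at hb'
        exact outerIdx_ne_incl f₂ _ b hb'.symm) a
    have h2 : jpd (incl f₁ t.1) t.2 (jmap (ParCompat.bothHom hρ) c) =
        jmap (ParCompat.bothHom hρ) (jpd (incl f₁ t.1) t.2 c) :=
      jpd_jmap_of_injective (ParCompat.bothHom hρ) Function.injective_id _ _ c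
    have h4 : (liftIdx (incl f₁) t).1 = incl f₁ t.1 := rfl
    have h5 : (liftIdx (incl f₁) t).2 = t.2 := rfl
    rw [insertPush_pd, insertTwo_pd, outerOn_pd, outerOn_pd, h4, h5, jpd_mul, h1, h2, zero_mul,
      zero_add, hz c, hz, smul_add, map_negOnePow_smul]

include h in
omit [Fintype I] [DecidableEq I] [Fintype K] [LinearOrder K] [Fintype K₁] [LinearOrder K₁]
  [Fintype K₂] [LinearOrder K₂] [Fintype B] [LinearOrder B] [Fintype C] [LinearOrder C]
      [CharZero k] in
/-- The two decompositions of the Jouanolou algebra for the two orders of composition. -/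
theorem jmap_blockHom_mul_comm (hρ : ∀ a, collapse e₁ (collapse f₁ a) = ρ a)
    (hρ' : ∀ a, collapse e₂ (collapse f₂ a) = ρ a) {r₁ r₂ : ℕ} {a₁ : Jou k d (⊤ : SimpleGraph B)}
    {a₂ : Jou k d (⊤ : SimpleGraph C)} (ha₁ : a₁ ∈ jdeg r₁) (ha₂ : a₂ ∈ jdeg r₂)
    (c : Jou k d (partialGraph ρ)) :
    jmap (blockHom f₁) a₂ * jmap (partialGraphHom (collapse f₁))
        (jmap h.leftHom a₁ * jmap (ParCompat.bothHom hρ) c) =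
      ((r₁ : ℤ) * r₂).negOnePow • (jmap (blockHom f₂) a₁ * jmap (partialGraphHom (collapse f₂))
        (jmap h.symm.leftHom a₂ * jmap (ParCompat.bothHom hρ') c)) := by
  have h1 : jmap (partialGraphHom (collapse f₁)) (jmap h.leftHom a₁) =
      jmap (k := k) (d := d) (blockHom f₂) a₁ := jmap_jmap _ _ _ (fun _ => rfl) a₁
  have h2 : jmap (partialGraphHom (collapse f₂)) (jmap h.symm.leftHom a₂) =
      jmap (k := k) (d := d) (blockHom f₁) a₂ := jmap_jmap _ _ _ (fun _ => rfl) a₂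
  have h3 : jmap (partialGraphHom (collapse f₁)) (jmap (ParCompat.bothHom hρ) c) =
      jmap (k := k) (d := d) (partialGraphHom (collapse f₂)) (jmap (ParCompat.bothHom hρ') c) :=
    (jmap_jmap _ _ (partialGraphHom ρ) (fun _ => rfl) c).trans
      (jmap_jmap _ _ _ (fun _ => rfl) c).symm
  rw [map_mul, map_mul, h1, h2, h3, ← mul_assoc, ← mul_assoc,
    jou_mul_comm (jmap_mem_jdeg _ ha₂) (jmap_mem_jdeg _ ha₁), smul_mul_assoc,
    mul_comm (r₂ : ℤ)]

include h in
/-- The value of `(κ ∘_i μ) ∘_j ν`, with its sign, as the double insertion of the values of `μ` and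
`ν` into `κ`. -/
theorem compOn_compOn_mk (hρ : ∀ a, collapse e₁ (collapse f₁ a) = ρ a) (he₁ : IsOrdered e₁)
    {κ : OpOn k d M K} (hκ : IsDLin κ) {p q : ℤ} {μ : OpOn k d M B} (hμ : IsHom 𝓜 p μ)
    {ν : OpOn k d M C} (hν : IsHom 𝓜 q ν) {ε : K → ℤ} {εB : B → ℤ} {εC : C → ℤ} {mK : K → M}
    {mB : B → M} {mC : C → M} (hK : ∀ l, mK l ∈ 𝓜.deg (ε l)) (hB : ∀ l, mB l ∈ 𝓜.deg (εB l))
    (hC : ∀ l, mC l ∈ 𝓜.deg (εC l)) {r₁ r₂ : ℕ} {a₁ : Jou k d (⊤ : SimpleGraph B)}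
    {a₂ : Jou k d (⊤ : SimpleGraph C)} (ha₁ : a₁ ∈ jdeg r₁) (ha₂ : a₂ ∈ jdeg r₂)
    (c : Jou k d (partialGraph ρ)) :
    compOn 𝓜 f₁ (compOn_isDLin 𝓜 e₁ hκ hμ.1) hν.1 (jmMk _ (box k (glue f₁ (glue e₁ mK mB) mC))
      (jmap (blockHom f₁) a₂ * jmap (partialGraphHom (collapse f₁))
        (jmap h.leftHom a₁ * jmap (ParCompat.bothHom hρ) c))) =
      (q * ∑ l with l < j, Function.update ε i (∑ b, εB b) l +
        r₂ * ∑ l with j < l, Function.update ε i (∑ b, εB b) l +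
        (p * ∑ l with l < i, Function.update ε j (∑ b, εC b + r₂ + q) l +
        r₁ * ∑ l with i < l, Function.update ε j (∑ b, εC b + r₂ + q) l)).negOnePow •
      outerOn ρ κ hκ (jmMk _ (insertTwo h hρ mK (μ (jmMk _ (box k mB) a₁))
        (ν (jmMk _ (box k mC) a₂))) c) := by
  have h1 : ∑ l with l < j', glue e₁ ε εB l =
      ∑ l with l < j, Function.update ε i (∑ b, εB b) l := by
    rw [← he₁.sum_lt_outer ε εB ⟨j, h.ne.symm⟩, h.eq₁]
  have h2 : ∑ l with j' < l, glue e₁ ε εB l =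
      ∑ l with j < l, Function.update ε i (∑ b, εB b) l := by
    rw [← he₁.sum_gt_outer ε εB ⟨j, h.ne.symm⟩, h.eq₁]
  rw [compOn_mk 𝓜 f₁ (compOn_isDLin 𝓜 e₁ hκ hμ.1) hν.1 hν (fun l _ => glue_mem_deg e₁ hK hB l)
      _ ha₂,
    outerOn_compOn_insertTwo h hρ hκ hμ hK mB ha₁ c (hν.mk_mem hC ha₂), negOnePow_smul_smul,
    h1, h2]

include h in
/-- Parallel associativity. Both sides are the value of `κ` on a double insertion, which is
symmetric, so only the signs have to be compared. -/
theorem compOn_comm (he₁ : IsOrdered e₁) (he₂ : IsOrdered e₂) (hij : i < j) {κ : OpOn k d M K}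
    (hκ : IsDLin κ) {p q : ℤ} {μ : OpOn k d M B} (hμ : IsHom 𝓜 p μ) {ν : OpOn k d M C}
    (hν : IsHom 𝓜 q ν) :
    compOn 𝓜 f₁ (compOn_isDLin 𝓜 e₁ hκ hμ.1) hν.1 =
      (p * q).negOnePow • compOn 𝓜 f₂ (compOn_isDLin 𝓜 e₂ hκ hν.1) hμ.1 := by
  have hρ : ∀ a, collapse e₁ (collapse f₁ a) = (collapse e₁ ∘ collapse f₁) a := fun _ => rfl
  have hρ' : ∀ a, collapse e₂ (collapse f₂ a) = (collapse e₁ ∘ collapse f₁) a := fun a =>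
    (h.collapse_collapse a).symm
  refine jouBox_glue_ext 𝓜 f₁ fun ε₁ εC m₁ mC r₂ r' a₂ b hm₁ hmC ha₂ _ => ?_
  obtain ⟨ε, hε, hm⟩ := outerFam_mem 𝓜 e₁ hm₁
  have hmB : ∀ x, m₁ (incl e₁ x) ∈ 𝓜.deg (ε₁ (incl e₁ x)) := fun x => hm₁ _
  rw [eq_glue e₁ m₁]
  refine LinearMap.congr_fun (f := compOn 𝓜 f₁ (compOn_isDLin 𝓜 e₁ hκ hμ.1) hν.1 ∘ₗ jmMk _ _ ∘ₗ
      (LinearMap.mulLeft k (jmap (blockHom f₁) a₂)) ∘ₗ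
      (jmap (partialGraphHom (collapse f₁))).toLinearMap)
    (g := ((p * q).negOnePow • compOn 𝓜 f₂ (compOn_isDLin 𝓜 e₂ hκ hν.1) hμ.1) ∘ₗ jmMk _ _ ∘ₗ
      (LinearMap.mulLeft k (jmap (blockHom f₁) a₂)) ∘ₗ
      (jmap (partialGraphHom (collapse f₁))).toLinearMap)
    (jou_hom_ext_mul h.leftHom (ParCompat.bothHom hρ) Function.surjective_id (h.dart_cases hρ)
      fun r₁ r₃ a₁ ha₁ c _ => ?_) b
  simp only [LinearMap.comp_apply, LinearMap.mulLeft_apply, AlgHom.toLinearMap_apply]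
  have L := compOn_compOn_mk h hρ he₁ hκ hμ hν hm hmB hmC ha₁ ha₂ c
  have R := compOn_compOn_mk h.symm hρ' he₂ hκ hν hμ hm hmC hmB ha₂ ha₁ c
  rw [← insertTwo_comm h hρ hρ', ← h.glue_glue] at R
  rw [L, jmap_blockHom_mul_comm h hρ hρ' ha₁ ha₂, map_negOnePow_smul, map_negOnePow_smul,
    negOnePow_smul_apply, R, negOnePow_smul_smul, negOnePow_smul_smul]
  congr 1
  refine negOnePow_congr ?_
  -- As `i < j`, on the left `ν` moves past the inputs of `μ`, and on the right past the value of
  -- `μ`, of degree `p + r₁ + ∑ εB`; on the left `a₁` moves past the value of `ν`, and on the right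
  -- past the inputs of `ν`. Together with the exchange of `a₁` and `a₂` this leaves the sign
  -- `(-1)^(p q)`.
  have e1 : ∀ f, ∑ l with l < j, Function.update ε i f l =
      ∑ l with l < j, Function.update ε i 0 l + f := fun f =>
    (sum_filter_update_zero (· < j) ε i f).trans (by rw [if_pos hij])
  have e2 : ∀ f, ∑ l with j < l, Function.update ε i f l =
      ∑ l with j < l, Function.update ε i 0 l := fun f =>
    (sum_filter_update_zero (j < ·) ε i f).trans (by rw [if_neg hij.not_gt, add_zero])
  have e3 : ∀ f, ∑ l with l < i, Function.update ε j f l =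
      ∑ l with l < i, Function.update ε j 0 l := fun f =>
    (sum_filter_update_zero (· < i) ε j f).trans (by rw [if_neg hij.not_gt, add_zero])
  have e4 : ∀ f, ∑ l with i < l, Function.update ε j f l =
      ∑ l with i < l, Function.update ε j 0 l + f := fun f =>
    (sum_filter_update_zero (i < ·) ε j f).trans (by rw [if_pos hij])
  rw [e1 (∑ b, _), e1 (_ + _), e2 (∑ b, _), e2 (_ + _), e3 (∑ b, _), e3 (_ + _), e4 (∑ b, _),
    e4 (_ + _)]
  exact even_of_eq (even_two_mul (-(p * q))) (by ring)

omit [CharZero k] in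
theorem isOrdered_finCongr_trans {a b : ℕ} (h : b = a) {K B : Type*} [LT K] [LT B] {i : K}
    {e : Fin a ≃ {j : K // j ≠ i} ⊕ B} (he : IsOrdered e) : IsOrdered ((finCongr h).trans e) := by
  subst h; exact he

theorem parCompat_insEquiv {l m n : ℕ} (i j : Fin (l + 1 + 1)) (hij : i < j)
    (h₁ : l + m + 1 = l + 1 + m) (h₂ : l + n + 1 = l + 1 + n) (h₃ : l + m + n = l + n + m)
    (hj : (j : ℕ) + m - 1 < l + m + 1) (hi : (i : ℕ) < l + n + 1) :
    ParCompat ((finCongr h₁).trans (insEquiv (m := l + 1) i m))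
      (insEquiv (m := l + m) ⟨j + m - 1, hj⟩ n)
      ((finCongr h₂).trans (insEquiv (m := l + 1) j n))
      ((finCongr h₃).trans (insEquiv (m := l + n) ⟨i, hi⟩ m)) where
  ne := hij.ne
  eq₁ := by
    ext
    rw [val_outerIdx_finCongr, val_outerIdx_insEquiv]
    exact if_neg (Fin.lt_def.1 hij).not_gt
  eq₂ := by
    ext
    rw [val_outerIdx_finCongr, val_outerIdx_insEquiv]
    exact if_pos (Fin.lt_def.1 hij)
  outer a hi hj hj' hi' := by
    rw [Fin.lt_def] at hij
    have h1 : (a : ℕ) ≠ i := fun h => hi (Fin.ext h)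
    have h2 : (a : ℕ) ≠ j := fun h => hj (Fin.ext h)
    ext
    rw [val_outerIdx_finCongr, val_outerIdx_insEquiv, val_outerIdx_insEquiv]
    simp only
    rw [val_outerIdx_finCongr, val_outerIdx_finCongr, val_outerIdx_insEquiv, val_outerIdx_insEquiv]
    split_ifs <;> simp only at * <;> omega
  left b h := by
    rw [Fin.lt_def] at hij
    have := b.2
    ext
    rw [val_incl_finCongr, val_outerIdx_insEquiv, val_incl_insEquiv]
    simp only
    rw [val_incl_finCongr, val_incl_insEquiv]
    split_ifs <;> omega
  right b h := by
    rw [Fin.lt_def] at hij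
    have := b.2
    ext
    rw [val_outerIdx_finCongr, val_outerIdx_insEquiv, val_incl_insEquiv]
    simp only
    rw [val_incl_finCongr, val_incl_insEquiv]
    split_ifs <;> omega

theorem chiralComp_comm {l m n : ℕ} (i j : Fin (l + 2)) (hij : i < j) (κ : ChiralOp 𝓜 (l + 2))
    (p q : ℤ) (μ : ChiralOp 𝓜 m) (ν : ChiralOp 𝓜 n) (hμ : μ ∈ chiralDeg 𝓜 m p)
    (hν : ν ∈ chiralDeg 𝓜 n q) :
    chiralComp (m := l + m) ⟨j + m - 1, by omega⟩
        (recast (P := fun n => ChiralOp 𝓜 n) (Nat.add_right_comm l 1 m)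
          (chiralComp (m := l + 1) i κ μ)) ν =
      (p * q).negOnePow • recast (P := fun n => ChiralOp 𝓜 n) (Nat.add_right_comm l n m)
        (chiralComp (m := l + n) ⟨i, by omega⟩
          (recast (P := fun n => ChiralOp 𝓜 n) (Nat.add_right_comm l 1 n)
            (chiralComp (m := l + 1) j κ ν)) μ) := by
  have hμ' : IsHom 𝓜 p (toOp μ) := hμ
  have hν' : IsHom 𝓜 q (toOp ν) := hν
  have hj' : (j : ℕ) + m - 1 < l + m + 1 := by omega
  have hi' : (i : ℕ) < l + n + 1 := by rw [Fin.lt_def] at hij; omega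
  have h1 := toOp_recast (Nat.add_right_comm l 1 m) (chiralComp (m := l + 1) i κ μ)
    (chiralComp_toOp (m := l + 1) i κ μ)
  have h2 := toOp_recast (Nat.add_right_comm l 1 n) (chiralComp (m := l + 1) j κ ν)
    (chiralComp_toOp (m := l + 1) j κ ν)
  refine Subtype.ext ?_
  refine Eq.trans (chiralComp_toOp (m := l + m) ⟨j + m - 1, hj'⟩ _ ν) ?_
  refine (compOn_congr (insEquiv (m := l + m) ⟨j + m - 1, hj'⟩ n) (dlin (n := l + m + 1) _)
    (compOn_isDLin 𝓜 _ (dlin κ) hμ'.1) _ hν'.1 h1 rfl).trans ?_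
  refine (compOn_comm (parCompat_insEquiv i j hij (Nat.add_right_comm l 1 m).symm
    (Nat.add_right_comm l 1 n).symm (Nat.add_right_comm l m n) hj' hi')
    (isOrdered_finCongr_trans _ (isOrdered_insEquiv _ _))
    (isOrdered_finCongr_trans _ (isOrdered_insEquiv _ _)) hij (dlin κ) hμ' hν').trans ?_
  refine congrArg ((p * q).negOnePow • ·) (Eq.symm ?_)
  exact toOp_recast (Nat.add_right_comm l n m) _ ((chiralComp_toOp (m := l + n) ⟨i, hi'⟩ _ μ).trans
    (compOn_congr _ _ (compOn_isDLin 𝓜 _ (dlin κ) hν'.1) _ hμ'.1 h2 rfl))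

end ParComp


/-! ### Equivariance of the compositions -/

section PermCompat

/-- Compatibility of a permutation `ω` of the inputs of `μ ∘_i ν` with permutations `σ` and `τ` of
the inputs of `μ` and of `ν`. -/
structure PermCompat {I K B : Type*} {i : K} (σ : Equiv.Perm K) (τ : Equiv.Perm B)
    (ω : Equiv.Perm I)
    (e : I ≃ {j : K // j ≠ i} ⊕ B) (e' : I ≃ {j : K // j ≠ σ i} ⊕ B) : Prop where
  outer : ∀ j : {j : K // j ≠ i}, ω (outerIdx e j) = outerIdx e' ⟨σ j, σ.injective.ne j.2⟩
  inner : ∀ b, ω (incl e b) = incl e' (τ b)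

namespace PermCompat

variable {I K B : Type*} {i : K} {σ : Equiv.Perm K} {τ : Equiv.Perm B} {ω : Equiv.Perm I}
    {e : I ≃ {j : K // j ≠ i} ⊕ B} {e' : I ≃ {j : K // j ≠ σ i} ⊕ B} (h : PermCompat σ τ ω e e')

include h

theorem collapse_eq (a : I) : collapse e' (ω a) = σ (collapse e a) := by
  obtain ⟨j, rfl⟩ | ⟨b, rfl⟩ := idx_cases e a
  · rw [h.outer, collapse_outerIdx, collapse_outerIdx]
  · rw [h.inner, collapse_incl, collapse_incl]

theorem glue_symm {X : Type*} (m'' : K → X) (m' : B → X) :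
    (fun a => glue e m'' m' (ω.symm a)) =
      glue e' (fun j => m'' (σ.symm j)) fun b => m' (τ.symm b) := by
  ext a
  obtain ⟨a, rfl⟩ := ω.surjective a
  rw [Equiv.symm_apply_apply]
  obtain ⟨j, rfl⟩ | ⟨b, rfl⟩ := idx_cases e a
  · rw [h.outer, glue_outerIdx, glue_outerIdx, Equiv.symm_apply_apply]
  · rw [h.inner, glue_incl, glue_incl, Equiv.symm_apply_apply]

/-- The map of partial graphs given by the permutation of all inputs. -/
def graphHom : partialGraph (collapse e) →g partialGraph (collapse e') :=
  partialHom ω fun a b hab => σ.injective (by rw [← h.collapse_eq, ← h.collapse_eq, hab])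

end PermCompat

section Sign

variable {N K B : ℕ} {i : Fin K} {σ : Equiv.Perm (Fin K)} {τ : Equiv.Perm (Fin B)}
    {ω : Equiv.Perm (Fin N)} {e : Fin N ≃ {j : Fin K // j ≠ i} ⊕ Fin B}
    {e' : Fin N ≃ {j : Fin K // j ≠ σ i} ⊕ Fin B}

/-- The Koszul sign of the elements at the indices other than `i`. -/
theorem koszulExp_update_zero (ε : Fin K → ℤ) : koszulExp σ (Function.update ε i 0) =
    ∑ j : {j // j ≠ i}, ∑ l : {j // j ≠ i},
      if (j : Fin K) < l ∧ σ l < σ j then ε j * ε l else 0 := by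
  rw [koszulExp, Fintype.sum_eq_add_sum_subtype_ne _ i]
  refine (congrArg₂ (· + ·) (Finset.sum_eq_zero fun l _ => ?_)
      (Finset.sum_congr rfl fun j _ => ?_)).trans
    (zero_add _)
  · rw [Function.update_self, zero_mul, ite_self]
  · rw [Fintype.sum_eq_add_sum_subtype_ne _ i, Function.update_self, mul_zero, ite_self, zero_add]
    refine Finset.sum_congr rfl fun l _ => ?_
    rw [Function.update_of_ne j.2, Function.update_of_ne l.2]

theorem invSum_eq (ε : Fin K → ℤ) : invSum σ i ε =
    (∑ l : {j // j ≠ i}, if (l : Fin K) < i ∧ σ i < σ l then ε l else 0) +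
      ∑ l : {j // j ≠ i}, if i < (l : Fin K) ∧ σ l < σ i then ε l else 0 := by
  rw [invSum, Fintype.sum_eq_add_sum_subtype_ne _ i, if_neg (by simp), zero_add,
    ← Finset.sum_add_distrib]
  refine Finset.sum_congr rfl fun l _ => ?_
  by_cases h1 : i < (l : Fin K) ∧ σ l < σ i
  · rw [if_pos (Or.inl h1), if_pos h1, if_neg fun h => h.1.not_gt h1.1, zero_add]
  · by_cases h2 : (l : Fin K) < i ∧ σ i < σ l
    · rw [if_pos (Or.inr h2), if_neg h1, if_pos h2, add_zero]
    · rw [if_neg (not_or.2 ⟨h1, h2⟩), if_neg h1, if_neg h2, add_zero]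

/-- The Koszul sign of a permutation of blocks. -/
theorem koszulExp_glue (h : PermCompat σ τ ω e e') (he : IsOrdered e) (he' : IsOrdered e')
    (ε : Fin K → ℤ) (ε' : Fin B → ℤ) : koszulExp ω (glue e ε ε') =
      koszulExp σ (Function.update ε i 0) + koszulExp τ ε' + (∑ b, ε' b) * invSum σ i ε := by
  rw [koszulExp_update_zero, invSum_eq, koszulExp, koszulExp]
  simp only [sum_index e, glue_outerIdx, glue_incl, h.outer, h.inner, he.outer_lt_outer,
    he.incl_lt_incl, he.outer_lt_incl, he.incl_lt_outer, he'.outer_lt_outer, he'.incl_lt_incl,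
    he'.outer_lt_incl, he'.incl_lt_outer, Finset.sum_add_distrib]
  have h1 : (∑ j : {j // j ≠ i}, ∑ b, if (j : Fin K) < i ∧ σ i < σ j then ε j * ε' b else 0) =
      (∑ b, ε' b) * ∑ l : {j // j ≠ i}, if (l : Fin K) < i ∧ σ i < σ l then ε l else 0 := by
    rw [mul_comm, Finset.sum_mul_sum]
    refine Finset.sum_congr rfl fun j _ => Finset.sum_congr rfl fun b _ => ?_
    rw [ite_mul, zero_mul]
  have h2 : (∑ b, ∑ j : {j // j ≠ i}, if i < (j : Fin K) ∧ σ j < σ i then ε' b * ε j else 0) =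
      (∑ b, ε' b) * ∑ l : {j // j ≠ i}, if i < (l : Fin K) ∧ σ l < σ i then ε l else 0 := by
    rw [Finset.sum_mul_sum]
    refine Finset.sum_congr rfl fun j _ => Finset.sum_congr rfl fun b _ => ?_
    rw [mul_ite, mul_zero]
  rw [h1, h2]
  ring

end Sign

end PermCompat

section Equivariance

variable {k : Type*} [Field k] {d : ℕ} {M : Type*} [AddCommGroup M] [Module k M]
    [Module (Weyl k (Fin d))ᵐᵒᵖ M] [IsScalarTower k (Weyl k (Fin d))ᵐᵒᵖ M]
    {𝓜 : DGStructure k d M}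

variable {N K B : ℕ} {i : Fin K} {σ : Equiv.Perm (Fin K)} {τ : Equiv.Perm (Fin B)}
    {ω : Equiv.Perm (Fin N)} {e : Fin N ≃ {j : Fin K // j ≠ i} ⊕ Fin B}
    {e' : Fin N ≃ {j : Fin K // j ≠ σ i} ⊕ Fin B}

theorem diagSubst_diagPerm {π π' : Fin N → Fin K} (h : ∀ a, π' (ω a) = σ (π a))
    (y : DiagOn k d M (Fin K)) :
    diagSubst π' (diagPerm σ y) = diagPerm ω (diagSubst π y) := by
  induction y using push_induction with
  | ha y y' hy hy' => simp only [map_add, hy, hy']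
  | hm x F =>
    refine puMk_induction (P := fun y => diagSubst π' (diagPerm σ y) = diagPerm ω (diagSubst π y)) x
      ?_ (fun c y hy => by rw [map_smul, map_smul, hy, map_smul, map_smul])
      (fun y y' hy hy' => by rw [map_add, map_add, hy, hy', map_add, map_add]) (fun c y hy => ?_) F
    · rw [diagPerm_mk, map_one (MvPolynomial.rename _), diagSubst_mk_one, diagSubst_mk_one,
        diagPerm_mk, map_one (MvPolynomial.rename _)]
    · rw [diagPerm_pd, diagSubst_pd, diagSubst_pd, map_sum, hy,
        ← Equiv.sum_comp (ω.prodCongr (Equiv.refl (Fin d)))]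
      refine Finset.sum_congr rfl fun a _ => ?_
      have h1 : liftIdx (d := d) π' (ω.prodCongr (Equiv.refl (Fin d)) a) = (σ c.1, c.2) ↔
          liftIdx π a = c := by
        refine ⟨fun hh => Prod.ext (σ.injective ?_) (congrArg Prod.snd hh :), fun hh => ?_⟩
        · exact (h a.1).symm.trans (congrArg Prod.fst hh :)
        · subst hh; exact Prod.ext (h a.1) rfl
      by_cases hc : liftIdx π a = c
      · rw [if_pos hc, if_pos (h1.2 hc), diagPerm_pd]; rfl
      · rw [if_neg hc, if_neg fun hh => hc (h1.1 hh), map_zero]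

variable [CharZero k]

variable (𝓜) in
omit [CharZero k] in
theorem jmMk_perm (σ : Equiv.Perm (Fin N)) {ε : Fin N → ℤ} {m : Fin N → M}
    (hm : ∀ j, m j ∈ 𝓜.deg (ε j)) (a : Jou k d (⊤ : SimpleGraph (Fin N))) :
    jmMk _ (box k fun i => m (σ.symm i)) (jmap (permHom σ) a) =
      (koszulExp σ ε).negOnePow • jouBoxPerm 𝓜 σ (jmMk _ (box k m) a) := by
  rw [jouBoxPerm_box 𝓜 σ hm, negOnePow_smul_smul, ← two_mul, Int.negOnePow_two_mul, one_smul]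

/-- A permuted operation, applied to an inserted element. -/
theorem outerOn_opPerm (h : PermCompat σ τ ω e e') {μ : OpOn k d M (Fin K)} (hμ : IsDLin μ)
    {ε : Fin K → ℤ} {m'' : Fin K → M} (hm : ∀ j, m'' j ∈ 𝓜.deg (ε j)) {f : ℤ}
    {y : DiagOn k d M (Fin B)} (hy : y ∈ tgtDeg 𝓜 (Fin B) f)
    (b : Jou k d (partialGraph (collapse e))) :
    outerOn (collapse e') (opPerm 𝓜 σ μ) (opPerm_isDLin 𝓜 σ hμ) (jmMk _
        (insertPush e' (fun j => m'' (σ.symm j)) (diagPerm τ y)) (jmap h.graphHom b)) =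
      (koszulExp σ (Function.update ε i f)).negOnePow • diagPerm ω
        (outerOn (collapse e) μ hμ (jmMk _ (insertPush e m'' y) b)) := by
  refine tgtDeg_induction (P := fun y => ∀ b : Jou k d (partialGraph (collapse e)),
    outerOn (collapse e') (opPerm 𝓜 σ μ) (opPerm_isDLin 𝓜 σ hμ) (jmMk _
        (insertPush e' (fun j => m'' (σ.symm j)) (diagPerm τ y)) (jmap h.graphHom b)) =
      (koszulExp σ (Function.update ε i f)).negOnePow • diagPerm ω
        (outerOn (collapse e) μ hμ (jmMk _ (insertPush e m'' y) b)))
    (fun x hx b => ?_) (fun t z hz b => ?_) (fun z z' hz hz' b => ?_) (fun t z hz b => ?_) hy b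
  · have h1 : restrictDiag (collapse e') (jmap h.graphHom b) =
        jmap (k := k) (d := d) (permHom σ) (restrictDiag (collapse e) b) :=
      (jmap_jmap _ _ ((permHom σ).comp (SimpleGraph.Hom.comap (collapse e) ⊤))
        h.collapse_eq b).trans (jmap_jmap _ _ _ (fun _ => rfl) b).symm
    rw [diagPerm_mk, map_one (MvPolynomial.rename _), insertPush_one, insertPush_one, outerOn_one,
      outerOn_one, h1, ← update_comp_symm σ m'' i x,
      jmMk_perm 𝓜 σ (fun j => update_mem_deg 𝓜 hm i hx j), map_negOnePow_smul, map_negOnePow_smul,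
      opPerm_jouBoxPerm, diagSubst_diagPerm h.collapse_eq]
  · rw [map_smul, map_smul, map_smul, LinearMap.smul_apply, map_smul, hz b, map_smul, map_smul,
      LinearMap.smul_apply, map_smul, map_smul, smul_comm t]
  · rw [map_add, map_add, map_add, LinearMap.add_apply, map_add, hz b, hz' b, map_add, map_add,
      LinearMap.add_apply, map_add, map_add, smul_add]
  · have h1 : jpd (ω (incl e t.1)) t.2 (jmap h.graphHom b) =
        jmap h.graphHom (jpd (incl e t.1) t.2 b) :=
      jpd_jmap_of_injective h.graphHom ω.injective _ _ b
    have h4 : (liftIdx (incl e) t) = (incl e t.1, t.2) := rfl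
    have h5 : (liftIdx (incl e') (τ t.1, t.2)) = (ω (incl e t.1), t.2) :=
      Prod.ext (h.inner _).symm rfl
    rw [diagPerm_pd, insertPush_pd, insertPush_pd, outerOn_pd, outerOn_pd, h5, h4]
    simp only
    rw [h1, hz, hz, map_add, diagPerm_pd, smul_add, map_negOnePow_smul]

theorem sum_lt_perm (σ : Equiv.Perm (Fin K)) (i : Fin K) (ε : Fin K → ℤ) :
    ∑ j with j < σ i, ε (σ.symm j) = ∑ j with σ j < σ i, ε j := by
  rw [Finset.sum_filter, Finset.sum_filter, ← Equiv.sum_comp σ]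
  simp

theorem sum_gt_perm (σ : Equiv.Perm (Fin K)) (i : Fin K) (ε : Fin K → ℤ) :
    ∑ j with σ i < j, ε (σ.symm j) = ∑ j with σ i < σ j, ε j := by
  rw [Finset.sum_filter, Finset.sum_filter, ← Equiv.sum_comp σ]
  simp

/-- Equivariance of the compositions. -/
theorem compOn_opPerm (h : PermCompat σ τ ω e e') (he : IsOrdered e) (he' : IsOrdered e')
    {μ : OpOn k d M (Fin K)} (hμ : IsDLin μ) {q : ℤ} {ν : OpOn k d M (Fin B)} (hν : IsHom 𝓜 q ν) :
    compOn 𝓜 e' (opPerm_isDLin 𝓜 σ hμ) (opPerm_isDLin 𝓜 τ hν.1) =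
      opPerm 𝓜 ω (compOn 𝓜 e hμ hν.1) := by
  have key : compOn 𝓜 e' (opPerm_isDLin 𝓜 σ hμ) (opPerm_isDLin 𝓜 τ hν.1) ∘ₗ jouBoxPerm 𝓜 ω =
      diagPerm ω ∘ₗ compOn 𝓜 e hμ hν.1 := by
    refine jouBox_glue_ext 𝓜 e fun ε ε' m'' m' r r' a b hm hm' ha _ => ?_
    have h1 : jmap (permHom ω) (jmap (blockHom e) a) =
        jmap (k := k) (d := d) (blockHom e') (jmap (permHom τ) a) :=
      (jmap_jmap _ _ ((blockHom e').comp (permHom τ)) h.inner a).trans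
        (jmap_jmap _ _ _ (fun _ => rfl) a).symm
    have h2 : jmap (permHom ω) (jmap (partialGraphHom (collapse e)) b) =
        jmap (k := k) (d := d) (partialGraphHom (collapse e')) (jmap h.graphHom b) :=
      (jmap_jmap _ _ ((partialGraphHom (collapse e')).comp h.graphHom) (fun _ => rfl) b).trans
        (jmap_jmap _ _ _ (fun _ => rfl) b).symm
    rw [LinearMap.comp_apply, LinearMap.comp_apply, jouBoxPerm_box 𝓜 ω (glue_mem_deg e hm hm'),
      map_mul, h1, h2, h.glue_symm, map_negOnePow_smul,
      compOn_mk 𝓜 e' (opPerm_isDLin 𝓜 σ hμ) (opPerm_isDLin 𝓜 τ hν.1) (hν.opPerm τ)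
        (fun j _ => hm (σ.symm j)) _ (jmap_mem_jdeg _ ha), jmMk_perm 𝓜 τ hm', map_negOnePow_smul,
      opPerm_jouBoxPerm, map_negOnePow_smul, map_negOnePow_smul, negOnePow_smul_apply,
      map_negOnePow_smul, outerOn_opPerm h hμ hm (hν.mk_mem hm' ha), negOnePow_smul_smul,
      negOnePow_smul_smul, negOnePow_smul_smul, compOn_mk 𝓜 e hμ hν.1 hν (fun j _ => hm j) _ ha,
      map_negOnePow_smul, koszulExp_glue h he he', sum_lt_perm, sum_gt_perm, koszulExp_update σ ε i
      (_ + _)]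
    congr 1
    refine negOnePow_congr ?_
    -- `ν` moves past the inputs before `i` and `a` past those after `i`; the permutation changes
    -- these exponents by sums over the inputs whose order with respect to `i` is reversed, as does
    -- moving the value of `ν` instead of its inputs
    have E1 := (even_invSum σ ε i).mul_left q
    have E2 := (even_invSum_gt σ ε i).mul_left r
    have E3 := even_two_mul (koszulExp σ (Function.update ε i 0) + koszulExp τ ε' +
      (∑ b, ε' b) * invSum σ i ε - q * ∑ j with j < i, ε j - r * ∑ j with i < j, ε j)
    exact even_of_eq ((E1.add E2).add E3) (by ring)
  refine LinearMap.ext fun x => ?_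
  have := LinearMap.congr_fun key (jouBoxPerm 𝓜 ω⁻¹ x)
  rwa [LinearMap.comp_apply, ← jouBoxPerm_mul, mul_inv_cancel, jouBoxPerm_one] at this

theorem permCompat_blockPerm {m n : ℕ} (i : Fin (m + 1)) (σ : Equiv.Perm (Fin (m + 1)))
    (τ : Equiv.Perm (Fin n)) :
    PermCompat σ τ (blockPerm i σ τ) (insEquiv i n) (insEquiv (σ i) n) where
  outer j := by simp [blockPerm, outerIdx]
  inner b := by simp [blockPerm, incl]

theorem chiralAct_comp {m n : ℕ} (i : Fin (m + 1)) (σ : Equiv.Perm (Fin (m + 1)))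
    (τ : Equiv.Perm (Fin n)) (μ : ChiralOp 𝓜 (m + 1)) (ν : ChiralOp 𝓜 n) :
    chiralComp (σ i) (chiralAct 𝓜 (m + 1) σ μ) (chiralAct 𝓜 n τ ν) =
      chiralAct 𝓜 (m + n) (blockPerm i σ τ) (chiralComp i μ ν) := by
  induction ν using chiral_induction with
  | ha ν ν' h h' => simp only [map_add, h, h']
  | h q ν hν =>
  exact Subtype.ext (compOn_opPerm (permCompat_blockPerm i σ τ) (isOrdered_insEquiv i n)
    (isOrdered_insEquiv (σ i) n) (dlin μ) hν)

end Equivariance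

/-! ### The operad of chiral operations -/

section Operad

/-- A dg operad structure is determined by its operations; the remaining fields are properties. -/
theorem DGOperad.ext_structure {k : Type*} [Field k] {P : ℕ → Type*} [∀ n, AddCommGroup (P n)]
    [∀ n, Module k (P n)] {O O' : DGOperad k P} (hdeg : O.deg = O'.deg) (hd : O.d = O'.d)
    (hact : O.act = O'.act) (hone : O.one = O'.one)
    (hcomp : @DGOperad.comp k _ P _ _ O = @DGOperad.comp k _ P _ _ O') : O = O' := by
  cases O; cases O'
  simp only at hdeg hd hact hone hcomp
  subst hdeg hd hact hone hcomp
  rfl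

variable {k : Type*} [Field k] [CharZero k] {d : ℕ} {M : Type*} [AddCommGroup M] [Module k M]
    [Module (Weyl k (Fin d))ᵐᵒᵖ M] [IsScalarTower k (Weyl k (Fin d))ᵐᵒᵖ M]
    (𝓜 : DGStructure k d M)

/-- The dg operad of chiral operations. -/
def chiralOperad : DGOperad k fun n => ↥(ChiralOp 𝓜 n) where
  deg := chiralDeg 𝓜
  internal := isInternal_chiralDeg
  d := chiralDiff 𝓜
  d_mem _ _ _ hμ := IsHom.opDiff hμ
  d_d _ μ := chiralDiff_chiralDiff 𝓜 μ
  act := chiralAct 𝓜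
  act_mem _ σ _ _ hμ := IsHom.opPerm σ hμ
  act_d _ σ μ := chiralDiff_chiralAct 𝓜 σ μ
  one := chiralOne 𝓜
  one_mem := unitOp_isHom 𝓜
  d_one := Subtype.ext (unitOp_diff 𝓜)
  comp := chiralComp
  comp_mem := chiralComp_mem
  d_comp := chiralDiff_comp
  comp_one := chiralComp_one
  one_comp := chiralOne_comp
  assoc_seq := chiralComp_assoc
  assoc_par := chiralComp_comm
  act_comp := chiralAct_comp

theorem isChiral_chiralOperad : IsChiral 𝓜 (chiralOperad 𝓜) where
  mem_deg _ _ _ := Iff.rfl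
  d_eq _ _ _ hf := opDiff_eq 𝓜 hf
  act_eq _ _ _ _ := rfl
  one_eq m := unitOp_box m
  comp_eq _ n i := ⟨diagW _, isDiagRestriction_diagW _, fun μ _ ν hν _ _ hm m' _ _ ha b =>
    compOn_mk 𝓜 (insEquiv i n) (dlin μ) (dlin ν) hν hm m' ha b⟩

/-- A `𝒟`-linear map on `𝐉¹(M)` is determined by its values on the elements `m ⊗ 1`, since the
Jouanolou algebra of one point is generated by the coordinates. -/
theorem IsDLin.ext_fin_one {f g : OpOn k d M (Fin 1)} (hf : IsDLin f) (hg : IsDLin g)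
    (h : ∀ m : Fin 1 → M, f (jmMk _ (box k m) 1) = g (jmMk _ (box k m) 1)) : f = g := by
  refine jm_ext fun n a => ?_
  suffices H : ∀ b, f (jmMk _ n b) = g (jmMk _ n b) → f (jmMk _ n (a * b)) = g (jmMk _ n (a * b)) by
    simpa using H 1 (LinearMap.congr_fun (f := f ∘ₗ (jmMk _).flip 1) (g := g ∘ₗ (jmMk _).flip 1)
      (box_ext h) n)
  induction a using jou_induction with
  | hs r =>
    intro b hb
    rw [← Algebra.smul_def, map_smul, map_smul, map_smul, hb]
  | hg x =>
    match x with
    | .z i s =>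
      intro b hb
      have := ract_jm_z (G := ⊤) (i, s) n b
      rw [← this, hf.ract, hg.ract, hb]
    | .x e _ => exact isEmptyElim e
    | .dx e _ => exact isEmptyElim e
  | hm a a' ha ha' =>
    intro b hb
    rw [mul_assoc]
    exact ha _ (ha' b hb)
  | ha a a' ha ha' =>
    intro b hb
    rw [add_mul, map_add, map_add, map_add, ha b hb, ha' b hb]

variable {𝓜}

/-- The formulas determine the operad structure: the map `w` is unique, and operations are
determined by their values on the elements adapted to a block of inputs. -/
theorem IsChiral.eq {O O' : DGOperad k fun n => ↥(ChiralOp 𝓜 n)} (h : IsChiral 𝓜 O)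
    (h' : IsChiral 𝓜 O') : O = O' := by
  refine DGOperad.ext_structure ?_ ?_ ?_ ?_ ?_
  · exact funext fun n => funext fun p => Submodule.ext fun f =>
      (h.mem_deg n p f).trans (h'.mem_deg n p f).symm
  · refine funext fun n => LinearMap.ext fun f => ?_
    induction f using chiral_induction with
    | h p f hf => exact Subtype.ext ((h.d_eq n p f hf).trans (h'.d_eq n p f hf).symm)
    | ha f g hf hg => rw [map_add, map_add, hf, hg]
  · exact funext fun n => MonoidHom.ext fun σ => LinearMap.ext fun f => Subtype.ext <|
      LinearMap.ext fun x => (h.act_eq n σ f x).trans (h'.act_eq n σ f x).symm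
  · exact Subtype.ext (IsDLin.ext_fin_one (dlin O.one) (dlin O'.one) fun m =>
      (h.one_eq m).trans (h'.one_eq m).symm)
  · refine funext fun m => funext fun n => funext fun i => LinearMap.ext fun μ =>
      LinearMap.ext fun ν => ?_
    induction ν using chiral_induction with
    | ha ν ν' hν hν' => rw [map_add, map_add, hν, hν']
    | h q ν hν =>
      obtain ⟨w, hw, hc⟩ := h.comp_eq m n i
      obtain ⟨w', hw', hc'⟩ := h'.comp_eq m n i
      have hww : w = w' := hw.eq_diagW.trans hw'.eq_diagW.symm
      subst hww
      exact Subtype.ext (jouBox_glue_ext 𝓜 (insEquiv i n) fun ε _ m'' m' r _ a b hm _ ha _ =>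
        (hc μ q ν hν ε m'' (fun j _ => hm j) m' r a ha b).trans
          (hc' μ q ν hν ε m'' (fun j _ => hm j) m' r a ha b).symm)

end Operad

end HigherChiral

end

theorem mainTheorem3 {k : Type*} [Field k] [CharZero k] (d : ℕ) {M : Type*} [AddCommGroup M]
    [Module k M] [Module (HigherChiral.Weyl k (Fin d))ᵐᵒᵖ M]
    [IsScalarTower k (HigherChiral.Weyl k (Fin d))ᵐᵒᵖ M] (𝓜 : HigherChiral.DGStructure k d M) :
    ∃! O : HigherChiral.DGOperad k (fun n => ↥(HigherChiral.ChiralOp 𝓜 n)),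
      HigherChiral.IsChiral 𝓜 O := by
  exact ⟨HigherChiral.chiralOperad 𝓜, HigherChiral.isChiral_chiralOperad 𝓜,
    fun _ h => h.eq (HigherChiral.isChiral_chiralOperad 𝓜)⟩
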